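/- Consider the Ad Types Problem without gap rules: there are $n\ge 1$ slots and $k\ge 1$ ad types with $n$ ads of each type (missing ads are added with value $0$); type $\theta$ has a discount curve $\alpha^\theta_1\ge\dots\ge\alpha^\theta_n\ge 0$, and an ad $i$ of type $\theta$ with value $v_i\ge 0$ has value $v_{ij}=\alpha^\theta_j v_i$ in slot $j$. Some of the ads are bidders; let $B$ be their set. Bidder $i\in B$ has a bid $b_i\ge 0$ and a reserve price $r_i\ge 0$. Let $\mathcal X$ be the Hungarian algorithm for this problem. It keeps dual variables $u_i$ for ads and $p_j$ for slots and a matching $M$, initially $u_i=0$, $p_j=\max_{i',j'}v_{i'j'}$ and $M=\emptyset$. For each slot $j$ in descending order of discounts it grows an alternating tree from $j$: repeatedly it takes an edge $(i',j')$ of least slack $\Delta=u_{i'}+p_{j'}-v_{i'j'}$ among the edges between slots in the tree and ads outside of it, adds $\Delta$ to $u$ on the ads of the tree, subtracts $\Delta$ from $p$ on the slots of the tree, and adds $i'$ to the tree, together with its slot if $i'$ is matched; if $i'$ is unmatched, $M$ is augmented along the path from $j$ to $i'$ and the next slot is treated. The pricing algorithm with bidder-specific reserves lets $B'=\{i\in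 B: b_i\ge r_i\}$, sets $p_i=0$ for $i\notin B'$, computes the outcome $\omega=\mathcal X(B')$ from the bids of the bidders in $B'$ (a slot that is given to an ad outside $B'$ stays empty), and for each $i\in B'$ computes the outcome $\omega'=\mathcal X(b_i\to r_i,B'_{-i})$, in which the bid of $i$ is replaced by $r_i$, and the price $$p_i=\sum_{j\in B'\setminus\{i\}} b_j x_j(\omega')-\sum_{j\in B'\setminus\{i\}} b_j x_j(\omega)+x_i(\omega')\,r_i ,$$ where $x_j(\omega)$ is the discount of the slot that $j$ gets in $\omega$ ($0$ if it gets none). It returns $(\omega,p)$. Then $\mathcal X$ can be implemented on a unit-cost real RAM in such a way that, with a constant $C$ that does not depend on $n$, $k$ or the instance, the following holds for all instances. The pricing algorithm, which calls $\mathcal X$ once for $\omega$ and once for each bidder in $B'$, returns its output within $C\,(|B'|+1)\,n^2(k+\log n)$ steps; in particular, when there are at most $n$ bidders, it runs in $O(n^3(k+\log n))$ time. If the call is omitted for the bidders in $B'$ who get no slot in $\omega$ (their price is left at $0$, as the formula gives), there are at most $\min(|B'|,n)+1$ calls, and the time is at most $C\,n^3(k+\log n)$ for any number of bidders, that is, up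 to $n$ of each type. -/

import Mathlib

open Finset

namespace AdTypes

/-! ## The allocation problem and the Hungarian algorithm for it

There are `n` slots, `k` ad types and `n` ads of each type (missing ads are ads of value `0`).
An ad is a pair (type, index); a (partial) assignment says which ad, if any, each slot holds. -/

/-- The ad `(θ, i)` is the `i`-th ad of type `θ`. -/
abbrev Ad (k n : ℕ) : Type := Fin k × Fin n

/-- A partial assignment of ads to slots. -/
abbrev Assignment (k n : ℕ) : Type := Fin n → Option (Ad k n)

section Hungarian

variable {k n : ℕ}

/-- Weight of the edge between the ad `a` (of value `v a`) and the slot `j`. -/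
def weight (disc : Fin k → Fin n → ℝ) (v : Ad k n → ℝ) (a : Ad k n) (j : Fin n) : ℝ :=
  disc a.1 j * v a

/-- The data kept from phase to phase: the dual solution and the matching. -/
structure HState (k n : ℕ) where
  u : Ad k n → ℝ
  p : Fin n → ℝ
  M : Assignment k n

/-- The data of a phase: the current dual solution and the alternating tree. `par a = some j` says
that the ad `a` was put into the tree through the edge `(a, j)`, and `par a = none` that `a` is
not in the tree; `S` is the set of slots in the tree. -/
structure Tree (k n : ℕ) where
  u : Ad k n → ℝ
  p : Fin n → ℝ
  par : Ad k n → Option (Fin n)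
  S : Finset (Fin n)

/-- How much the dual solution has to move until the edge `(a, j)` is tight. -/
def Tree.slack (w : Ad k n → Fin n → ℝ) (T : Tree k n) (a : Ad k n) (j : Fin n) : ℝ :=
  T.u a + T.p j - w a j

/-- `(a, j)` is a next edge to become tight: among the edges between a slot of the tree and an ad
outside of the tree, none has a smaller slack. -/
def Tree.NextTight (w : Ad k n → Fin n → ℝ) (T : Tree k n) (a : Ad k n) (j : Fin n) : Prop :=
  T.par a = none ∧ j ∈ T.S ∧
    ∀ a' j', T.par a' = none → j' ∈ T.S → T.slack w a j ≤ T.slack w a' j'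

/-- Move the dual solution until `(a, j)` is tight (on the ads and slots of the tree only) and put
the ad `a` into the tree through this edge. -/
def Tree.addEdge (w : Ad k n → Fin n → ℝ) (T : Tree k n) (a : Ad k n) (j : Fin n) : Tree k n where
  u := fun a' => if T.par a' = none then T.u a' else T.u a' + T.slack w a j
  p := fun j' => if j' ∈ T.S then T.p j' - T.slack w a j else T.p j'
  par := Function.update T.par a (some j)
  S := T.S

/-- Put the slot `m` into the tree. -/
def Tree.addSlot (T : Tree k n) (m : Fin n) : Tree k n := { T with S := insert m T.S }

/-- Augmentation of `M` along the path of the tree from the ad `a` to the root: every ad on the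
path moves to the slot through which it was put into the tree. -/
inductive Augment (par : Ad k n → Option (Fin n)) (root : Fin n) :
    Assignment k n → Ad k n → Assignment k n → Prop
  | last {M : Assignment k n} {a : Ad k n} (h : par a = some root) :
      Augment par root M a (Function.update M root (some a))
  | move {M M' : Assignment k n} {a b : Ad k n} {j : Fin n} (h : par a = some j) (hj : j ≠ root)
      (hb : M j = some b) (hM : Augment par root (Function.update M j (some a)) b M') :
      Augment par root M a M'

/-- The `while` loop of a phase that starts in the free slot `root`, with the matching `M`. As long
as the next tight edge leads to a matched ad, this ad and its slot join the tree; when it leads to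
an unmatched ad, the matching is augmented and the phase ends. -/
inductive Phase (w : Ad k n → Fin n → ℝ) (M : Assignment k n) (root : Fin n) :
    Tree k n → HState k n → Prop
  | grow {T : Tree k n} {H : HState k n} {a : Ad k n} {j m : Fin n} (h : T.NextTight w a j)
      (hm : M m = some a) (hH : Phase w M root ((T.addEdge w a j).addSlot m) H) :
      Phase w M root T H
  | finish {T : Tree k n} {M' : Assignment k n} {a : Ad k n} {j : Fin n} (h : T.NextTight w a j)
      (hm : ∀ m, M m ≠ some a) (hM : Augment (T.addEdge w a j).par root M a M') :
      Phase w M root T ⟨(T.addEdge w a j).u, (T.addEdge w a j).p, M'⟩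

/-- One phase for each slot of the list, in the order of the list. -/
inductive Phases (w : Ad k n → Fin n → ℝ) : List (Fin n) → HState k n → HState k n → Prop
  | nil {H : HState k n} : Phases w [] H H
  | cons {H H' H'' : HState k n} {j : Fin n} {l : List (Fin n)}
      (h : Phase w H.M j ⟨H.u, H.p, fun _ => none, {j}⟩ H') (hl : Phases w l H' H'') :
      Phases w (j :: l) H H''

/-- The start: `u = 0`, every price is the largest weight, and the matching is empty. -/
noncomputable def HState.init (w : Ad k n → Fin n → ℝ) : HState k n where
  u := fun _ => 0
  p := fun _ => ⨆ e : Ad k n × Fin n, w e.1 e.2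
  M := fun _ => none

/-- `H` is the result of a run of the Hungarian algorithm on the instance with the discount curves
`disc` and the values `v`; the slots are treated in the order of descending discounts. -/
def HungarianResult (disc : Fin k → Fin n → ℝ) (v : Ad k n → ℝ) (H : HState k n) : Prop :=
  Phases (weight disc v) (List.finRange n) (HState.init (weight disc v)) H

end Hungarian

/-! ## Auctions with reserve prices -/

/-- A pricing instance: discount curves, the set of the ads that stand for a bidder, their bids and
their reserve prices. -/
structure Auction (k n : ℕ) where
  disc : Fin k → Fin n → ℝ
  bidders : Finset (Ad k n)
  bid : Ad k n → ℝ
  reserve : Ad k n → ℝ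
  disc_nonneg : ∀ θ j, 0 ≤ disc θ j
  disc_anti : ∀ θ, Antitone (disc θ)
  bid_nonneg : ∀ a, 0 ≤ bid a
  reserve_nonneg : ∀ a, 0 ≤ reserve a

namespace Auction

variable {k n : ℕ} (A : Auction k n)

open Classical in
/-- The bidders whose bid is at least their reserve price. -/
noncomputable def accepted : Finset (Ad k n) := A.bidders.filter fun a => A.reserve a ≤ A.bid a

open Classical in
/-- The bids of the accepted bidders; all other ads are ads of value `0`. -/
noncomputable def acceptedBids (a : Ad k n) : ℝ := if a ∈ A.accepted then A.bid a else 0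

/-- `ω` is the outcome that the Hungarian algorithm computes from the values `v`; a slot that gets
an ad which does not stand for an accepted bidder remains empty. -/
def IsOutcome (v : Ad k n → ℝ) (ω : Assignment k n) : Prop :=
  ∃ H, HungarianResult A.disc v H ∧ ∀ j a, ω j = some a ↔ H.M j = some a ∧ a ∈ A.accepted

open Classical in
/-- The quantity that `a` receives in the outcome `ω`. -/
noncomputable def quantity (ω : Assignment k n) (a : Ad k n) : ℝ :=
  ∑ j, if ω j = some a then A.disc a.1 j else 0

open Classical in
/-- The (declared) social welfare, in the outcome `ω`, of the accepted bidders other than `a`. -/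
noncomputable def welfareOthers (ω : Assignment k n) (a : Ad k n) : ℝ :=
  ∑ b ∈ A.accepted.erase a, A.bid b * A.quantity ω b

open Classical in
/-- `(ω, p)` is an output of the pricing algorithm that calls the Hungarian algorithm as its
allocation procedure. -/
structure IsPricing (ω : Assignment k n) (p : Ad k n → ℝ) : Prop where
  outcome : A.IsOutcome A.acceptedBids ω
  rejected : ∀ a, a ∉ A.accepted → p a = 0
  price : ∀ a ∈ A.accepted, ∃ ω',
    A.IsOutcome (Function.update A.acceptedBids a (A.reserve a)) ω' ∧
      p a = A.welfareOthers ω' a - A.welfareOthers ω a + A.quantity ω' a * A.reserve a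

end Auction

/-! ## The machine: a unit-cost real RAM

A program has arrays of natural numbers and arrays of real numbers, both with two indices. It can
add and subtract natural numbers, add, subtract and multiply real numbers, and compare. There is no
conversion from real numbers to natural numbers. -/

/-- A memory: the content of the cell `[r][c]` of the array number `a`. -/
structure Mem where
  nat : ℕ → ℕ → ℕ → ℕ
  real : ℕ → ℕ → ℕ → ℝ

/-- Change one cell. -/
def setCell {β : Type} (f : ℕ → ℕ → ℕ → β) (a r c : ℕ) (x : β) : ℕ → ℕ → ℕ → β :=
  fun a' r' c' => if a' = a ∧ r' = r ∧ c' = c then x else f a' r' c'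

inductive NExp where
  | lit (m : ℕ)
  | get (a : ℕ) (r c : NExp)
  | add (e f : NExp)
  | sub (e f : NExp)

def NExp.eval (σ : Mem) : NExp → ℕ
  | .lit m => m
  | .get a r c => σ.nat a (r.eval σ) (c.eval σ)
  | .add e f => e.eval σ + f.eval σ
  | .sub e f => e.eval σ - f.eval σ

inductive RExp where
  | lit (m : ℤ)
  | get (a : ℕ) (r c : NExp)
  | add (e f : RExp)
  | sub (e f : RExp)
  | mul (e f : RExp)

def RExp.eval (σ : Mem) : RExp → ℝ
  | .lit m => m
  | .get a r c => σ.real a (r.eval σ) (c.eval σ)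
  | .add e f => e.eval σ + f.eval σ
  | .sub e f => e.eval σ - f.eval σ
  | .mul e f => e.eval σ * f.eval σ

inductive BExp where
  | lt (e f : NExp)
  | eq (e f : NExp)
  | le (e f : RExp)
  | not (b : BExp)
  | and (b b' : BExp)

def BExp.eval (σ : Mem) : BExp → Prop
  | .lt e f => e.eval σ < f.eval σ
  | .eq e f => e.eval σ = f.eval σ
  | .le e f => e.eval σ ≤ f.eval σ
  | .not b => ¬ b.eval σ
  | .and b b' => b.eval σ ∧ b'.eval σ

/-- Programs. `call` calls the (one) procedure that is available to the program. -/
inductive Com where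
  | setN (a : ℕ) (r c e : NExp)
  | setR (a : ℕ) (r c : NExp) (e : RExp)
  | seq (s s' : Com)
  | branch (b : BExp) (s s' : Com)
  | loop (b : BExp) (s : Com)
  | call

/-- `Exec proc s σ t q σ'`: the program `s`, started in the memory `σ`, halts in the memory `σ'`
after `t` steps and `q` calls. Every assignment and every test is a step (the expressions in a
program have a fixed size); `proc σ t σ'` says that a call in `σ` costs `t` steps and leads to
`σ'`. -/
inductive Exec (proc : Mem → ℕ → Mem → Prop) : Com → Mem → ℕ → ℕ → Mem → Prop
  | setN (a : ℕ) (r c e : NExp) (σ : Mem) :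
      Exec proc (.setN a r c e) σ 1 0
        { σ with nat := setCell σ.nat a (r.eval σ) (c.eval σ) (e.eval σ) }
  | setR (a : ℕ) (r c : NExp) (e : RExp) (σ : Mem) :
      Exec proc (.setR a r c e) σ 1 0
        { σ with real := setCell σ.real a (r.eval σ) (c.eval σ) (e.eval σ) }
  | seq {s s' : Com} {σ σ' σ'' : Mem} {t t' q q' : ℕ} (h : Exec proc s σ t q σ')
      (h' : Exec proc s' σ' t' q' σ'') : Exec proc (.seq s s') σ (t + t') (q + q') σ''
  | branchTrue {b : BExp} {s s' : Com} {σ σ' : Mem} {t q : ℕ} (hb : b.eval σ)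
      (h : Exec proc s σ t q σ') : Exec proc (.branch b s s') σ (t + 1) q σ'
  | branchFalse {b : BExp} {s s' : Com} {σ σ' : Mem} {t q : ℕ} (hb : ¬ b.eval σ)
      (h : Exec proc s' σ t q σ') : Exec proc (.branch b s s') σ (t + 1) q σ'
  | loopTrue {b : BExp} {s : Com} {σ σ' σ'' : Mem} {t t' q q' : ℕ} (hb : b.eval σ)
      (h : Exec proc s σ t q σ') (h' : Exec proc (.loop b s) σ' t' q' σ'') :
      Exec proc (.loop b s) σ (t + t' + 1) (q + q') σ''
  | loopFalse {b : BExp} {s : Com} {σ : Mem} (hb : ¬ b.eval σ) : Exec proc (.loop b s) σ 1 0 σ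
  | call {σ σ' : Mem} {t : ℕ} (h : proc σ t σ') : Exec proc .call σ t 1 σ'

/-- No procedure is available. -/
def noProc : Mem → ℕ → Mem → Prop := fun _ _ _ => False

/-! ## Numbers of the arrays -/

namespace Arr

/-- Arrays of natural numbers: `num` and `types` hold `n` and `k` (in the cell `[0][0]`);
`isBidder[θ][i]` is a flag; row `0` of `matchT` and `matchI` holds the type and the index of the ad
that a call gives to each slot; `acc[θ][i]` is the flag for accepted bidders; row `0` of `own`,
`ownT`, `ownI` holds the outcome; `won[θ][i]` is the flag for ads with a slot; the others are loop
counters. -/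
abbrev num : ℕ := 0
abbrev types : ℕ := 1
abbrev isBidder : ℕ := 2
abbrev matchT : ℕ := 3
abbrev matchI : ℕ := 4
abbrev acc : ℕ := 5
abbrev own : ℕ := 6
abbrev ownT : ℕ := 7
abbrev ownI : ℕ := 8
abbrev won : ℕ := 9
abbrev cT : ℕ := 10
abbrev cI : ℕ := 11
abbrev cJ : ℕ := 12

/-- Arrays of real numbers: `disc[θ][j]`, `val[θ][i]` (the values for which a procedure is
called), `bid[θ][i]`, `reserve[θ][i]`, `price[θ][i]`, the scalars `sw`, `sw'`, `x'`, and the dual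
variables `dualU[θ][i]`, `dualP[0][j]` that the procedure computes. -/
abbrev disc : ℕ := 0
abbrev val : ℕ := 1
abbrev bid : ℕ := 2
abbrev reserve : ℕ := 3
abbrev price : ℕ := 4
abbrev sw : ℕ := 5
abbrev sw' : ℕ := 6
abbrev x' : ℕ := 7
abbrev dualU : ℕ := 8
abbrev dualP : ℕ := 9

end Arr

/-! ## The allocation procedure -/

/-- The memory that holds `n`, `k`, the discount curves and the values, and `0` elsewhere. -/
def allocMem (k n : ℕ) (disc val : ℕ → ℕ → ℝ) : Mem where
  nat := fun a r c => if r = 0 ∧ c = 0 then (if a = Arr.num then n else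
    if a = Arr.types then k else 0) else 0
  real := fun a r c => if r < k ∧ c < n then (if a = Arr.disc then disc r c else
    if a = Arr.val then val r c else 0) else 0

/-- A family with indices below `k` and `n` as a table. -/
noncomputable def table {k n : ℕ} (f : Ad k n → ℝ) (r c : ℕ) : ℝ :=
  if h : r < k ∧ c < n then f (⟨r, h.1⟩, ⟨c, h.2⟩) else 0

/-- The ad with the type number `r` and the index `c`. -/
def readAd (k n r c : ℕ) : Option (Ad k n) :=
  if h : r < k ∧ c < n then some (⟨r, h.1⟩, ⟨c, h.2⟩) else none

/-- What the procedure has computed: the dual solution and the matching. -/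
def readHState (k n : ℕ) (σ : Mem) : HState k n where
  u := fun a => σ.real Arr.dualU a.1 a.2
  p := fun j => σ.real Arr.dualP 0 j
  M := fun j => readAd k n (σ.nat Arr.matchT 0 j) (σ.nat Arr.matchI 0 j)

/-- The program `X` implements the Hungarian algorithm: on every instance (the ads need not be
sorted by value, and there may be ties) it halts with the result of a run of this algorithm. -/
def ImplementsHungarian (X : Com) : Prop :=
  ∀ (k n : ℕ), 0 < k → 0 < n → ∀ (disc : Fin k → Fin n → ℝ) (v : Ad k n → ℝ),
    (∀ θ j, 0 ≤ disc θ j) → (∀ θ, Antitone (disc θ)) → (∀ a, 0 ≤ v a) →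
    ∃ (t : ℕ) (τ : Mem),
      Exec noProc X (allocMem k n (table fun a => disc a.1 a.2) (table v)) t 0 τ ∧
        HungarianResult disc v (readHState k n τ)

/-- A call of the procedure `X` from the memory `σ`. The procedure works in a memory of its own, in
which it finds the arguments and nothing else, and only the matching is handed back. The cost is
the running time of `X` and a step for each number that is copied. -/
def callProc (X : Com) (σ : Mem) (s : ℕ) (σ' : Mem) : Prop :=
  ∃ (t : ℕ) (τ : Mem),
    Exec noProc X (allocMem (σ.nat Arr.types 0 0) (σ.nat Arr.num 0 0)
      (σ.real Arr.disc) (σ.real Arr.val)) t 0 τ ∧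
    s = t + 2 * (σ.nat Arr.types 0 0 * σ.nat Arr.num 0 0) + 2 * σ.nat Arr.num 0 0 + 2 ∧
    σ' = { σ with
      nat := fun a r c =>
        if (a = Arr.matchT ∨ a = Arr.matchI) ∧ r = 0 ∧ c < σ.nat Arr.num 0 0 then τ.nat a r c
        else σ.nat a r c }

/-! ## The pricing algorithm as a program -/

/-- The cell `[0][0]` of an array, as a variable. -/
abbrev NExp.var (a : ℕ) : NExp := .get a (.lit 0) (.lit 0)

/-- The cell `[0][0]` of an array, as a variable. -/
abbrev RExp.var (a : ℕ) : RExp := .get a (.lit 0) (.lit 0)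

/-- The cell `[0][c]` of an array. -/
abbrev NExp.row (a : ℕ) (c : NExp) : NExp := .get a (.lit 0) c

/-- `a := e` for a variable `a`. -/
abbrev Com.letR (a : ℕ) (e : RExp) : Com := .setR a (.lit 0) (.lit 0) e

/-- `for a = 0, ..., e - 1 do s`. -/
def Com.forLt (a : ℕ) (e : NExp) (s : Com) : Com :=
  .seq (.setN a (.lit 0) (.lit 0) (.lit 0))
    (.loop (.lt (.var a) e)
      (.seq s (.setN a (.lit 0) (.lit 0) (.add (.var a) (.lit 1)))))

/-- A statement that does nothing (it costs a step). -/
def Com.skip : Com := .setN Arr.cJ (.lit 0) (.lit 0) (.var Arr.cJ)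

/-- Execute `s` for all ads `(cT, cI)`. -/
def forAds (s : Com) : Com :=
  .forLt Arr.cT (.var Arr.types) (.forLt Arr.cI (.var Arr.num) s)

/-- Execute `s` for all slots `cJ`. -/
def forSlots (s : Com) : Com := .forLt Arr.cJ (.var Arr.num) s

/-- Cell `[cT][cI]` of an array of natural numbers: the entry of the current ad. -/
abbrev curN (a : ℕ) : NExp := .get a (.var Arr.cT) (.var Arr.cI)

/-- Cell `[cT][cI]` of an array of real numbers: the entry of the current ad. -/
abbrev curR (a : ℕ) : RExp := .get a (.var Arr.cT) (.var Arr.cI)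

/-- Set the entry of the current ad. -/
abbrev setCurN (a : ℕ) (e : NExp) : Com := .setN a (.var Arr.cT) (.var Arr.cI) e

/-- Set the entry of the current ad. -/
abbrev setCurR (a : ℕ) (e : RExp) : Com := .setR a (.var Arr.cT) (.var Arr.cI) e

/-- The ad `(rT[cJ], rI[cJ])` is the current ad. -/
def isCur (rT rI : ℕ) : BExp :=
  .and (.eq (.row rT (.var Arr.cJ)) (.var Arr.cT)) (.eq (.row rI (.var Arr.cJ)) (.var Arr.cI))

/-- The value, for the ad `(rT[cJ], rI[cJ])`, of the slot `cJ`: its bid times its discount. -/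
def slotValue (rT rI : ℕ) : RExp :=
  .mul (.get Arr.bid (.row rT (.var Arr.cJ)) (.row rI (.var Arr.cJ)))
    (.get Arr.disc (.row rT (.var Arr.cJ)) (.var Arr.cJ))

/-- The accepted bidders are found; their bids, and `0` for all other ads, are the arguments of
the first call. All prices are set to `0`. -/
def findAccepted : Com :=
  forAds (.seq (setCurR Arr.price (.lit 0))
    (.branch (.and (.eq (curN Arr.isBidder) (.lit 1)) (.le (curR Arr.reserve) (curR Arr.bid)))
      (.seq (setCurN Arr.acc (.lit 1)) (setCurR Arr.val (curR Arr.bid)))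
      (.seq (setCurN Arr.acc (.lit 0)) (setCurR Arr.val (.lit 0)))))

/-- The outcome `ω` is read off from the result of the first call. -/
def readOutcome : Com :=
  forSlots (.branch
    (.eq (.get Arr.acc (.row Arr.matchT (.var Arr.cJ)) (.row Arr.matchI (.var Arr.cJ))) (.lit 1))
    (.seq (.setN Arr.own (.lit 0) (.var Arr.cJ) (.lit 1))
      (.seq (.setN Arr.ownT (.lit 0) (.var Arr.cJ) (.row Arr.matchT (.var Arr.cJ)))
        (.seq (.setN Arr.ownI (.lit 0) (.var Arr.cJ) (.row Arr.matchI (.var Arr.cJ)))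
          (.setN Arr.won (.row Arr.matchT (.var Arr.cJ)) (.row Arr.matchI (.var Arr.cJ))
            (.lit 1)))))
    (.setN Arr.own (.lit 0) (.var Arr.cJ) (.lit 0)))

/-- The welfare of the others in `ω`. -/
def sumOutcome : Com :=
  .seq (.letR Arr.sw (.lit 0))
    (forSlots (.branch
      (.and (.eq (.row Arr.own (.var Arr.cJ)) (.lit 1)) (.not (isCur Arr.ownT Arr.ownI)))
      (.letR Arr.sw (.add (.var Arr.sw) (slotValue Arr.ownT Arr.ownI)))
      .skip))

/-- The welfare of the others in `ω'`, and the quantity that the current ad gets in `ω'`. -/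
def sumAlternative : Com :=
  .seq (.letR Arr.sw' (.lit 0)) (.seq (.letR Arr.x' (.lit 0))
    (forSlots (.branch
      (.eq (.get Arr.acc (.row Arr.matchT (.var Arr.cJ)) (.row Arr.matchI (.var Arr.cJ))) (.lit 1))
      (.branch (isCur Arr.matchT Arr.matchI)
        (.letR Arr.x' (.add (.var Arr.x') (.get Arr.disc (.var Arr.cT) (.var Arr.cJ))))
        (.letR Arr.sw' (.add (.var Arr.sw') (slotValue Arr.matchT Arr.matchI))))
      .skip)))

/-- The price of the current ad: its bid is replaced by its reserve price, the procedure is called,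
and the bid is restored. -/
def priceCurrent : Com :=
  .seq sumOutcome (.seq (setCurR Arr.val (curR Arr.reserve)) (.seq .call (.seq sumAlternative
    (.seq (setCurR Arr.price (.add (.sub (.var Arr.sw') (.var Arr.sw))
      (.mul (.var Arr.x') (curR Arr.reserve))))
      (setCurR Arr.val (curR Arr.bid))))))

/-- The pricing algorithm; the ads that satisfy the test `b` are priced. -/
def pricingWith (b : BExp) : Com :=
  .seq findAccepted (.seq .call (.seq readOutcome
    (forAds (.branch b priceCurrent .skip))))

/-- The pricing algorithm, literally: the price of each accepted bidder is computed by a call. -/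
def pricing : Com := pricingWith (.eq (curN Arr.acc) (.lit 1))

/-- The pricing algorithm, with the shortcut that the price of an accepted bidder who does not get
a slot is left at `0`, without a call. -/
def pricingWinners : Com :=
  pricingWith (.and (.eq (curN Arr.acc) (.lit 1)) (.eq (curN Arr.won) (.lit 1)))

/-- The memory that holds the auction `A`, and `0` elsewhere. -/
noncomputable def Auction.mem {k n : ℕ} (A : Auction k n) : Mem where
  nat := open Classical in fun a r c =>
    if a = Arr.num then (if r = 0 ∧ c = 0 then n else 0) else
    if a = Arr.types then (if r = 0 ∧ c = 0 then k else 0) else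
    if a = Arr.isBidder then (if ∃ b ∈ A.bidders, readAd k n r c = some b then 1 else 0) else 0
  real := fun a r c =>
    if a = Arr.disc then table (fun b => A.disc b.1 b.2) r c else
    if a = Arr.bid then table A.bid r c else
    if a = Arr.reserve then table A.reserve r c else 0

/-- The outcome that the pricing program leaves in the memory. -/
def readOwners (k n : ℕ) (σ : Mem) : Assignment k n := fun j =>
  if σ.nat Arr.own 0 j = 1 then readAd k n (σ.nat Arr.ownT 0 j) (σ.nat Arr.ownI 0 j) else none

/-- The prices that the pricing program leaves in the memory. -/
def readPrices (k n : ℕ) (σ : Mem) : Ad k n → ℝ := fun a => σ.real Arr.price a.1 a.2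

end AdTypes

/-! The heart of the matter is an implementation of one phase of the Hungarian algorithm in O(n(k +
log n)) steps. A call has n phases, so it costs O(n²(k + log n)), and the pricing bounds follow by
counting calls.

A phase is a run of Dijkstra's algorithm. The dual variables need not be moved whenever the tree
grows: it suffices to remember for each slot of the tree the distance `key` at which it joined. The
current dual solution is a function of these distances, and the slack of an edge out of the tree is
the length of the path that ends with it, minus the current distance (`Search.slack_eq`). So the
edge of least slack is the end of a shortest path, `Search.grow` is one growth step, and the dual
variables are moved once, at the end (`Search.finish`).

A slot of the tree has about kn edges, but only O(k) of them matter. If the ad a' lies in the slot b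
along a tight edge, then slack(a, j) = slack(a', j) + slack(a, b) + (d_j - d_b)(v' - v) for all ads
a of the same type, with discounts d and values v, v' (`HState.slack_split`). If the last product is
nonnegative, the edge (a, j) is not shorter than a detour through b. Complementary slackness forces
larger discounts to hold larger values (`HState.Good.values_le`). Hence for each type and each slot
four matched candidates are enough: the nearest slot with the same discount on either side, the most
valuable ad in the next occupied group of smaller discount, and the least valuable ad in the next
occupied group of larger discount (`Search.dominated`). Unmatched ads have dual variable 0, so of
these only the most valuable one of each type is needed. Two sweeps over the slots for each type
fill the tables of candidates in O(kn) steps per phase.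

A phase thus needs O(kn) insertions and decreases of keys, and at most n deletions of the minimum.
These take O(1) and O(log n) amortized steps in a quake heap: a forest of tournament trees in which
a decrease of a key cuts a subtree off and leaves a hole. Only a deletion of the minimum repairs the
heap. It links trees of equal height, and if the number of nodes of some height i + 1 exceeds 3/4 of
that of height i, it removes everything above i. In this case many children are missing, by
`Heap.Inv.two_mul_count_le`, and the potential stored with the missing children pays for the removal
(`wp_heapTruncAll`). The heights therefore stay O(log n) (`Heap.Inv.lt_maxHeight`).

The pricing programs call this procedure, whose correctness and cost are `wp_hungarian`. That a
bidder without a slot may be skipped is `HungarianResult.lower`: an ad that is unmatched at the end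
was never chosen, lowering its value only increases its slacks, and the initial price is determined
by an ad that is matched. So the same run is a run for the lowered bid, the welfare of the others is
unchanged, and the formula gives the price 0. At most n bidders have a slot, which bounds the number
of calls. -/

namespace AdTypes

/-! ## Reasoning about programs -/

/-- Change a cell of an array of natural numbers. -/
def Mem.setN (σ : Mem) (a r c x : ℕ) : Mem := { σ with nat := setCell σ.nat a r c x }

/-- Change a cell of an array of real numbers. -/
def Mem.setR (σ : Mem) (a r c : ℕ) (x : ℝ) : Mem := { σ with real := setCell σ.real a r c x }

@[simp] theorem Mem.setN_real (σ : Mem) (a r c x : ℕ) : (σ.setN a r c x).real = σ.real := rfl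

@[simp] theorem Mem.setR_nat (σ : Mem) (a r c : ℕ) (x : ℝ) : (σ.setR a r c x).nat = σ.nat := rfl

theorem Mem.setN_nat (σ : Mem) (a r c x a' r' c' : ℕ) :
    (σ.setN a r c x).nat a' r' c' = if a' = a ∧ r' = r ∧ c' = c then x else σ.nat a' r' c' := rfl

theorem Mem.setR_real (σ : Mem) (a r c : ℕ) (x : ℝ) (a' r' c' : ℕ) :
    (σ.setR a r c x).real a' r' c' = if a' = a ∧ r' = r ∧ c' = c then x else σ.real a' r' c' := rfl

theorem Mem.setN_nat_of_ne (σ : Mem) (a r c x : ℕ) {a' : ℕ} (h : a' ≠ a) :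
    (σ.setN a r c x).nat a' = σ.nat a' := by
  funext r' c'; simp [Mem.setN_nat, h]

theorem Mem.setR_real_of_ne (σ : Mem) (a r c : ℕ) (x : ℝ) {a' : ℕ} (h : a' ≠ a) :
    (σ.setR a r c x).real a' = σ.real a' := by
  funext r' c'; simp [Mem.setR_real, h]

/-- Is the program free of loops and calls? -/
def Com.isStraight : Com → Bool
  | .setN .. => true
  | .setR .. => true
  | .seq s s' => s.isStraight && s'.isStraight
  | .branch _ s s' => s.isStraight && s'.isStraight
  | .loop .. => false
  | .call => false

/-- A bound for the number of steps of a program without loops. -/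
def Com.cost : Com → ℕ
  | .setN .. => 1
  | .setR .. => 1
  | .seq s s' => s.cost + s'.cost
  | .branch _ s s' => s.cost + s'.cost + 1
  | .loop .. => 0
  | .call => 0

open Classical in
/-- The effect of a program without loops. -/
noncomputable def Com.run : Com → Mem → Mem
  | .setN a r c e, σ => σ.setN a (r.eval σ) (c.eval σ) (e.eval σ)
  | .setR a r c e, σ => σ.setR a (r.eval σ) (c.eval σ) (e.eval σ)
  | .seq s s', σ => s'.run (s.run σ)
  | .branch b s s', σ => if b.eval σ then s.run σ else s'.run σ
  | .loop .., σ => σ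
  | .call, σ => σ

/-- Straight-line code acts as a function on memories, so its effect can be computed by `simp`. The
bound `cost` charges both branches of a test, which only affects the constants. -/
theorem exec_run (proc : Mem → ℕ → Mem → Prop) (s : Com) :
    s.isStraight = true → ∀ σ, ∃ t ≤ s.cost, Exec proc s σ t 0 (s.run σ) := by
  induction s with
  | setN a r c e => exact fun _ σ => ⟨1, le_rfl, .setN a r c e σ⟩
  | setR a r c e => exact fun _ σ => ⟨1, le_rfl, .setR a r c e σ⟩
  | seq s s' ih ih' =>
    intro h σ
    simp only [Com.isStraight, Bool.and_eq_true] at h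
    obtain ⟨t, ht, e⟩ := ih h.1 σ
    obtain ⟨t', ht', e'⟩ := ih' h.2 (s.run σ)
    exact ⟨t + t', Nat.add_le_add ht ht', .seq e e'⟩
  | branch b s s' ih ih' =>
    intro h σ
    simp only [Com.isStraight, Bool.and_eq_true] at h
    by_cases hb : b.eval σ
    · obtain ⟨t, ht, e⟩ := ih h.1 σ
      refine ⟨t + 1, by simp only [Com.cost]; omega, ?_⟩
      simpa [Com.run, hb] using Exec.branchTrue hb e
    · obtain ⟨t, ht, e⟩ := ih' h.2 σ
      refine ⟨t + 1, by simp only [Com.cost]; omega, ?_⟩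
      simpa [Com.run, hb] using Exec.branchFalse hb e
  | loop => intro h; simp [Com.isStraight] at h
  | call => intro h; simp [Com.isStraight] at h

/-- The arrays of natural numbers in which a program writes. -/
def Com.natWrites : Com → List ℕ
  | .setN a .. => [a]
  | .setR .. => []
  | .seq s s' => s.natWrites ++ s'.natWrites
  | .branch _ s s' => s.natWrites ++ s'.natWrites
  | .loop _ s => s.natWrites
  | .call => []

/-- The arrays of real numbers in which a program writes. -/
def Com.realWrites : Com → List ℕ
  | .setN .. => []
  | .setR a .. => [a]
  | .seq s s' => s.realWrites ++ s'.realWrites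
  | .branch _ s s' => s.realWrites ++ s'.realWrites
  | .loop _ s => s.realWrites
  | .call => []

/-- The lists of written arrays are syntactic, so frame conditions become decidable facts about
array numbers. Calls are excluded because they write arrays that the lists do not mention. -/
theorem exec_frame {s : Com} {σ τ : Mem} {t q : ℕ} (h : Exec noProc s σ t q τ) :
    (∀ a, a ∉ s.natWrites → τ.nat a = σ.nat a) ∧ (∀ a, a ∉ s.realWrites → τ.real a = σ.real a) := by
  induction h with
  | setN a r c e σ =>
    refine ⟨fun b hb => Mem.setN_nat_of_ne σ a _ _ _ ?_, fun _ _ => rfl⟩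
    simpa [Com.natWrites] using hb
  | setR a r c e σ =>
    refine ⟨fun _ _ => rfl, fun b hb => Mem.setR_real_of_ne σ a _ _ _ ?_⟩
    simpa [Com.realWrites] using hb
  | seq h h' ih ih' =>
    simp only [Com.natWrites, Com.realWrites, List.mem_append, not_or]
    exact ⟨fun a ha => (ih'.1 a ha.2).trans (ih.1 a ha.1),
      fun a ha => (ih'.2 a ha.2).trans (ih.2 a ha.1)⟩
  | branchTrue hb h ih =>
    simp only [Com.natWrites, Com.realWrites, List.mem_append, not_or]
    exact ⟨fun a ha => ih.1 a ha.1, fun a ha => ih.2 a ha.1⟩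
  | branchFalse hb h ih =>
    simp only [Com.natWrites, Com.realWrites, List.mem_append, not_or]
    exact ⟨fun a ha => ih.1 a ha.2, fun a ha => ih.2 a ha.2⟩
  | loopTrue hb h h' ih ih' =>
    exact ⟨fun a ha => (ih'.1 a ha).trans (ih.1 a ha), fun a ha => (ih'.2 a ha).trans (ih.2 a ha)⟩
  | loopFalse hb => exact ⟨fun _ _ => rfl, fun _ _ => rfl⟩
  | call h => exact h.elim

theorem run_nat {s : Com} (hs : s.isStraight = true) (σ : Mem) {a : ℕ} (ha : a ∉ s.natWrites) :
    (s.run σ).nat a = σ.nat a :=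
  let ⟨_, _, e⟩ := exec_run noProc s hs σ
  (exec_frame e).1 a ha

theorem run_real {s : Com} (hs : s.isStraight = true) (σ : Mem) {a : ℕ} (ha : a ∉ s.realWrites) :
    (s.run σ).real a = σ.real a :=
  let ⟨_, _, e⟩ := exec_run noProc s hs σ
  (exec_frame e).2 a ha

/-- Started in `σ` with a budget of `c` steps, `s` halts within the budget, without a call, and
establishes `Q` of a remaining budget and the final memory. -/
def Wp (s : Com) (Q : ℕ → Mem → Prop) (c : ℕ) (σ : Mem) : Prop :=
  ∃ t τ c', Exec noProc s σ t 0 τ ∧ t + c' ≤ c ∧ Q c' τ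

namespace Wp

variable {s s' : Com} {Q Q' : ℕ → Mem → Prop} {c : ℕ} {σ : Mem} {b : BExp}

theorem straight (hs : s.isStraight = true) (c' : ℕ) (hc : s.cost + c' ≤ c) (h : Q c' (s.run σ)) :
    Wp s Q c σ := by
  obtain ⟨t, ht, e⟩ := exec_run noProc s hs σ
  exact ⟨t, _, c', e, by omega, h⟩

theorem mono (h : Wp s Q c σ) (hQ : ∀ c σ, Q c σ → Q' c σ) : Wp s Q' c σ := by
  obtain ⟨t, τ, c', e, hc, h⟩ := h
  exact ⟨t, τ, c', e, hc, hQ _ _ h⟩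

/-- Only the arrays in which the program writes are changed. -/
theorem framed (h : Wp s Q c σ) : Wp s (fun c τ => Q c τ ∧
    (∀ a, a ∉ s.natWrites → τ.nat a = σ.nat a) ∧ (∀ a, a ∉ s.realWrites → τ.real a = σ.real a)) c σ := by
  obtain ⟨t, τ, c', e, hc, h⟩ := h
  exact ⟨t, τ, c', e, hc, h, exec_frame e⟩

/-- A part of the budget can be set aside. -/
theorem frame (h : Wp s Q c σ) (d : ℕ) {e : ℕ} (he : c + d ≤ e) :
    Wp s (fun c' τ => ∃ c'', c' = c'' + d ∧ Q c'' τ) e σ := by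
  obtain ⟨t, τ, c', ex, hc, h⟩ := h
  exact ⟨t, τ, c' + d, ex, by omega, c', rfl, h⟩

theorem seq (h : Wp s (fun c' τ => Wp s' Q c' τ) c σ) : Wp (.seq s s') Q c σ := by
  obtain ⟨t, τ, c', e, hc, t', τ', c'', e', hc', h⟩ := h
  exact ⟨t + t', τ', c'', .seq e e', by omega, h⟩

theorem branch (c' : ℕ) (hc : c' + 1 ≤ c) (h : b.eval σ → Wp s Q c' σ)
    (h' : ¬ b.eval σ → Wp s' Q c' σ) : Wp (.branch b s s') Q c σ := by
  by_cases hb : b.eval σ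
  · obtain ⟨t, τ, c'', e, hc', h⟩ := h hb
    exact ⟨t + 1, τ, c'', .branchTrue hb e, by omega, h⟩
  · obtain ⟨t, τ, c'', e, hc', h⟩ := h' hb
    exact ⟨t + 1, τ, c'', .branchFalse hb e, by omega, h⟩

/-- The rule for loops; they terminate since each test takes a step. -/
theorem loop (I : ℕ → Mem → Prop) (h : I c σ)
    (hI : ∀ c σ, I c σ → ∃ c', c' + 1 ≤ c ∧ (b.eval σ → Wp s I c' σ) ∧ (¬ b.eval σ → Q c' σ)) :
    Wp (.loop b s) Q c σ := by
  induction c using Nat.strong_induction_on generalizing σ with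
  | _ c ih =>
    obtain ⟨c', hc', hT, hF⟩ := hI c σ h
    by_cases hb : b.eval σ
    · obtain ⟨t, τ, c'', e, hc'', hi⟩ := hT hb
      obtain ⟨t', τ', d, e', hd, hq⟩ := ih c'' (by omega) hi
      exact ⟨t + t' + 1, τ', d, .loopTrue hb e e', by omega, hq⟩
    · exact ⟨1, σ, c', .loopFalse hb, by omega, hF hb⟩

/-- The rule for counting loops with a bound `K` for the cost of each iteration and an invariant
that may have a budget of its own. -/
theorem forLt {a : ℕ} {e : NExp} (N K : ℕ) (I : ℕ → ℕ → Mem → Prop) (c₀ : ℕ)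
    (hc : c₀ + N * (K + 2) + 2 ≤ c) (h0 : I 0 c₀ (σ.setN a 0 0 0))
    (he : ∀ i c σ, I i c σ → e.eval σ = N)
    (hs : ∀ i, i < N → ∀ c σ, I i c σ → σ.nat a 0 0 = i →
      Wp s (fun c' τ => τ.nat a 0 0 = i ∧ I (i + 1) c' (τ.setN a 0 0 (i + 1))) (c + K) σ)
    (hQ : ∀ c σ, I N c σ → σ.nat a 0 0 = N → Q c σ) : Wp (.forLt a e s) Q c σ := by
  refine seq (straight rfl (c - 1) (by simp only [Com.cost]; omega) ?_)
  -- The remaining iterations are prepaid: `K + 2` for the body, the test and the increment, and one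
  -- step for the last test. The rest `d` belongs to the invariant, which may store a potential in
  -- it.
  refine loop (fun c τ => ∃ i ≤ N, τ.nat a 0 0 = i ∧
    ∃ d, d + (N - i) * (K + 2) + 1 ≤ c ∧ I i d τ) ?_ ?_
  · exact ⟨0, by simp, by simp [Com.run, NExp.eval, Mem.setN_nat], c₀, by simp; omega, h0⟩
  · rintro c τ ⟨i, hi, ha, d, hd, hI⟩
    by_cases hb : i < N
    · refine ⟨c - 1, by omega, fun _ => ?_, fun hb' => ?_⟩
      · have hexp : (N - i) * (K + 2) = (N - (i + 1)) * (K + 2) + (K + 2) := by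
          rw [← Nat.succ_mul]; congr 1; omega
        refine seq (((hs i hb d τ hI ha).frame ((N - (i + 1)) * (K + 2) + 2) (by omega)).mono ?_)
        rintro c' τ' ⟨c'', rfl, ha', hI'⟩
        refine straight rfl (c'' + (N - (i + 1)) * (K + 2) + 1) (by simp only [Com.cost]; omega) ?_
        refine ⟨i + 1, hb, by simp [Com.run, NExp.eval, Mem.setN_nat, ha'], c'', le_rfl, ?_⟩
        simpa [Com.run, NExp.eval, ha'] using hI'
      · simp only [BExp.eval, NExp.eval, he i d τ hI, ha] at hb'
        exact absurd hb hb'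
    · obtain rfl : i = N := by omega
      refine ⟨d, by omega, fun hb' => ?_, fun _ => hQ _ _ hI ha⟩
      simp only [BExp.eval, NExp.eval, he i d τ hI, ha] at hb'
      exact absurd hb' hb

end Wp


/-! ## Heaps with tournament trees of bounded height (quake heaps)

The items are natural numbers. The trees are stored by items: the item `x` wins its matches up to
the height `H x`, and `ch x h - 1` is the item that it beats in order to reach the height `h`. -/

/-- Change a value of a function. -/
def upd {β : Type} (f : ℕ → β) (x : ℕ) (b : β) : ℕ → β := fun y => if y = x then b else f y

/-- Change a value of a function of two arguments. -/
def upd2 {β : Type} (f : ℕ → ℕ → β) (x z : ℕ) (b : β) : ℕ → ℕ → β :=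
  fun y w => if y = x ∧ w = z then b else f y w

@[grind =] theorem upd_apply {β : Type} (f : ℕ → β) (x : ℕ) (b : β) (y : ℕ) :
    upd f x b y = if y = x then b else f y := rfl

@[simp] theorem upd_self {β : Type} (f : ℕ → β) (x : ℕ) (b : β) : upd f x b x = b := if_pos rfl

@[simp] theorem upd_of_ne {β : Type} {f : ℕ → β} {x y : ℕ} {b : β} (h : y ≠ x) :
    upd f x b y = f y := if_neg h

@[grind =] theorem upd2_apply {β : Type} (f : ℕ → ℕ → β) (x z : ℕ) (b : β) (y w : ℕ) :
    upd2 f x z b y w = if y = x ∧ w = z then b else f y w := rfl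

-- An item stands for the whole chain of nodes that it occupies, one of each height up to `H x`, so
-- that removing the upmost node of a root is a decrement of `H`. References are stored as
-- successors, with `0` for absence; the status `2` marks deleted items.
@[ext] structure Heap where
  /-- `1` for the items in the heap -/
  st : ℕ → ℕ
  H : ℕ → ℕ
  /-- the item that beats `x` is `pa x - 1` -/
  pa : ℕ → ℕ
  ch : ℕ → ℕ → ℕ
  /-- at most one root for each height, while trees are linked -/
  bk : ℕ → ℕ
  /-- the list of the other roots, and its length -/
  pl : ℕ → ℕ
  pn : ℕ
  /-- the number of the items of at least a given height -/
  cnt : ℕ → ℕ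
  key : ℕ → ℝ

namespace Heap

variable {n : ℕ} {q : Heap}

def items (n : ℕ) (q : Heap) : Finset ℕ := (range n).filter fun x => q.st x = 1

/-- Children are only constrained up to the height of the item, so old entries of `ch` above it are
harmless, and an entry `0` below it is a hole. The lists and the buckets together contain each root
exactly once. -/
structure Inv (n : ℕ) (q : Heap) : Prop where
  lt : ∀ x, q.st x = 1 → x < n
  child : ∀ x h c, q.st x = 1 → 1 ≤ h → h ≤ q.H x → q.ch x h = c + 1 →
    q.st c = 1 ∧ q.H c + 1 = h ∧ q.pa c = x + 1
  parent : ∀ c x, q.st c = 1 → q.pa c = x + 1 →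
    q.st x = 1 ∧ q.H c + 1 ≤ q.H x ∧ q.ch x (q.H c + 1) = c + 1 ∧ q.key x ≤ q.key c
  bucket : ∀ h x, q.bk h = x + 1 → q.st x = 1 ∧ q.pa x = 0 ∧ q.H x = h
  list : ∀ i < q.pn, q.st (q.pl i) = 1 ∧ q.pa (q.pl i) = 0 ∧ q.bk (q.H (q.pl i)) ≠ q.pl i + 1
  list_inj : ∀ i < q.pn, ∀ j < q.pn, q.pl i = q.pl j → i = j
  roots : ∀ x, q.st x = 1 → q.pa x = 0 → q.bk (q.H x) = x + 1 ∨ ∃ i < q.pn, q.pl i = x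
  count : ∀ i, q.cnt i = #((q.items n).filter fun x => i ≤ q.H x)

theorem Inv.mem_items (hq : q.Inv n) {x : ℕ} : x ∈ q.items n ↔ q.st x = 1 := by
  simp only [items, mem_filter, mem_range, and_iff_right_iff_imp]; exact hq.lt x

/-- The number of trees. -/
def trees (n : ℕ) (q : Heap) : ℕ := #((q.items n).filter fun x => q.pa x = 0)

/-- The number of missing children above the height `i`. -/
def holes (n : ℕ) (q : Heap) (i : ℕ) : ℕ :=
  ∑ x ∈ q.items n, #((Ioc i (q.H x)).filter fun h => q.ch x h = 0)

/-- The number of the items of at least height `i` that are not roots. -/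
def beaten (n : ℕ) (q : Heap) (i : ℕ) : ℕ :=
  #((q.items n).filter fun x => q.pa x ≠ 0 ∧ i ≤ q.H x)

/-! ### Operations -/

/-- Insert `x`. -/
def push (q : Heap) (x : ℕ) (κ : ℝ) : Heap :=
  { q with
    st := upd q.st x 1
    H := upd q.H x 0
    pa := upd q.pa x 0
    pl := upd q.pl q.pn x
    pn := q.pn + 1
    cnt := upd q.cnt 0 (q.cnt 0 + 1)
    key := upd q.key x κ }

/-- Decrease the key of a root. -/
def lower (q : Heap) (x : ℕ) (κ : ℝ) : Heap := { q with key := upd q.key x κ }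

/-- Decrease the key of `x`, which `y` beats, and make `x` a root. -/
def cut (q : Heap) (x y : ℕ) (κ : ℝ) : Heap :=
  { q with
    ch := upd2 q.ch y (q.H x + 1) 0
    pa := upd q.pa x 0
    pl := upd q.pl q.pn x
    pn := q.pn + 1
    key := upd q.key x κ }

/-- Remove the upmost node of the root `r`, which has no child there. -/
def truncHole (q : Heap) (r : ℕ) : Heap :=
  { q with
    H := upd q.H r (q.H r - 1)
    cnt := upd q.cnt (q.H r) (q.cnt (q.H r) - 1) }

/-- Remove the upmost node of the root `r`, with the child `c`. -/
def truncChild (q : Heap) (r c : ℕ) : Heap :=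
  { q with
    H := upd q.H r (q.H r - 1)
    cnt := upd q.cnt (q.H r) (q.cnt (q.H r) - 1)
    pa := upd q.pa c 0
    pl := upd q.pl q.pn c
    pn := q.pn + 1 }

/-- Remove the root number `i`, of height `0`. -/
def delete (q : Heap) (i : ℕ) : Heap :=
  { q with
    st := upd q.st (q.pl i) 2
    pl := upd q.pl i (q.pl (q.pn - 1))
    pn := q.pn - 1
    cnt := upd q.cnt 0 (q.cnt 0 - 1) }

/-- Move the last root of the list to its bucket. -/
def store (q : Heap) : Heap :=
  { q with
    bk := upd q.bk (q.H (q.pl (q.pn - 1))) (q.pl (q.pn - 1) + 1)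
    pn := q.pn - 1 }

/-- Move the root of height `h` from its bucket to the list. -/
def unstore (q : Heap) (h : ℕ) : Heap :=
  { q with
    bk := upd q.bk h 0
    pl := upd q.pl q.pn (q.bk h - 1)
    pn := q.pn + 1 }

/-- Link the last root of the list with the root of the same height `h` that is in a bucket: `w`
beats `l`. -/
def link (q : Heap) (h w l : ℕ) : Heap :=
  { q with
    bk := upd q.bk h 0
    pa := upd q.pa l (w + 1)
    ch := upd2 q.ch w (h + 1) (l + 1)
    H := upd q.H w (h + 1)
    pl := upd q.pl (q.pn - 1) w
    cnt := upd q.cnt (h + 1) (q.cnt (h + 1) + 1) }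

/-! ### Counting -/

theorem card_filter_add_one {s : Finset ℕ} {p p' : ℕ → Prop} [DecidablePred p] [DecidablePred p']
    {x : ℕ} (hx : x ∈ s) (h : ∀ y ∈ s, y ≠ x → (p y ↔ p' y)) (h1 : p x) (h2 : ¬ p' x) :
    #(s.filter p) = #(s.filter p') + 1 := by
  have : s.filter p = insert x (s.filter p') := by
    ext y; by_cases hy : y = x <;> simp_all
  rw [this, card_insert_of_notMem (by simp [h2])]

/-- Every operation changes the summand of a single item; the additive form avoids truncated
subtraction. -/
theorem sum_add_swap {s : Finset ℕ} {f g : ℕ → ℕ} {x : ℕ} (hx : x ∈ s)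
    (h : ∀ y ∈ s, y ≠ x → f y = g y) : ∑ y ∈ s, f y + g x = ∑ y ∈ s, g y + f x := by
  rw [← add_sum_erase _ _ hx, ← add_sum_erase _ g hx]
  rw [sum_congr rfl fun y hy => h y (mem_of_mem_erase hy) (ne_of_mem_erase hy)]
  ring

theorem items_push {x : ℕ} {κ : ℝ} (hx : x < n) : (q.push x κ).items n = insert x (q.items n) := by
  ext y; simp only [items, push, upd_apply, mem_filter, mem_range, mem_insert]; grind

theorem items_delete {i : ℕ} : (q.delete i).items n = (q.items n).erase (q.pl i) := by
  ext y; simp only [items, delete, upd_apply, mem_filter, mem_range, mem_erase]; grind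

/-! ### The invariant is kept -/

theorem Inv.push (hq : q.Inv n) {x : ℕ} (κ : ℝ) (hx : x < n) (hst : q.st x ≠ 1) :
    (q.push x κ).Inv n where
  lt := by have := hq.lt; simp only [Heap.push]; grind
  child := by
    have h1 := hq.child; simp only [Heap.push]; intro z h c hz hh hh' hc
    have := h1 z h c (by grind) hh (by grind) hc
    have : c ≠ x := by grind
    grind
  parent := by
    have h1 := hq.parent; simp only [Heap.push]; intro c z hc hz
    have := h1 c z (by grind) (by grind)
    have : z ≠ x := by grind
    grind
  bucket := by have := hq.bucket; simp only [Heap.push]; grind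
  list := by have := hq.list; have := hq.bucket; simp only [Heap.push]; grind
  list_inj := by have := hq.list_inj; have := hq.list; simp only [Heap.push]; grind
  roots := by
    have := hq.roots; simp only [Heap.push]; intro y h1 h2
    by_cases hy : y = x
    · exact Or.inr ⟨q.pn, by omega, by simp [hy]⟩
    · rcases this y (by grind) (by grind) with h | ⟨i, hi, h⟩
      · left; grind
      · right; exact ⟨i, by omega, by grind⟩
  count := by
    intro i
    rw [items_push hx, filter_insert]
    have hx' : x ∉ q.items n := by simpa [hq.mem_items] using hst
    have hf : (q.items n).filter (fun y => i ≤ (q.push x κ).H y)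
        = (q.items n).filter (fun y => i ≤ q.H y) := by
      refine filter_congr fun y hy => ?_
      have : y ≠ x := by rintro rfl; exact hx' hy
      simp [Heap.push, this]
    have := hq.count
    rw [hf]
    by_cases hi : i = 0
    · subst hi
      rw [if_pos (by simp), card_insert_of_notMem (by simp [hx']), ← hq.count]; simp [Heap.push]
    · rw [if_neg (by simp [Heap.push, hi]), ← hq.count]; simp [Heap.push, hi]

theorem Inv.lower (hq : q.Inv n) {x : ℕ} {κ : ℝ} (hpa : q.pa x = 0) (hκ : κ ≤ q.key x) :
    (q.lower x κ).Inv n where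
  lt := hq.lt
  child := hq.child
  parent := by have := hq.parent; simp only [Heap.lower]; grind
  bucket := hq.bucket
  list := hq.list
  list_inj := hq.list_inj
  roots := hq.roots
  count := hq.count

/-- The item takes its whole subtree along, so all heights and counts stay as they are. The only
trace is a hole in the parent `y`, one above the height of `x`. -/
theorem Inv.cut (hq : q.Inv n) {x y : ℕ} {κ : ℝ} (hst : q.st x = 1) (hpa : q.pa x = y + 1)
    (hκ : κ ≤ q.key x) : (q.cut x y κ).Inv n where
  lt := hq.lt
  child := by
    have h1 := hq.child; have := hq.parent; simp only [Heap.cut]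
    intro z h c hz hh hh' hc
    by_cases hzy : z = y
    · subst hzy
      by_cases hhx : h = q.H x + 1
      · simp [hhx, upd2_apply] at hc
      · have := h1 z h c hz hh hh' (by simpa [hhx, upd2_apply] using hc)
        have : c ≠ x := by grind
        grind
    · have := h1 z h c hz hh hh' (by simpa [hzy, upd2_apply] using hc)
      have : c ≠ x := by grind
      grind
  parent := by
    have h1 := hq.parent; simp only [Heap.cut]
    intro c z hc hz
    have hcx : c ≠ x := by rintro rfl; simp at hz
    have := h1 c z hc (by simpa [hcx] using hz)
    have h2 := h1 x y hst hpa
    have : ¬ (z = y ∧ q.H c + 1 = q.H x + 1) := by grind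
    grind
  bucket := by have := hq.bucket; simp only [Heap.cut]; grind
  list := by have := hq.list; have := hq.bucket; simp only [Heap.cut]; grind
  list_inj := by have := hq.list_inj; have := hq.list; simp only [Heap.cut]; grind
  roots := by
    have := hq.roots; simp only [Heap.cut]; intro z h1 h2
    by_cases hy : z = x
    · exact Or.inr ⟨q.pn, by omega, by simp [hy]⟩
    · rcases this z h1 (by grind) with h | ⟨i, hi, h⟩
      · left; grind
      · right; exact ⟨i, by omega, by grind⟩
  count := hq.count

theorem Inv.count_trunc (hq : q.Inv n) {r : ℕ} (hst : q.st r = 1) (hr : 0 < q.H r) (i : ℕ) :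
    upd q.cnt (q.H r) (q.cnt (q.H r) - 1) i =
      #((q.items n).filter fun x => i ≤ upd q.H r (q.H r - 1) x) := by
  by_cases hi : i = q.H r
  · subst hi
    rw [upd_self, hq.count, card_filter_add_one (p := fun x => q.H r ≤ q.H x) (p' := fun x => q.H r ≤ upd q.H r (q.H r - 1) x)
      (hq.mem_items.2 hst) (fun y _ hy => by simp [hy]) le_rfl (by simp; omega)]
    simp
  · rw [upd_of_ne hi, hq.count]
    refine congrArg _ (filter_congr fun y _ => ?_)
    by_cases hy : y = r
    · subst hy; simp; omega
    · simp [hy]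

theorem Inv.truncHole (hq : q.Inv n) {i r : ℕ} (hi : i < q.pn) (hir : q.pl i = r) (hr : 0 < q.H r)
    (hh : q.ch r (q.H r) = 0) : (q.truncHole r).Inv n where
  lt := hq.lt
  child := by
    have := hq.child; have := hq.list i hi; have := hq.parent
    simp only [Heap.truncHole]
    intro x h c h1 h2 h3 h4
    have : h ≤ q.H x := by grind
    have := hq.child x h c h1 h2 this h4
    have : c ≠ r := by grind
    grind
  parent := by
    have := hq.list i hi; have := hq.parent
    simp only [Heap.truncHole]
    intro c x h1 h2
    have : c ≠ r := by grind
    grind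
  bucket := by have := hq.list i hi; have := hq.bucket; simp only [Heap.truncHole]; grind
  list := by
    have h1 := hq.list i hi; have h2 := hq.list; have h3 := hq.bucket; simp only [Heap.truncHole]
    intro j hj
    by_cases hjr : q.pl j = r
    -- The bucket of the new height cannot refer to `r`, since its content already had that height
    -- before.
    · have := h3 (q.H r - 1) r
      grind
    · grind
  list_inj := hq.list_inj
  roots := by
    have h1 := hq.list i hi; have := hq.roots; simp only [Heap.truncHole]
    grind
  count := hq.count_trunc (hir ▸ (hq.list i hi).1) hr

theorem Inv.truncChild (hq : q.Inv n) {i r c : ℕ} (hi : i < q.pn) (hir : q.pl i = r) (hr : 0 < q.H r)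
    (hh : q.ch r (q.H r) = c + 1) : (q.truncChild r c).Inv n := by
  have h1 := hq.list i hi
  have hc := hq.child r (q.H r) c (hir ▸ h1.1) hr le_rfl hh
  have hcr : c ≠ r := by grind
  exact {
  lt := hq.lt
  child := by
    have h2 := hq.child; have h3 := hq.parent
    simp only [Heap.truncChild]
    intro x h d hx h4 h5 h6
    have : h ≤ q.H x := by grind
    have h7 := h2 x h d hx h4 this h6
    have : d ≠ c := by grind
    have : d ≠ r := by grind
    grind
  parent := by
    have := hq.parent
    simp only [Heap.truncChild]
    intro d x h1 h2
    have : d ≠ c := by grind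
    have : d ≠ r := by grind
    grind
  bucket := by have := hq.bucket; simp only [Heap.truncChild]; grind
  list := by
    have h2 := hq.list; have h3 := hq.bucket; simp only [Heap.truncChild]
    intro j hj
    by_cases hjn : j = q.pn
    · subst hjn
      have := h3 (q.H c) c
      grind
    · by_cases hjr : q.pl j = r
      · have := h3 (q.H r - 1) r
        grind
      · grind
  list_inj := by have := hq.list_inj; have := hq.list; simp only [Heap.truncChild]; grind
  roots := by
    have := hq.roots; simp only [Heap.truncChild]; intro z h1 h2
    by_cases hy : z = c
    · exact Or.inr ⟨q.pn, by omega, by simp [hy]⟩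
    · rcases this z h1 (by grind) with h | ⟨j, hj, h⟩
      · left; grind
      · right; exact ⟨j, by omega, by grind⟩
  count := hq.count_trunc (hir ▸ h1.1) hr }

/-- A root of height 0 has neither parent nor children, so no other item refers to it. The last
entry of the list fills the gap. -/
theorem Inv.delete (hq : q.Inv n) {i : ℕ} (hi : i < q.pn) (h0 : q.H (q.pl i) = 0) :
    (q.delete i).Inv n := by
  have h1 := hq.list i hi
  exact {
  lt := by have := hq.lt; simp only [Heap.delete]; grind
  child := by
    have := hq.child; simp only [Heap.delete]
    intro x h c hx h2 h3 h4
    have : x ≠ q.pl i := by grind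
    have := hq.child x h c (by grind) h2 h3 h4
    have : c ≠ q.pl i := by grind
    grind
  parent := by
    have := hq.parent; simp only [Heap.delete]
    intro c x hc hp
    have : c ≠ q.pl i := by grind
    have := hq.parent c x (by grind) hp
    have : x ≠ q.pl i := by grind
    grind
  bucket := by have := hq.bucket; simp only [Heap.delete]; grind
  list := by
    have := hq.list; have := hq.list_inj; simp only [Heap.delete]
    intro j hj
    by_cases hji : j = i
    · subst hji
      have := hq.list (q.pn - 1) (by omega)
      have : q.pl (q.pn - 1) ≠ q.pl j := fun h => by
        have := hq.list_inj _ (by omega) _ hi h; omega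
      grind
    · have := hq.list j (by omega)
      have : q.pl j ≠ q.pl i := fun h => hji (hq.list_inj _ (by omega) _ hi h)
      grind
  list_inj := by
    have h2 := hq.list_inj; simp only [Heap.delete]
    intro j hj l hl
    have := h2 j (by omega) l (by omega)
    have := h2 (q.pn - 1) (by omega) l (by omega)
    have := h2 j (by omega) (q.pn - 1) (by omega)
    grind
  roots := by
    have := hq.roots; simp only [Heap.delete]; intro z h1 h2
    have hz : z ≠ q.pl i := by grind
    rcases this z (by grind) h2 with h | ⟨j, hj, h⟩
    · left; grind
    · right
      by_cases hjn : j = q.pn - 1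
      · refine ⟨i, ?_, by grind⟩
        have : i ≠ q.pn - 1 := by grind
        omega
      · exact ⟨j, by omega, by grind⟩
  count := by
    intro j
    have hm : q.pl i ∈ q.items n := hq.mem_items.2 h1.1
    rw [items_delete, filter_erase]
    by_cases hj : j = 0
    · subst hj
      rw [card_erase_of_mem (by simp [hm])]
      simp [Heap.delete, hq.count]
    · rw [erase_eq_of_notMem (fun h => by have := (mem_filter.1 h).2; simp only [Heap.delete] at this; omega)]
      simp [Heap.delete, hq.count, hj] }

theorem Inv.store (hq : q.Inv n) (hpn : 0 < q.pn) (hb : q.bk (q.H (q.pl (q.pn - 1))) = 0) :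
    q.store.Inv n := by
  have h1 := hq.list (q.pn - 1) (by omega)
  exact {
  lt := hq.lt
  child := hq.child
  parent := hq.parent
  bucket := by have := hq.bucket; simp only [Heap.store]; grind
  list := by
    simp only [Heap.store]; intro i hi
    have h2 := hq.list i (by omega)
    have := fun h => hq.list_inj i (by omega) (q.pn - 1) (by omega) h
    grind
  list_inj := by have := hq.list_inj; simp only [Heap.store]; grind
  roots := by
    simp only [Heap.store]; intro x hx hp
    by_cases hxr : x = q.pl (q.pn - 1)
    · left; subst hxr; simp
    · rcases hq.roots x hx hp with h | ⟨j, hj, h⟩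
      · left; grind
      · right; refine ⟨j, ?_, h⟩
        have : j ≠ q.pn - 1 := by grind
        omega
  count := hq.count }

theorem Inv.unstore (hq : q.Inv n) {h : ℕ} (hb : q.bk h ≠ 0) : (q.unstore h).Inv n := by
  have h1 := hq.bucket h (q.bk h - 1) (by omega)
  exact {
  lt := hq.lt
  child := hq.child
  parent := hq.parent
  bucket := by have := hq.bucket; simp only [Heap.unstore]; grind
  list := by
    simp only [Heap.unstore]; intro i hi
    have h2 := hq.list i
    by_cases hin : i = q.pn
    · subst hin; simp [h1]
    · have := h2 (by omega); grind
  list_inj := by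
    have h2 := hq.list_inj; have h3 := hq.list; simp only [Heap.unstore]
    intro i hi j hj
    have h4 := h2 i; have h5 := h2 j; have h6 := h3 i; have h7 := h3 j
    by_cases hin : i = q.pn <;> by_cases hjn : j = q.pn <;> grind
  roots := by
    simp only [Heap.unstore]; intro x hx hp
    rcases hq.roots x hx hp with h' | ⟨j, hj, h'⟩
    · by_cases hh : q.H x = h
      · right; exact ⟨q.pn, by omega, by subst hh; simp [h']⟩
      · left; simpa [hh] using h'
    · right; exact ⟨j, by omega, by grind⟩
  count := hq.count }

/-- Both roots have the height `h`, so the new child sits exactly where the invariant wants it. The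
winner takes the last place of the list, whichever of the two was there before. -/
theorem Inv.link (hq : q.Inv n) {h w l : ℕ} (hpn : 0 < q.pn)
    (hh : q.H (q.pl (q.pn - 1)) = h) (hb : q.bk h ≠ 0)
    (hwl : (w = q.pl (q.pn - 1) ∧ l = q.bk h - 1) ∨ (l = q.pl (q.pn - 1) ∧ w = q.bk h - 1))
    (hk : q.key w ≤ q.key l) : (q.link h w l).Inv n := by
  have h1 := hq.list (q.pn - 1) (by omega)
  have h2 := hq.bucket h (q.bk h - 1) (by omega)
  have hne : w ≠ l := by grind
  have hw : q.st w = 1 ∧ q.pa w = 0 ∧ q.H w = h := by grind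
  have hl : q.st l = 1 ∧ q.pa l = 0 ∧ q.H l = h := by grind
  exact {
  lt := hq.lt
  child := by
    simp only [Heap.link]
    intro x i c hx hi hi' hc
    by_cases hxw : x = w
    · subst hxw
      by_cases hih : i = h + 1
      · subst hih; simp [upd2_apply] at hc; subst hc; grind
      · have := hq.child x i c hx hi (by simp at hi'; omega) (by simpa [hih, upd2_apply] using hc)
        grind
    · have := hq.child x i c hx hi (by simpa [hxw] using hi') (by simpa [hxw, upd2_apply] using hc)
      grind
  parent := by
    simp only [Heap.link]
    intro c x hc hx
    by_cases hcl : c = l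
    · subst hcl; grind
    · have h3 := hq.parent c x hc (by simpa [hcl] using hx)
      have : c ≠ w := by grind
      by_cases hxw : x = w
      · subst hxw; grind
      · grind
  bucket := by
    simp only [Heap.link]; intro i x hx
    have h3 := hq.bucket i x
    grind
  list := by
    simp only [Heap.link]; intro i hi
    have h3 := hq.list i hi
    have h4 := hq.list_inj i hi (q.pn - 1) (by omega)
    have h5 := hq.bucket (h + 1) w
    grind
  list_inj := by
    simp only [Heap.link]; intro i hi j hj
    have h3 := hq.list_inj i hi j hj
    have h4 := hq.list_inj i hi (q.pn - 1) (by omega)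
    have h5 := hq.list_inj j hj (q.pn - 1) (by omega)
    have h6 := hq.list i hi; have h7 := hq.list j hj
    grind
  roots := by
    simp only [Heap.link]; intro x hx hp
    by_cases hxw : x = w
    · right; exact ⟨q.pn - 1, by omega, by simp [hxw]⟩
    · have hxl : x ≠ l := by rintro rfl; simp at hp
      rcases hq.roots x hx (by simpa [hxl] using hp) with h' | ⟨j, hj, h'⟩
      · left; grind
      · right; refine ⟨j, hj, ?_⟩
        grind
  count := by
    intro i
    by_cases hi : i = h + 1
    · subst hi
      simp only [Heap.link, upd_self]
      rw [hq.count]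
      exact (card_filter_add_one (p := fun x => h + 1 ≤ upd q.H w (h + 1) x)
        (hq.mem_items.2 hw.1) (fun y _ hy => by simp [hy]) (by simp) (by omega)).symm
    · simp only [Heap.link, upd_of_ne hi]
      rw [hq.count]
      refine congrArg _ (filter_congr fun y _ => ?_)
      by_cases hy : y = w
      · subst hy; simp; omega
      · simp [hy] }

/-! ### Potentials -/

theorem trees_push (hq : q.Inv n) {x : ℕ} (κ : ℝ) (hx : x < n) (hst : q.st x ≠ 1) :
    (q.push x κ).trees n = q.trees n + 1 := by
  have hx' : x ∉ q.items n := by simpa [hq.mem_items] using hst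
  unfold trees
  rw [items_push hx, filter_insert, if_pos (by simp [push]), card_insert_of_notMem (by simp [hx'])]
  refine congrArg (· + 1) (congrArg _ (filter_congr fun y hy => ?_))
  have : y ≠ x := by rintro rfl; exact hx' hy
  simp [Heap.push, this]

theorem holes_push (hq : q.Inv n) {x : ℕ} (κ : ℝ) (hx : x < n) (hst : q.st x ≠ 1) (i : ℕ) :
    (q.push x κ).holes n i = q.holes n i := by
  have hx' : x ∉ q.items n := by simpa [hq.mem_items] using hst
  unfold holes
  rw [items_push hx, sum_insert hx']
  have : #((Ioc i ((q.push x κ).H x)).filter fun h => (q.push x κ).ch x h = 0) = 0 := by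
    simp [push]
  rw [this, zero_add]
  refine sum_congr rfl fun y hy => ?_
  have : y ≠ x := by rintro rfl; exact hx' hy
  simp [Heap.push, this]

theorem trees_cut (hq : q.Inv n) {x y : ℕ} {κ : ℝ} (hst : q.st x = 1) (hpa : q.pa x = y + 1) :
    (q.cut x y κ).trees n = q.trees n + 1 :=
  card_filter_add_one (hq.mem_items.2 hst) (fun z _ hz => by simp [cut, hz]) (by simp [cut])
    (by omega)

theorem holes_cut (hq : q.Inv n) {x y : ℕ} {κ : ℝ} (hst : q.st x = 1) (hpa : q.pa x = y + 1) :
    (q.cut x y κ).holes n 0 ≤ q.holes n 0 + 1 := by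
  have hy := hq.parent x y hst hpa
  have h1 := sum_add_swap (x := y) (s := q.items n)
    (f := fun z => #((Ioc 0 (q.H z)).filter fun h => upd2 q.ch y (q.H x + 1) 0 z h = 0))
    (g := fun z => #((Ioc 0 (q.H z)).filter fun h => q.ch z h = 0)) (hq.mem_items.2 hy.1)
    (fun z _ hz => by simp [upd2_apply, hz])
  have h2 : #((Ioc 0 (q.H y)).filter fun h => upd2 q.ch y (q.H x + 1) 0 y h = 0)
      = #((Ioc 0 (q.H y)).filter fun h => q.ch y h = 0) + 1 :=
    card_filter_add_one (x := q.H x + 1) (by simp; omega)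
      (fun z _ hz => by simp [upd2_apply, hz]) (by simp [upd2_apply]) (by omega)
  have h3 : (q.cut x y κ).holes n 0 = ∑ z ∈ q.items n,
    #((Ioc 0 (q.H z)).filter fun h => upd2 q.ch y (q.H x + 1) 0 z h = 0) := rfl
  have h4 : q.holes n 0 = ∑ z ∈ q.items n, #((Ioc 0 (q.H z)).filter fun h => q.ch z h = 0) := rfl
  omega

/-- The upmost node of a root carries a hole precisely if its child is missing. The new heap enters
only through three components, so that the lemma serves both kinds of truncation. -/
theorem holes_trunc (hq : q.Inv n) {r i : ℕ} {q' : Heap} (hst : q.st r = 1) (hi : i < q.H r)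
    (hst' : q'.st = q.st) (hch : q'.ch = q.ch) (hH : q'.H = upd q.H r (q.H r - 1)) :
    q'.holes n i + (if q.ch r (q.H r) = 0 then 1 else 0) = q.holes n i := by
  have h1 := sum_add_swap (x := r) (s := q.items n)
    (f := fun z => #((Ioc i (q.H z)).filter fun h => q.ch z h = 0))
    (g := fun z => #((Ioc i (upd q.H r (q.H r - 1) z)).filter fun h => q.ch z h = 0))
    (hq.mem_items.2 hst) (fun z _ hz => by simp [hz])
  rw [upd_self] at h1
  have h2 : Ioc i (q.H r) = insert (q.H r) (Ioc i (q.H r - 1)) := by ext; simp; omega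
  rw [h2, filter_insert] at h1
  have h3 : q'.holes n i = ∑ y ∈ q.items n, #((Ioc i (upd q.H r (q.H r - 1) y)).filter fun h => q.ch y h = 0) := by
    simp only [holes, items, hst', hch, hH]
  rw [h3]
  have h4 : q.holes n i = ∑ z ∈ q.items n, #((Ioc i (q.H z)).filter fun h => q.ch z h = 0) := rfl
  split_ifs at h1 ⊢ with h
  · rw [card_insert_of_notMem (by simp; omega)] at h1; omega
  · omega

theorem trees_truncChild (hq : q.Inv n) {i r c : ℕ} (hi : i < q.pn) (hir : q.pl i = r)
    (hr : 0 < q.H r) (hh : q.ch r (q.H r) = c + 1) :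
    (q.truncChild r c).trees n = q.trees n + 1 := by
  have hc := hq.child r (q.H r) c (hir ▸ (hq.list i hi).1) hr le_rfl hh
  exact card_filter_add_one (x := c) (hq.mem_items.2 hc.1) (fun z _ hz => by simp [truncChild, hz])
    (by simp [truncChild]) (by omega)

/-- The freed child, of height `q.H r - 1`, is the only item that ceases to be beaten. The root `r`
was not counted before, so its loss of height does not matter. -/
theorem beaten_truncChild (hq : q.Inv n) {i j r c : ℕ} (hi : i < q.pn) (hir : q.pl i = r)
    (hr : j < q.H r) (hh : q.ch r (q.H r) = c + 1) :
    (q.truncChild r c).beaten n j + 1 = q.beaten n j := by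
  have h1 := hq.list i hi
  have hc := hq.child r (q.H r) c (hir ▸ h1.1) (by omega) le_rfl hh
  refine (card_filter_add_one (x := c) (hq.mem_items.2 hc.1) (fun z _ hz => ?_) ?_ ?_).symm
  · simp only [truncChild]
    by_cases hzr : z = r
    · subst hzr; subst hir; simp [h1.2.1, hz]
    · simp [hz, hzr]
  · omega
  · simp [truncChild]

theorem beaten_truncHole {i j r : ℕ} (hq : q.Inv n) (hi : i < q.pn) (hir : q.pl i = r) :
    (q.truncHole r).beaten n j = q.beaten n j := by
  have h1 := hq.list i hi
  refine congrArg _ (filter_congr fun z _ => ?_)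
  simp only [truncHole]
  by_cases hzr : z = r
  · subst hzr; subst hir; simp [h1.2.1]
  · simp [hzr]

theorem trees_delete (hq : q.Inv n) {i : ℕ} (hi : i < q.pn) :
    (q.delete i).trees n + 1 = q.trees n := by
  have h1 := hq.list i hi
  have hm : q.pl i ∈ (q.items n).filter fun x => q.pa x = 0 := by
    simp [hq.mem_items, h1.1, h1.2.1]
  have h2 : (q.delete i).trees n = #(((q.items n).erase (q.pl i)).filter fun x => q.pa x = 0) := by
    rw [← items_delete]; rfl
  rw [h2, filter_erase, card_erase_of_mem hm]
  have := card_pos.2 ⟨_, hm⟩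
  unfold trees
  omega

theorem holes_delete {i j : ℕ} : (q.delete i).holes n j ≤ q.holes n j := by
  unfold holes
  rw [items_delete]
  exact sum_le_sum_of_subset (erase_subset _ _)

theorem trees_link (hq : q.Inv n) {h w l : ℕ} (hl : q.st l = 1) (hpa : q.pa l = 0) :
    (q.link h w l).trees n + 1 = q.trees n :=
  (card_filter_add_one (x := l) (hq.mem_items.2 hl) (fun z _ hz => by simp [link, hz]) hpa
    (by simp [link])).symm

/-- The only new node comes with a child. -/
theorem holes_link {h w l : ℕ} (hw : q.H w = h) : (q.link h w l).holes n 0 = q.holes n 0 := by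
  refine sum_congr rfl fun z _ => ?_
  change #((Ioc 0 (upd q.H w (h + 1) z)).filter fun i => upd2 q.ch w (h + 1) (l + 1) z i = 0) = _
  by_cases hzw : z = w
  · subst hzw
    have h2 : Ioc 0 (h + 1) = insert (h + 1) (Ioc 0 h) := by ext; simp; omega
    rw [upd_self, h2, filter_insert, if_neg (by simp [upd2_apply]), hw]
    refine congrArg _ (filter_congr fun y hy => ?_)
    have : y ≠ h + 1 := by simp at hy; omega
    simp [upd2_apply, this]
  · simp [upd2_apply, hzw]

/-! ### Heights -/

theorem Inv.count_le (hq : q.Inv n) (i : ℕ) : q.cnt i ≤ n := by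
  rw [hq.count]
  refine (card_le_card (filter_subset _ _)).trans ?_
  exact (card_le_card (filter_subset _ _)).trans (by simp)

theorem Inv.count_pos (hq : q.Inv n) {i : ℕ} : 0 < q.cnt i ↔ ∃ x, q.st x = 1 ∧ i ≤ q.H x := by
  rw [hq.count, card_pos]
  simp [Finset.Nonempty, hq.mem_items]

/-- The numbers of the nodes of each height decrease fast. -/
def Balanced (q : Heap) : Prop := ∀ i, 4 * q.cnt (i + 1) ≤ 3 * q.cnt i

theorem pow_mul_count_le {m : ℕ} (hb : ∀ i < m, 4 * q.cnt (i + 1) ≤ 3 * q.cnt i) :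
    4 ^ m * q.cnt m ≤ 3 ^ m * q.cnt 0 := by
  induction m with
  | zero => simp
  | succ i ih =>
    calc 4 ^ (i + 1) * q.cnt (i + 1) = 4 ^ i * (4 * q.cnt (i + 1)) := by ring
      _ ≤ 4 ^ i * (3 * q.cnt i) := Nat.mul_le_mul_left _ (hb i (by omega))
      _ = 3 * (4 ^ i * q.cnt i) := by ring
      _ ≤ 3 * (3 ^ i * q.cnt 0) := Nat.mul_le_mul_left _ (ih fun j hj => hb j (by omega))
      _ = _ := by ring

/-- A bound for the heights in balanced heaps of `n` items. -/
def maxHeight (n : ℕ) : ℕ := 3 * Nat.log 2 n + 3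

/-- Balance gives (4/3)^m ≤ n, and (4/3)³ = 64/27 exceeds 2; this is the comparison of 54 with 64.
Balance is needed only below `m`, since the bound is also used in heaps whose balance has yet to be
restored. -/
theorem Inv.lt_maxHeight (hq : q.Inv n) {m : ℕ} (hb : ∀ i < m, 4 * q.cnt (i + 1) ≤ 3 * q.cnt i)
    (hm : 0 < q.cnt m) : m < maxHeight n := by
  by_contra hlt
  simp only [maxHeight, not_lt] at hlt
  have h1 := pow_mul_count_le hb
  have h2 : n < 2 ^ (Nat.log 2 n + 1) := Nat.lt_pow_succ_log_self (by norm_num) n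
  set l := Nat.log 2 n
  obtain ⟨d, rfl⟩ := Nat.exists_eq_add_of_le hlt
  have h3 : 4 ^ (3 * l + 3 + d) ≤ 3 ^ (3 * l + 3 + d) * n :=
    calc 4 ^ (3 * l + 3 + d) ≤ 4 ^ (3 * l + 3 + d) * q.cnt (3 * l + 3 + d) :=
          Nat.le_mul_of_pos_right _ hm
      _ ≤ _ := h1.trans (Nat.mul_le_mul_left _ (hq.count_le 0))
  have h4 : 3 ^ (3 * l + 3 + d) * n < 3 ^ (3 * l + 3 + d) * 2 ^ (l + 1) :=
    Nat.mul_lt_mul_of_pos_left h2 (by positivity)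
  have h5 : 3 ^ (3 * l + 3 + d) * 2 ^ (l + 1) = 54 ^ (l + 1) * 3 ^ d := by
    rw [show 3 * l + 3 + d = 3 * (l + 1) + d by ring, pow_add, pow_mul,
      show (54 : ℕ) = 3 ^ 3 * 2 by norm_num, mul_pow]
    ring
  have h6 : 4 ^ (3 * l + 3 + d) = 64 ^ (l + 1) * 4 ^ d := by
    rw [show 3 * l + 3 + d = 3 * (l + 1) + d by ring, pow_add, pow_mul]
    norm_num
  have h7 : 54 ^ (l + 1) * 3 ^ d ≤ 64 ^ (l + 1) * 4 ^ d :=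
    Nat.mul_le_mul (Nat.pow_le_pow_left (by norm_num) _) (Nat.pow_le_pow_left (by norm_num) _)
  omega

theorem Inv.height_lt (hq : q.Inv n) (hb : q.Balanced) {x : ℕ} (hx : q.st x = 1) :
    q.H x < maxHeight n :=
  hq.lt_maxHeight (fun i _ => hb i) (hq.count_pos.2 ⟨x, hx, le_rfl⟩)

theorem beaten_le_count (hq : q.Inv n) (i : ℕ) : q.beaten n i ≤ q.cnt i := by
  rw [hq.count]
  exact card_le_card fun x hx => by simp_all

/-- The nodes of height `i + 1` that have a child there inject into the items whose height is
exactly `i`, and the others are holes above `i`. The items of height exactly `i` make up the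
difference of the two counts. -/
theorem Inv.two_mul_count_le (hq : q.Inv n) (i : ℕ) :
    2 * q.cnt (i + 1) ≤ q.cnt i + q.holes n i := by
  have h1 : q.cnt (i + 1) = #((q.items n).filter fun x => i + 1 ≤ q.H x ∧ q.ch x (i + 1) = 0)
      + #((q.items n).filter fun x => i + 1 ≤ q.H x ∧ q.ch x (i + 1) ≠ 0) := by
    rw [hq.count, ← card_filter_add_card_filter_not (fun x => q.ch x (i + 1) = 0), filter_filter,
      filter_filter]
  have h2 : q.cnt i = q.cnt (i + 1) + #((q.items n).filter fun x => q.H x = i) := by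
    rw [hq.count, hq.count, ← card_filter_add_card_filter_not (fun x => i + 1 ≤ q.H x),
      filter_filter, filter_filter]
    congr 2 <;> (ext x; simp; omega)
  have h3 : #((q.items n).filter fun x => i + 1 ≤ q.H x ∧ q.ch x (i + 1) ≠ 0)
      ≤ #((q.items n).filter fun x => q.H x = i) := by
    have key : ∀ x, q.st x = 1 → i + 1 ≤ q.H x → q.ch x (i + 1) ≠ 0 →
        q.st (q.ch x (i + 1) - 1) = 1 ∧ q.H (q.ch x (i + 1) - 1) + 1 = i + 1 ∧
          q.pa (q.ch x (i + 1) - 1) = x + 1 := fun x hx hi hc =>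
      hq.child x (i + 1) _ hx (by omega) hi (by omega)
    refine card_le_card_of_injOn (fun x => q.ch x (i + 1) - 1) (fun x hx => ?_) fun x hx y hy h => ?_
    · simp only [coe_filter, Set.mem_ofPred_eq, hq.mem_items] at hx ⊢
      have := key x hx.1 hx.2.1 hx.2.2
      exact ⟨this.1, by omega⟩
    · simp only [coe_filter, Set.mem_ofPred_eq, hq.mem_items] at hx hy
      have h1 := key x hx.1 hx.2.1 hx.2.2
      have h2 := key y hy.1 hy.2.1 hy.2.2
      simp only at h
      rw [h] at h1
      omega
  have h4 : #((q.items n).filter fun x => i + 1 ≤ q.H x ∧ q.ch x (i + 1) = 0) ≤ q.holes n i := by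
    rw [card_filter]
    refine sum_le_sum fun x _ => ?_
    split_ifs with h
    · exact card_pos.2 ⟨i + 1, by simp; exact ⟨by omega, h.2⟩⟩
    · exact Nat.zero_le _
  omega

/-- Too many nodes of height `i + 1` force holes: with the previous inequality, the count at `i` is
below twice the number of holes. So the holes can pay for all the subtrees that a truncation at
height `i` sets free. -/
theorem Inv.beaten_le (hq : q.Inv n) {i : ℕ} (h : 3 * q.cnt i < 4 * q.cnt (i + 1)) :
    q.beaten n i ≤ 2 * q.holes n i := by
  have := hq.two_mul_count_le i
  have := beaten_le_count hq i
  omega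

theorem holes_eq_zero (hq : q.Inv n) {i : ℕ} (h : ∀ x, q.st x = 1 → q.H x ≤ i) :
    q.holes n i = 0 :=
  sum_eq_zero fun x hx => by simp [Ioc_eq_empty_of_le (h x (hq.mem_items.1 hx))]

theorem holes_anti (q : Heap) {i j : ℕ} (h : i ≤ j) : q.holes n j ≤ q.holes n i :=
  sum_le_sum fun _ _ => card_le_card (filter_subset_filter _ (Ioc_subset_Ioc_left h))

/-- A lower bound for the keys of the roots is a lower bound for all keys. -/
theorem Inv.le_key (hq : q.Inv n) (hbk : ∀ h, q.bk h = 0) {κ : ℝ}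
    (hκ : ∀ i < q.pn, κ ≤ q.key (q.pl i)) {y : ℕ} (hy : q.st y = 1) : κ ≤ q.key y := by
  -- Among the items with a key not above that of `y`, one of maximal height is a root: its parent
  -- would be higher and have no larger key.
  obtain ⟨x, hx, hmax⟩ := exists_max_image ((q.items n).filter fun x => q.key x ≤ q.key y) q.H
    ⟨y, by simp [hq.mem_items, hy]⟩
  simp only [mem_filter, hq.mem_items] at hx hmax
  rcases hpa : q.pa x with _ | z
  · rcases hq.roots x hx.1 hpa with h | ⟨i, hi, h⟩
    · simp [hbk] at h
    · exact (hκ i hi).trans (h ▸ hx.2)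
  · have h1 := hq.parent x z hx.1 hpa
    have := hmax z ⟨h1.1, h1.2.2.2.trans hx.2⟩
    omega

end Heap


/-! ## Heaps as programs -/

namespace Arr

/-- The arrays of the heap: row `0` of `hSt`, `hH`, `hPa`, `hBk`, `hPl`, `hCnt`, all of `hCh`, and
the scalar `hPn` hold the components of the heap; the others are scalars for intermediate results. -/
abbrev hSt : ℕ := 20
abbrev hH : ℕ := 21
abbrev hPa : ℕ := 22
abbrev hCh : ℕ := 23
abbrev hBk : ℕ := 24
abbrev hPl : ℕ := 25
abbrev hPn : ℕ := 26
abbrev hCnt : ℕ := 27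
abbrev tX : ℕ := 28
abbrev tH : ℕ := 29
abbrev tW : ℕ := 30
abbrev tL : ℕ := 31
abbrev tI : ℕ := 32
abbrev tBest : ℕ := 33
/-- An item, the source of its key, and the array of the sources of the keys of the items. -/
abbrev item : ℕ := 40
abbrev cur : ℕ := 41
abbrev src : ℕ := 42
/-- The keys of the items, and a new key (arrays of real numbers). -/
abbrev key : ℕ := 10
abbrev newKey : ℕ := 11

end Arr

/-- Set a variable. -/
abbrev Com.letN (a : ℕ) (e : NExp) : Com := .setN a (.lit 0) (.lit 0) e

/-- Set the cell `[0][c]` of an array. -/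
abbrev Com.setRow (a : ℕ) (c e : NExp) : Com := .setN a (.lit 0) c e

infixr:60 " ;; " => Com.seq

theorem frame_setN {P : ℕ → Prop} {σ τ : Mem} {b r c x : ℕ} (h : ∀ a, P a → τ.nat a = σ.nat a)
    (hb : ¬ P b) (a : ℕ) (ha : P a) : (τ.setN b r c x).nat a = σ.nat a := by
  rw [Mem.setN_nat_of_ne _ _ _ _ _ (by rintro rfl; exact hb ha), h a ha]

theorem Mem.setN_self (σ : Mem) (a r c : ℕ) : σ.setN a r c (σ.nat a r c) = σ := by
  have : setCell σ.nat a r c (σ.nat a r c) = σ.nat := by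
    funext a' r' c'; simp only [setCell]; split_ifs with h
    · obtain ⟨rfl, rfl, rfl⟩ := h; rfl
    · rfl
  simp only [Mem.setN, this]

@[simp] theorem Com.run_skip (σ : Mem) : Com.skip.run σ = σ := by
  simp [Com.skip, Com.run, NExp.eval, Mem.setN_self]

/-- The heap in the memory. -/
def heapOf (σ : Mem) : Heap where
  st := σ.nat Arr.hSt 0
  H := σ.nat Arr.hH 0
  pa := σ.nat Arr.hPa 0
  ch := σ.nat Arr.hCh
  bk := σ.nat Arr.hBk 0
  pl := σ.nat Arr.hPl 0
  pn := σ.nat Arr.hPn 0 0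
  cnt := σ.nat Arr.hCnt 0
  key := σ.real Arr.key 0

section heapOf

variable (σ : Mem)

@[simp] theorem heapOf_st : (heapOf σ).st = σ.nat Arr.hSt 0 := rfl
@[simp] theorem heapOf_H : (heapOf σ).H = σ.nat Arr.hH 0 := rfl
@[simp] theorem heapOf_pa : (heapOf σ).pa = σ.nat Arr.hPa 0 := rfl
@[simp] theorem heapOf_ch : (heapOf σ).ch = σ.nat Arr.hCh := rfl
@[simp] theorem heapOf_bk : (heapOf σ).bk = σ.nat Arr.hBk 0 := rfl
@[simp] theorem heapOf_pl : (heapOf σ).pl = σ.nat Arr.hPl 0 := rfl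
@[simp] theorem heapOf_pn : (heapOf σ).pn = σ.nat Arr.hPn 0 0 := rfl
@[simp] theorem heapOf_cnt : (heapOf σ).cnt = σ.nat Arr.hCnt 0 := rfl
@[simp] theorem heapOf_key : (heapOf σ).key = σ.real Arr.key 0 := rfl

end heapOf

/-- The parts of the memory that the heap does not use are unchanged. -/
structure HeapFrame (σ τ : Mem) : Prop where
  nat : ∀ a, a < 20 ∨ 40 ≤ a → τ.nat a = σ.nat a
  real : τ.real = σ.real

theorem HeapFrame.refl (σ : Mem) : HeapFrame σ σ := ⟨fun _ _ => rfl, rfl⟩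

theorem HeapFrame.trans {σ τ υ : Mem} (h : HeapFrame σ τ) (h' : HeapFrame τ υ) : HeapFrame σ υ :=
  ⟨fun a ha => (h'.nat a ha).trans (h.nat a ha), h'.real.trans h.real⟩

theorem HeapFrame.setN (σ : Mem) {a r c x : ℕ} (ha : 20 ≤ a ∧ a < 40) : HeapFrame σ (σ.setN a r c x) :=
  ⟨fun b hb => Mem.setN_nat_of_ne _ _ _ _ _ (by omega), rfl⟩

theorem HeapFrame.setN' {σ τ : Mem} (h : HeapFrame σ τ) {a r c x : ℕ} (ha : 20 ≤ a ∧ a < 40) :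
    HeapFrame σ (τ.setN a r c x) := h.trans (.setN τ ha)

/-! ### The potential of a heap, and truncation of roots -/

/-- The weights of a tree, of a root in the list, and of a missing child in the potential. -/
def treeWt : ℕ := 100
def listWt : ℕ := 40
def holeWt : ℕ := 400

/-- The potential of the heap, with an additional weight for the roots in the list. -/
def Heap.pot (n : ℕ) (e : ℕ) (q : Heap) : ℕ :=
  treeWt * q.trees n + (listWt + e) * q.pn + holeWt * q.holes n 0

/-- Remove the upmost node of the root `tX`. -/
def truncTop : Com :=
  .letN Arr.tH (.row Arr.hH (.var Arr.tX)) ;;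
  .setRow Arr.hCnt (.var Arr.tH) (.sub (.row Arr.hCnt (.var Arr.tH)) (.lit 1)) ;;
  .setRow Arr.hH (.var Arr.tX) (.sub (.var Arr.tH) (.lit 1)) ;;
  .branch (.lt (.lit 0) (.get Arr.hCh (.var Arr.tX) (.var Arr.tH)))
    (.setRow Arr.hPa (.sub (.get Arr.hCh (.var Arr.tX) (.var Arr.tH)) (.lit 1)) (.lit 0) ;;
     .setRow Arr.hPl (.var Arr.hPn) (.sub (.get Arr.hCh (.var Arr.tX) (.var Arr.tH)) (.lit 1)) ;;
     .letN Arr.hPn (.add (.var Arr.hPn) (.lit 1)))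
    .skip

/-- The last clause protects the scratch variables of the loops that use this code; only `tH` is
overwritten among them. -/
theorem truncTop_run (σ : Mem) :
    heapOf (truncTop.run σ) = (if (heapOf σ).ch (σ.nat Arr.tX 0 0) ((heapOf σ).H (σ.nat Arr.tX 0 0)) = 0
      then (heapOf σ).truncHole (σ.nat Arr.tX 0 0)
      else (heapOf σ).truncChild (σ.nat Arr.tX 0 0)
        ((heapOf σ).ch (σ.nat Arr.tX 0 0) ((heapOf σ).H (σ.nat Arr.tX 0 0)) - 1)) ∧
    HeapFrame σ (truncTop.run σ) ∧ (∀ a, 30 ≤ a ∨ a = 28 → (truncTop.run σ).nat a = σ.nat a) := by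
  simp only [truncTop, Com.run, NExp.eval, BExp.eval, Mem.setN_nat, Com.run_skip]
  by_cases h : σ.nat Arr.hCh (σ.nat Arr.tX 0 0) (σ.nat Arr.hH 0 (σ.nat Arr.tX 0 0)) = 0
  · simp [h]
    refine ⟨?_, ⟨?_, rfl⟩, ?_⟩
    · ext <;> simp [Heap.truncHole, Mem.setN_nat, upd_apply]
    all_goals repeat refine frame_setN ?_ (by decide)
    all_goals exact fun _ _ => rfl
  · simp [h, Nat.pos_iff_ne_zero]
    refine ⟨?_, ⟨?_, rfl⟩, ?_⟩
    · ext <;> simp [Heap.truncChild, Mem.setN_nat, upd_apply]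
    all_goals repeat refine frame_setN ?_ (by decide)
    all_goals exact fun _ _ => rfl

/-- What an operation that changes only the trees keeps. -/
structure HeapStep (n : ℕ) (σ τ : Mem) : Prop where
  inv : (heapOf τ).Inv n
  st : (heapOf τ).st = (heapOf σ).st
  frame : HeapFrame σ τ

/-- A truncation either uses up a hole or turns a beaten item into a new tree in the list. Holes are
recorded above `j` as well as above 0, since the potential counts all of them while the accounting
of a truncation at height `j` only uses those above `j`. -/
theorem Heap.trunc_step {n i r j : ℕ} {q q' : Heap} (hq : q.Inv n) (hi : i < q.pn) (hir : q.pl i = r)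
    (hj : j < q.H r) (hq' : q' = if q.ch r (q.H r) = 0 then q.truncHole r
      else q.truncChild r (q.ch r (q.H r) - 1)) :
    q'.Inv n ∧ q'.st = q.st ∧ q'.key = q.key ∧ q'.bk = q.bk ∧ q'.H = upd q.H r (q.H r - 1) ∧
    q.pn ≤ q'.pn ∧ (∀ l < q.pn, q'.pl l = q.pl l) ∧ (∀ l ≤ j, q'.cnt l = q.cnt l) ∧
    (q'.trees n = q.trees n ∧ q'.pn = q.pn ∧ q'.beaten n j = q.beaten n j ∧
        q'.holes n j + 1 = q.holes n j ∧ q'.holes n 0 + 1 = q.holes n 0 ∨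
      q'.trees n = q.trees n + 1 ∧ q'.pn = q.pn + 1 ∧ q'.beaten n j + 1 = q.beaten n j ∧
        q'.holes n j = q.holes n j ∧ q'.holes n 0 = q.holes n 0) := by
  have hst : q.st r = 1 := hir ▸ (hq.list i hi).1
  subst hq'
  split_ifs with h
  · refine ⟨hq.truncHole hi hir (by omega) h, rfl, rfl, rfl, rfl, le_rfl, fun _ _ => rfl,
      fun l hl => upd_of_ne (by omega), .inl ⟨rfl, rfl, Heap.beaten_truncHole hq hi hir, ?_, ?_⟩⟩
    · simpa [h] using Heap.holes_trunc (q' := q.truncHole r) hq hst hj rfl rfl rfl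
    · simpa [h] using Heap.holes_trunc (q' := q.truncHole r) hq hst (Nat.zero_lt_of_lt hj) rfl rfl rfl
  · obtain ⟨c, hc⟩ := Nat.exists_eq_succ_of_ne_zero h
    rw [hc, Nat.succ_eq_add_one, Nat.add_sub_cancel]
    refine ⟨hq.truncChild hi hir (by omega) hc, rfl, rfl, rfl, rfl, Nat.le_succ _,
      fun l hl => upd_of_ne (by omega), fun l hl => upd_of_ne (by omega),
      .inr ⟨Heap.trees_truncChild hq hi hir (by omega) hc, rfl, Heap.beaten_truncChild hq hi hir hj hc,
        ?_, ?_⟩⟩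
    · simpa [h] using Heap.holes_trunc (q' := q.truncChild r c) hq hst hj rfl rfl rfl
    · simpa [h] using Heap.holes_trunc (q' := q.truncChild r c) hq hst (Nat.zero_lt_of_lt hj) rfl rfl rfl

/-! ### Deletion of the minimum -/

/-- Find the number `tBest` of the root with the smallest key. -/
def heapScan : Com :=
  .letN Arr.tBest (.lit 0) ;;
  .letN Arr.tI (.lit 1) ;;
  .loop (.lt (.var Arr.tI) (.var Arr.hPn))
    (.branch (.le (.get Arr.key (.lit 0) (.row Arr.hPl (.var Arr.tI)))
        (.get Arr.key (.lit 0) (.row Arr.hPl (.var Arr.tBest))))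
      (.letN Arr.tBest (.var Arr.tI)) .skip ;;
    .letN Arr.tI (.add (.var Arr.tI) (.lit 1)))

/-- The scan takes at most 8 steps for each root in the list, which is the additional list weight
that it consumes. All roots are in the list because the buckets are empty, and the smallest key of a
root is the smallest key of all. -/
theorem wp_heapScan {n d e c : ℕ} {σ : Mem} (hq : (heapOf σ).Inv n) (hbk : ∀ h, (heapOf σ).bk h = 0)
    (hpn : 0 < (heapOf σ).pn) (hc : (heapOf σ).pot n (e + 8) + d + 4 ≤ c) :
    Wp heapScan (fun c τ => (heapOf τ).pot n e + d ≤ c ∧ heapOf τ = heapOf σ ∧ HeapFrame σ τ ∧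
      τ.nat Arr.tBest 0 0 < (heapOf σ).pn ∧
      ∀ y, (heapOf σ).st y = 1 →
        (heapOf σ).key ((heapOf σ).pl (τ.nat Arr.tBest 0 0)) ≤ (heapOf σ).key y) c σ := by
  have hpot : (heapOf σ).pot n (e + 8) = (heapOf σ).pot n e + 8 * (heapOf σ).pn := by
    simp only [Heap.pot]; ring
  refine .seq (.straight rfl (c - 1) (by simp only [Com.cost]; omega) ?_)
  refine .seq (.straight rfl (c - 2) (by simp only [Com.cost]; omega) ?_)
  refine .loop (fun c τ => ∃ i, τ.nat Arr.tI 0 0 = i ∧ 1 ≤ i ∧ i ≤ (heapOf σ).pn ∧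
    (heapOf σ).pot n e + 8 * ((heapOf σ).pn - i) + d + 1 ≤ c ∧ heapOf τ = heapOf σ ∧ HeapFrame σ τ ∧
    τ.nat Arr.tBest 0 0 < (heapOf σ).pn ∧
    ∀ l < i, (heapOf σ).key ((heapOf σ).pl (τ.nat Arr.tBest 0 0)) ≤
      (heapOf σ).key ((heapOf σ).pl l)) ⟨1, ?_⟩ ?_
  · have h1 : heapOf ((Com.letN Arr.tI (.lit 1)).run ((Com.letN Arr.tBest (.lit 0)).run σ)) = heapOf σ := by
      ext <;> simp [Com.run, NExp.eval, Mem.setN_nat]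
    refine ⟨by simp [Com.run, NExp.eval, Mem.setN_nat], le_rfl, hpn, by omega, h1, ⟨?_, rfl⟩,
      by simpa [Com.run, NExp.eval, Mem.setN_nat] using hpn, ?_⟩
    · simp only [Com.run]
      repeat refine frame_setN ?_ (by decide)
      exact fun _ _ => rfl
    · intro l hl
      obtain rfl : l = 0 := by omega
      simp [Com.run, NExp.eval, Mem.setN_nat]
  · rintro c τ ⟨i, hi, h1, hin, hc, hh, hf, hb, hle⟩
    have hpn' : τ.nat Arr.hPn 0 0 = (heapOf σ).pn := by rw [← hh]; rfl
    refine ⟨c - 1, by omega, fun hlt => ?_, fun hlt => ?_⟩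
    · simp only [BExp.eval, NExp.eval, hi, hpn'] at hlt
      refine .straight rfl (c - 8) (by simp only [Com.cost, Com.skip]; omega) ⟨i + 1, ?_⟩
      have e1 : ∀ m, τ.real Arr.key 0 (τ.nat Arr.hPl 0 m) = (heapOf σ).key ((heapOf σ).pl m) := by
        intro m; rw [← hh]; rfl
      simp only [Com.run, NExp.eval, BExp.eval, RExp.eval, Com.run_skip, hi, e1]
      split_ifs with hkey
      · have h2 : heapOf ((τ.setN Arr.tBest 0 0 i).setN Arr.tI 0 0
            ((τ.setN Arr.tBest 0 0 i).nat Arr.tI 0 0 + 1)) = heapOf σ := by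
          rw [← hh]; ext <;> simp [Mem.setN_nat]
        refine ⟨by simp [Mem.setN_nat, hi], by omega, hlt, by omega, h2, ⟨?_, hf.real⟩,
          by simpa [Mem.setN_nat] using hlt, ?_⟩
        · repeat refine frame_setN ?_ (by decide)
          exact hf.nat
        · intro l hl
          simp only [Mem.setN_nat]
          rcases Nat.lt_succ_iff_lt_or_eq.1 hl with h | rfl
          · simpa using hkey.trans (hle l h)
          · simp
      · have h2 : heapOf (τ.setN Arr.tI 0 0 (τ.nat Arr.tI 0 0 + 1)) = heapOf σ := by
          rw [← hh]; ext <;> simp [Mem.setN_nat]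
        refine ⟨by simp [Mem.setN_nat, hi], by omega, hlt, by omega, by simpa [hi] using h2,
          ⟨?_, hf.real⟩, by simpa [Mem.setN_nat] using hb, ?_⟩
        · repeat refine frame_setN ?_ (by decide)
          exact hf.nat
        · intro l hl
          simp only [Mem.setN_nat]
          rcases Nat.lt_succ_iff_lt_or_eq.1 hl with h | rfl
          · simpa using hle l h
          · simpa using (not_le.1 hkey).le
    · simp only [BExp.eval, NExp.eval, hi, hpn'] at hlt
      obtain rfl : i = (heapOf σ).pn := by omega
      exact ⟨by rw [hh]; omega, hh, hf, hb, fun y hy => hq.le_key hbk hle hy⟩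

/-- Delete the root number `tBest`. -/
def heapDelete : Com :=
  .letN Arr.tX (.row Arr.hPl (.var Arr.tBest)) ;;
  .loop (.lt (.lit 0) (.row Arr.hH (.var Arr.tX))) truncTop ;;
  .letN Arr.hPn (.sub (.var Arr.hPn) (.lit 1)) ;;
  .setRow Arr.hPl (.var Arr.tBest) (.row Arr.hPl (.var Arr.hPn)) ;;
  .setRow Arr.hSt (.var Arr.tX) (.lit 2) ;;
  .setRow Arr.hCnt (.lit 0) (.sub (.row Arr.hCnt (.lit 0)) (.lit 1))

/-- The root is stripped level by level until it has height 0. Each level adds at most one tree and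
one list entry, a potential of 140; with the steps of the loop this stays below 170 per level. -/
theorem wp_heapDelete {n d c b x : ℕ} {σ : Mem} (hq : (heapOf σ).Inv n)
    (hbk : ∀ h, (heapOf σ).bk h = 0) (hb : ∀ y, (heapOf σ).st y = 1 → (heapOf σ).H y ≤ b)
    (hbest : σ.nat Arr.tBest 0 0 < (heapOf σ).pn) (hx : (heapOf σ).pl (σ.nat Arr.tBest 0 0) = x)
    (hc : (heapOf σ).pot n 0 + 170 * b + d + 10 ≤ c) :
    Wp heapDelete (fun c τ => (heapOf τ).pot n 0 + d ≤ c ∧ (heapOf τ).Inv n ∧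
      (heapOf τ).st = upd (heapOf σ).st x 2 ∧ (∀ h, (heapOf τ).bk h = 0) ∧
      (∀ y, (heapOf τ).st y = 1 → (heapOf τ).H y ≤ b) ∧ HeapFrame σ τ) c σ := by
  have hx1 : (heapOf σ).st x = 1 := hx ▸ (hq.list _ hbest).1
  refine .seq (.straight rfl (c - 1) (by simp only [Com.cost]; omega) ?_)
  have h0 : heapOf ((Com.letN Arr.tX (.row Arr.hPl (.var Arr.tBest))).run σ) = heapOf σ := by
    ext <;> simp [Com.run, NExp.eval, Mem.setN_nat]
  refine .seq (.loop (fun c τ => (heapOf τ).pot n 0 + 170 * (heapOf τ).H x + d + 8 ≤ c ∧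
    (heapOf τ).Inv n ∧ (heapOf τ).st = (heapOf σ).st ∧ (∀ h, (heapOf τ).bk h = 0) ∧
    (∀ y, (heapOf τ).st y = 1 → (heapOf τ).H y ≤ b) ∧ HeapFrame σ τ ∧
    τ.nat Arr.tBest 0 0 < (heapOf τ).pn ∧ (heapOf τ).pl (τ.nat Arr.tBest 0 0) = x ∧
    τ.nat Arr.tX 0 0 = x) ?_ ?_)
  · have := hb x hx1
    rw [h0]
    refine ⟨by omega, hq, rfl, hbk, hb, ⟨?_, rfl⟩, ?_, ?_, ?_⟩
    · simp only [Com.run]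
      repeat refine frame_setN ?_ (by decide)
      exact fun _ _ => rfl
    · simpa [Com.run, NExp.eval, Mem.setN_nat] using hbest
    · simpa [Com.run, NExp.eval, Mem.setN_nat] using hx
    · simpa [Com.run, NExp.eval, Mem.setN_nat] using hx
  · rintro c τ ⟨hc, hq, hst, hbk, hb, hf, hbest, hx, htx⟩
    refine ⟨c - 1, by omega, fun hlt => ?_, fun hlt => ?_⟩
    · simp only [BExp.eval, NExp.eval, htx] at hlt
      obtain ⟨hrun, hf', hkeep⟩ := truncTop_run τ
      rw [htx] at hrun
      obtain ⟨i1, i2, i3, i4, i5, i6, i7, i8, i9⟩ := Heap.trunc_step (j := 0) hq hbest hx hlt hrun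
      have ecost : truncTop.cost = 8 := rfl
      have hpos : 0 < (heapOf τ).H x := hlt
      refine .straight rfl (c - 10) (by omega) ⟨?_, i1, i2.trans hst, by rw [i4]; exact hbk, ?_,
        hf.trans hf', ?_, ?_, ?_⟩
      · rw [i5, upd_self]
        simp only [Heap.pot, treeWt, listWt, holeWt] at hc ⊢
        have : 170 * (heapOf τ).H x = 170 * ((heapOf τ).H x - 1) + 170 := by omega
        omega
      · intro y hy
        rw [i2] at hy
        have := hb y hy
        rw [i5, upd_apply]; split_ifs
        · subst y; omega
        · omega
      · rw [hkeep _ (by decide)]; omega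
      · rw [hkeep _ (by decide), i7 _ hbest]; exact hx
      · rw [hkeep _ (by decide)]; exact htx
    · simp only [BExp.eval, NExp.eval, htx, not_lt, Nat.le_zero] at hlt
      have hH0 : (heapOf τ).H ((heapOf τ).pl (τ.nat Arr.tBest 0 0)) = 0 := by rw [hx]; exact hlt
      have hpl : τ.nat Arr.hPl 0 (τ.nat Arr.tBest 0 0) = x := hx
      refine .straight rfl (c - 1 - 4) (by simp only [Com.cost]; omega) ?_
      have hrun : heapOf (Com.run (.letN Arr.hPn (.sub (.var Arr.hPn) (.lit 1)) ;;
          .setRow Arr.hPl (.var Arr.tBest) (.row Arr.hPl (.var Arr.hPn)) ;;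
          .setRow Arr.hSt (.var Arr.tX) (.lit 2) ;;
          .setRow Arr.hCnt (.lit 0) (.sub (.row Arr.hCnt (.lit 0)) (.lit 1))) τ)
          = (heapOf τ).delete (τ.nat Arr.tBest 0 0) := by
        ext <;> simp [Com.run, NExp.eval, Mem.setN_nat, Heap.delete, upd_apply, hpl, htx]
      rw [hrun]
      have t1 := Heap.trees_delete hq hbest
      have t2 := Heap.holes_delete (n := n) (q := heapOf τ) (i := τ.nat Arr.tBest 0 0) (j := 0)
      refine ⟨?_, hq.delete hbest hH0, ?_, hbk, ?_, ⟨?_, ?_⟩⟩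
      · have : ((heapOf τ).delete (τ.nat Arr.tBest 0 0)).pn = (heapOf τ).pn - 1 := rfl
        simp only [Heap.pot, treeWt, listWt, holeWt] at hc ⊢
        omega
      · rw [← hst, ← hx]; rfl
      · intro y hy
        have hy' : upd (heapOf τ).st ((heapOf τ).pl (τ.nat Arr.tBest 0 0)) 2 y = 1 := hy
        rw [upd_apply] at hy'
        split_ifs at hy' with h
        · simp at hy'
        · exact hb y hy'
      · simp only [Com.run]
        repeat refine frame_setN ?_ (by decide)
        exact hf.nat
      · exact hf.real

/-- The term 75·b is a reserve for the later pass over the buckets. Storing a root frees its list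
weight 40; linking frees a tree of weight 100, of which 75 go to the possibly larger height bound.
In both cases at least 25 remain for the steps. -/
theorem Heap.link_step {n b : ℕ} {q q' : Heap} (hq : q.Inv n) (hpn : 0 < q.pn)
    (hb : ∀ y, q.st y = 1 → q.H y ≤ b) (hq' : q' =
      let r := q.pl (q.pn - 1)
      if q.bk (q.H r) = 0 then q.store else
      if q.key r ≤ q.key (q.bk (q.H r) - 1) then q.link (q.H r) r (q.bk (q.H r) - 1)
      else q.link (q.H r) (q.bk (q.H r) - 1) r) :
    q'.Inv n ∧ q'.st = q.st ∧ ∃ b', (∀ y, q'.st y = 1 → q'.H y ≤ b') ∧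
      q'.pot n 0 + 75 * b' + 25 ≤ q.pot n 0 + 75 * b := by
  have h1 := hq.list (q.pn - 1) (by omega)
  by_cases hbk : q.bk (q.H (q.pl (q.pn - 1))) = 0
  · simp only [hbk, if_true] at hq'
    subst hq'
    refine ⟨hq.store hpn hbk, rfl, b, hb, ?_⟩
    have e1 : q.store.trees n = q.trees n := rfl
    have e2 : q.store.holes n 0 = q.holes n 0 := rfl
    have e3 : q.store.pn = q.pn - 1 := rfl
    simp only [Heap.pot, treeWt, listWt, holeWt, e1, e2, e3]
    omega
  · simp only [hbk, if_false] at hq'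
    generalize hr : q.pl (q.pn - 1) = r at *
    have h2 := hq.bucket (q.H r) (q.bk (q.H r) - 1) (by omega)
    obtain ⟨w, l, rfl, hwl, hk'⟩ : ∃ w l, q' = q.link (q.H r) w l ∧
        ((w = r ∧ l = q.bk (q.H r) - 1) ∨ (l = r ∧ w = q.bk (q.H r) - 1)) ∧
        q.key w ≤ q.key l := by
      by_cases hk : q.key r ≤ q.key (q.bk (q.H r) - 1)
      · exact ⟨_, _, by rw [hq', if_pos hk], .inl ⟨rfl, rfl⟩, hk⟩
      · exact ⟨_, _, by rw [hq', if_neg hk], .inr ⟨rfl, rfl⟩, (not_le.1 hk).le⟩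
    have hw : q.st w = 1 ∧ q.H w = q.H r := by grind
    have hl : q.st l = 1 ∧ q.pa l = 0 := by grind
    refine ⟨hq.link hpn (by rw [hr]) hbk (by rwa [hr]) hk', rfl, b + 1, ?_, ?_⟩
    · intro y hy
      have := hb y hy
      have := hb w hw.1
      simp only [Heap.link, upd_apply]; split_ifs <;> omega
    · have e1 := Heap.trees_link hq (h := q.H r) (w := w) hl.1 hl.2
      have e2 := Heap.holes_link (n := n) (l := l) hw.2
      have e3 : (q.link (q.H r) w l).pn = q.pn := rfl
      simp only [Heap.pot, treeWt, listWt, holeWt, e2, e3]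
      omega

/-- Link the roots in the list until at most one root of each height is left, in its bucket. -/
def heapLinkStep : Com :=
  .letN Arr.tX (.row Arr.hPl (.sub (.var Arr.hPn) (.lit 1))) ;;
  .letN Arr.tH (.row Arr.hH (.var Arr.tX)) ;;
  .branch (.eq (.row Arr.hBk (.var Arr.tH)) (.lit 0))
    (.setRow Arr.hBk (.var Arr.tH) (.add (.var Arr.tX) (.lit 1)) ;;
     .letN Arr.hPn (.sub (.var Arr.hPn) (.lit 1)))
    (.letN Arr.tL (.sub (.row Arr.hBk (.var Arr.tH)) (.lit 1)) ;;
     .setRow Arr.hBk (.var Arr.tH) (.lit 0) ;;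
     .letN Arr.tW (.var Arr.tX) ;;
     .branch (.le (.get Arr.key (.lit 0) (.var Arr.tX)) (.get Arr.key (.lit 0) (.var Arr.tL)))
       .skip
       (.letN Arr.tW (.var Arr.tL) ;; .letN Arr.tL (.var Arr.tX)) ;;
     .setRow Arr.hPa (.var Arr.tL) (.add (.var Arr.tW) (.lit 1)) ;;
     .setN Arr.hCh (.var Arr.tW) (.add (.var Arr.tH) (.lit 1)) (.add (.var Arr.tL) (.lit 1)) ;;
     .setRow Arr.hH (.var Arr.tW) (.add (.var Arr.tH) (.lit 1)) ;;
     .setRow Arr.hPl (.sub (.var Arr.hPn) (.lit 1)) (.var Arr.tW) ;;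
     .setRow Arr.hCnt (.add (.var Arr.tH) (.lit 1))
       (.add (.row Arr.hCnt (.add (.var Arr.tH) (.lit 1))) (.lit 1)))

theorem heapLinkStep_run (σ : Mem) :
    (heapOf (heapLinkStep.run σ) =
      let q := heapOf σ
      let r := q.pl (q.pn - 1)
      if q.bk (q.H r) = 0 then q.store else
      if q.key r ≤ q.key (q.bk (q.H r) - 1) then q.link (q.H r) r (q.bk (q.H r) - 1)
      else q.link (q.H r) (q.bk (q.H r) - 1) r) ∧ HeapFrame σ (heapLinkStep.run σ) := by
  obtain ⟨r, hr⟩ : ∃ r, σ.nat Arr.hPl 0 (σ.nat Arr.hPn 0 0 - 1) = r := ⟨_, rfl⟩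
  by_cases h : σ.nat Arr.hBk 0 (σ.nat Arr.hH 0 r) = 0
  · simp [heapLinkStep, Com.run, NExp.eval, BExp.eval, Mem.setN_nat, h, hr]
    refine ⟨?_, ⟨?_, rfl⟩⟩
    · ext <;> simp [Heap.store, Mem.setN_nat, upd_apply, hr]
    · repeat refine frame_setN ?_ (by decide)
      exact fun _ _ => rfl
  · by_cases hk : σ.real Arr.key 0 r ≤ σ.real Arr.key 0 (σ.nat Arr.hBk 0 (σ.nat Arr.hH 0 r) - 1)
    all_goals
      simp [heapLinkStep, Com.run, NExp.eval, BExp.eval, RExp.eval, Mem.setN_nat, h, hr, hk]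
      refine ⟨?_, ⟨?_, rfl⟩⟩
      · ext <;> simp [Heap.link, Mem.setN_nat, upd_apply, upd2_apply]
      · repeat refine frame_setN ?_ (by decide)
        exact fun _ _ => rfl

def heapLink : Com := .loop (.lt (.lit 0) (.var Arr.hPn)) heapLinkStep

theorem wp_heapLink {n d c b : ℕ} {σ : Mem} (hq : (heapOf σ).Inv n)
    (hb : ∀ y, (heapOf σ).st y = 1 → (heapOf σ).H y ≤ b)
    (hc : (heapOf σ).pot n 0 + 75 * b + d + 1 ≤ c) :
    Wp heapLink (fun c τ => HeapStep n σ τ ∧ (heapOf τ).pn = 0 ∧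
      ∃ b, (∀ y, (heapOf τ).st y = 1 → (heapOf τ).H y ≤ b) ∧
        (heapOf τ).pot n 0 + 75 * b + d ≤ c) c σ := by
  refine .loop (fun c τ => HeapStep n σ τ ∧ 
      ∃ b, (∀ y, (heapOf τ).st y = 1 → (heapOf τ).H y ≤ b) ∧
        (heapOf τ).pot n 0 + 75 * b + d + 1 ≤ c) ⟨⟨hq, rfl, .refl _⟩, b, hb, hc⟩ ?_
  rintro c τ ⟨⟨hq, hst, hf⟩, b, hb, hc⟩
  refine ⟨c - 1, by omega, fun hlt => ?_, fun hlt => ?_⟩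
  · have hpn : 0 < (heapOf τ).pn := hlt
    obtain ⟨hrun, hf'⟩ := heapLinkStep_run τ
    obtain ⟨i1, i2, b', i3, i4⟩ := Heap.link_step hq hpn hb hrun
    have ecost : heapLinkStep.cost ≤ 20 := by decide
    exact .straight rfl (c - 25) (by omega) ⟨⟨i1, i2.trans hst, hf.trans hf'⟩, b', i3, by omega⟩
  · exact ⟨⟨hq, hst, hf⟩, by simpa [BExp.eval, NExp.eval] using hlt, b, hb, by omega⟩

/-- Move the roots from the buckets to the list. -/
def heapCollect : Com :=
  .letN Arr.tH (.lit 0) ;;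
  .loop (.lt (.lit 0) (.row Arr.hCnt (.var Arr.tH)))
    (.branch (.lt (.lit 0) (.row Arr.hBk (.var Arr.tH)))
      (.setRow Arr.hPl (.var Arr.hPn) (.sub (.row Arr.hBk (.var Arr.tH)) (.lit 1)) ;;
       .letN Arr.hPn (.add (.var Arr.hPn) (.lit 1)) ;;
       .setRow Arr.hBk (.var Arr.tH) (.lit 0))
      .skip ;;
    .letN Arr.tH (.add (.var Arr.tH) (.lit 1)))

/-- The reserve of 75 per height covers the list weight 40 + 13 of a root that returns to the list
and the steps spent on its height. The loop may stop at the first height without nodes, since there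
are none above it either. -/
theorem wp_heapCollect {n d c b : ℕ} {σ : Mem} (hq : (heapOf σ).Inv n) (hpn : (heapOf σ).pn = 0)
    (hb : ∀ y, (heapOf σ).st y = 1 → (heapOf σ).H y ≤ b)
    (hc : (heapOf σ).pot n 0 + 75 * b + d + 80 ≤ c) :
    Wp heapCollect (fun c τ => HeapStep n σ τ ∧ (∀ h, (heapOf τ).bk h = 0) ∧
        (heapOf τ).pot n 13 + d ≤ c) c σ := by
  refine .seq (.straight rfl (c - 1) (by simp only [Com.cost]; omega) ?_)
  have h0 : heapOf ((Com.letN Arr.tH (.lit 0)).run σ) = heapOf σ := by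
    ext <;> simp [Com.run, NExp.eval, Mem.setN_nat]
  have hpot : (heapOf σ).pot n 13 = (heapOf σ).pot n 0 := by
    simp only [Heap.pot, hpn, mul_zero]
  refine .loop (fun c τ => ∃ i, τ.nat Arr.tH 0 0 = i ∧ i ≤ b + 1 ∧ HeapStep n σ τ ∧
      (∀ y, (heapOf τ).st y = 1 → (heapOf τ).H y ≤ b) ∧ (∀ h < i, (heapOf τ).bk h = 0) ∧
      (heapOf τ).pot n 13 + 75 * (b + 1 - i) + d + 1 ≤ c) ⟨0, ?_⟩ ?_
  · refine ⟨by simp [Com.run, NExp.eval, Mem.setN_nat], by omega, ⟨by rwa [h0], by rw [h0], ?_, rfl⟩, 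
      by rwa [h0], by simp, by rw [h0]; omega⟩
    simp only [Com.run]
    repeat refine frame_setN ?_ (by decide)
    exact fun _ _ => rfl
  · rintro c τ ⟨i, hi, hib, ⟨hq, hst, hf⟩, hb, hbk, hc⟩
    refine ⟨c - 1, by omega, fun hlt => ?_, fun hlt => ?_⟩
    · simp only [BExp.eval, NExp.eval, hi] at hlt
      obtain ⟨x, hx, hix⟩ := hq.count_pos.1 hlt
      have := hb x hx
      by_cases h : τ.nat Arr.hBk 0 i = 0
      · refine .straight rfl (c - 10) (by simp only [Com.cost, Com.skip]; omega) ?_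
        have hrun : heapOf (Com.run (.branch (.lt (.lit 0) (.row Arr.hBk (.var Arr.tH)))
            (.setRow Arr.hPl (.var Arr.hPn) (.sub (.row Arr.hBk (.var Arr.tH)) (.lit 1)) ;;
             .letN Arr.hPn (.add (.var Arr.hPn) (.lit 1)) ;;
             .setRow Arr.hBk (.var Arr.tH) (.lit 0))
            .skip ;;
          .letN Arr.tH (.add (.var Arr.tH) (.lit 1))) τ) = heapOf τ := by
          ext <;> simp [Com.run, NExp.eval, BExp.eval, Mem.setN_nat, hi, h]
        refine ⟨i + 1, by simp [Com.run, NExp.eval, BExp.eval, Mem.setN_nat, hi, h], by omega,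
          ⟨by rwa [hrun], by rwa [hrun], ?_, ?_⟩, by rwa [hrun], ?_, by rw [hrun]; omega⟩
        · simp only [Com.run, NExp.eval, BExp.eval, hi, h, Nat.lt_irrefl, if_false, Com.run_skip]
          repeat refine frame_setN ?_ (by decide)
          exact hf.nat
        · simp [Com.run, NExp.eval, BExp.eval, hi, h, hf.real]
        · rw [hrun]; intro j hj
          rcases Nat.lt_succ_iff_lt_or_eq.1 hj with h' | rfl
          · exact hbk j h'
          · exact h
      · refine .straight rfl (c - 10) (by simp only [Com.cost, Com.skip]; omega) ?_
        have hrun : heapOf (Com.run (.branch (.lt (.lit 0) (.row Arr.hBk (.var Arr.tH)))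
            (.setRow Arr.hPl (.var Arr.hPn) (.sub (.row Arr.hBk (.var Arr.tH)) (.lit 1)) ;;
             .letN Arr.hPn (.add (.var Arr.hPn) (.lit 1)) ;;
             .setRow Arr.hBk (.var Arr.tH) (.lit 0))
            .skip ;;
          .letN Arr.tH (.add (.var Arr.tH) (.lit 1))) τ) = (heapOf τ).unstore i := by
          ext <;> simp [Com.run, NExp.eval, BExp.eval, Mem.setN_nat, hi, Nat.pos_iff_ne_zero, h,
            Heap.unstore, upd_apply]
        refine ⟨i + 1, by simp [Com.run, NExp.eval, BExp.eval, Mem.setN_nat, hi, h, Nat.pos_iff_ne_zero],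
          by omega, ⟨by rw [hrun]; exact hq.unstore h, by rwa [hrun], ?_, ?_⟩, by rwa [hrun], ?_, ?_⟩
        · simp only [Com.run, NExp.eval, BExp.eval, hi, h, Nat.pos_iff_ne_zero, ne_eq, not_false_eq_true,
            if_true]
          repeat refine frame_setN ?_ (by decide)
          exact hf.nat
        · simp [Com.run, NExp.eval, BExp.eval, hi, h, hf.real, Nat.pos_iff_ne_zero]
        · rw [hrun]; intro j hj
          simp only [Heap.unstore, upd_apply]
          split_ifs with h'
          · rfl
          · exact hbk j (by omega)
        · rw [hrun]
          have e1 : ((heapOf τ).unstore i).trees n = (heapOf τ).trees n := rfl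
          have e2 : ((heapOf τ).unstore i).holes n 0 = (heapOf τ).holes n 0 := rfl
          have e3 : ((heapOf τ).unstore i).pn = (heapOf τ).pn + 1 := rfl
          simp only [Heap.pot, treeWt, listWt, holeWt, e1, e2, e3] at hc ⊢
          omega
    · simp only [BExp.eval, NExp.eval, hi, not_lt, Nat.le_zero] at hlt
      refine ⟨⟨hq, hst, hf⟩, fun h => ?_, by omega⟩
      by_contra hne
      have h1 := hq.bucket h ((heapOf τ).bk h - 1) (by omega)
      have h2 : 0 < (heapOf τ).cnt i := hq.count_pos.2 ⟨_, h1.1, by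
        rw [h1.2.2]; by_contra hlt'; exact hne (hbk h (by omega))⟩
      have h3 : (heapOf τ).cnt i = 0 := hlt
      omega

/-- Restore the balance: find the smallest height `tW` above which there are too many nodes, and
remove all nodes above it. -/
def heapBalance : Com :=
  .letN Arr.tW (.lit 0) ;;
  .loop (.and (.lt (.lit 0) (.row Arr.hCnt (.add (.var Arr.tW) (.lit 1))))
      (.not (.lt (.add (.row Arr.hCnt (.var Arr.tW))
          (.add (.row Arr.hCnt (.var Arr.tW)) (.row Arr.hCnt (.var Arr.tW))))
        (.add (.add (.row Arr.hCnt (.add (.var Arr.tW) (.lit 1)))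
            (.row Arr.hCnt (.add (.var Arr.tW) (.lit 1))))
          (.add (.row Arr.hCnt (.add (.var Arr.tW) (.lit 1)))
            (.row Arr.hCnt (.add (.var Arr.tW) (.lit 1))))))))
    (.letN Arr.tW (.add (.var Arr.tW) (.lit 1))) ;;
  .branch (.lt (.lit 0) (.row Arr.hCnt (.add (.var Arr.tW) (.lit 1))))
    (.letN Arr.tI (.lit 0) ;;
     .loop (.lt (.var Arr.tI) (.var Arr.hPn))
       (.letN Arr.tX (.row Arr.hPl (.var Arr.tI)) ;;
        .branch (.lt (.var Arr.tW) (.row Arr.hH (.var Arr.tX)))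
          truncTop
          (.letN Arr.tI (.add (.var Arr.tI) (.lit 1)))))
    .skip

/-- If all roots are in the list and of height at most `i`, then all items are. -/
theorem Heap.Inv.height_le {n i : ℕ} {q : Heap} (hq : q.Inv n) (hbk : ∀ h, q.bk h = 0)
    (hi : ∀ l < q.pn, q.H (q.pl l) ≤ i) {y : ℕ} (hy : q.st y = 1) : q.H y ≤ i := by
  -- An item of maximal height has no parent, since parents are higher; so it is a root, and the
  -- roots are all in the list.
  obtain ⟨x, hx, hmax⟩ := exists_max_image (q.items n) q.H ⟨y, by simp [hq.mem_items, hy]⟩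
  simp only [hq.mem_items] at hx hmax
  refine (hmax y hy).trans ?_
  rcases hpa : q.pa x with _ | z
  · rcases hq.roots x hx hpa with h | ⟨l, hl, h⟩
    · simp [hbk] at h
    · exact h ▸ hi l hl
  · have h1 := hq.parent x z hx hpa
    have := hmax z h1.1
    omega

/-- Removing everything above `i` frees at most as many trees as there are beaten items of height at
least `i`, and by `Heap.Inv.beaten_le` these are at most twice the holes above `i`. A freed tree
costs at most 170, namely 100 + 48 of potential and its steps, hence 340 per hole; each hole that
vanishes releases 400. The surplus of 5 in the list weight pays for the walk through the list. -/
theorem wp_heapTruncAll {n d c i : ℕ} {σ : Mem} (hq : (heapOf σ).Inv n)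
    (hbk : ∀ h, (heapOf σ).bk h = 0) (hi : σ.nat Arr.tW 0 0 = i)
    (hbal : ∀ l < i, 4 * (heapOf σ).cnt (l + 1) ≤ 3 * (heapOf σ).cnt l)
    (hviol : 3 * (heapOf σ).cnt i < 4 * (heapOf σ).cnt (i + 1))
    (hc : (heapOf σ).pot n 13 + d + 2 ≤ c) :
    Wp (.letN Arr.tI (.lit 0) ;;
     .loop (.lt (.var Arr.tI) (.var Arr.hPn))
       (.letN Arr.tX (.row Arr.hPl (.var Arr.tI)) ;;
        .branch (.lt (.var Arr.tW) (.row Arr.hH (.var Arr.tX)))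
          truncTop
          (.letN Arr.tI (.add (.var Arr.tI) (.lit 1)))))
      (fun c τ => HeapStep n σ τ ∧ (∀ h, (heapOf τ).bk h = 0) ∧ (heapOf τ).Balanced ∧
        (heapOf τ).pot n 8 + d ≤ c) c σ := by
  have hbeat := hq.beaten_le hviol
  have h0 : heapOf ((Com.letN Arr.tI (.lit 0)).run σ) = heapOf σ := by
    ext <;> simp [Com.run, NExp.eval, Mem.setN_nat]
  refine .seq (.straight rfl (c - 1) (by simp only [Com.cost]; omega) ?_)
  -- Each hole above `i` lends 380 in advance; when it is removed, 20 of its 400 are left for the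
  -- steps. In the end no hole above `i` exists, so no debt remains. The position `j` advances only
  -- past roots that are low enough.
  refine .loop (fun c τ => ∃ j, τ.nat Arr.tI 0 0 = j ∧ τ.nat Arr.tW 0 0 = i ∧ HeapStep n σ τ ∧
      (∀ h, (heapOf τ).bk h = 0) ∧ (∀ l ≤ i, (heapOf τ).cnt l = (heapOf σ).cnt l) ∧
      j ≤ (heapOf τ).pn ∧ (∀ l < j, (heapOf τ).H ((heapOf τ).pl l) ≤ i) ∧
      (heapOf τ).pot n 8 + 170 * (heapOf τ).beaten n i + 5 * ((heapOf τ).pn - j) + d + 1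
        ≤ c + 380 * (heapOf τ).holes n i) ⟨0, ?_⟩ ?_
  · refine ⟨by simp [Com.run, NExp.eval, Mem.setN_nat], by simp [Com.run, NExp.eval, Mem.setN_nat, hi],
      ⟨by rwa [h0], by rw [h0], ?_, rfl⟩, by rwa [h0], by simp [h0], by omega, by simp, ?_⟩
    · simp only [Com.run]
      repeat refine frame_setN ?_ (by decide)
      exact fun _ _ => rfl
    · rw [h0]
      simp only [Heap.pot] at hc ⊢
      have : (listWt + 13) * (heapOf σ).pn = (listWt + 8) * (heapOf σ).pn + 5 * (heapOf σ).pn := by ring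
      omega
  · rintro c τ ⟨j, hj, hi, ⟨hq, hst, hf⟩, hbk, hcnt, hjn, hle, hc⟩
    have hhole := (heapOf τ).holes_anti (n := n) (Nat.zero_le i)
    have hpot : 400 * (heapOf τ).holes n 0 ≤ (heapOf τ).pot n 8 := by
      simp only [Heap.pot, holeWt]; omega
    refine ⟨c - 1, by omega, fun hlt => ?_, fun hlt => ?_⟩
    · simp only [BExp.eval, NExp.eval, hj] at hlt
      have hlt' : j < (heapOf τ).pn := hlt
      refine .seq (.straight rfl (c - 2) (by simp only [Com.cost]; omega) ?_)
      obtain ⟨x, hx⟩ : ∃ x, τ.nat Arr.hPl 0 j = x := ⟨_, rfl⟩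
      have h1 : heapOf ((Com.letN Arr.tX (.row Arr.hPl (.var Arr.tI))).run τ) = heapOf τ := by
        ext <;> simp [Com.run, NExp.eval, Mem.setN_nat]
      have hf1 : HeapFrame τ ((Com.letN Arr.tX (.row Arr.hPl (.var Arr.tI))).run τ) :=
        (HeapFrame.refl _).setN' (by decide)
      have k1 : ((Com.letN Arr.tX (.row Arr.hPl (.var Arr.tI))).run τ).nat Arr.tX 0 0 = x := by
        simp [Com.run, NExp.eval, Mem.setN_nat, hj, hx]
      have k2 : ((Com.letN Arr.tX (.row Arr.hPl (.var Arr.tI))).run τ).nat Arr.tI 0 0 = j := by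
        simp [Com.run, NExp.eval, Mem.setN_nat, hj]
      have k3 : ((Com.letN Arr.tX (.row Arr.hPl (.var Arr.tI))).run τ).nat Arr.tW 0 0 = i := by
        simp [Com.run, NExp.eval, Mem.setN_nat, hi]
      generalize (Com.letN Arr.tX (.row Arr.hPl (.var Arr.tI))).run τ = υ at h1 hf1 k1 k2 k3 ⊢
      have hxH : υ.nat Arr.hH 0 x = (heapOf τ).H x := by rw [← h1]; rfl
      refine .branch (c - 3) (by omega) (fun hb => ?_) (fun hb => ?_)
      · simp only [BExp.eval, NExp.eval, k1, k3, hxH] at hb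
        obtain ⟨hrun, hf', hkeep⟩ := truncTop_run υ
        rw [k1, h1] at hrun
        obtain ⟨i1, i2, i3, i4, i5, i6, i7, i8, i9⟩ := Heap.trunc_step hq hlt' hx hb hrun
        have ecost : truncTop.cost = 8 := rfl
        have hfin : (heapOf (truncTop.run υ)).pot n 8 + 170 * (heapOf (truncTop.run υ)).beaten n i +
            5 * ((heapOf (truncTop.run υ)).pn - j) + d + 1 + 11
            ≤ c + 380 * (heapOf (truncTop.run υ)).holes n i := by
          simp only [Heap.pot, treeWt, listWt, holeWt] at hc ⊢
          omega
        refine .straight rfl (c - 11) ?_ ⟨j, by rw [hkeep _ (by decide), k2],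
          by rw [hkeep _ (by decide), k3], ⟨i1, i2.trans hst, (hf.trans hf1).trans hf'⟩,
          by rwa [i4], fun l hl => (i8 l hl).trans (hcnt l hl), by omega, ?_, ?_⟩
        · have := (heapOf (truncTop.run υ)).holes_anti (n := n) (Nat.zero_le i)
          have : 400 * (heapOf (truncTop.run υ)).holes n 0 ≤ (heapOf (truncTop.run υ)).pot n 8 := by
            simp only [Heap.pot, holeWt]; omega
          omega
        · intro l hl
          have := hle l hl
          rw [i7 l (by omega), i5, upd_apply]; split_ifs with h
          · rw [h] at this; omega
          · exact this
        · omega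
      · simp only [BExp.eval, NExp.eval, k1, k3, hxH] at hb
        have h2 : heapOf ((Com.letN Arr.tI (.add (.var Arr.tI) (.lit 1))).run υ) = heapOf τ := by
          rw [← h1]; ext <;> simp [Com.run, NExp.eval, Mem.setN_nat]
        refine .straight rfl (c - 5) (by simp only [Com.cost]; omega) ⟨j + 1, ?_, ?_, ?_, ?_⟩
        · simp [Com.run, NExp.eval, Mem.setN_nat, k2]
        · simp [Com.run, NExp.eval, Mem.setN_nat, k3]
        · exact ⟨by rwa [h2], by rwa [h2], (hf.trans hf1).setN' (by decide)⟩
        · rw [h2]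
          refine ⟨hbk, hcnt, hlt, fun l hl => ?_, by omega⟩
          rcases Nat.lt_succ_iff_lt_or_eq.1 hl with h | rfl
          · exact hle l h
          · rw [show (heapOf τ).pl l = x from hx]; omega
    · simp only [BExp.eval, NExp.eval, hj] at hlt
      have hlt' : ¬ j < (heapOf τ).pn := hlt
      have hH : ∀ y, (heapOf τ).st y = 1 → (heapOf τ).H y ≤ i := fun y hy =>
        hq.height_le hbk (fun l hl => hle l (by omega)) hy
      have h2 := Heap.holes_eq_zero hq hH
      refine ⟨⟨hq, hst, hf⟩, hbk, fun l => ?_, by omega⟩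
      by_cases hl : l < i
      · rw [hcnt _ (by omega), hcnt _ (by omega)]; exact hbal l hl
      · have : (heapOf τ).cnt (l + 1) = 0 := by
          by_contra hne
          obtain ⟨y, hy, hy'⟩ := hq.count_pos.1 (Nat.pos_of_ne_zero hne)
          have := hH y hy
          omega
        omega

/-- The smallest unbalanced height is found with two steps per height. The heap as a whole may be
too high here, but below the first violation the balance holds, which bounds the search by
`Heap.maxHeight`. If the search runs out of nodes instead, all higher counts vanish and the heap is
balanced. -/
theorem wp_heapBalance {n d c : ℕ} {σ : Mem} (hq : (heapOf σ).Inv n)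
    (hbk : ∀ h, (heapOf σ).bk h = 0)
    (hc : (heapOf σ).pot n 13 + 2 * Heap.maxHeight n + d + 6 ≤ c) :
    Wp heapBalance (fun c τ => HeapStep n σ τ ∧ (∀ h, (heapOf τ).bk h = 0) ∧
      (heapOf τ).Balanced ∧ (heapOf τ).pot n 8 + d ≤ c) c σ := by
  have h0 : heapOf ((Com.letN Arr.tW (.lit 0)).run σ) = heapOf σ := by
    ext <;> simp [Com.run, NExp.eval, Mem.setN_nat]
  refine .seq (.straight rfl (c - 1) (by simp only [Com.cost]; omega) ?_)
  refine .seq (.loop (fun c τ => ∃ i, τ.nat Arr.tW 0 0 = i ∧ heapOf τ = heapOf σ ∧ HeapFrame σ τ ∧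
    i ≤ Heap.maxHeight n ∧ (∀ l < i, 4 * (heapOf σ).cnt (l + 1) ≤ 3 * (heapOf σ).cnt l) ∧
    (heapOf σ).pot n 13 + 2 * (Heap.maxHeight n - i) + d + 5 ≤ c) ⟨0, ?_⟩ ?_)
  · exact ⟨by simp [Com.run, NExp.eval, Mem.setN_nat], h0, (HeapFrame.refl _).setN' (by decide),
      by omega, by simp, by omega⟩
  · rintro c τ ⟨i, hi, hh, hf, hiL, hbal, hc⟩
    have e1 : ∀ l, τ.nat Arr.hCnt 0 l = (heapOf σ).cnt l := fun l => by rw [← hh]; rfl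
    refine ⟨c - 1, by omega, fun hlt => ?_, fun hlt => ?_⟩
    · simp only [BExp.eval, NExp.eval, hi, e1] at hlt
      have hbal' : ∀ l < i + 1, 4 * (heapOf σ).cnt (l + 1) ≤ 3 * (heapOf σ).cnt l := by
        intro l hl
        rcases Nat.lt_succ_iff_lt_or_eq.1 hl with h | rfl
        · exact hbal l h
        · omega
      have := hq.lt_maxHeight hbal' hlt.1
      refine .straight rfl (c - 2) (by simp only [Com.cost]; omega) ⟨i + 1, ?_, ?_,
        hf.setN' (by decide), by omega, hbal', by omega⟩
      · simp [Com.run, NExp.eval, Mem.setN_nat, hi]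
      · rw [← hh]; ext <;> simp [Com.run, NExp.eval, Mem.setN_nat]
    · simp only [BExp.eval, NExp.eval, hi, e1] at hlt
      refine .branch (c - 2) (by omega) (fun hb => ?_) (fun hb => ?_)
      · simp only [BExp.eval, NExp.eval, hi, e1] at hb
        refine (wp_heapTruncAll (d := d) (i := i) (by rwa [hh]) (by rwa [hh]) hi (by rwa [hh])
          (by rw [hh]; omega) (by rw [hh]; omega)).mono ?_
        rintro c' υ ⟨⟨j1, j2, j3⟩, j4⟩
        exact ⟨⟨j1, by rw [j2, hh], hf.trans j3⟩, j4⟩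
      · simp only [BExp.eval, NExp.eval, hi, e1] at hb
        refine .straight rfl (c - 3) (by simp only [Com.cost, Com.skip]; omega) ?_
        rw [Com.run_skip]
        refine ⟨⟨by rwa [hh], by rw [hh], hf⟩, by rwa [hh], fun l => ?_, ?_⟩
        · rw [hh]
          by_cases hl : l < i
          · exact hbal l hl
          · have : (heapOf σ).cnt (l + 1) = 0 := by
              by_contra hne
              obtain ⟨y, hy, hy'⟩ := hq.count_pos.1 (Nat.pos_of_ne_zero hne)
              exact hb (hq.count_pos.2 ⟨y, hy, by omega⟩)
            omega
        · rw [hh]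
          have : (heapOf σ).pot n 8 ≤ (heapOf σ).pot n 13 := by simp only [Heap.pot, listWt]; omega
          omega

/-- Delete the root number `tBest`, and restore the balance. -/
def heapPop : Com := heapDelete ;; heapLink ;; heapCollect ;; heapBalance

/-- Per height the cost is 170 + 75 + 2 = 247, for the deletion, the buckets and the search for a
violation; the constant is 10 + 1 + 80 + 6. The list weight is back at `8` afterwards, ready for the
next scan. -/
theorem wp_heapPop {n d c x : ℕ} {σ : Mem} (hq : (heapOf σ).Inv n)
    (hbk : ∀ h, (heapOf σ).bk h = 0) (hbal : (heapOf σ).Balanced)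
    (hbest : σ.nat Arr.tBest 0 0 < (heapOf σ).pn) (hx : (heapOf σ).pl (σ.nat Arr.tBest 0 0) = x)
    (hc : (heapOf σ).pot n 0 + 247 * Heap.maxHeight n + d + 97 ≤ c) :
    Wp heapPop (fun c τ => (heapOf τ).Inv n ∧ (heapOf τ).st = upd (heapOf σ).st x 2 ∧
      (∀ h, (heapOf τ).bk h = 0) ∧ (heapOf τ).Balanced ∧ HeapFrame σ τ ∧
      (heapOf τ).pot n 8 + d ≤ c) c σ := by
  refine .seq ((wp_heapDelete (b := Heap.maxHeight n)
    (d := 77 * Heap.maxHeight n + d + 87) hq hbk (fun y hy => (hq.height_lt hbal hy).le) hbest hx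
    (by omega)).mono ?_)
  rintro c1 τ1 ⟨hc1, q1, st1, bk1, b1, f1⟩
  refine .seq ((wp_heapLink (d := 2 * Heap.maxHeight n + d + 86) q1 b1 (by omega)).mono ?_)
  rintro c2 τ2 ⟨⟨q2, st2, f2⟩, pn2, b2, hb2, hc2⟩
  refine .seq ((wp_heapCollect (d := 2 * Heap.maxHeight n + d + 6) q2 pn2 hb2 (by omega)).mono ?_)
  rintro c3 τ3 ⟨⟨q3, st3, f3⟩, bk3, hc3⟩
  refine (wp_heapBalance (d := d) q3 bk3 (by omega)).mono ?_
  rintro c4 τ4 ⟨⟨q4, st4, f4⟩, bk4, bal4, hc4⟩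
  exact ⟨q4, by rw [st4, st3, st2, st1], bk4, bal4, ((f1.trans f2).trans f3).trans f4, hc4⟩

/-! ### Insertion and decrease of a key -/

/-- Insert the item `item` with the key `newKey` into the heap, or decrease its key; `cur` is the
source of the key. -/
def heapUpdate : Com :=
  .branch (.eq (.row Arr.hSt (.var Arr.item)) (.lit 0))
    (.setR Arr.key (.lit 0) (.var Arr.item) (.var Arr.newKey) ;;
     .setRow Arr.src (.var Arr.item) (.var Arr.cur) ;;
     .setRow Arr.hSt (.var Arr.item) (.lit 1) ;;
     .setRow Arr.hH (.var Arr.item) (.lit 0) ;;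
     .setRow Arr.hPa (.var Arr.item) (.lit 0) ;;
     .setRow Arr.hPl (.var Arr.hPn) (.var Arr.item) ;;
     .letN Arr.hPn (.add (.var Arr.hPn) (.lit 1)) ;;
     .setRow Arr.hCnt (.lit 0) (.add (.row Arr.hCnt (.lit 0)) (.lit 1)))
    (.branch (.and (.eq (.row Arr.hSt (.var Arr.item)) (.lit 1))
        (.not (.le (.get Arr.key (.lit 0) (.var Arr.item)) (.var Arr.newKey))))
      (.setR Arr.key (.lit 0) (.var Arr.item) (.var Arr.newKey) ;;
       .setRow Arr.src (.var Arr.item) (.var Arr.cur) ;;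
       .branch (.eq (.row Arr.hPa (.var Arr.item)) (.lit 0))
         .skip
         (.setN Arr.hCh (.sub (.row Arr.hPa (.var Arr.item)) (.lit 1))
            (.add (.row Arr.hH (.var Arr.item)) (.lit 1)) (.lit 0) ;;
          .setRow Arr.hPa (.var Arr.item) (.lit 0) ;;
          .setRow Arr.hPl (.var Arr.hPn) (.var Arr.item) ;;
          .letN Arr.hPn (.add (.var Arr.hPn) (.lit 1))))
      .skip)

/-- The effect of `heapUpdate` for the item `m`, the key `κ` and the source `j`. -/
structure HeapUpdated (n m j : ℕ) (κ : ℝ) (σ τ : Mem) : Prop where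
  inv : (heapOf τ).Inv n
  bk : (heapOf τ).bk = (heapOf σ).bk
  bal : (heapOf τ).Balanced
  pot : (heapOf τ).pot n 8 ≤ (heapOf σ).pot n 8 + 548
  frame : ∀ a, (a < 20 ∨ 40 ≤ a) ∧ a ≠ Arr.src ∧ a ≠ Arr.cJ → τ.nat a = σ.nat a
  real : ∀ a, a ≠ Arr.key → τ.real a = σ.real a
  eff : (σ.nat Arr.hSt 0 m = 0 ∨ σ.nat Arr.hSt 0 m = 1 ∧ κ < σ.real Arr.key 0 m) ∧
      τ.nat Arr.hSt 0 = upd (σ.nat Arr.hSt 0) m 1 ∧ τ.real Arr.key 0 = upd (σ.real Arr.key 0) m κ ∧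
      τ.nat Arr.src 0 = upd (σ.nat Arr.src 0) m j ∨
    (σ.nat Arr.hSt 0 m ≠ 0 ∧ (σ.nat Arr.hSt 0 m = 1 → σ.real Arr.key 0 m ≤ κ)) ∧
      τ.nat Arr.hSt 0 = σ.nat Arr.hSt 0 ∧ τ.real Arr.key 0 = σ.real Arr.key 0 ∧
      τ.nat Arr.src 0 = σ.nat Arr.src 0

/-- The dearest case is a cut: a tree, a list entry and a hole, 100 + 48 + 400 = 548. Balance is
preserved for free, since an insertion only raises the count of height 0 and a decrease of a key
changes no count. -/
theorem heapUpdate_run {n m j : ℕ} {κ : ℝ} {σ : Mem} (hq : (heapOf σ).Inv n)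
    (hbal : (heapOf σ).Balanced) (hm : σ.nat Arr.item 0 0 = m) (hj : σ.nat Arr.cur 0 0 = j)
    (hκ : σ.real Arr.newKey 0 0 = κ) (hmn : m < n) :
    HeapUpdated n m j κ σ (heapUpdate.run σ) := by
  by_cases h0 : σ.nat Arr.hSt 0 m = 0
  · have hne : (heapOf σ).st m ≠ 1 := by simp [h0]
    have hrun : heapOf (heapUpdate.run σ) = (heapOf σ).push m κ := by
      ext <;> simp [heapUpdate, Com.run, NExp.eval, BExp.eval, RExp.eval, Mem.setN_nat, Mem.setR_real,
        h0, hm, hκ, Heap.push, upd_apply]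
    have e1 := Heap.trees_push hq κ hmn hne
    have e2 := Heap.holes_push hq κ hmn hne 0
    refine ⟨by rw [hrun]; exact hq.push κ hmn hne, by rw [hrun]; rfl, ?_, ?_, ?_, ?_, ?_⟩
    · rw [hrun]; intro l
      have := hbal l
      rcases l with _ | l
      · simp only [Heap.push, upd_apply]; simp only [zero_add, one_ne_zero, if_false, if_true]
        simp only [zero_add] at this; omega
      · simpa [Heap.push, upd_apply] using this
    · have e3 : ((heapOf σ).push m κ).pn = (heapOf σ).pn + 1 := rfl
      rw [hrun]
      simp only [Heap.pot, treeWt, listWt, holeWt, e1, e2, e3]; omega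
    · refine fun a ha => run_nat rfl σ ?_
      simp only [heapUpdate, Com.natWrites, Com.skip, List.mem_append, List.mem_singleton,
        List.not_mem_nil, false_or]
      simp only [Arr.hSt, Arr.hH, Arr.hPa, Arr.hCh, Arr.hPl, Arr.hPn, Arr.hCnt, Arr.src, Arr.cJ] at ha ⊢
      omega
    · refine fun a ha => run_real rfl σ ?_
      simp [heapUpdate, Com.realWrites, Com.skip]; omega
    · refine .inl ⟨.inl h0, ?_, ?_, ?_⟩ <;> funext y <;>
        simp [heapUpdate, Com.run, NExp.eval, BExp.eval, RExp.eval, Mem.setN_nat, Mem.setR_real,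
        h0, hm, hκ, hj, upd_apply]
  · by_cases h1 : σ.nat Arr.hSt 0 m = 1 ∧ ¬ σ.real Arr.key 0 m ≤ κ
    · have hst : (heapOf σ).st m = 1 := h1.1
      have hle : κ ≤ (heapOf σ).key m := (not_le.1 h1.2).le
      rcases hpa : (heapOf σ).pa m with _ | y
      · have hpa' : σ.nat Arr.hPa 0 m = 0 := hpa
        have hrun : heapOf (heapUpdate.run σ) = (heapOf σ).lower m κ := by
          ext <;> simp [heapUpdate, Com.run, NExp.eval, BExp.eval, RExp.eval, Mem.setN_nat,
            Mem.setR_real, h1.1, h1.2, hm, hκ, hpa', Heap.lower, upd_apply, -not_le]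
        refine ⟨by rw [hrun]; exact hq.lower hpa hle, by rw [hrun]; rfl, by rw [hrun]; exact hbal,
          by rw [hrun]; exact Nat.le_add_right _ _, ?_, ?_, ?_⟩
        · refine fun a ha => run_nat rfl σ ?_
          simp only [heapUpdate, Com.natWrites, Com.skip, List.mem_append, List.mem_singleton,
            List.not_mem_nil, false_or]
          simp only [Arr.hSt, Arr.hH, Arr.hPa, Arr.hCh, Arr.hPl, Arr.hPn, Arr.hCnt, Arr.src, Arr.cJ] at ha ⊢
          omega
        · refine fun a ha => run_real rfl σ ?_
          simp [heapUpdate, Com.realWrites, Com.skip]; omega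
        · refine .inl ⟨.inr ⟨h1.1, not_le.1 h1.2⟩, ?_, ?_, ?_⟩ <;> funext y <;>
            simp [heapUpdate, Com.run, NExp.eval, BExp.eval, RExp.eval, Mem.setN_nat, Mem.setR_real,
              h1.1, h1.2, hpa', hm, hκ, hj, upd_apply, -not_le]
          rintro rfl; exact h1.1
      · have hpa' : σ.nat Arr.hPa 0 m = y + 1 := hpa
        have hrun : heapOf (heapUpdate.run σ) = (heapOf σ).cut m y κ := by
          ext <;> simp [heapUpdate, Com.run, NExp.eval, BExp.eval, RExp.eval, Mem.setN_nat,
            Mem.setR_real, h1.1, h1.2, hm, hκ, hpa', Heap.cut, upd_apply, upd2_apply, -not_le]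
        have e1 := Heap.trees_cut (κ := κ) hq hst hpa
        have e2 := Heap.holes_cut (κ := κ) hq hst hpa
        have e3 : ((heapOf σ).cut m y κ).pn = (heapOf σ).pn + 1 := rfl
        refine ⟨by rw [hrun]; exact hq.cut hst hpa hle, by rw [hrun]; rfl, by rw [hrun]; exact hbal,
          ?_, ?_, ?_, ?_⟩
        · rw [hrun]
          simp only [Heap.pot, treeWt, listWt, holeWt, e1, e3]; omega
        · refine fun a ha => run_nat rfl σ ?_
          simp only [heapUpdate, Com.natWrites, Com.skip, List.mem_append, List.mem_singleton,
            List.not_mem_nil, false_or]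
          simp only [Arr.hSt, Arr.hH, Arr.hPa, Arr.hCh, Arr.hPl, Arr.hPn, Arr.hCnt, Arr.src, Arr.cJ] at ha ⊢
          omega
        · refine fun a ha => run_real rfl σ ?_
          simp [heapUpdate, Com.realWrites, Com.skip]; omega
        · refine .inl ⟨.inr ⟨h1.1, not_le.1 h1.2⟩, ?_, ?_, ?_⟩ <;> funext y <;>
            simp [heapUpdate, Com.run, NExp.eval, BExp.eval, RExp.eval, Mem.setN_nat, Mem.setR_real,
              h1.1, h1.2, hpa', hm, hκ, hj, upd_apply, -not_le]
          rintro rfl; exact h1.1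
    · have hrun : heapUpdate.run σ = σ := by
        simp only [heapUpdate, Com.run, NExp.eval, BExp.eval, RExp.eval, hm, hκ, h0, if_false, h1,
          Com.run_skip]
      rw [hrun]
      refine ⟨hq, rfl, hbal, by omega, fun _ _ => rfl, fun _ _ => rfl, .inr ⟨⟨h0, fun h => ?_⟩, rfl, rfl, rfl⟩⟩
      by_contra hlt
      exact h1 ⟨h, hlt⟩

/-! ### Empty heaps -/

/-- A heap without items. -/
structure Heap.Fresh (q : Heap) : Prop where
  st : ∀ x, q.st x = 0
  bk : ∀ h, q.bk h = 0
  pn : q.pn = 0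
  cnt : ∀ i, q.cnt i = 0

/-- The components that are not mentioned may hold whatever an earlier phase left there: the
invariant only constrains them for items, bucket entries and list entries, and there are none. -/
theorem Heap.Fresh.inv {n : ℕ} {q : Heap} (h : q.Fresh) : q.Inv n where
  lt := by simp [h.st]
  child := by simp [h.st]
  parent := by simp [h.st]
  bucket := by simp [h.bk]
  list := by simp [h.pn]
  list_inj := by simp [h.pn]
  roots := by simp [h.st]
  count := by simp [h.cnt, Heap.items, h.st]

theorem Heap.Fresh.balanced {q : Heap} (h : q.Fresh) : q.Balanced := by simp [Heap.Balanced, h.cnt]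

theorem Heap.Fresh.pot {n e : ℕ} {q : Heap} (h : q.Fresh) : q.pot n e = 0 := by
  simp [Heap.pot, h.pn, Heap.trees, Heap.holes, Heap.items, h.st]

/-- Remove everything from the heap. -/
def heapReset : Com :=
  .letN Arr.hPn (.lit 0) ;;
  .letN Arr.tH (.lit 0) ;;
  .loop (.lt (.lit 0) (.row Arr.hCnt (.var Arr.tH)))
    (.setRow Arr.hCnt (.var Arr.tH) (.lit 0) ;; .letN Arr.tH (.add (.var Arr.tH) (.lit 1))) ;;
  .forLt Arr.tI (.var Arr.num) (.setRow Arr.hSt (.var Arr.tI) (.lit 0))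

/-- Balance bounds the number of nonzero counts by `Heap.maxHeight`, and the buckets are already
empty; so a reset costs O(n), once per phase. -/
theorem wp_heapReset {n d c : ℕ} {σ : Mem} (hq : (heapOf σ).Inv n) (hbk : ∀ h, (heapOf σ).bk h = 0)
    (hbal : (heapOf σ).Balanced) (hn : σ.nat Arr.num 0 0 = n) (hst : ∀ x, n ≤ x → σ.nat Arr.hSt 0 x = 0)
    (hc : 3 * n + 3 * Heap.maxHeight n + d + 10 ≤ c) :
    Wp heapReset (fun c τ => (heapOf τ).Fresh ∧ d ≤ c) c σ := by
  refine .seq (.straight rfl (c - 1) (by simp only [Com.cost]; omega) ?_)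
  refine .seq (.straight rfl (c - 2) (by simp only [Com.cost]; omega) ?_)
  refine .seq (.mono (Q := fun c τ => (∀ i, τ.nat Arr.hCnt 0 i = 0) ∧ τ.nat Arr.hPn 0 0 = 0 ∧
    τ.nat Arr.num 0 0 = n ∧ (∀ h, τ.nat Arr.hBk 0 h = 0) ∧ (∀ x, n ≤ x → τ.nat Arr.hSt 0 x = 0) ∧
    3 * n + d + 4 ≤ c)
    (.loop (fun c τ => ∃ i, τ.nat Arr.tH 0 0 = i ∧ i ≤ Heap.maxHeight n ∧ (∀ l < i, τ.nat Arr.hCnt 0 l = 0) ∧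
      (∀ l, i ≤ l → τ.nat Arr.hCnt 0 l = (heapOf σ).cnt l) ∧ τ.nat Arr.hPn 0 0 = 0 ∧
      τ.nat Arr.num 0 0 = n ∧ (∀ h, τ.nat Arr.hBk 0 h = 0) ∧ (∀ x, n ≤ x → τ.nat Arr.hSt 0 x = 0) ∧
      3 * n + d + 5 + 3 * (Heap.maxHeight n - i) ≤ c) ⟨0, ?_⟩ ?_) ?_)
  · have hbk' : ∀ h, σ.nat Arr.hBk 0 h = 0 := hbk
    simp [Com.run, NExp.eval, Mem.setN_nat, hn, hbk']
    exact ⟨hst, by omega⟩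
  · rintro c τ ⟨i, hi, hiL, hlt, hge, hpn, hn, hbk, hst, hc⟩
    refine ⟨c - 1, by omega, fun hb => ?_, fun hb => ?_⟩
    · simp only [BExp.eval, NExp.eval, hi, hge i le_rfl] at hb
      have := hq.lt_maxHeight (fun l _ => hbal l) hb
      refine .straight rfl (c - 3) (by simp only [Com.cost]; omega) ⟨i + 1, ?_, by omega, ?_, ?_, ?_⟩
      · simp [Com.run, NExp.eval, Mem.setN_nat, hi]
      · intro l hl
        simp [Com.run, NExp.eval, Mem.setN_nat, hi]
        intro; exact hlt l (by omega)
      · intro l hl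
        have : l ≠ i := by omega
        simp [Com.run, NExp.eval, Mem.setN_nat, hi, this, hge l (by omega)]
      · simp [Com.run, NExp.eval, Mem.setN_nat, hn, hpn, hbk]
        exact ⟨hst, by omega⟩
    · simp only [BExp.eval, NExp.eval, hi, hge i le_rfl, not_lt, Nat.le_zero] at hb
      refine ⟨fun l => ?_, hpn, hn, hbk, hst, by omega⟩
      by_cases hl : l < i
      · exact hlt l hl
      · rw [hge l (by omega)]
        by_contra hne
        obtain ⟨x, hx, hx'⟩ := hq.count_pos.1 (Nat.pos_of_ne_zero hne)
        have := hq.count_pos.2 ⟨x, hx, (by omega : i ≤ (heapOf σ).H x)⟩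
        omega
  · rintro c τ ⟨h1, h2, hn, h3, hst, hc⟩
    refine .forLt n 1 (fun i c τ => (∀ l, τ.nat Arr.hCnt 0 l = 0) ∧ τ.nat Arr.hPn 0 0 = 0 ∧
      τ.nat Arr.num 0 0 = n ∧ (∀ h, τ.nat Arr.hBk 0 h = 0) ∧
      (∀ x, n ≤ x ∨ x < i → τ.nat Arr.hSt 0 x = 0) ∧ d ≤ c) d (by omega) ?_ ?_ ?_ ?_
    · simp [Mem.setN_nat, h1, h2, hn, h3]; exact hst
    · rintro i c τ ⟨-, -, hn, -⟩; exact hn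
    · rintro i hi c τ ⟨h1, h2, hn, h3, hst, hc⟩ hi'
      refine .straight rfl c (by simp only [Com.cost]; omega) ⟨?_, ?_⟩
      · simp [Com.run, NExp.eval, Mem.setN_nat, hi']
      · simp [Com.run, NExp.eval, Mem.setN_nat, hi', h1, h2, hn, h3, hc]
        intro x hx hxi
        exact hst x (by omega)
    · rintro c τ ⟨h1, h2, hn, h3, hst, hc⟩ hi'
      exact ⟨⟨fun x => hst x (by omega), h3, h2, h1⟩, hc⟩


/-! ## The Hungarian algorithm with distances instead of dual updates -/

section Hungarian

variable {k n : ℕ} {w : Ad k n → Fin n → ℝ}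

/-- The slack of an edge. -/
def HState.slack (w : Ad k n → Fin n → ℝ) (H : HState k n) (a : Ad k n) (j : Fin n) : ℝ :=
  H.u a + H.p j - w a j

/-- The dual solution is feasible and complementary to the matching, which matches the slots up to
`r`. -/
structure HState.Good (w : Ad k n → Fin n → ℝ) (r : ℕ) (H : HState k n) : Prop where
  feas : ∀ a j, 0 ≤ H.slack w a j
  tight : ∀ j a, H.M j = some a → H.slack w a j = 0
  inj : ∀ i j a, H.M i = some a → H.M j = some a → i = j
  dom : ∀ j : Fin n, H.M j = none ↔ r ≤ j
  free : ∀ a, (∀ j, H.M j ≠ some a) → H.u a = 0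

theorem HState.good_init [Nonempty (Ad k n × Fin n)] : (HState.init w).Good w 0 where
  feas a j := by
    have : w a j ≤ ⨆ e : Ad k n × Fin n, w e.1 e.2 :=
      le_ciSup (f := fun e : Ad k n × Fin n => w e.1 e.2) (Set.finite_range _).bddAbove (a, j)
    simp only [slack, init]; linarith
  tight j a h := by simp [init] at h
  inj i j a h := by simp [init] at h
  dom j := by simp [init]
  free a _ := rfl

/-- Every type has an unmatched ad. -/
theorem HState.Good.exists_unmatched {r : ℕ} {H : HState k n} (hH : H.Good w r) (hr : r < n)
    (θ : Fin k) : ∃ i, ∀ j, H.M j ≠ some (θ, i) := by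
  by_contra! h
  choose f hf using h
  have hinj : Function.Injective f := fun i i' hi => by
    have := (hf i).symm.trans ((congrArg H.M hi).trans (hf i'))
    simpa using this
  -- The n ads of the type would occupy n different slots, hence also the free slot `r`.
  obtain ⟨i, hi⟩ := Finite.surjective_of_injective hinj ⟨r, hr⟩
  have := hf i
  rw [hi, (hH.dom _).2 le_rfl] at this
  simp at this

/-- The tree `T` of a phase is described by distances: `key m` is the distance at which the slot `m`
joined the tree, through the slot `src m`, and `D` is the current distance. -/
structure Search (w : Ad k n → Fin n → ℝ) (H : HState k n) (r : Fin n) (T : Tree k n)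
    (key : Fin n → ℝ) (src : Fin n → Fin n) (D : ℝ) : Prop where
  root : r ∈ T.S
  matched : ∀ m ∈ T.S, m ≠ r → H.M m ≠ none
  u_in : ∀ m ∈ T.S, ∀ a, H.M m = some a → T.u a = H.u a + (D - key m)
  u_out : ∀ a, (∀ m ∈ T.S, H.M m ≠ some a) → T.u a = H.u a
  p_in : ∀ j ∈ T.S, T.p j = H.p j - (D - key j)
  p_out : ∀ j, j ∉ T.S → T.p j = H.p j
  par_in : ∀ m ∈ T.S, ∀ a, H.M m = some a → T.par a = some (src m)
  par_out : ∀ a, (∀ m ∈ T.S, H.M m ≠ some a) → T.par a = none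
  le : ∀ j ∈ T.S, key j ≤ D
  edge : ∀ b ∈ T.S, ∀ a, H.M b = some a → ∀ j ∈ T.S, key b ≤ key j + H.slack w a j
  out : ∀ a, (∀ m ∈ T.S, H.M m ≠ some a) → ∀ j ∈ T.S, D ≤ key j + H.slack w a j
  src_in : ∀ m ∈ T.S, ∀ a, H.M m = some a → src m ∈ T.S ∧ key m = key (src m) + H.slack w a (src m)
  order : ∃ ord : Fin n → ℕ, (∀ m ∈ T.S, ord m < #T.S) ∧
    ∀ m ∈ T.S, m ≠ r → ord (src m) < ord m

namespace Search

variable {H : HState k n} {r : Fin n} {T : Tree k n} {key : Fin n → ℝ} {src : Fin n → Fin n} {D : ℝ}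

theorem init (hH : H.Good w r) (hk : key r = 0) :
    Search w H r ⟨H.u, H.p, fun _ => none, {r}⟩ key src 0 := by
  have hr : H.M r = none := (hH.dom r).2 le_rfl
  refine ⟨by simp, by simp, ?_, fun _ _ => rfl, ?_, fun _ _ => rfl, ?_, fun _ _ => rfl, ?_, ?_, ?_,
    ?_, fun _ => 0, ?_⟩ <;> simp [hk, hr, hH.feas]

/-- Keys and sources of slots outside the tree are tentative and change whenever an edge is relaxed;
the description of the tree does not depend on them. The source of the root is irrelevant because
the root holds no ad. -/
theorem congr {key' : Fin n → ℝ} {src' : Fin n → Fin n} (h : Search w H r T key src D)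
    (hk : ∀ m ∈ T.S, key' m = key m) (hs : ∀ m ∈ T.S, m ≠ r → src' m = src m)
    (hr : H.M r = none) : Search w H r T key' src' D := by
  have hs' : ∀ m ∈ T.S, ∀ a, H.M m = some a → src' m = src m := fun m hm a ha =>
    hs m hm (by rintro rfl; simp [hr] at ha)
  refine ⟨h.root, h.matched, fun m hm a ha => ?_, h.u_out, fun j hj => ?_, h.p_out,
    fun m hm a ha => ?_, h.par_out, fun j hj => ?_, fun b hb a ha j hj => ?_,
    fun a ha j hj => ?_, fun m hm a ha => ?_, ?_⟩
  · rw [hk m hm]; exact h.u_in m hm a ha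
  · rw [hk j hj]; exact h.p_in j hj
  · rw [hs' m hm a ha]; exact h.par_in m hm a ha
  · rw [hk j hj]; exact h.le j hj
  · rw [hk b hb, hk j hj]; exact h.edge b hb a ha j hj
  · rw [hk j hj]; exact h.out a ha j hj
  · obtain ⟨h1, h2⟩ := h.src_in m hm a ha
    rw [hs' m hm a ha, hk m hm, hk _ h1]; exact ⟨h1, h2⟩
  · obtain ⟨ord, h1, h2⟩ := h.order
    exact ⟨ord, h1, fun m hm hmr => by rw [hs m hm hmr]; exact h2 m hm hmr⟩

theorem not_mem_iff (h : Search w H r T key src D) {a : Ad k n} :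
    T.par a = none ↔ ∀ m ∈ T.S, H.M m ≠ some a := by
  refine ⟨fun hp m hm ha => ?_, h.par_out a⟩
  rw [h.par_in m hm a ha] at hp
  simp at hp

/-- This is the translation between the two views of a phase: up to the common summand `-D`, the
slack in the current dual solution is a path length measured with the slacks of the initial one.
Choosing the least slack is therefore Dijkstra's choice. -/
theorem slack_eq (h : Search w H r T key src D) {a : Ad k n} (ha : ∀ m ∈ T.S, H.M m ≠ some a)
    {j : Fin n} (hj : j ∈ T.S) : T.slack w a j = key j + H.slack w a j - D := by
  simp only [Tree.slack, HState.slack, h.u_out a ha, h.p_in j hj]; ring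

theorem nextTight (h : Search w H r T key src D) {a : Ad k n} (ha : ∀ m ∈ T.S, H.M m ≠ some a)
    {j : Fin n} (hj : j ∈ T.S)
    (hmin : ∀ a', (∀ m ∈ T.S, H.M m ≠ some a') → ∀ j' ∈ T.S,
      key j + H.slack w a j ≤ key j' + H.slack w a' j') : T.NextTight w a j := by
  refine ⟨h.par_out a ha, hj, fun a' j' ha' hj' => ?_⟩
  have ha'' := h.not_mem_iff.1 ha'
  rw [h.slack_eq ha hj, h.slack_eq ha'' hj']
  linarith [hmin a' ha'' j' hj']

/-- The tree grows by an ad and its slot. -/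
theorem grow (h : Search w H r T key src D) (hH : H.Good w r) {a : Ad k n} {j m : Fin n}
    (hm : H.M m = some a) (hmS : m ∉ T.S) (hj : src m = j) (hjS : j ∈ T.S)
    (hkey : key m = key j + H.slack w a j)
    (hmin : ∀ a', (∀ m ∈ T.S, H.M m ≠ some a') → ∀ j' ∈ T.S, key m ≤ key j' + H.slack w a' j') :
    Search w H r ((T.addEdge w a j).addSlot m) key src (key m) := by
  have hr : H.M r = none := (hH.dom r).2 le_rfl
  have ha : ∀ m' ∈ T.S, H.M m' ≠ some a := fun m' hm' h' =>
    hmS (hH.inj _ _ _ hm h' ▸ hm')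
  have hsl : T.slack w a j = key m - D := by rw [h.slack_eq ha hjS, hkey]
  have hD : D ≤ key m := hkey ▸ h.out a ha j hjS
  have hS : ((T.addEdge w a j).addSlot m).S = insert m T.S := rfl
  have hmem : ∀ {b}, b ∈ ((T.addEdge w a j).addSlot m).S → b = m ∨ b ∈ T.S := mem_insert.1
  have huniq : ∀ b ∈ T.S, ∀ c, H.M b = some c → c ≠ a := fun b hb c hc hca => ha b hb (hca ▸ hc)
  have htm : H.slack w a m = 0 := hH.tight m a hm
  refine ⟨?_, ?_, ?_, ?_, ?_, ?_, ?_, ?_, ?_, ?_, ?_, ?_, ?_⟩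
  · exact mem_insert_of_mem h.root
  · intro b hb hbr
    replace hb := hmem hb
    rcases hb with rfl | hb
    · simp [hm]
    · exact h.matched b hb hbr
  · intro b hb c hc
    replace hb := hmem hb
    rcases hb with rfl | hb
    · obtain rfl : a = c := by simpa [hm] using hc
      simp [Tree.addSlot, Tree.addEdge, h.par_out a ha, h.u_out a ha]
    · simp only [Tree.addSlot, Tree.addEdge, h.par_in b hb c hc, reduceCtorEq, if_false, hsl,
        h.u_in b hb c hc]
      ring
  · intro c hc
    have hc' : ∀ m ∈ T.S, H.M m ≠ some c := fun b hb => hc b (mem_insert_of_mem hb)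
    simp [Tree.addSlot, Tree.addEdge, h.par_out c hc', h.u_out c hc']
  · intro b hb
    replace hb := hmem hb
    rcases hb with rfl | hb
    · simp [Tree.addSlot, Tree.addEdge, hmS, h.p_out b hmS]
    · simp only [Tree.addSlot, Tree.addEdge, hb, if_true, hsl, h.p_in b hb]; ring
  · intro b hb
    have hb' : b ∉ T.S := fun h' => hb (mem_insert_of_mem h')
    simp [Tree.addSlot, Tree.addEdge, hb', h.p_out b hb']
  · intro b hb c hc
    replace hb := hmem hb
    rcases hb with rfl | hb
    · obtain rfl : a = c := by simpa [hm] using hc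
      simp [Tree.addSlot, Tree.addEdge, hj]
    · simp only [Tree.addSlot, Tree.addEdge, Function.update_of_ne (huniq b hb c hc),
        h.par_in b hb c hc]
  · intro c hc
    have hca : c ≠ a := fun h' => hc m (mem_insert_self _ _) (h' ▸ hm)
    simp only [Tree.addSlot, Tree.addEdge, Function.update_of_ne hca]
    exact h.par_out c fun b hb => hc b (mem_insert_of_mem hb)
  · intro b hb
    replace hb := hmem hb
    rcases hb with rfl | hb
    · exact le_rfl
    · exact (h.le b hb).trans hD
  -- For the new ad and an old slot the bound is the minimality of the chosen edge. For the new slot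
  -- it holds because keys are assigned in increasing order and slacks are nonnegative.
  · intro b hb c hc i hi
    replace hb := hmem hb
    rcases hb with rfl | hb
    · obtain rfl : a = c := by simpa [hm] using hc
      replace hi := hmem hi
      rcases hi with rfl | hi
      · linarith
      · exact hmin a ha i hi
    · replace hi := hmem hi
      rcases hi with rfl | hi
      · linarith [h.le b hb, hH.feas c i]
      · exact h.edge b hb c hc i hi
  · intro c hc i hi
    replace hi := hmem hi
    rcases hi with rfl | hi
    · linarith [hH.feas c i]
    · exact hmin c (fun b hb => hc b (mem_insert_of_mem hb)) i hi
  · intro b hb c hc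
    replace hb := hmem hb
    rcases hb with rfl | hb
    · obtain rfl : a = c := by simpa [hm] using hc
      rw [hj]
      exact ⟨mem_insert_of_mem hjS, hkey⟩
    · exact ⟨mem_insert_of_mem (h.src_in b hb c hc).1, (h.src_in b hb c hc).2⟩
  · obtain ⟨ord, h1, h2⟩ := h.order
    -- The new slot gets a rank above all ranks in use, so sources always have smaller ranks. This
    -- makes the later walk to the root terminate.
    refine ⟨Function.update ord m #T.S, fun b hb => ?_, fun b hb hbr => ?_⟩
    · rw [hS, card_insert_of_notMem hmS]
      replace hb := hmem hb
      rcases hb with rfl | hb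
      · simp
      · rw [Function.update_of_ne (by rintro rfl; exact hmS hb)]
        exact (h1 b hb).trans (Nat.lt_succ_self _)
    · replace hb := hmem hb
      rcases hb with rfl | hb
      · rw [hj, Function.update_self, Function.update_of_ne (by rintro rfl; exact hmS hjS)]
        exact h1 _ hjS
      · have hb' : b ≠ m := by rintro rfl; exact hmS hb
        obtain ⟨c, hc⟩ := Option.ne_none_iff_exists'.1 (h.matched b hb hbr)
        have hs : src b ≠ m := by
          intro h'; exact hmS (h' ▸ (h.src_in b hb c hc).1)
        rw [Function.update_of_ne hb', Function.update_of_ne hs]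
        exact h2 b hb hbr

end Search

/-! ### Augmentation, and the end of a phase -/

/-- What an augmentation does to the matching. -/
theorem Augment.good {par : Ad k n → Option (Fin n)} {r : Fin n} {M M' : Assignment k n} {a : Ad k n}
    (h : Augment par r M a M') {P : Ad k n → Fin n → Prop}
    (hpar : ∀ b j, (b = a ∨ ∃ m, M m = some b) → par b = some j → P b j)
    (hP : ∀ j b, M j = some b → P b j) (hinj : ∀ i j b, M i = some b → M j = some b → i = j)
    (ha : ∀ j, M j ≠ some a) (hr : M r = none) :
    (∀ j b, M' j = some b → P b j) ∧ (∀ i j b, M' i = some b → M' j = some b → i = j) ∧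
    (∀ j, M' j = none ↔ M j = none ∧ j ≠ r) ∧
    (∀ b, (∃ j, M' j = some b) ↔ b = a ∨ ∃ j, M j = some b) := by
  induction h with
  | @last M a h =>
    refine ⟨fun j b hb => ?_, fun i j b hi hj => ?_, fun j => ?_, fun b => ⟨?_, ?_⟩⟩
    · by_cases hj : j = r
      · subst hj
        obtain rfl : a = b := by simpa using hb
        exact hpar a j (.inl rfl) h
      · rw [Function.update_of_ne hj] at hb
        exact hP j b hb
    · by_cases hi' : i = r <;> by_cases hj' : j = r
      · rw [hi', hj']
      · subst hi'
        rw [Function.update_of_ne hj'] at hj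
        obtain rfl : a = b := by simpa using hi
        exact (ha j hj).elim
      · subst hj'
        rw [Function.update_of_ne hi'] at hi
        obtain rfl : a = b := by simpa using hj
        exact (ha i hi).elim
      · rw [Function.update_of_ne hi'] at hi
        rw [Function.update_of_ne hj'] at hj
        exact hinj i j b hi hj
    · by_cases hj : j = r
      · subst hj; simp
      · simp [hj]
    · rintro ⟨j, hj⟩
      by_cases hj' : j = r
      · subst hj'; left; simpa using hj.symm
      · rw [Function.update_of_ne hj'] at hj
        exact .inr ⟨j, hj⟩
    · rintro (rfl | ⟨j, hj⟩)
      · exact ⟨r, by simp⟩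
      · have : j ≠ r := by rintro rfl; simp [hr] at hj
        exact ⟨j, by rwa [Function.update_of_ne this]⟩
  | @move M M' a b j h hj hb hM ih =>
    have hab : a ≠ b := by rintro rfl; exact ha j hb
    have hmem : ∀ c, (∃ m, Function.update M j (some a) m = some c) →
        c = a ∨ ∃ m, M m = some c := by
      rintro c ⟨m, hm⟩
      by_cases hmj : m = j
      · subst hmj; left; simpa using hm.symm
      · rw [Function.update_of_ne hmj] at hm
        exact .inr ⟨m, hm⟩
    -- Once `a` has taken the slot `j`, the displaced ad `b` is matched nowhere, by injectivity; it
    -- plays the role of the unmatched ad in the induction hypothesis.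
    obtain ⟨h1, h2, h3, h4⟩ := ih (fun c i hc => by
        rcases hc with rfl | hc
        · exact hpar c i (.inr ⟨j, hb⟩)
        · exact hpar c i (hmem c hc))
      (fun i c hc => by
        by_cases hij : i = j
        · subst hij
          obtain rfl : a = c := by simpa using hc
          exact hpar a i (.inl rfl) h
        · rw [Function.update_of_ne hij] at hc
          exact hP i c hc)
      (fun i i' c hc hc' => by
        by_cases hi : i = j <;> by_cases hi' : i' = j
        · rw [hi, hi']
        · subst hi
          rw [Function.update_of_ne hi'] at hc'
          obtain rfl : a = c := by simpa using hc
          exact (ha i' hc').elim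
        · subst hi'
          rw [Function.update_of_ne hi] at hc
          obtain rfl : a = c := by simpa using hc'
          exact (ha i hc).elim
        · rw [Function.update_of_ne hi] at hc
          rw [Function.update_of_ne hi'] at hc'
          exact hinj i i' c hc hc')
      (fun i hi => by
        by_cases hij : i = j
        · subst hij; exact hab (by simpa using hi)
        · rw [Function.update_of_ne hij] at hi
          exact hij (hinj i j b hi hb))
      (by rw [Function.update_of_ne (Ne.symm hj)]; exact hr)
    refine ⟨h1, h2, fun i => ?_, fun c => ?_⟩
    · rw [h3]
      by_cases hij : i = j
      · subst hij; simp [hb]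
      · rw [Function.update_of_ne hij]
    · rw [h4]
      constructor
      · rintro (rfl | hc)
        · exact .inr ⟨j, hb⟩
        · exact hmem c hc
      · rintro (rfl | ⟨m, hm⟩)
        · exact .inr ⟨j, by simp⟩
        · by_cases hmj : m = j
          · subst hmj; left; simpa [hb] using hm.symm
          · exact .inr ⟨m, by rwa [Function.update_of_ne hmj]⟩

namespace Search

variable {H : HState k n} {r : Fin n} {T : Tree k n} {key : Fin n → ℝ} {src : Fin n → Fin n} {D : ℝ}

/-- The dual solution at the end of a phase. -/
theorem moved (h : Search w H r T key src D) {a : Ad k n} {j : Fin n}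
    (ha : ∀ m, H.M m ≠ some a) (hjS : j ∈ T.S) {δ : ℝ} (hδ : δ = key j + H.slack w a j) :
    (∀ m ∈ T.S, ∀ c, H.M m = some c → (T.addEdge w a j).u c = H.u c + (δ - key m)) ∧
    (∀ c, (∀ m ∈ T.S, H.M m ≠ some c) → (T.addEdge w a j).u c = H.u c) ∧
    (∀ i ∈ T.S, (T.addEdge w a j).p i = H.p i - (δ - key i)) ∧
    (∀ i, i ∉ T.S → (T.addEdge w a j).p i = H.p i) := by
  have ha' : ∀ m ∈ T.S, H.M m ≠ some a := fun m _ => ha m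
  have hsl : T.slack w a j = δ - D := by rw [h.slack_eq ha' hjS, hδ]
  refine ⟨fun m hm c hc => ?_, fun c hc => ?_, fun i hi => ?_, fun i hi => ?_⟩
  · simp only [Tree.addEdge, h.par_in m hm c hc, reduceCtorEq, if_false, h.u_in m hm c hc, hsl]
    ring
  · simp [Tree.addEdge, h.par_out c hc, h.u_out c hc]
  · simp only [Tree.addEdge, hi, if_true, hsl, h.p_in i hi]; ring
  · simp [Tree.addEdge, hi, h.p_out i hi]

/-- The end of a phase. -/
theorem finish (h : Search w H r T key src D) (hH : H.Good w r) {a : Ad k n} {j : Fin n}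
    (ha : ∀ m, H.M m ≠ some a) (hjS : j ∈ T.S)
    (hmin : ∀ a', (∀ m ∈ T.S, H.M m ≠ some a') → ∀ j' ∈ T.S,
      key j + H.slack w a j ≤ key j' + H.slack w a' j') {M' : Assignment k n}
    (hM : Augment (T.addEdge w a j).par r H.M a M') :
    HState.Good w (r + 1) ⟨(T.addEdge w a j).u, (T.addEdge w a j).p, M'⟩ := by
  have ha' : ∀ m ∈ T.S, H.M m ≠ some a := fun m _ => ha m
  have hr : H.M r = none := (hH.dom r).2 le_rfl
  obtain ⟨δ, hδ⟩ : ∃ δ, δ = key j + H.slack w a j := ⟨_, rfl⟩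
  rw [← hδ] at hmin
  have hD : D ≤ δ := hδ ▸ h.out a ha' j hjS
  obtain ⟨hu_in, hu_out, hp_in, hp_out⟩ := h.moved ha hjS hδ
  have hslack : ∀ c i, (⟨(T.addEdge w a j).u, (T.addEdge w a j).p, M'⟩ : HState k n).slack w c i =
      (T.addEdge w a j).u c + (T.addEdge w a j).p i - w c i := fun _ _ => rfl
  -- All edges that the new matching can use are tight for the new dual solution: tree edges by the
  -- equation for `key`, old matching edges because both ends are moved by opposite amounts or not
  -- at all.
  obtain ⟨h1, h2, h3, h4⟩ := hM.good (P := fun c i =>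
      (T.addEdge w a j).u c + (T.addEdge w a j).p i - w c i = 0) (fun c i hc hp => by
        by_cases hca : c = a
        · subst hca
          obtain rfl : j = i := by simpa [Tree.addEdge] using hp
          rw [hu_out c ha', hp_in j hjS]
          simp only [HState.slack] at hδ
          linarith
        · have hp' : T.par c = some i := by
            simpa [Tree.addEdge, Function.update_of_ne hca] using hp
          have hc' : ∃ m ∈ T.S, H.M m = some c := by
            by_contra! h'
            rw [h.par_out c h'] at hp'
            simp at hp'
          obtain ⟨m, hm, hmc⟩ := hc'
          rw [h.par_in m hm c hmc] at hp'
          obtain rfl : src m = i := by simpa using hp'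
          obtain ⟨hs, hk⟩ := h.src_in m hm c hmc
          rw [hu_in m hm c hmc, hp_in _ hs]
          simp only [HState.slack] at hk
          linarith)
    (fun i c hc => by
      have ht := hH.tight i c hc
      simp only [HState.slack] at ht
      by_cases hi : i ∈ T.S
      · rw [hu_in i hi c hc, hp_in i hi]; linarith
      · rw [hu_out c (fun m hm hmc => hi (hH.inj _ _ _ hc hmc ▸ hm)), hp_out i hi]; linarith)
    hH.inj ha hr
  -- Feasibility is checked in four cases. If both ends are in the tree, the shortest path
  -- inequality `edge` applies; if only the ad is, its slack grows; if only the slot is, the slack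
  -- decreases but `δ` is minimal; otherwise nothing changes.
  refine ⟨fun c i => ?_, h1, h2, fun i => ?_, fun c hc => ?_⟩
  · rw [hslack]
    have hf := hH.feas c i
    by_cases hc : ∃ m ∈ T.S, H.M m = some c
    · obtain ⟨m, hm, hmc⟩ := hc
      rw [hu_in m hm c hmc]
      by_cases hi : i ∈ T.S
      · have := h.edge m hm c hmc i hi
        rw [hp_in i hi]
        simp only [HState.slack] at this
        linarith
      · have := h.le m hm
        rw [hp_out i hi]
        simp only [HState.slack] at hf
        linarith
    · push Not at hc
      rw [hu_out c hc]
      by_cases hi : i ∈ T.S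
      · have := hmin c hc i hi
        rw [hp_in i hi]
        simp only [HState.slack] at this ⊢
        linarith
      · rw [hp_out i hi]
        exact hf
  · rw [h3, hH.dom, Fin.ne_iff_vne]
    omega
  · have hc' : ∀ m, H.M m ≠ some c := fun m hm => by
      obtain ⟨i, hi⟩ := (h4 c).2 (.inr ⟨m, hm⟩)
      exact hc i hi
    change (T.addEdge w a j).u c = 0
    rw [hu_out c fun m _ => hc' m, hH.free c hc']

end Search

end Hungarian

/-! ## Edges that can be disregarded -/

section Candidates

variable {k n : ℕ} {disc : Fin k → Fin n → ℝ} {v : Ad k n → ℝ}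

/-- Enough candidates for the slots that are reached next from the slot `j`, among the slots of the ads of type
`θ`. -/
structure Candidates (disc : Fin k → Fin n → ℝ) (v : Ad k n → ℝ) (M : Assignment k n) (θ : Fin k)
    (j : Fin n) (c : Set (Fin n)) : Prop where
  same : ∀ m i, M m = some (θ, i) → disc θ m = disc θ j → m ≠ j →
    ∃ b ∈ c, ∃ i', M b = some (θ, i') ∧ disc θ b = disc θ j ∧ (j < b ∧ b ≤ m ∨ m ≤ b ∧ b < j)
  below : ∀ m i, M m = some (θ, i) → disc θ m < disc θ j →
    ∃ b ∈ c, ∃ i', M b = some (θ, i') ∧ disc θ m ≤ disc θ b ∧ disc θ b < disc θ j ∧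
      (disc θ b = disc θ m → v (θ, i) ≤ v (θ, i'))
  above : ∀ m i, M m = some (θ, i) → disc θ j < disc θ m →
    ∃ b ∈ c, ∃ i', M b = some (θ, i') ∧ disc θ b ≤ disc θ m ∧ disc θ j < disc θ b ∧
      (disc θ b = disc θ m → v (θ, i') ≤ v (θ, i))

variable {H : HState k n} {r : Fin n} {T : Tree k n} {key : Fin n → ℝ} {src : Fin n → Fin n} {D : ℝ}
  {c : Fin n → Set (Fin n)} {θ : Fin k}

/-- The weight is a product of a discount and a value, so the combination over the four pairs of two
ads of one type and two slots collapses to a product of differences. Tightness of one pair removes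
its slack. -/
theorem HState.slack_split {b j : Fin n} {i i' : Fin n}
    (hb : H.slack (weight disc v) (θ, i') b = 0) :
    H.slack (weight disc v) (θ, i) j = H.slack (weight disc v) (θ, i') j +
      H.slack (weight disc v) (θ, i) b + (disc θ j - disc θ b) * (v (θ, i') - v (θ, i)) := by
  simp only [slack, weight] at hb ⊢
  linear_combination -hb

/-- This is the exchange argument: if the slot of larger discount held the ad of smaller value,
swapping the two would gain, so one of the crossing edges would have negative slack. -/
theorem HState.Good.values_le {r : ℕ} (hH : H.Good (weight disc v) r) {m b : Fin n} {i i' : Fin n}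
    (hm : H.M m = some (θ, i)) (hb : H.M b = some (θ, i')) (h : disc θ m < disc θ b) :
    v (θ, i) ≤ v (θ, i') := by
  have h1 := HState.slack_split (j := m) (i := i) (hH.tight b _ hb)
  rw [hH.tight m _ hm] at h1
  have := hH.feas (θ, i') m
  have := hH.feas (θ, i) b
  by_contra! hlt
  have := mul_pos (sub_pos.2 h) (sub_pos.2 hlt)
  nlinarith

/-- An edge to `m` is not better than an edge through an ad in a better place. -/
theorem Search.detour (h : Search (weight disc v) H r T key src D) (hH : H.Good (weight disc v) r)
    {b j : Fin n} {i i' : Fin n} (hj : j ∈ T.S) (hb : H.M b = some (θ, i'))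
    (hle : 0 ≤ (disc θ j - disc θ b) * (v (θ, i') - v (θ, i))) :
    (b ∉ T.S ∧ key j + H.slack (weight disc v) (θ, i') j ≤ key j + H.slack (weight disc v) (θ, i) j) ∨
    (b ∈ T.S ∧ key b + H.slack (weight disc v) (θ, i) b ≤ key j + H.slack (weight disc v) (θ, i) j) := by
  have h1 := HState.slack_split (j := j) (i := i) (hH.tight b _ hb)
  by_cases hbS : b ∈ T.S
  · have := h.edge b hbS _ hb j hj
    exact .inr ⟨hbS, by linarith⟩
  · have := hH.feas (θ, i) b
    exact .inl ⟨hbS, by linarith⟩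

/-- Within a group of equal discounts the product in `HState.slack_split` vanishes, so every slot of
the group is a valid detour. The nearest one towards `m` is a candidate: it is either outside of the
tree, or it replaces `j` and is closer to `m`. -/
theorem Search.same_group (h : Search (weight disc v) H r T key src D)
    (hH : H.Good (weight disc v) r) (hc : ∀ j ∈ T.S, Candidates disc v H.M θ j (c j)) (N : ℕ) :
    ∀ j ∈ T.S, ∀ m i, H.M m = some (θ, i) → m ∉ T.S → disc θ m = disc θ j →
      (m : ℕ) - j + (j - m) ≤ N →
      ∃ j' ∈ T.S, ∃ b ∈ c j', ∃ i', H.M b = some (θ, i') ∧ b ∉ T.S ∧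
        key j' + H.slack (weight disc v) (θ, i') j' ≤ key j + H.slack (weight disc v) (θ, i) j := by
  induction N with
  | zero =>
    intro j hj m i hm hmS _ hN
    have : m = j := Fin.ext (by omega)
    exact absurd (this ▸ hj) hmS
  | succ N ih =>
    intro j hj m i hm hmS hd hN
    obtain ⟨b, hbc, i', hb, hbd, hpos⟩ := (hc j hj).same m i hm hd (by rintro rfl; exact hmS hj)
    rcases h.detour hH (i := i) hj hb (by rw [hbd]; simp) with ⟨hbS, h1⟩ | ⟨hbS, h1⟩
    · exact ⟨j, hj, b, hbc, i', hb, hbS, h1⟩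
    · obtain ⟨j', hj', b', h2, i'', h3, h4, h5⟩ := ih b hbS m i hm hmS (by rw [hd, hbd]) (by
        rcases hpos with ⟨h2, h3⟩ | ⟨h2, h3⟩ <;>
          simp only [Fin.lt_def, Fin.le_def] at h2 h3 <;> omega)
      exact ⟨j', hj', b', h2, i'', h3, h4, h5.trans h1⟩

/-- Every edge from the tree to a matched ad outside is replaced by a candidate edge of no greater
path length. If the candidate slot on the way is itself in the tree, the search continues from
there; each such detour moves towards the slot `m` or reaches its group. -/
theorem Search.dominated (h : Search (weight disc v) H r T key src D)
    (hH : H.Good (weight disc v) r) (hanti : Antitone (disc θ))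
    (hc : ∀ j ∈ T.S, Candidates disc v H.M θ j (c j)) (N : ℕ) :
    ∀ j ∈ T.S, ∀ m i, H.M m = some (θ, i) → m ∉ T.S → (m : ℕ) - j + (j - m) ≤ N →
      ∃ j' ∈ T.S, ∃ b ∈ c j', ∃ i', H.M b = some (θ, i') ∧ b ∉ T.S ∧
        key j' + H.slack (weight disc v) (θ, i') j' ≤ key j + H.slack (weight disc v) (θ, i) j := by
  have hlt : ∀ {x y : Fin n}, disc θ x < disc θ y → (y : ℕ) < x := fun {x y} hxy => by
    by_contra hle
    exact absurd (hanti (show x ≤ y from not_lt.1 hle)) (not_le.2 hxy)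
  induction N with
  | zero =>
    intro j hj m i hm hmS hN
    have : m = j := Fin.ext (by omega)
    exact absurd (this ▸ hj) hmS
  | succ N ih =>
    intro j hj m i hm hmS hN
    -- When `b` is already in the group of `m`, it may lie beyond `m`, and the distance need not
    -- have decreased. Then `Search.same_group`, with its own induction, takes over.
    have key_step : ∀ b ∈ c j, ∀ i', H.M b = some (θ, i') →
        0 ≤ (disc θ j - disc θ b) * (v (θ, i') - v (θ, i)) →
        (disc θ b = disc θ m ∨ (m : ℕ) - b + (b - m) ≤ N) →
        ∃ j' ∈ T.S, ∃ b ∈ c j', ∃ i', H.M b = some (θ, i') ∧ b ∉ T.S ∧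
          key j' + H.slack (weight disc v) (θ, i') j' ≤
            key j + H.slack (weight disc v) (θ, i) j := by
      intro b hbc i' hb hle hcase
      rcases h.detour hH (i := i) hj hb hle with ⟨hbS, h1⟩ | ⟨hbS, h1⟩
      · exact ⟨j, hj, b, hbc, i', hb, hbS, h1⟩
      · obtain ⟨j', hj', b', h2, i'', h3, h4, h5⟩ : ∃ j' ∈ T.S, ∃ b' ∈ c j', ∃ i', H.M b' = some (θ, i') ∧
            b' ∉ T.S ∧ key j' + H.slack (weight disc v) (θ, i') j' ≤
              key b + H.slack (weight disc v) (θ, i) b := by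
          rcases hcase with hd | hN'
          · exact h.same_group hH hc _ b hbS m i hm hmS hd.symm le_rfl
          · exact ih b hbS m i hm hmS hN'
        exact ⟨j', hj', b', h2, i'', h3, h4, h5.trans h1⟩
    rcases lt_trichotomy (disc θ m) (disc θ j) with hd | hd | hd
    · obtain ⟨b, hbc, i', hb, h1, h2, h3⟩ := (hc j hj).below m i hm hd
      have hv : v (θ, i) ≤ v (θ, i') := by
        rcases h1.lt_or_eq with h1 | h1
        · exact hH.values_le hm hb h1
        · exact h3 h1.symm
      refine key_step b hbc i' hb (mul_nonneg (by linarith) (by linarith)) ?_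
      rcases h1.lt_or_eq with h1 | h1
      · have := hlt h1
        have := hlt h2
        right; omega
      · exact .inl h1.symm
    · exact h.same_group hH hc _ j hj m i hm hmS hd le_rfl
    · obtain ⟨b, hbc, i', hb, h1, h2, h3⟩ := (hc j hj).above m i hm hd
      have hv : v (θ, i') ≤ v (θ, i) := by
        rcases h1.lt_or_eq with h1 | h1
        · exact hH.values_le hb hm h1
        · exact h3 h1
      refine key_step b hbc i' hb (mul_nonneg_of_nonpos_of_nonpos (by linarith) (by linarith)) ?_
      rcases h1.lt_or_eq with h1 | h1
      · have := hlt h1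
        have := hlt h2
        right; omega
      · exact .inl h1

end Candidates


/-! ## The search for candidates -/

theorem Com.run_branch_true {b : BExp} {s s' : Com} {σ : Mem} (h : b.eval σ) :
    (Com.branch b s s').run σ = s.run σ := if_pos h

theorem Com.run_branch_false {b : BExp} {s s' : Com} {σ : Mem} (h : ¬ b.eval σ) :
    (Com.branch b s s').run σ = s'.run σ := if_neg h

/-- `x` is `0`, if no element has the property `P`, or the successor of an element with the
properties `P` and `R`. -/
def Pick (P R : ℕ → Prop) (x : ℕ) : Prop := (x = 0 ∧ ∀ h, ¬ P h) ∨ ∃ h, x = h + 1 ∧ P h ∧ R h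

/-- `x` picks an element of `V` of largest `f` among those with the same `A` as `g`. -/
def Largest (V : Set ℕ) (A f : ℕ → ℝ) (g x : ℕ) : Prop :=
  Pick (fun h => h ∈ V ∧ A h = A g) (fun h => ∀ m ∈ V, A m = A g → f m ≤ f h) x

/-- `x` picks an element of `V` of largest `A`, and among those of largest `f`, among those with
smaller `A` than `g`. -/
def Previous (V : Set ℕ) (A f : ℕ → ℝ) (g x : ℕ) : Prop :=
  Pick (fun h => h ∈ V ∧ A h < A g)
    (fun h => ∀ m ∈ V, A m < A g → A m ≤ A h ∧ (A m = A h → f m ≤ f h)) x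

section Sweep

variable {V V' : Set ℕ} {A f : ℕ → ℝ} {g g' x y : ℕ}

theorem Largest.of_empty : Largest ∅ A f g 0 := .inl ⟨rfl, by simp⟩

theorem Previous.of_empty : Previous ∅ A f g 0 := .inl ⟨rfl, by simp⟩

theorem Largest.congr (h : Largest V A f g x) (hA : A g = A g') : Largest V A f g' x := by
  simpa only [Largest, hA] using h

theorem Previous.congr (h : Previous V A f g x) (hA : A g = A g') : Previous V A f g' x := by
  simpa only [Previous, hA] using h

theorem Largest.of_lt (h : ∀ m ∈ V, A m < A g) : Largest V A f g 0 :=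
  .inl ⟨rfl, fun m hm => (h m hm.1).ne hm.2⟩

/-- When the discount changes, the best slot of the finished group becomes the new answer. If that
group held no ad of the type, the old answer stays, as it refers to the last occupied group. -/
theorem Previous.next (h : Previous V A f g y) (hx : Largest V A f g x) (hV : ∀ m ∈ V, A m ≤ A g)
    (hg : A g < A g') : Previous V A f g' (if 0 < x then x else y) := by
  rcases hx with ⟨rfl, hx⟩ | ⟨i, rfl, hi, hx⟩
  · simp only [lt_irrefl, if_false]
    have hlt : ∀ m ∈ V, A m < A g := fun m hm => (hV m hm).lt_of_ne fun h' => hx m ⟨hm, h'⟩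
    rcases h with ⟨rfl, h⟩ | ⟨i, rfl, hi, h⟩
    · exact .inl ⟨rfl, fun m hm => h m ⟨hm.1, hlt m hm.1⟩⟩
    · exact .inr ⟨i, rfl, ⟨hi.1, hi.2.trans hg⟩, fun m hm _ => h m hm (hlt m hm)⟩
  · simp only [Nat.succ_pos, if_true]
    exact .inr ⟨i, rfl, ⟨hi.1, hi.2 ▸ hg⟩, fun m hm _ => ⟨hi.2 ▸ hV m hm,
      fun h' => hx m hm (h'.trans hi.2)⟩⟩

theorem Largest.insert_new (h : Largest V A f g x) (hV : ∀ m, m ∈ V' ↔ m ∈ V ∨ m = g)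
    (hx : 0 < x → f (x - 1) ≤ f g) : Largest V' A f g (g + 1) := by
  refine .inr ⟨g, rfl, ⟨(hV g).2 (.inr rfl), rfl⟩, fun m hm hA => ?_⟩
  rcases (hV m).1 hm with hm | rfl
  · rcases h with ⟨rfl, h⟩ | ⟨i, rfl, hi, h⟩
    · exact (h m ⟨hm, hA⟩).elim
    · exact (h m hm hA).trans (by simpa using hx)
  · exact le_rfl

theorem Largest.insert_old (h : Largest V A f g x) (hV : ∀ m, m ∈ V' ↔ m ∈ V ∨ m = g)
    (hx : 0 < x) (hf : f g ≤ f (x - 1)) : Largest V' A f g x := by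
  rcases h with ⟨rfl, h⟩ | ⟨i, rfl, hi, h⟩
  · simp at hx
  · refine .inr ⟨i, rfl, ⟨(hV i).2 (.inl hi.1), hi.2⟩, fun m hm hA => ?_⟩
    rcases (hV m).1 hm with hm | rfl
    · exact h m hm hA
    · simpa using hf

/-- The slot that is added belongs to the current group, which is not among the earlier ones. -/
theorem Previous.insert (h : Previous V A f g x) (hV : ∀ m, m ∈ V' ↔ m ∈ V ∨ m = g) :
    Previous V' A f g x := by
  rcases h with ⟨rfl, h⟩ | ⟨i, rfl, hi, h⟩
  · refine .inl ⟨rfl, fun m hm => ?_⟩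
    rcases (hV m).1 hm.1 with hm' | rfl
    · exact h m ⟨hm', hm.2⟩
    · exact lt_irrefl _ hm.2
  · refine .inr ⟨i, rfl, ⟨(hV i).2 (.inl hi.1), hi.2⟩, fun m hm hA => ?_⟩
    rcases (hV m).1 hm with hm | rfl
    · exact h m hm hA
    · exact (lt_irrefl _ hA).elim

end Sweep

namespace Arr

/-- The candidate tables (next slot in the same group, best slot of the next group, to the right and
to the left), the root of a phase, and loop counters and scalars. -/
abbrev sameR : ℕ := 43
abbrev nextR : ℕ := 44
abbrev sameL : ℕ := 45
abbrev nextL : ℕ := 46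
abbrev used : ℕ := 47
abbrev top : ℕ := 48
abbrev root : ℕ := 49
abbrev vJ : ℕ := 50
abbrev slot : ℕ := 51
abbrev near : ℕ := 52
abbrev best : ℕ := 53
abbrev prevBest : ℕ := 54
abbrev prev : ℕ := 55
abbrev vT : ℕ := 56
abbrev vI : ℕ := 57

end Arr

/-- The value of the ad that the slot `e` holds, if it is an ad of type `vT`. -/
abbrev heldValue (e : NExp) : RExp := .get Arr.val (.var Arr.vT) (.row Arr.matchI e)

/-- The discount of the slot `e` for ads of type `vT`. -/
abbrev discAt (e : NExp) : RExp := .get Arr.disc (.var Arr.vT) e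

/-- Start a new group if the discount changes. -/
def sweepGroup : Com :=
  .branch (.and (.lt (.lit 0) (.var Arr.prev))
      (.not (.and (.le (discAt (.var Arr.slot)) (discAt (.sub (.var Arr.prev) (.lit 1))))
        (.le (discAt (.sub (.var Arr.prev) (.lit 1))) (discAt (.var Arr.slot))))))
    (.branch (.lt (.lit 0) (.var Arr.best)) (.letN Arr.prevBest (.var Arr.best)) .skip ;;
     .letN Arr.best (.lit 0) ;;
     .letN Arr.near (.lit 0))
    .skip

/-- Visit a slot that holds an ad of the current type. -/
def sweepVisit (better : BExp) : Com :=
  .branch (.and (.lt (.var Arr.slot) (.var Arr.root))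
      (.eq (.row Arr.matchT (.var Arr.slot)) (.var Arr.vT)))
    (.letN Arr.near (.add (.var Arr.slot) (.lit 1)) ;;
     .branch (.and (.lt (.lit 0) (.var Arr.best)) (.not better)) .skip
       (.letN Arr.best (.add (.var Arr.slot) (.lit 1))))
    .skip

/-- Visit a slot. -/
def sweepStep (pos : NExp) (better : BExp) (same next : ℕ) : Com :=
  .letN Arr.slot pos ;;
  sweepGroup ;;
  .setN same (.var Arr.vT) (.var Arr.slot) (.var Arr.near) ;;
  .setN next (.var Arr.vT) (.var Arr.slot) (.var Arr.prevBest) ;;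
  sweepVisit better ;;
  .letN Arr.prev (.add (.var Arr.slot) (.lit 1))

/-- Visit all slots. -/
def sweep (pos : NExp) (better : BExp) (same next : ℕ) : Com :=
  .letN Arr.near (.lit 0) ;;
  .letN Arr.best (.lit 0) ;;
  .letN Arr.prevBest (.lit 0) ;;
  .letN Arr.prev (.lit 0) ;;
  .forLt Arr.vJ (.add (.var Arr.root) (.lit 1)) (sweepStep pos better same next)

/-- A sweep changes only its table and its variables. -/
structure SweepFrame (same next : ℕ) (σ τ : Mem) : Prop where
  nat : ∀ a, a ∉ [same, next, 50, 51, 52, 53, 54, 55, 12] → τ.nat a = σ.nat a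
  real : τ.real = σ.real

/-- The slot `j` holds an ad of type `θ`. -/
def Holds (σ : Mem) (r θ j : ℕ) : Prop := j < r ∧ σ.nat Arr.matchT 0 j = θ

/-- The state of a sweep after `i` slots. -/
structure SweepInv (σ : Mem) (r θ same next : ℕ) (pos : ℕ → ℕ) (V : ℕ → Set ℕ) (A N W : ℕ → ℝ)
    (i : ℕ) (τ : Mem) : Prop where
  frame : SweepFrame same next σ τ
  row : ∀ θ', θ' ≠ θ → τ.nat same θ' = σ.nat same θ' ∧ τ.nat next θ' = σ.nat next θ'
  done : ∀ l < i, Largest (V l) A N (pos l) (τ.nat same θ (pos l)) ∧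
    Previous (V l) A W (pos l) (τ.nat next θ (pos l))
  state : (i = 0 ∧ τ.nat Arr.prev 0 0 = 0 ∧ τ.nat Arr.near 0 0 = 0 ∧ τ.nat Arr.best 0 0 = 0 ∧
      τ.nat Arr.prevBest 0 0 = 0) ∨
    ∃ l, i = l + 1 ∧ τ.nat Arr.prev 0 0 = pos l + 1 ∧ Largest (V i) A N (pos l) (τ.nat Arr.near 0 0) ∧
      Largest (V i) A W (pos l) (τ.nat Arr.best 0 0) ∧
      Previous (V i) A W (pos l) (τ.nat Arr.prevBest 0 0)

open Classical in
theorem sweepGroup_run (σ : Mem) :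
    let change := 0 < σ.nat Arr.prev 0 0 ∧
      σ.real Arr.disc (σ.nat Arr.vT 0 0) (σ.nat Arr.slot 0 0) ≠
        σ.real Arr.disc (σ.nat Arr.vT 0 0) (σ.nat Arr.prev 0 0 - 1)
    (sweepGroup.run σ).nat Arr.near 0 0 = (if change then 0 else σ.nat Arr.near 0 0) ∧
    (sweepGroup.run σ).nat Arr.best 0 0 = (if change then 0 else σ.nat Arr.best 0 0) ∧
    (sweepGroup.run σ).nat Arr.prevBest 0 0 = (if change then
      (if 0 < σ.nat Arr.best 0 0 then σ.nat Arr.best 0 0 else σ.nat Arr.prevBest 0 0)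
      else σ.nat Arr.prevBest 0 0) := by
  intro change
  -- The machine can only compare real numbers by `le`, so equality of discounts is tested in both
  -- directions.
  have hc : (BExp.eval σ (.and (.lt (.lit 0) (.var Arr.prev))
      (.not (.and (.le (discAt (.var Arr.slot)) (discAt (.sub (.var Arr.prev) (.lit 1))))
        (.le (discAt (.sub (.var Arr.prev) (.lit 1))) (discAt (.var Arr.slot))))))) ↔ change := by
    simp only [BExp.eval, NExp.eval, RExp.eval, change, ← le_antisymm_iff, ne_eq]
  by_cases h : change
  · rw [sweepGroup, Com.run_branch_true (hc.2 h)]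
    by_cases hb : 0 < σ.nat Arr.best 0 0
    · simp [Com.run, h, hb, BExp.eval, NExp.eval, Mem.setN_nat]
    · obtain hb' : σ.nat Arr.best 0 0 = 0 := by omega
      simp [Com.run, h, hb', BExp.eval, NExp.eval, Mem.setN_nat]
  · rw [sweepGroup, Com.run_branch_false (fun h' => h (hc.1 h')), Com.run_skip]
    simp only [h, if_false, and_self]

open Classical in
theorem sweepVisit_run (better : BExp) (σ : Mem) {r θ g : ℕ} (hr : σ.nat Arr.root 0 0 = r)
    (hθ : σ.nat Arr.vT 0 0 = θ) (hg : σ.nat Arr.slot 0 0 = g) {P : Prop}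
    (hP : better.eval (σ.setN Arr.near 0 0 (g + 1)) ↔ P) :
    ((sweepVisit better).run σ).nat Arr.near 0 0 =
      (if Holds σ r θ g then g + 1 else σ.nat Arr.near 0 0) ∧
    ((sweepVisit better).run σ).nat Arr.best 0 0 = (if Holds σ r θ g then
      (if 0 < σ.nat Arr.best 0 0 ∧ ¬ P then σ.nat Arr.best 0 0 else g + 1)
      else σ.nat Arr.best 0 0) := by
  have hc : BExp.eval σ (.and (.lt (.var Arr.slot) (.var Arr.root))
      (.eq (.row Arr.matchT (.var Arr.slot)) (.var Arr.vT))) ↔ Holds σ r θ g := by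
    simp only [BExp.eval, NExp.eval, hr, hθ, hg, Holds]
  by_cases h : Holds σ r θ g
  · rw [sweepVisit, Com.run_branch_true (hc.2 h)]
    simp only [Com.run, NExp.eval, hg, Com.run_skip, BExp.eval, hP]
    split_ifs with h1 h2 h2
    · simp [Mem.setN_nat]
    · exact absurd (by simpa [Mem.setN_nat] using h1) h2
    · exact absurd (by simpa [Mem.setN_nat] using h2) h1
    · simp [Mem.setN_nat, hg]
  · rw [sweepVisit, Com.run_branch_false (fun h' => h (hc.1 h')), Com.run_skip]
    simp only [h, if_false, and_self]

/-- The order in which a sweep visits the slots, and what it has seen. -/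
structure SweepOrder (σ : Mem) (r θ : ℕ) (pos : ℕ → ℕ) (V : ℕ → Set ℕ) (A N W : ℕ → ℝ) : Prop where
  disc : ∀ i j, σ.real Arr.disc θ i = σ.real Arr.disc θ j ↔ A i = A j
  mono : ∀ l l', l ≤ l' → l' ≤ r → A (pos l) ≤ A (pos l')
  near : ∀ l l', l ≤ l' → l' ≤ r → N (pos l) ≤ N (pos l')
  inj : ∀ l l', l ≤ r → l' ≤ r → pos l = pos l' → l = l'
  start : V 0 = ∅
  next : ∀ l ≤ r, ∀ m, m ∈ V (l + 1) ↔ m ∈ V l ∨ m = pos l ∧ Holds σ r θ (pos l)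

theorem SweepOrder.visited {σ : Mem} {r θ : ℕ} {pos : ℕ → ℕ} {V : ℕ → Set ℕ} {A N W : ℕ → ℝ}
    (h : SweepOrder σ r θ pos V A N W) {i : ℕ} (hi : i ≤ r + 1) {m : ℕ} (hm : m ∈ V i) :
    ∃ l < i, m = pos l := by
  induction i with
  | zero => simp [h.start] at hm
  | succ i ih =>
    rcases (h.next i (by omega) m).1 hm with hm | ⟨rfl, -⟩
    · obtain ⟨l, hl, rfl⟩ := ih (by omega) hm
      exact ⟨l, by omega, rfl⟩
    · exact ⟨i, by omega, rfl⟩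

/-- The order inside a step matters: the group is updated first, then the tables are written, and
only then does the slot itself become visible. So the tables never offer a slot as a candidate for
itself. -/
theorem SweepInv.step {σ τ : Mem} {r θ same next i : ℕ} {pos : ℕ → ℕ} {V : ℕ → Set ℕ} {A N W : ℕ → ℝ}
    {pe : NExp} {better : BExp}
    (h : SweepInv σ r θ same next pos V A N W i τ) (hi : i ≤ r) (hvJ : τ.nat Arr.vJ 0 0 = i)
    (hr : σ.nat Arr.root 0 0 = r) (hθ : σ.nat Arr.vT 0 0 = θ)
    (hs : (same = 43 ∧ next = 44) ∨ (same = 45 ∧ next = 46)) (ho : SweepOrder σ r θ pos V A N W)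
    (hpe : ∀ τ : Mem, τ.nat Arr.vJ 0 0 = i → τ.nat Arr.root 0 0 = r → pe.eval τ = pos i)
    (hbetter : ∀ τ : Mem, τ.real = σ.real → τ.nat Arr.matchI = σ.nat Arr.matchI →
      τ.nat Arr.vT 0 0 = θ →
      (better.eval τ ↔ W (τ.nat Arr.best 0 0 - 1) ≤ W (τ.nat Arr.slot 0 0))) :
    SweepInv σ r θ same next pos V A N W (i + 1)
      (((sweepStep pe better same next).run τ).setN Arr.vJ 0 0 (i + 1)) ∧
      ((sweepStep pe better same next).run τ).nat Arr.vJ 0 0 = i := by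
  classical
  have hV1 : Holds σ r θ (pos i) → ∀ m, m ∈ V (i + 1) ↔ m ∈ V i ∨ m = pos i := fun hh m => by
    rw [ho.next i hi]; simp [hh]
  have hV2 : ¬ Holds σ r θ (pos i) → V (i + 1) = V i := fun hh => by
    ext m; rw [ho.next i hi]; simp [hh]
  obtain ⟨⟨hfr, hre⟩, hrow, hdone, hst⟩ := h
  have hs' : same ≠ next ∧ 43 ≤ same ∧ same ≤ 46 ∧ 43 ≤ next ∧ next ≤ 46 := by
    clear hst; rcases hs with ⟨rfl, rfl⟩ | ⟨rfl, rfl⟩ <;> decide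
  have hne : ∀ a, a < 43 ∨ 46 < a → a ≠ same ∧ a ≠ next := fun a ha => by omega
  have hwG : sweepGroup.natWrites = [54, 12, 53, 52, 12] := rfl
  have hwV : (sweepVisit better).natWrites = [52, 12, 53, 12] := rfl
  have frσ : ∀ a, a < 12 ∨ 12 < a ∧ a < 43 ∨ 46 < a ∧ a < 50 ∨ 55 < a → τ.nat a = σ.nat a :=
    fun a ha => hfr a (by simp only [List.mem_cons, List.not_mem_nil, or_false]; omega)
  set g := pos i with hg
  set τ1 := τ.setN Arr.slot 0 0 g with h1
  have e1 : (Com.letN Arr.slot pe).run τ = τ1 := by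
    simp only [Com.run, NExp.eval, h1, hpe τ hvJ (by rw [frσ _ (by decide), hr])]
  have t1 : ∀ a, a ≠ Arr.slot → τ1.nat a = τ.nat a := fun a ha => Mem.setN_nat_of_ne _ _ _ _ _ ha
  have s1 : τ1.nat Arr.slot 0 0 = g := by simp [h1, Mem.setN_nat]
  set τ2 := sweepGroup.run τ1 with h2
  obtain ⟨n2, b2, p2⟩ := sweepGroup_run τ1
  have t2 : ∀ a, a < 12 ∨ 12 < a ∧ a < 52 ∨ 54 < a → τ2.nat a = τ1.nat a := fun a ha =>
    run_nat rfl τ1 (by rw [hwG]; simp only [List.mem_cons, List.not_mem_nil, or_false]; omega)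
  have r2 : τ2.real = σ.real := by
    rw [← hre]; funext a
    exact run_real rfl τ1 (by simp [sweepGroup, Com.realWrites, Com.skip])
  rw [← h2] at n2 b2 p2
  set τ3 := τ2.setN same θ g (τ2.nat Arr.near 0 0) with h3
  set τ4 := τ3.setN next θ g (τ2.nat Arr.prevBest 0 0) with h4
  have t4 : ∀ a, a < 43 ∨ 46 < a → τ4.nat a = τ2.nat a := fun a ha => by
    rw [h4, h3, Mem.setN_nat_of_ne _ _ _ _ _ (hne a ha).2, Mem.setN_nat_of_ne _ _ _ _ _ (hne a ha).1]
  have vT4 : τ4.nat Arr.vT 0 0 = θ := by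
    rw [t4 _ (by decide), t2 _ (by decide), t1 _ (by decide), frσ _ (by decide), hθ]
  have sl4 : τ4.nat Arr.slot 0 0 = g := by rw [t4 _ (by decide), t2 _ (by decide), s1]
  have mI4 : τ4.nat Arr.matchI = σ.nat Arr.matchI := by
    rw [t4 _ (by decide), t2 _ (by decide), t1 _ (by decide), frσ _ (by decide)]
  have mT4 : τ4.nat Arr.matchT = σ.nat Arr.matchT := by
    rw [t4 _ (by decide), t2 _ (by decide), t1 _ (by decide), frσ _ (by decide)]
  have rt4 : τ4.nat Arr.root 0 0 = r := by
    rw [t4 _ (by decide), t2 _ (by decide), t1 _ (by decide), frσ _ (by decide), hr]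
  set τ5 := (sweepVisit better).run τ4 with h5
  obtain ⟨n5, b5⟩ := sweepVisit_run better τ4 rt4 vT4 sl4
    (P := W (τ4.nat Arr.best 0 0 - 1) ≤ W g) (by
      rw [hbetter _ (by exact r2) (by rw [Mem.setN_nat_of_ne _ _ _ _ _ (by decide), mI4])
        (by rw [Mem.setN_nat_of_ne _ _ _ _ _ (by decide), vT4]),
        Mem.setN_nat_of_ne τ4 Arr.near _ _ _ (a' := Arr.best) (by decide),
        Mem.setN_nat_of_ne τ4 Arr.near _ _ _ (a' := Arr.slot) (by decide), sl4])
  have t5 : ∀ a, a < 12 ∨ 12 < a ∧ a < 52 ∨ 53 < a → τ5.nat a = τ4.nat a := fun a ha =>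
    run_nat rfl τ4 (by rw [hwV]; simp only [List.mem_cons, List.not_mem_nil, or_false]; omega)
  have r5 : τ5.real = σ.real := by
    rw [← r2]; funext a
    exact run_real rfl τ4 (by simp [sweepVisit, Com.realWrites, Com.skip])
  rw [← h5] at n5 b5
  have hH : Holds τ4 r θ g ↔ Holds σ r θ g := by simp only [Holds, mT4]
  simp only [hH] at n5 b5
  have erun : (sweepStep pe better same next).run τ = τ5.setN Arr.prev 0 0 (g + 1) := by
    have sl2 : τ2.nat Arr.slot 0 0 = g := by rw [t2 _ (by decide), s1]
    have vT2 : τ2.nat Arr.vT 0 0 = θ := by rw [← t4 _ (by decide), vT4]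
    have sl3 : τ3.nat Arr.slot 0 0 = g := by rw [h3, Mem.setN_nat_of_ne _ _ _ _ _ (hne _ (by decide)).1, sl2]
    have vT3 : τ3.nat Arr.vT 0 0 = θ := by rw [h3, Mem.setN_nat_of_ne _ _ _ _ _ (hne _ (by decide)).1, vT2]
    have pb3 : τ3.nat Arr.prevBest 0 0 = τ2.nat Arr.prevBest 0 0 := by
      rw [h3, Mem.setN_nat_of_ne _ _ _ _ _ (hne _ (by decide)).1]
    have sl5 : τ5.nat Arr.slot 0 0 = g := by rw [t5 _ (by decide), sl4]
    have e3 : (Com.setN same (.var Arr.vT) (.var Arr.slot) (.var Arr.near)).run τ2 = τ3 := by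
      simp only [Com.run, NExp.eval, sl2, vT2, h3]
    have e4 : (Com.setN next (.var Arr.vT) (.var Arr.slot) (.var Arr.prevBest)).run τ3 = τ4 := by
      simp only [Com.run, NExp.eval, sl3, vT3, pb3, h4]
    simp only [sweepStep]
    rw [Com.run, e1, Com.run, ← h2, Com.run, e3, Com.run, e4, Com.run, ← h5]
    simp only [Com.run, NExp.eval, sl5]
  rw [erun]
  have hvis : ∀ m ∈ V i, A m ≤ A g := by
    intro m hm
    obtain ⟨l, hl, rfl⟩ := ho.visited (by omega) hm
    exact ho.mono l i hl.le hi
  have hvisN : ∀ m ∈ V i, N m ≤ N g := by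
    intro m hm
    obtain ⟨l, hl, rfl⟩ := ho.visited (by omega) hm
    exact ho.near l i hl.le hi
  -- the state when the slot is recorded
  have hrec : Largest (V i) A N g (τ2.nat Arr.near 0 0) ∧ Largest (V i) A W g (τ2.nat Arr.best 0 0) ∧
      Previous (V i) A W g (τ2.nat Arr.prevBest 0 0) := by
    have vT1 : τ1.nat Arr.vT 0 0 = θ := by rw [t1 _ (by decide), frσ _ (by decide), hθ]
    have re1 : τ1.real = σ.real := hre
    rw [n2, b2, p2, s1, vT1, re1, t1 _ (by decide), t1 _ (by decide), t1 _ (by decide),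
      t1 _ (by decide)]
    rcases hst with ⟨rfl, q1, q2, q3, q4⟩ | ⟨l, rfl, q1, q2, q3, q4⟩
    · simp only [q1, q2, q3, q4, lt_irrefl, false_and, if_false, ho.start]
      exact ⟨.of_empty, .of_empty, .of_empty⟩
    · rw [q1]
      by_cases hd : A (pos l) = A g
      · have : ¬ (0 < pos l + 1 ∧ σ.real Arr.disc θ g ≠ σ.real Arr.disc θ (pos l + 1 - 1)) := by
          simp [(ho.disc _ _).2 hd]
        rw [if_neg this, if_neg this, if_neg this]
        exact ⟨q2.congr hd, q3.congr hd, q4.congr hd⟩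
      · have : (0 < pos l + 1 ∧ σ.real Arr.disc θ g ≠ σ.real Arr.disc θ (pos l + 1 - 1)) := by
          refine ⟨Nat.succ_pos _, fun h' => hd ((ho.disc _ _).1 (by simpa using h'.symm))⟩
        rw [if_pos this, if_pos this, if_pos this]
        have hlt : A (pos l) < A g := (ho.mono l (l + 1) (by omega) hi).lt_of_ne hd
        have hvl : ∀ m ∈ V (l + 1), A m ≤ A (pos l) := by
          intro m hm
          obtain ⟨l', hl', rfl⟩ := ho.visited (by omega) hm
          exact ho.mono l' l (by omega) (by omega)
        exact ⟨.of_lt fun m hm => (hvl m hm).trans_lt hlt, .of_lt fun m hm => (hvl m hm).trans_lt hlt,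
          by convert q4.next q3 hvl hlt using 1⟩
  obtain ⟨c1, c2, c3⟩ := hrec
  have best4 : τ4.nat Arr.best 0 0 = τ2.nat Arr.best 0 0 := by rw [t4 _ (by decide)]
  have near4 : τ4.nat Arr.near 0 0 = τ2.nat Arr.near 0 0 := by rw [t4 _ (by decide)]
  have pb5 : τ5.nat Arr.prevBest 0 0 = τ2.nat Arr.prevBest 0 0 := by
    rw [t5 _ (by decide), t4 _ (by decide)]
  have tab : ∀ a, 43 ≤ a ∧ a ≤ 46 →
      ((τ5.setN Arr.prev 0 0 (g + 1)).setN Arr.vJ 0 0 (i + 1)).nat a = τ4.nat a := fun a ha => by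
    rw [Mem.setN_nat_of_ne _ _ _ _ _ (fun h' => by subst h'; exact absurd ha (by decide)),
      Mem.setN_nat_of_ne _ _ _ _ _ (fun h' => by subst h'; exact absurd ha (by decide)), t5 _ (by omega)]
  have tab2 : ∀ a, 43 ≤ a ∧ a ≤ 46 → τ2.nat a = τ.nat a := fun a ha => by
    rw [t2 _ (by omega), t1 _ (fun h' => by subst h'; exact absurd ha (by decide))]
  have tabS : ∀ x y, τ4.nat same x y = if x = θ ∧ y = g then τ2.nat Arr.near 0 0 else τ.nat same x y := by
    intro x y
    rw [h4, Mem.setN_nat_of_ne _ _ _ _ _ hs'.1, h3, Mem.setN_nat, tab2 _ ⟨hs'.2.1, hs'.2.2.1⟩]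
    simp
  have tabN : ∀ x y, τ4.nat next x y = if x = θ ∧ y = g then τ2.nat Arr.prevBest 0 0 else τ.nat next x y := by
    intro x y
    rw [h4, Mem.setN_nat, h3, Mem.setN_nat_of_ne _ _ _ _ _ hs'.1.symm, tab2 _ hs'.2.2.2]
    simp
  refine ⟨?_, ?_⟩
  swap
  · rw [Mem.setN_nat_of_ne _ _ _ _ _ (by decide), t5 _ (by decide), t4 _ (by decide),
      t2 _ (by decide), t1 _ (by decide), hvJ]
  refine ⟨⟨fun a ha => ?_, r5⟩, fun θ' hθ' => ?_, fun l hl => ?_, .inr ⟨i, rfl, ?_, ?_, ?_, ?_⟩⟩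
  · have ha' := ha
    simp only [List.mem_cons, List.not_mem_nil, or_false, not_or] at ha
    rw [Mem.setN_nat_of_ne _ _ _ _ _ (by clear_value τ4; simp only [Arr.vJ]; omega),
      Mem.setN_nat_of_ne _ _ _ _ _ (by simp only [Arr.prev]; omega), t5 _ (by omega), h4,
      Mem.setN_nat_of_ne _ _ _ _ _ (by omega), h3, Mem.setN_nat_of_ne _ _ _ _ _ (by omega),
      t2 _ (by omega), t1 _ (by simp only [Arr.slot]; omega), hfr a ha']
  · rw [tab _ (by omega), tab _ (by omega)]
    refine ⟨?_, ?_⟩ <;> funext y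
    · rw [tabS, if_neg (fun h' => hθ' h'.1), (hrow θ' hθ').1]
    · rw [tabN, if_neg (fun h' => hθ' h'.1), (hrow θ' hθ').2]
  · rw [tab _ (by omega), tab _ (by omega), tabS, tabN]
    by_cases hli : l = i
    · subst hli
      simp only [← hg, and_self, if_true]
      exact ⟨c1, c3⟩
    · have : pos l ≠ g := fun h' => hli (ho.inj l i (by omega) hi h')
      simp only [this, and_false, if_false]
      exact hdone l (by omega)
  · rw [Mem.setN_nat_of_ne _ _ _ _ _ (by decide)]
    simp [Mem.setN_nat, hg]
  all_goals rw [Mem.setN_nat_of_ne _ _ _ _ _ (by decide), Mem.setN_nat_of_ne _ _ _ _ _ (by decide)]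
  all_goals by_cases hhub : Holds σ r θ g
  · rw [n5, if_pos hhub]
    refine c1.insert_new (hV1 hhub) fun hpos => ?_
    rcases c1 with ⟨h', -⟩ | ⟨y, hy, hyV, -⟩
    · omega
    · rw [hy, Nat.add_sub_cancel]; exact hvisN y hyV.1
  · rw [n5, if_neg hhub, near4, hV2 hhub]
    exact c1
  · rw [b5, if_pos hhub, best4]
    split_ifs with hbt
    · exact c2.insert_old (hV1 hhub) hbt.1 (not_le.1 hbt.2).le
    · refine c2.insert_new (hV1 hhub) fun hpos => ?_
      by_contra h'; exact hbt ⟨hpos, h'⟩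
  · rw [b5, if_neg hhub, best4, hV2 hhub]
    exact c2
  · rw [pb5]
    exact c3.insert (hV1 hhub)
  · rw [pb5, hV2 hhub]
    exact c3

/-- The order of the slots and the quantities to be compared are parameters, so one analysis covers
both directions. The sweep includes the root, which holds no ad but belongs to the tree and needs
candidates. -/
theorem wp_sweep {σ : Mem} {r θ same next c d : ℕ} {pos : ℕ → ℕ} {V : ℕ → Set ℕ} {A N W : ℕ → ℝ}
    {pe : NExp} {better : BExp}
    (hr : σ.nat Arr.root 0 0 = r) (hθ : σ.nat Arr.vT 0 0 = θ)
    (hs : (same = 43 ∧ next = 44) ∨ (same = 45 ∧ next = 46)) (ho : SweepOrder σ r θ pos V A N W)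
    (hpe : ∀ i, ∀ τ : Mem, τ.nat Arr.vJ 0 0 = i → τ.nat Arr.root 0 0 = r → pe.eval τ = pos i)
    (hbetter : ∀ τ : Mem, τ.real = σ.real → τ.nat Arr.matchI = σ.nat Arr.matchI →
      τ.nat Arr.vT 0 0 = θ →
      (better.eval τ ↔ W (τ.nat Arr.best 0 0 - 1) ≤ W (τ.nat Arr.slot 0 0)))
    (hc : (r + 1) * 20 + 6 + d ≤ c) :
    Wp (sweep pe better same next) (fun c τ => SweepFrame same next σ τ ∧
      (∀ θ', θ' ≠ θ → τ.nat same θ' = σ.nat same θ' ∧ τ.nat next θ' = σ.nat next θ') ∧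
      (∀ l ≤ r, Largest (V l) A N (pos l) (τ.nat same θ (pos l)) ∧
        Previous (V l) A W (pos l) (τ.nat next θ (pos l))) ∧ d ≤ c) c σ := by
  refine .seq (.straight rfl (c - 1) (by simp only [Com.cost]; omega) ?_)
  refine .seq (.straight rfl (c - 2) (by simp only [Com.cost]; omega) ?_)
  refine .seq (.straight rfl (c - 3) (by simp only [Com.cost]; omega) ?_)
  refine .seq (.straight rfl (c - 4) (by simp only [Com.cost]; omega) ?_)
  have hs' : same ≠ 50 ∧ same ≠ 52 ∧ same ≠ 53 ∧ same ≠ 54 ∧ same ≠ 55 ∧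
      next ≠ 50 ∧ next ≠ 52 ∧ next ≠ 53 ∧ next ≠ 54 ∧ next ≠ 55 := by
    rcases hs with ⟨rfl, rfl⟩ | ⟨rfl, rfl⟩ <;> decide
  have hcost : (sweepStep pe better same next).cost = 17 := rfl
  refine .forLt (r + 1) 18 (fun i c τ => SweepInv σ r θ same next pos V A N W i τ ∧ d ≤ c) d
    (by omega) ⟨⟨⟨?_, rfl⟩, ?_, ?_, .inl ⟨rfl, ?_⟩⟩, le_rfl⟩ ?_ ?_ ?_
  · intro a ha
    simp only [List.mem_cons, List.not_mem_nil, or_false, not_or] at ha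
    obtain ⟨h1, h2, h3, h4, h5, h6, h7, h8, h9⟩ := ha
    simp only [Com.run]
    rw [Mem.setN_nat_of_ne _ _ _ _ _ h3, Mem.setN_nat_of_ne _ _ _ _ _ h8,
      Mem.setN_nat_of_ne _ _ _ _ _ h7, Mem.setN_nat_of_ne _ _ _ _ _ h6, Mem.setN_nat_of_ne _ _ _ _ _ h5]
  · obtain ⟨h1, h2, h3, h4, h5, h6, h7, h8, h9, h10⟩ := hs'
    intro θ' _
    simp only [Com.run]
    rw [Mem.setN_nat_of_ne _ _ _ _ _ h1, Mem.setN_nat_of_ne _ _ _ _ _ h5,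
      Mem.setN_nat_of_ne _ _ _ _ _ h4, Mem.setN_nat_of_ne _ _ _ _ _ h3, Mem.setN_nat_of_ne _ _ _ _ _ h2,
      Mem.setN_nat_of_ne _ _ _ _ _ h6, Mem.setN_nat_of_ne _ _ _ _ _ h10,
      Mem.setN_nat_of_ne _ _ _ _ _ h9, Mem.setN_nat_of_ne _ _ _ _ _ h8, Mem.setN_nat_of_ne _ _ _ _ _ h7]
    exact ⟨rfl, rfl⟩
  · intro l hl; omega
  · simp [Com.run, NExp.eval, Mem.setN_nat]
  · rintro i c τ ⟨h, -⟩
    have : τ.nat Arr.root = σ.nat Arr.root := h.frame.nat _ (by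
      rcases hs with ⟨rfl, rfl⟩ | ⟨rfl, rfl⟩ <;> decide)
    simp only [NExp.eval, this, hr]
  · rintro i hi c τ ⟨h, hd⟩ hi'
    obtain ⟨h1, h2⟩ := h.step (pe := pe) (by omega) hi' hr hθ hs ho (hpe i) hbetter
    have hst : (sweepStep pe better same next).isStraight = true := rfl
    exact .straight hst c (by omega) ⟨h2, h1, hd⟩
  · rintro c τ ⟨h, hd⟩ -
    exact ⟨h.frame, h.row, fun l hl => h.done l (by omega), hd⟩

def sweepRight : Com :=
  sweep (.sub (.var Arr.root) (.var Arr.vJ))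
    (.le (heldValue (.sub (.var Arr.best) (.lit 1))) (heldValue (.var Arr.slot))) Arr.sameR Arr.nextR

def sweepLeft : Com :=
  sweep (.var Arr.vJ)
    (.le (heldValue (.var Arr.slot)) (heldValue (.sub (.var Arr.best) (.lit 1)))) Arr.sameL Arr.nextL

/-- The candidates for the slot `j` and the type `θ` in the memory `τ`, for the matching in `σ`. -/
structure CandTable (σ : Mem) (r θ j : ℕ) (τ : Mem) : Prop where
  sameR : Largest {h | Holds σ r θ h ∧ j < h} (σ.real Arr.disc θ) (fun h => -(h : ℝ)) j
    (τ.nat Arr.sameR θ j)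
  nextR : Previous {h | Holds σ r θ h ∧ j < h} (σ.real Arr.disc θ)
    (fun h => σ.real Arr.val θ (σ.nat Arr.matchI 0 h)) j (τ.nat Arr.nextR θ j)
  sameL : Largest {h | Holds σ r θ h ∧ h < j} (fun h => -σ.real Arr.disc θ h) (fun h => (h : ℝ)) j
    (τ.nat Arr.sameL θ j)
  nextL : Previous {h | Holds σ r θ h ∧ h < j} (fun h => -σ.real Arr.disc θ h)
    (fun h => -σ.real Arr.val θ (σ.nat Arr.matchI 0 h)) j (τ.nat Arr.nextL θ j)

/-- Fill the candidate tables. -/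
def candidates : Com := .forLt Arr.vT (.var Arr.types) (sweepRight ;; sweepLeft)

theorem wp_candidates {σ : Mem} {r k c d : ℕ} (hr : σ.nat Arr.root 0 0 = r)
    (hk : σ.nat Arr.types 0 0 = k)
    (hanti : ∀ θ < k, ∀ i j, i ≤ j → j ≤ r → σ.real Arr.disc θ j ≤ σ.real Arr.disc θ i)
    (hc : k * ((r + 1) * 40 + 14) + 2 + d ≤ c) :
    Wp candidates (fun c τ => (∀ a, a ∉ [43, 44, 45, 46, 50, 51, 52, 53, 54, 55, 56, 12] →
      τ.nat a = σ.nat a) ∧ τ.real = σ.real ∧ (∀ θ < k, ∀ j ≤ r, CandTable σ r θ j τ) ∧ d ≤ c) c σ := by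
  refine .forLt k ((r + 1) * 40 + 12) (fun i c τ =>
    (∀ a, a ∉ [43, 44, 45, 46, 50, 51, 52, 53, 54, 55, 56, 12] → τ.nat a = σ.nat a) ∧
    τ.real = σ.real ∧ (∀ θ < i, ∀ j ≤ r, CandTable σ r θ j τ) ∧ d ≤ c) d
    (by ring_nf at hc ⊢; omega) ⟨?_, rfl, by simp, le_rfl⟩ ?_ ?_ ?_
  · intro a ha
    exact Mem.setN_nat_of_ne _ _ _ _ _ (by rintro rfl; exact ha (by decide))
  · rintro i c τ ⟨h, -⟩
    simp only [NExp.eval, h Arr.types (by decide), hk]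
  · rintro θ hθ c τ ⟨hfr, hre, htab, hd⟩ hvT
    have hmT : τ.nat Arr.matchT = σ.nat Arr.matchT := hfr _ (by decide)
    have hmI : τ.nat Arr.matchI = σ.nat Arr.matchI := hfr _ (by decide)
    have hH : ∀ h, Holds τ r θ h ↔ Holds σ r θ h := fun h => by simp only [Holds, hmT]
    -- From the root downwards the discounts increase, and what has been visited lies to the right.
    -- Nearness is `-h`, and the best ad of a group of smaller discount is the one of largest value.
    refine .seq ((wp_sweep (r := r) (θ := θ) (d := c + ((r + 1) * 20 + 6)) (pos := fun l => r - l)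
      (V := fun l => {h | Holds σ r θ h ∧ r < h + l}) (A := σ.real Arr.disc θ)
      (N := fun h => -(h : ℝ)) (W := fun h => σ.real Arr.val θ (σ.nat Arr.matchI 0 h))
      (by rw [hfr _ (by decide), hr]) hvT (.inl ⟨rfl, rfl⟩) ?_ ?_ ?_ (by omega)).mono ?_)
    · refine ⟨fun i j => by rw [hre], fun l l' hl hl' => hanti θ hθ _ _ (by omega) (by omega), ?_,
        fun l l' hl hl' h => by omega, ?_, fun l hl m => ?_⟩
      · intro l l' hl hl'
        have : r - l' ≤ r - l := by omega
        simpa using (by exact_mod_cast this : ((r - l' : ℕ) : ℝ) ≤ ((r - l : ℕ) : ℝ))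
      · ext h
        simp only [Holds, Set.mem_ofPred_eq, Set.mem_empty_iff_false, iff_false]
        omega
      · simp only [Set.mem_ofPred_eq, hH]
        constructor
        · rintro ⟨h1, h2⟩
          by_cases hm : r < m + l
          · exact .inl ⟨h1, hm⟩
          · obtain rfl : m = r - l := by omega
            exact .inr ⟨rfl, h1⟩
        · rintro (⟨h1, h2⟩ | ⟨rfl, h1⟩)
          · exact ⟨h1, by omega⟩
          · exact ⟨h1, by omega⟩
    · intro i υ h1 h2
      simp only [NExp.eval, h1, h2]
    · intro υ h1 h2 h3
      simp only [BExp.eval, RExp.eval, NExp.eval, h1, h2, h3, hre, hmI]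
    · rintro c1 τ1 ⟨⟨hfr1, hre1⟩, hrow1, htab1, hd1⟩
      have hmT1 : τ1.nat Arr.matchT = σ.nat Arr.matchT := (hfr1 _ (by decide)).trans hmT
      have hmI1 : τ1.nat Arr.matchI = σ.nat Arr.matchI := (hfr1 _ (by decide)).trans hmI
      have hH1 : ∀ h, Holds τ1 r θ h ↔ Holds σ r θ h := fun h => by simp only [Holds, hmT1]
      have hvT1 : τ1.nat Arr.vT 0 0 = θ := by rw [hfr1 _ (by decide), hvT]
      -- In the other direction all signs are reversed: groups of larger discount come first, and
      -- the least valuable ad of the nearest group is wanted.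
      refine (wp_sweep (r := r) (θ := θ) (d := c) (pos := fun l => l)
        (V := fun l => {h | Holds σ r θ h ∧ h < l}) (A := fun h => -σ.real Arr.disc θ h)
        (N := fun h => (h : ℝ)) (W := fun h => -σ.real Arr.val θ (σ.nat Arr.matchI 0 h))
        (by rw [hfr1 _ (by decide), hfr _ (by decide), hr]) hvT1 (.inr ⟨rfl, rfl⟩) ?_ ?_ ?_
        (by omega)).mono ?_
      · refine ⟨fun i j => by rw [hre1, hre, neg_inj],
          fun l l' hl hl' => neg_le_neg (hanti θ hθ _ _ (by omega) (by omega)),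
          fun l l' hl _ => Nat.cast_le.2 hl, fun l l' hl hl' h => h, by simp, fun l hl m => ?_⟩
        simp only [Set.mem_ofPred_eq, hH1]
        constructor
        · rintro ⟨h1, h2⟩
          rcases Nat.lt_succ_iff_lt_or_eq.1 h2 with h | rfl
          · exact .inl ⟨h1, h⟩
          · exact .inr ⟨rfl, h1⟩
        · rintro (⟨h1, h2⟩ | ⟨rfl, h1⟩)
          · exact ⟨h1, by omega⟩
          · exact ⟨h1, by omega⟩
      · intro i υ h1 h2
        simp only [NExp.eval, h1]
      · intro υ h1 h2 h3
        simp only [BExp.eval, RExp.eval, NExp.eval, h1, h2, h3, hre1, hre, hmI1, neg_le_neg_iff]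
      · rintro c2 τ2 ⟨⟨hfr2, hre2⟩, hrow2, htab2, hd2⟩
        have e : ∀ a, a ≠ Arr.vT → (τ2.setN Arr.vT 0 0 (θ + 1)).nat a = τ2.nat a := fun a ha =>
          Mem.setN_nat_of_ne _ _ _ _ _ ha
        refine ⟨by rw [hfr2 _ (by decide), hvT1], fun a ha => ?_, hre2.trans (hre1.trans hre), ?_, hd.trans hd2⟩
        · rw [e a (by rintro rfl; exact ha (by decide)),
            hfr2 a (fun h => ha (by simp only [List.mem_cons] at h ⊢; tauto)),
            hfr1 a (fun h => ha (by simp only [List.mem_cons] at h ⊢; tauto)), hfr a ha]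
        · intro θ' hθ' j hj
          rcases Nat.lt_succ_iff_lt_or_eq.1 hθ' with h | rfl
          · have t := htab θ' h j hj
            have r1 := hrow1 θ' h.ne
            have r2 := hrow2 θ' h.ne
            refine ⟨?_, ?_, ?_, ?_⟩
            · rw [e _ (by decide), hfr2 _ (by decide), r1.1]; exact t.sameR
            · rw [e _ (by decide), hfr2 _ (by decide), r1.2]; exact t.nextR
            · rw [e _ (by decide), r2.1, hfr1 _ (by decide)]; exact t.sameL
            · rw [e _ (by decide), r2.2, hfr1 _ (by decide)]; exact t.nextL
          · have t1 := htab1 (r - j) (by omega)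
            have t2 := htab2 j hj
            simp only [Nat.sub_sub_self hj] at t1
            have hset : {h | Holds σ r θ' h ∧ r < h + (r - j)} = {h | Holds σ r θ' h ∧ j < h} := by
              ext h; simp only [Set.mem_ofPred_eq]
              constructor <;> rintro ⟨h1, h2⟩ <;> exact ⟨h1, by omega⟩
            rw [hset] at t1
            refine ⟨?_, ?_, ?_, ?_⟩
            · rw [e _ (by decide), hfr2 _ (by decide)]; exact t1.1
            · rw [e _ (by decide), hfr2 _ (by decide)]; exact t1.2
            · rw [e _ (by decide)]; exact t2.1
            · rw [e _ (by decide)]; exact t2.2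
  · rintro c τ ⟨h1, h2, h3, h4⟩ -
    exact ⟨h1, h2, h3, h4⟩


/-! ## The frontier of a search -/

section Frontier

variable {k n : ℕ}

/-- A row of numbers as a map between slots. -/
def slotMap (f : ℕ → ℕ) (m : Fin n) : Fin n := if h : f m < n then ⟨f m, h⟩ else m

theorem slotMap_eq {f : ℕ → ℕ} {m j : Fin n} (h : f m = j) : slotMap f m = j := by
  simp [slotMap, h]

/-- The state of the search: `st m` is `1` for the slots that are in the heap and `2` for those that
have joined the tree, `key` and `src` describe the best known edges to these slots, and `(a₀, j₀)` of
length `bu` is the best known edge to an unmatched ad. The pairs of slots in `P` and the pairs of slots and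
types in `Q` have been taken into account. -/
structure Frontier (w : Ad k n → Fin n → ℝ) (H : HState k n) (r : Fin n) (T : Tree k n) (st : ℕ → ℕ)
    (key : ℕ → ℝ) (src : ℕ → ℕ) (cur : Fin n) (D bu : ℝ) (a₀ : Ad k n) (j₀ : Fin n)
    (P : Fin n → Fin n → Prop) (Q : Fin n → Fin k → Prop) : Prop where
  search : Search w H r T (fun m => key m) (slotMap src) D
  le_two : ∀ x, st x ≤ 2
  held : ∀ x, st x ≠ 0 → ∃ m : Fin n, (m : ℕ) = x ∧ H.M m ≠ none
  tree : ∀ m : Fin n, m ∈ T.S ↔ m = r ∨ st m = 2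
  item : ∀ m : Fin n, st m = 1 → ∀ a, H.M m = some a →
    ∃ j ∈ T.S, src m = j ∧ key m = key j + H.slack w a j
  cand : ∀ j m, P j m → j ∈ T.S ∧
    (m ∈ T.S ∨ st m = 1 ∧ ∀ a, H.M m = some a → key m ≤ key j + H.slack w a j)
  best_mem : j₀ ∈ T.S
  best_free : ∀ m, H.M m ≠ some a₀
  best : bu = key j₀ + H.slack w a₀ j₀
  top : ∀ j θ, Q j θ → j ∈ T.S ∧
    ∀ i, (∀ m, H.M m ≠ some (θ, i)) → bu ≤ key j + H.slack w (θ, i) j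
  cur_mem : cur ∈ T.S
  cur_key : key cur = D

namespace Frontier

variable {w : Ad k n → Fin n → ℝ} {H : HState k n} {r : Fin n} {T : Tree k n} {st : ℕ → ℕ} {key : ℕ → ℝ}
  {src : ℕ → ℕ} {cur : Fin n} {D bu : ℝ} {a₀ : Ad k n} {j₀ : Fin n} {P P' : Fin n → Fin n → Prop}
  {Q Q' : Fin n → Fin k → Prop}

theorem mono (h : Frontier w H r T st key src cur D bu a₀ j₀ P Q) (hP : ∀ j m, P' j m → P j m)
    (hQ : ∀ j θ, Q' j θ → Q j θ) : Frontier w H r T st key src cur D bu a₀ j₀ P' Q' :=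
  { h with cand := fun j m hp => h.cand j m (hP j m hp), top := fun j θ hq => h.top j θ (hQ j θ hq) }

theorem init (hH : H.Good w r) (hst : ∀ x, st x = 0) (hk : key r = 0)
    (ha : ∀ m, H.M m ≠ some a₀) (hbu : bu = H.slack w a₀ r) :
    Frontier w H r ⟨H.u, H.p, fun _ => none, {r}⟩ st key src r 0 bu a₀ r (fun _ _ => False)
      (fun _ _ => False) := by
  refine ⟨.init hH hk, ?_, ?_, ?_, ?_, ?_, ?_, ha, ?_, ?_, ?_, hk⟩ <;> simp [hst, hk, hbu]

theorem root_none (hH : H.Good w r) : H.M r = none := (hH.dom r).2 le_rfl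

/-- An edge from `cur` to `m` is taken into account, and it is the best edge to `m`. -/
theorem relax (h : Frontier w H r T st key src cur D bu a₀ j₀ P Q) (hH : H.Good w r) {m : Fin n}
    {a : Ad k n} (hm : H.M m = some a) {κ : ℝ} (hκ : κ = D + H.slack w a cur)
    (hst : st m = 0 ∨ st m = 1 ∧ κ < key m) :
    Frontier w H r T (upd st m 1) (upd key m κ) (upd src m cur) cur D bu a₀ j₀
      (fun j m' => P j m' ∨ j = cur ∧ m' = m) Q := by
  have hmr : m ≠ r := by rintro rfl; simp [root_none hH] at hm
  have hmS : m ∉ T.S := by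
    rw [h.tree]; rintro (h' | h')
    · exact hmr h'
    · omega
  have hne : ∀ j ∈ T.S, (j : ℕ) ≠ m := fun j hj h' => hmS (Fin.ext h' ▸ hj)
  have hk : ∀ j ∈ T.S, upd key m κ j = key j := fun j hj => upd_of_ne (hne j hj)
  refine ⟨h.search.congr hk (fun j hj _ => ?_) (root_none hH), fun x => ?_, fun x hx => ?_, fun j => ?_,
    fun j hj b hb => ?_, fun j i hji => ?_, h.best_mem, h.best_free, ?_, fun j θ hq => ?_, h.cur_mem, ?_⟩
  · simp only [slotMap, upd_of_ne (hne j hj)]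
  · rw [upd_apply]; split_ifs
    · omega
    · exact h.le_two x
  · by_cases hxm : x = m
    · exact ⟨m, hxm.symm, by simp [hm]⟩
    · rw [upd_of_ne hxm] at hx; exact h.held x hx
  · by_cases hjm : j = m
    · subst hjm; rw [upd_self]; exact iff_of_false hmS (by simp [hmr])
    · rw [upd_of_ne (fun h' => hjm (Fin.ext h'))]; exact h.tree j
  · by_cases hjm : j = m
    · subst hjm
      obtain rfl : a = b := by simpa [hm] using hb
      exact ⟨cur, h.cur_mem, by rw [upd_self], by rw [upd_self, hk _ h.cur_mem, h.cur_key, hκ]⟩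
    · have hjm' : (j : ℕ) ≠ m := fun h' => hjm (Fin.ext h')
      rw [upd_of_ne hjm'] at hj
      obtain ⟨i, hi, h1, h2⟩ := h.item j hj b hb
      exact ⟨i, hi, by rw [upd_of_ne hjm', h1], by rw [upd_of_ne hjm', hk i hi, h2]⟩
  · have hjS : j ∈ T.S := by
      rcases hji with hP | ⟨rfl, -⟩
      · exact (h.cand j i hP).1
      · exact h.cur_mem
    refine ⟨hjS, ?_⟩
    rw [hk j hjS]
    by_cases him : i = m
    · subst him
      refine .inr ⟨by rw [upd_self], fun b hb => ?_⟩
      obtain rfl : a = b := by simpa [hm] using hb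
      rw [upd_self]
      rcases hji with hP | ⟨rfl, -⟩
      · rcases (h.cand j i hP).2 with h' | ⟨h1, h2⟩
        · exact absurd h' hmS
        · have h3 := h2 a hm
          rcases hst with h4 | ⟨-, h4⟩
          · omega
          · linarith
      · rw [hκ, h.cur_key]
    · have him' : (i : ℕ) ≠ m := fun h' => him (Fin.ext h')
      rcases hji with hP | ⟨-, h'⟩
      · rw [upd_of_ne him', upd_of_ne him']; exact (h.cand j i hP).2
      · exact absurd h' him
  · rw [hk _ h.best_mem]; exact h.best
  · obtain ⟨h1, h2⟩ := h.top j θ hq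
    refine ⟨h1, ?_⟩
    rw [hk j h1]; exact h2
  · rw [hk _ h.cur_mem, h.cur_key]

/-- An edge from `cur` to `m` is taken into account, but it is not needed. -/
theorem skip (h : Frontier w H r T st key src cur D bu a₀ j₀ P Q) {m : Fin n}
    {a : Ad k n} (hm : H.M m = some a) {κ : ℝ} (hκ : κ = D + H.slack w a cur)
    (hst : st m ≠ 0 ∧ (st m = 1 → key m ≤ κ)) :
    Frontier w H r T st key src cur D bu a₀ j₀ (fun j m' => P j m' ∨ j = cur ∧ m' = m) Q := by
  refine { h with cand := fun j i hji => ?_ }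
  rcases hji with hP | ⟨rfl, rfl⟩
  · exact h.cand j i hP
  · refine ⟨h.cur_mem, ?_⟩
    have := h.le_two i
    by_cases h2 : st i = 2
    · exact .inl ((h.tree i).2 (.inr h2))
    · refine .inr ⟨by omega, fun b hb => ?_⟩
      obtain rfl : a = b := by simpa [hm] using hb
      rw [h.cur_key, ← hκ]
      exact hst.2 (by omega)

/-- An edge from `cur` to the best unmatched ad of a type is taken into account. -/
theorem relaxTop {disc : Fin k → Fin n → ℝ} {v : Ad k n → ℝ}
    (h : Frontier (weight disc v) H r T st key src cur D bu a₀ j₀ P Q) (hH : H.Good (weight disc v) r)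
    (hd : ∀ θ j, 0 ≤ disc θ j) {θ : Fin k} {i : Fin n} (hi : ∀ m, H.M m ≠ some (θ, i))
    (hbest : ∀ i', (∀ m, H.M m ≠ some (θ, i')) → v (θ, i') ≤ v (θ, i)) {κ : ℝ}
    (hκ : κ = D + H.slack (weight disc v) (θ, i) cur) :
    (bu ≤ κ → Frontier (weight disc v) H r T st key src cur D bu a₀ j₀ P
      (fun j θ' => Q j θ' ∨ j = cur ∧ θ' = θ)) ∧
    (κ ≤ bu → Frontier (weight disc v) H r T st key src cur D κ (θ, i) cur P
      (fun j θ' => Q j θ' ∨ j = cur ∧ θ' = θ)) := by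
  -- Unmatched ads have dual variable 0, so within a type a larger value means a smaller slack,
  -- whatever the slot is.
  have hle : ∀ i', (∀ m, H.M m ≠ some (θ, i')) →
      κ ≤ key cur + H.slack (weight disc v) (θ, i') cur := by
    intro i' hi'
    rw [hκ, h.cur_key]
    simp only [HState.slack, weight, hH.free _ hi, hH.free _ hi']
    have := mul_le_mul_of_nonneg_left (hbest i' hi') (hd θ cur)
    linarith
  refine ⟨fun hb => { h with top := fun j θ' hq => ?_ }, fun hb => { h with
    top := fun j θ' hq => ?_
    best_mem := h.cur_mem
    best_free := hi
    best := by rw [h.cur_key, hκ] }⟩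
  · rcases hq with hq | ⟨rfl, rfl⟩
    · exact h.top j θ' hq
    · exact ⟨h.cur_mem, fun i' hi' => hb.trans (hle i' hi')⟩
  · rcases hq with hq | ⟨rfl, rfl⟩
    · exact ⟨(h.top j θ' hq).1, fun i' hi' => hb.trans ((h.top j θ' hq).2 i' hi')⟩
    · exact ⟨h.cur_mem, hle⟩

/-- When the candidates of all slots of the tree have been taken into account, no edge out of the tree is
shorter than the best known edges. -/
theorem lower {disc : Fin k → Fin n → ℝ} {v : Ad k n → ℝ}
    (h : Frontier (weight disc v) H r T st key src cur D bu a₀ j₀ P Q) (hH : H.Good (weight disc v) r)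
    (hanti : ∀ θ, Antitone (disc θ)) {c : Fin k → Fin n → Set (Fin n)}
    (hc : ∀ θ, ∀ j ≤ r, Candidates disc v H.M θ j (c θ j))
    (hP : ∀ j ∈ T.S, ∀ θ, ∀ m ∈ c θ j, P j m) (hQ : ∀ j ∈ T.S, ∀ θ, Q j θ) {x : ℝ} (hx : x ≤ bu)
    (hx' : ∀ m : Fin n, st m = 1 → x ≤ key m) {a : Ad k n} (ha : ∀ m ∈ T.S, H.M m ≠ some a) {j : Fin n}
    (hj : j ∈ T.S) : x ≤ key j + H.slack (weight disc v) a j := by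
  obtain ⟨θ, i⟩ := a
  by_cases hm : ∃ m, H.M m = some (θ, i)
  · obtain ⟨m, hm⟩ := hm
    have hle : ∀ j ∈ T.S, j ≤ r := fun j hj => by
      by_cases hjr : j = r
      · exact hjr.le
      · have := mt (hH.dom j).2 (h.search.matched j hj hjr)
        exact Fin.le_def.2 (by omega)
    -- The edge itself may never have been looked at, but the candidate edge that dominates it has;
    -- its slot is outside of the tree, hence in the heap with a key that is small enough.
    obtain ⟨j', hj', b, hb, i', hbi, hbS, h1⟩ := h.search.dominated (θ := θ) hH (hanti θ)
      (fun j hj => hc θ j (hle j hj)) _ j hj m i hm (fun hmS => ha m hmS hm) le_rfl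
    rcases (h.cand j' b (hP j' hj' θ b hb)).2 with h2 | ⟨h2, h3⟩
    · exact absurd h2 hbS
    · exact (hx' b h2).trans ((h3 _ hbi).trans h1)
  · push Not at hm
    exact hx.trans ((h.top j θ (hQ j hj θ)).2 i hm)

/-- The slot with the shortest edge joins the tree. -/
theorem pop {disc : Fin k → Fin n → ℝ} {v : Ad k n → ℝ}
    (h : Frontier (weight disc v) H r T st key src cur D bu a₀ j₀ P Q) (hH : H.Good (weight disc v) r)
    (hanti : ∀ θ, Antitone (disc θ)) {c : Fin k → Fin n → Set (Fin n)}
    (hc : ∀ θ, ∀ j ≤ r, Candidates disc v H.M θ j (c θ j))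
    (hP : ∀ j ∈ T.S, ∀ θ, ∀ m ∈ c θ j, P j m) (hQ : ∀ j ∈ T.S, ∀ θ, Q j θ) {x : ℕ} (hst : st x = 1)
    (hbu : key x ≤ bu) (hmin : ∀ m : Fin n, st m = 1 → key x ≤ key m) :
    ∃ m : Fin n, (m : ℕ) = x ∧ m ∉ T.S ∧ ∃ a j, H.M m = some a ∧ T.NextTight (weight disc v) a j ∧
      Frontier (weight disc v) H r ((T.addEdge (weight disc v) a j).addSlot m) (upd st x 2) key src m (key x)
        bu a₀ j₀ P Q := by
  obtain ⟨m, rfl, hm⟩ := h.held x (by omega)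
  obtain ⟨a, ha⟩ := Option.ne_none_iff_exists'.1 hm
  obtain ⟨j, hj, hsrc, hkey⟩ := h.item m hst a ha
  have hmr : m ≠ r := by rintro rfl; simp [root_none hH] at ha
  have hmS : m ∉ T.S := by
    rw [h.tree]; rintro (h' | h')
    · exact hmr h'
    · omega
  -- The least key in the heap is a lower bound for all edges out of the tree, so the tentative edge
  -- to `m` is a next tight edge.
  have hlow : ∀ a', (∀ m ∈ T.S, H.M m ≠ some a') → ∀ j' ∈ T.S,
      key m ≤ key j' + H.slack (weight disc v) a' j' := fun a' ha' j' hj' =>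
    h.lower hH hanti hc hP hQ hbu hmin ha' hj'
  have hnot : ∀ m' ∈ T.S, H.M m' ≠ some a := fun m' hm' h' => hmS (hH.inj _ _ _ ha h' ▸ hm')
  have hS : ∀ i, i ∈ ((T.addEdge (weight disc v) a j).addSlot m).S ↔ i = m ∨ i ∈ T.S := fun i =>
    mem_insert
  refine ⟨m, rfl, hmS, a, j, ha, h.search.nextTight hnot hj (by simpa only [← hkey] using hlow), ?_⟩
  refine ⟨h.search.grow hH ha hmS (slotMap_eq hsrc) hj hkey hlow, fun x => ?_, fun x hx => ?_, fun i => ?_,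
    fun i hi b hb => ?_, fun i m' hp => ?_, (hS _).2 (.inr h.best_mem), h.best_free, h.best,
    fun i θ hq => ⟨(hS _).2 (.inr (h.top i θ hq).1), (h.top i θ hq).2⟩, (hS _).2 (.inl rfl), rfl⟩
  · rw [upd_apply]; split_ifs
    · omega
    · exact h.le_two x
  · by_cases hxm : x = m
    · exact ⟨m, hxm.symm, hm⟩
    · rw [upd_of_ne hxm] at hx; exact h.held x hx
  · rw [hS, h.tree]
    by_cases him : i = m
    · subst him; simp [upd_self]
    · rw [upd_of_ne (fun h' => him (Fin.ext h'))]; simp [him]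
  · by_cases him : i = m
    · subst him; rw [upd_self] at hi; omega
    · rw [upd_of_ne (fun h' => him (Fin.ext h'))] at hi
      obtain ⟨j', hj', h1⟩ := h.item i hi b hb
      exact ⟨j', (hS _).2 (.inr hj'), h1⟩
  · obtain ⟨h1, h2⟩ := h.cand i m' hp
    refine ⟨(hS _).2 (.inr h1), ?_⟩
    by_cases hm' : m' = m
    · exact .inl ((hS _).2 (.inl hm'))
    · rcases h2 with h2 | h2
      · exact .inl ((hS _).2 (.inr h2))
      · rw [upd_of_ne (fun h' => hm' (Fin.ext h'))]; exact .inr h2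

end Frontier

end Frontier


/-! ## The search as a program -/

namespace Arr

/-- The end of the search, the best edge to an unmatched ad, the path of the augmentation. -/
abbrev done : ℕ := 58
abbrev buT : ℕ := 59
abbrev buJ : ℕ := 60
abbrev pT : ℕ := 61
abbrev pI : ℕ := 62
abbrev pJ : ℕ := 63
abbrev oT : ℕ := 64
abbrev oI : ℕ := 65
abbrev vS : ℕ := 66
/-- The current distance, and the length of the best edge to an unmatched ad (real numbers). -/
abbrev dist : ℕ := 12
abbrev bu : ℕ := 13

end Arr

/-- Take the best unmatched ad of the type `vT` into account. -/
def relaxTop : Com :=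
  .letR Arr.newKey (.add (.var Arr.dist) (.sub (.get Arr.dualP (.lit 0) (.var Arr.cur))
    (.mul (discAt (.var Arr.cur))
      (.get Arr.val (.var Arr.vT) (.sub (.row Arr.top (.var Arr.vT)) (.lit 1)))))) ;;
  .branch (.le (.var Arr.bu) (.var Arr.newKey)) .skip
    (.letN Arr.buT (.var Arr.vT) ;; .letN Arr.buJ (.var Arr.cur) ;; .letR Arr.bu (.var Arr.newKey))

/-- Take the candidate in the table `a` into account. -/
def relaxCand (a : ℕ) : Com :=
  .branch (.lt (.lit 0) (.get a (.var Arr.vT) (.var Arr.cur)))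
    (.letN Arr.item (.sub (.get a (.var Arr.vT) (.var Arr.cur)) (.lit 1)) ;;
     .letR Arr.newKey (.add (.var Arr.dist) (.sub (.add
       (.get Arr.dualU (.var Arr.vT) (.row Arr.matchI (.var Arr.item)))
       (.get Arr.dualP (.lit 0) (.var Arr.cur)))
       (.mul (discAt (.var Arr.cur)) (heldValue (.var Arr.item))))) ;;
     heapUpdate)
    .skip

def relaxType : Com :=
  relaxTop ;; relaxCand 43 ;; relaxCand 44 ;; relaxCand 45 ;; relaxCand 46

/-- Take the edges of the slot `cur` into account. -/
def relaxAll : Com := .forLt Arr.vT (.var Arr.types) relaxType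

section

variable {k n : ℕ}

/-- The part of the memory that does not change during a search. -/
structure Env (disc : Fin k → Fin n → ℝ) (v : Ad k n → ℝ) (H : HState k n) (r : Fin n)
    (tab : ℕ → ℕ → ℕ → ℕ) (top : Fin k → Fin n) (τ : Mem) : Prop where
  num : τ.nat Arr.num 0 0 = n
  types : τ.nat Arr.types 0 0 = k
  root : τ.nat Arr.root 0 0 = r
  disc : ∀ (θ : Fin k) (j : Fin n), τ.real Arr.disc θ j = disc θ j
  val : ∀ a : Ad k n, τ.real Arr.val a.1 a.2 = v a
  u : ∀ a : Ad k n, τ.real Arr.dualU a.1 a.2 = H.u a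
  p : ∀ j : Fin n, τ.real Arr.dualP 0 j = H.p j
  M : ∀ (j : Fin n) a, H.M j = some a → τ.nat Arr.matchT 0 j = a.1 ∧ τ.nat Arr.matchI 0 j = a.2
  tab : ∀ a, 43 ≤ a → a ≤ 46 → τ.nat a = tab a
  top : ∀ θ : Fin k, τ.nat Arr.top 0 θ = top θ + 1

/-- The slots in the candidate tables. -/
def candSet (tab : ℕ → ℕ → ℕ → ℕ) (θ : Fin k) (j : Fin n) : Set (Fin n) :=
  {b | ∃ a, 43 ≤ a ∧ a ≤ 46 ∧ tab a θ j = b + 1}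

/-- The tables are correct. -/
structure Plan (disc : Fin k → Fin n → ℝ) (v : Ad k n → ℝ) (H : HState k n) (r : Fin n)
    (tab : ℕ → ℕ → ℕ → ℕ) (top : Fin k → Fin n) : Prop where
  nonneg : ∀ θ j, 0 ≤ disc θ j
  anti : ∀ θ, Antitone (disc θ)
  good : H.Good (weight disc v) r
  cand : ∀ θ, ∀ j ≤ r, Candidates disc v H.M θ j (candSet tab θ j)
  held : ∀ a (θ : Fin k) (j : Fin n) h, j ≤ r → 43 ≤ a → a ≤ 46 → tab a θ j = h + 1 →
    ∃ m : Fin n, (m : ℕ) = h ∧ ∃ i, H.M m = some (θ, i)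
  free : ∀ θ m, H.M m ≠ some (θ, top θ)
  best : ∀ θ i, (∀ m, H.M m ≠ some (θ, i)) → v (θ, i) ≤ v (θ, top θ)

variable {disc : Fin k → Fin n → ℝ} {v : Ad k n → ℝ} {H : HState k n} {r : Fin n}
  {tab : ℕ → ℕ → ℕ → ℕ} {top : Fin k → Fin n}

theorem Env.congr {σ τ : Mem} (h : Env disc v H r tab top σ)
    (hn : ∀ a, a < 5 ∨ 43 ≤ a ∧ a ≤ 49 → τ.nat a = σ.nat a)
    (hr : ∀ a, a < 2 ∨ a = 8 ∨ a = 9 → τ.real a = σ.real a) : Env disc v H r tab top τ where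
  num := by rw [hn _ (by decide)]; exact h.num
  types := by rw [hn _ (by decide)]; exact h.types
  root := by rw [hn _ (by decide)]; exact h.root
  disc := by rw [hr _ (by decide)]; exact h.disc
  val := by rw [hr _ (by decide)]; exact h.val
  u := by rw [hr _ (by decide)]; exact h.u
  p := by rw [hr _ (by decide)]; exact h.p
  M := by rw [hn _ (by decide), hn _ (by decide)]; exact h.M
  tab a h1 h2 := by rw [hn a (by omega)]; exact h.tab a h1 h2
  top := by rw [hn _ (by decide)]; exact h.top

/-- The memory during a search. -/
structure SearchMem (disc : Fin k → Fin n → ℝ) (v : Ad k n → ℝ) (H : HState k n) (r : Fin n)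
    (tab : ℕ → ℕ → ℕ → ℕ) (top : Fin k → Fin n) (T : Tree k n) (cur : Fin n)
    (P : Fin n → Fin n → Prop) (Q : Fin n → Fin k → Prop) (τ : Mem) : Prop where
  env : Env disc v H r tab top τ
  inv : (heapOf τ).Inv n
  bk : ∀ h, (heapOf τ).bk h = 0
  bal : (heapOf τ).Balanced
  at_cur : τ.nat Arr.cur 0 0 = cur
  frontier : ∃ (θ₀ : Fin k) (j₀ : Fin n), τ.nat Arr.buT 0 0 = θ₀ ∧ τ.nat Arr.buJ 0 0 = j₀ ∧
    Frontier (weight disc v) H r T (τ.nat Arr.hSt 0) (τ.real Arr.key 0) (τ.nat Arr.src 0) cur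
      (τ.real Arr.dist 0 0) (τ.real Arr.bu 0 0) (θ₀, top θ₀) j₀ P Q

/-- The tables of candidates cover only the slots up to the root; tree slots other than the root are
matched and hence lie before it. -/
theorem Frontier.le_root {w : Ad k n → Fin n → ℝ} {T : Tree k n} {st : ℕ → ℕ} {key : ℕ → ℝ}
    {src : ℕ → ℕ} {cur : Fin n} {D bu : ℝ} {a₀ : Ad k n} {j₀ : Fin n} {P : Fin n → Fin n → Prop}
    {Q : Fin n → Fin k → Prop} (h : Frontier w H r T st key src cur D bu a₀ j₀ P Q)
    (hH : H.Good w r) {j : Fin n} (hj : j ∈ T.S) : j ≤ r := by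
  by_cases hjr : j = r
  · exact hjr.le
  · have := mt (hH.dom j).2 (h.search.matched j hj hjr)
    exact Fin.le_def.2 (by omega)

theorem SearchMem.mono {T : Tree k n} {cur : Fin n} {P P' : Fin n → Fin n → Prop}
    {Q Q' : Fin n → Fin k → Prop} {τ : Mem} (h : SearchMem disc v H r tab top T cur P Q τ)
    (hP : ∀ j m, P' j m → P j m) (hQ : ∀ j θ, Q' j θ → Q j θ) :
    SearchMem disc v H r tab top T cur P' Q' τ :=
  let ⟨θ₀, j₀, h1, h2, h3⟩ := h.frontier
  { h with frontier := ⟨θ₀, j₀, h1, h2, h3.mono hP hQ⟩ }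

theorem relaxTop_run (hp : Plan disc v H r tab top) {T : Tree k n} {cur : Fin n}
    {P : Fin n → Fin n → Prop} {Q : Fin n → Fin k → Prop} {σ : Mem}
    (h : SearchMem disc v H r tab top T cur P Q σ) {θ : Fin k} (hθ : σ.nat Arr.vT 0 0 = θ) :
    SearchMem disc v H r tab top T cur P (fun j θ' => Q j θ' ∨ j = cur ∧ θ' = θ) (relaxTop.run σ) ∧
    heapOf (relaxTop.run σ) = heapOf σ ∧ (relaxTop.run σ).nat Arr.vT 0 0 = θ := by
  have hwn : relaxTop.natWrites = [12, 59, 60] := rfl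
  have hwr : relaxTop.realWrites = [11, 13] := rfl
  have fn : ∀ a, a ≠ 12 ∧ a ≠ 59 ∧ a ≠ 60 → (relaxTop.run σ).nat a = σ.nat a := fun a ha =>
    run_nat rfl σ (by rw [hwn]; simpa using ha)
  have fr : ∀ a, a ≠ 11 ∧ a ≠ 13 → (relaxTop.run σ).real a = σ.real a := fun a ha =>
    run_real rfl σ (by rw [hwr]; simpa using ha)
  have hheap : heapOf (relaxTop.run σ) = heapOf σ := by
    simp only [heapOf, fn _ (by decide : Arr.hSt ≠ 12 ∧ _), fn _ (by decide : Arr.hH ≠ 12 ∧ _),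
      fn _ (by decide : Arr.hPa ≠ 12 ∧ _), fn _ (by decide : Arr.hCh ≠ 12 ∧ _),
      fn _ (by decide : Arr.hBk ≠ 12 ∧ _), fn _ (by decide : Arr.hPl ≠ 12 ∧ _),
      fn _ (by decide : Arr.hPn ≠ 12 ∧ _), fn _ (by decide : Arr.hCnt ≠ 12 ∧ _),
      fr _ (by decide : Arr.key ≠ 11 ∧ _)]
  refine ⟨⟨h.env.congr (fun a ha => fn a (by omega)) (fun a ha => fr a (by omega)),
    by rw [hheap]; exact h.inv, by rw [hheap]; exact h.bk, by rw [hheap]; exact h.bal,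
    by rw [fn _ (by decide)]; exact h.at_cur, ?_⟩, hheap, by rw [fn _ (by decide), hθ]⟩
  obtain ⟨θ₀, j₀, h1, h2, h3⟩ := h.frontier
  obtain ⟨κ, hκ⟩ : ∃ κ, κ = σ.real Arr.dist 0 0 + H.slack (weight disc v) (θ, top θ) cur := ⟨_, rfl⟩
  -- The program leaves out the dual variable of the ad, which is 0 because the ad is unmatched.
  have hval : σ.real Arr.dist 0 0 + (σ.real Arr.dualP 0 (σ.nat Arr.cur 0 0) -
      σ.real Arr.disc (σ.nat Arr.vT 0 0) (σ.nat Arr.cur 0 0) *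
      σ.real Arr.val (σ.nat Arr.vT 0 0) (σ.nat Arr.top 0 (σ.nat Arr.vT 0 0) - 1)) = κ := by
    have := h.env.val (θ, top θ)
    simp only at this
    rw [hκ, HState.slack, weight, hp.good.free _ (hp.free θ), hθ, h.at_cur, h.env.top, h.env.p, h.env.disc,
      Nat.add_sub_cancel, this]
    ring
  obtain ⟨c1, c2⟩ := h3.relaxTop hp.good hp.nonneg (hp.free θ) (hp.best θ) hκ
  have e0 : (Com.letR Arr.newKey (.add (.var Arr.dist) (.sub (.get Arr.dualP (.lit 0) (.var Arr.cur))
    (.mul (discAt (.var Arr.cur))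
      (.get Arr.val (.var Arr.vT) (.sub (.row Arr.top (.var Arr.vT)) (.lit 1))))))).run σ =
      σ.setR Arr.newKey 0 0 κ := by
    rw [← hval]; rfl
  by_cases hb : σ.real Arr.bu 0 0 ≤ κ
  · have hrun : relaxTop.run σ = σ.setR Arr.newKey 0 0 κ := by
      rw [relaxTop, Com.run, e0, Com.run_branch_true, Com.run_skip]
      simpa [BExp.eval, RExp.eval, NExp.eval, Mem.setR_real] using hb
    rw [hrun]
    exact ⟨θ₀, j₀, h1, h2, c1 hb⟩
  · have hrun : relaxTop.run σ = (((σ.setR Arr.newKey 0 0 κ).setN Arr.buT 0 0 θ).setN Arr.buJ 0 0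
        cur).setR Arr.bu 0 0 κ := by
      rw [relaxTop, Com.run, e0, Com.run_branch_false]
      · simp only [Com.run, NExp.eval, RExp.eval, Mem.setR_nat, hθ,
          Mem.setN_nat_of_ne _ Arr.buT 0 0 θ (by decide : Arr.cur ≠ Arr.buT), h.at_cur, Mem.setN_real]
        simp [Mem.setR_real]
      · simpa [BExp.eval, RExp.eval, NExp.eval, Mem.setR_real] using hb
    have h4 := c2 (not_le.1 hb).le
    refine ⟨θ, cur, by simp [hrun, Mem.setN_nat], by simp [hrun, Mem.setN_nat], ?_⟩
    rw [fn _ (by decide), fr _ (by decide), fn _ (by decide), fr _ (by decide)]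
    rw [show (relaxTop.run σ).real Arr.bu 0 0 = κ by simp [hrun, Mem.setR_real]]
    exact h4

theorem relaxCand_run (hp : Plan disc v H r tab top) {T : Tree k n} {cur : Fin n}
    {P : Fin n → Fin n → Prop} {Q : Fin n → Fin k → Prop} {σ : Mem} {a : ℕ} (ha : 43 ≤ a ∧ a ≤ 46)
    (h : SearchMem disc v H r tab top T cur P Q σ) {θ : Fin k} (hθ : σ.nat Arr.vT 0 0 = θ) :
    SearchMem disc v H r tab top T cur (fun j m => P j m ∨ j = cur ∧ tab a θ j = m + 1) Q
      ((relaxCand a).run σ) ∧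
    (heapOf ((relaxCand a).run σ)).pot n 8 ≤ (heapOf σ).pot n 8 + 548 ∧
    ((relaxCand a).run σ).nat Arr.vT 0 0 = θ := by
  have htab : σ.nat a (σ.nat Arr.vT 0 0) (σ.nat Arr.cur 0 0) = tab a θ cur := by
    rw [h.env.tab a ha.1 ha.2, hθ, h.at_cur]
  by_cases h0 : 0 < tab a θ cur
  swap
  · have : (relaxCand a).run σ = σ := by
      rw [relaxCand, Com.run_branch_false (by simpa only [BExp.eval, NExp.eval, htab] using h0),
        Com.run_skip]
    rw [this]
    refine ⟨h.mono (fun j m hj => ?_) fun _ _ hq => hq, by omega, hθ⟩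
    rcases hj with hj | ⟨rfl, hj⟩
    · exact hj
    · omega
  obtain ⟨θ₀, j₀, h1, h2, h3⟩ := h.frontier
  obtain ⟨x, hx⟩ : ∃ x, tab a θ cur = x + 1 := ⟨_, (Nat.sub_add_cancel h0).symm⟩
  obtain ⟨m, rfl, i, hm⟩ := hp.held a θ cur x (h3.le_root hp.good h3.cur_mem) ha.1 ha.2 hx
  obtain ⟨κ, hκ⟩ : ∃ κ, κ = σ.real Arr.dist 0 0 + H.slack (weight disc v) (θ, i) cur := ⟨_, rfl⟩
  set σ1 := (σ.setN Arr.item 0 0 m).setR Arr.newKey 0 0 κ with hσ1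
  have fn : ∀ a, a ≠ Arr.item → σ1.nat a = σ.nat a := fun a ha => Mem.setN_nat_of_ne _ _ _ _ _ ha
  have fr : ∀ a, a ≠ Arr.newKey → σ1.real a = σ.real a := fun a ha => Mem.setR_real_of_ne _ _ _ _ _ ha
  have hrun : (relaxCand a).run σ = heapUpdate.run σ1 := by
    rw [relaxCand, Com.run_branch_true (by simpa only [BExp.eval, NExp.eval, htab] using h0)]
    simp only [Com.run, NExp.eval, htab, hx, Nat.add_sub_cancel, RExp.eval, Mem.setN_real,
      Mem.setN_nat_of_ne σ Arr.item 0 0 m (by decide : Arr.vT ≠ Arr.item),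
      Mem.setN_nat_of_ne σ Arr.item 0 0 m (by decide : Arr.cur ≠ Arr.item),
      Mem.setN_nat_of_ne σ Arr.item 0 0 m (by decide : Arr.matchI ≠ Arr.item)]
    have e1 : (σ.setN Arr.item 0 0 m).nat Arr.item 0 0 = m := by simp [Mem.setN_nat]
    rw [e1, hσ1, hθ, h.at_cur, (h.env.M m _ hm).2, h.env.u (θ, i), h.env.p, h.env.disc, h.env.val (θ, i), hκ]
    rfl
  have hheap : heapOf σ1 = heapOf σ := by
    ext <;> simp [hσ1, Mem.setN_nat, Mem.setR_real]
  have hu := heapUpdate_run (n := n) (m := m) (j := cur) (κ := κ) (σ := σ1) (by rw [hheap]; exact h.inv)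
    (by rw [hheap]; exact h.bal) (by simp [hσ1, Mem.setN_nat])
    (by rw [fn _ (by decide), h.at_cur]) (by simp [hσ1, Mem.setR_real]) m.2
  rw [← hrun] at hu
  have gn : ∀ b, (b < 20 ∨ 40 < b) ∧ b ≠ 42 ∧ b ≠ 12 → ((relaxCand a).run σ).nat b = σ.nat b :=
    fun a ha => (hu.frame a ⟨by omega, ha.2⟩).trans (fn a (by simp only [Arr.item]; omega))
  have gr : ∀ b, b ≠ 10 ∧ b ≠ 11 → ((relaxCand a).run σ).real b = σ.real b :=
    fun a ha => (hu.real a ha.1).trans (fr a ha.2)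
  refine ⟨⟨h.env.congr (fun a ha => gn a (by omega)) (fun a ha => gr a (by omega)), hu.inv, ?_, hu.bal,
    by rw [gn _ (by decide)]; exact h.at_cur, θ₀, j₀, by rw [gn _ (by decide), h1],
    by rw [gn _ (by decide), h2], ?_⟩, by rw [← hheap]; exact hu.pot, by rw [gn _ (by decide), hθ]⟩
  · rw [hu.bk, hheap]; exact h.bk
  · rw [gr Arr.dist (by decide), gr Arr.bu (by decide)]
    have hP : ∀ j m', (P j m' ∨ j = cur ∧ tab a θ j = m' + 1) → P j m' ∨ j = cur ∧ m' = m := by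
      rintro j m' (hj | ⟨rfl, hj⟩)
      · exact .inl hj
      · exact .inr ⟨rfl, Fin.ext (by omega)⟩
    have heff := hu.eff
    rw [fn _ (by decide), fn _ (by decide), fr _ (by decide)] at heff
    rcases heff with ⟨e1, e2, e3, e4⟩ | ⟨e1, e2, e3, e4⟩ <;> rw [e2, e3, e4]
    · exact (h3.relax hp.good hm hκ e1).mono hP fun _ _ hq => hq
    · exact (h3.skip hm hκ e1).mono hP fun _ _ hq => hq

theorem heapOf_congr {σ τ : Mem} (hn : ∀ a, 20 ≤ a ∧ a ≤ 27 → τ.nat a = σ.nat a)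
    (hr : τ.real Arr.key = σ.real Arr.key) : heapOf τ = heapOf σ := by
  simp only [heapOf, hn Arr.hSt (by decide), hn Arr.hH (by decide), hn Arr.hPa (by decide),
    hn Arr.hCh (by decide), hn Arr.hBk (by decide), hn Arr.hPl (by decide), hn Arr.hPn (by decide),
    hn Arr.hCnt (by decide), hr]

theorem SearchMem.congr {T : Tree k n} {cur : Fin n} {P : Fin n → Fin n → Prop}
    {Q : Fin n → Fin k → Prop} {σ τ : Mem} (h : SearchMem disc v H r tab top T cur P Q σ)
    (hn : ∀ a, a < 5 ∨ 20 ≤ a ∧ a ≤ 27 ∨ 41 ≤ a ∧ a ≤ 49 ∨ a = 59 ∨ a = 60 → τ.nat a = σ.nat a)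
    (hr : τ.real = σ.real) : SearchMem disc v H r tab top T cur P Q τ := by
  have e : heapOf τ = heapOf σ := heapOf_congr (fun a ha => hn a (by omega)) (by rw [hr])
  refine ⟨h.env.congr (fun a ha => hn a (by omega)) fun a _ => by rw [hr], by rw [e]; exact h.inv,
    by rw [e]; exact h.bk, by rw [e]; exact h.bal, by rw [hn _ (by decide)]; exact h.at_cur, ?_⟩
  rw [hn Arr.buT (by decide), hn Arr.buJ (by decide), hn Arr.hSt (by decide), hn Arr.src (by decide), hr]
  exact h.frontier

/-- The pairs of slots that have been taken into account when the types below `t` of the slot `cur` have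
been. -/
def SeenSlots (tab : ℕ → ℕ → ℕ → ℕ) (S : Finset (Fin n)) (cur : Fin n) (k t : ℕ) (j m : Fin n) : Prop :=
  j ∈ S ∧ ∃ θ : Fin k, m ∈ candSet tab θ j ∧ (j ≠ cur ∨ (θ : ℕ) < t)

def SeenTypes (S : Finset (Fin n)) (cur : Fin n) (t : ℕ) (j : Fin n) (θ : Fin k) : Prop :=
  j ∈ S ∧ (j ≠ cur ∨ (θ : ℕ) < t)

/-- The cost of a step of `relaxAll`. -/
def relaxCost : ℕ := 2350

/-- A type costs at most 150 steps for its five edges and 4 · 548 = 2192 of potential for up to four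
heap updates; `relaxCost` exceeds the sum. The additional list weight `8` is kept for the scan that
follows. -/
theorem wp_relaxAll (hp : Plan disc v H r tab top) {T : Tree k n} {cur : Fin n} {σ : Mem} {c d : ℕ}
    (h : SearchMem disc v H r tab top T cur (SeenSlots tab T.S cur k 0) (SeenTypes T.S cur 0) σ)
    (hc : (heapOf σ).pot n 8 + k * (relaxCost + 2) + 2 + d ≤ c) :
    Wp relaxAll (fun c τ => SearchMem disc v H r tab top T cur (SeenSlots tab T.S cur k k)
      (SeenTypes T.S cur k) τ ∧ (heapOf τ).pot n 8 + d ≤ c) c σ := by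
  have hset : ∀ (τ : Mem) x t, SearchMem disc v H r tab top T cur (SeenSlots tab T.S cur k t)
      (SeenTypes T.S cur t) τ → SearchMem disc v H r tab top T cur (SeenSlots tab T.S cur k t)
      (SeenTypes T.S cur t) (τ.setN Arr.vT 0 0 x) ∧ heapOf (τ.setN Arr.vT 0 0 x) = heapOf τ := by
    intro τ x t h
    have : ∀ a, a ≠ 56 → (τ.setN Arr.vT 0 0 x).nat a = τ.nat a := fun a ha =>
      Mem.setN_nat_of_ne _ _ _ _ _ ha
    exact ⟨h.congr (fun a ha => this a (by omega)) rfl,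
      heapOf_congr (fun a ha => this a (by omega)) rfl⟩
  refine .forLt k relaxCost (fun i c τ => SearchMem disc v H r tab top T cur (SeenSlots tab T.S cur k i)
      (SeenTypes T.S cur i) τ ∧ (heapOf τ).pot n 8 + d ≤ c) ((heapOf σ).pot n 8 + d) (by omega) ?_ ?_ ?_ ?_
  · obtain ⟨h1, h2⟩ := hset σ 0 0 h
    exact ⟨h1, by rw [h2]⟩
  · rintro i c τ ⟨h, -⟩; exact h.env.types
  · rintro t ht c τ ⟨h, hd⟩ hvT
    obtain ⟨θ, rfl⟩ : ∃ θ : Fin k, (θ : ℕ) = t := ⟨⟨t, ht⟩, rfl⟩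
    obtain ⟨s0, p0, v0⟩ := relaxTop_run hp h hvT
    obtain ⟨s1, p1, v1⟩ := relaxCand_run hp (a := 43) (by decide) s0 v0
    obtain ⟨s2, p2, v2⟩ := relaxCand_run hp (a := 44) (by decide) s1 v1
    obtain ⟨s3, p3, v3⟩ := relaxCand_run hp (a := 45) (by decide) s2 v2
    obtain ⟨s4, p4, v4⟩ := relaxCand_run hp (a := 46) (by decide) s3 v3
    rw [p0] at p1
    have hcost : relaxType.cost ≤ 150 := by decide
    have s5 : SearchMem disc v H r tab top T cur (SeenSlots tab T.S cur k (θ + 1))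
        (SeenTypes T.S cur (θ + 1)) (relaxType.run τ) := by
      refine s4.mono ?_ ?_
      · rintro j m ⟨hj, θ', ⟨a, ha1, ha2, ha⟩, hjc⟩
        by_cases hold : j ≠ cur ∨ (θ' : ℕ) < θ
        · exact .inl (.inl (.inl (.inl ⟨hj, θ', ⟨a, ha1, ha2, ha⟩, hold⟩)))
        · push Not at hold
          obtain ⟨rfl, hθ⟩ := hold
          obtain rfl : θ' = θ := Fin.ext (by have := hjc.resolve_left (fun h => h rfl); omega)
          have : a = 43 ∨ a = 44 ∨ a = 45 ∨ a = 46 := by omega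
          rcases this with rfl | rfl | rfl | rfl
          · exact .inl (.inl (.inl (.inr ⟨rfl, ha⟩)))
          · exact .inl (.inl (.inr ⟨rfl, ha⟩))
          · exact .inl (.inr ⟨rfl, ha⟩)
          · exact .inr ⟨rfl, ha⟩
      · rintro j θ' ⟨hj, hjc⟩
        by_cases hold : j ≠ cur ∨ (θ' : ℕ) < θ
        · exact .inl ⟨hj, hold⟩
        · push Not at hold
          obtain ⟨rfl, hθ⟩ := hold
          exact .inr ⟨rfl, Fin.ext (by have := hjc.resolve_left (fun h => h rfl); omega)⟩
    obtain ⟨h1, h2⟩ := hset _ (θ + 1) _ s5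
    have hp5 : (heapOf (relaxType.run τ)).pot n 8 ≤ (heapOf τ).pot n 8 + 2192 := by
      simp only [relaxType, Com.run] at p1 p2 p3 p4 ⊢
      omega
    exact .straight rfl (c + 2200) (by simp only [relaxCost]; omega)
      ⟨v4, h1, by rw [h2]; omega⟩
  · rintro c τ ⟨h, hd⟩ -
    exact ⟨h, hd⟩

/-- Begin the search in the slot `root`. -/
def searchInit : Com :=
  .setR Arr.key (.lit 0) (.var Arr.root) (.lit 0) ;;
  .letN Arr.cur (.var Arr.root) ;;
  .letR Arr.dist (.lit 0) ;;
  .letN Arr.done (.lit 0) ;;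
  .letN Arr.buT (.lit 0) ;;
  .letN Arr.buJ (.var Arr.root) ;;
  .letR Arr.bu (.sub (.get Arr.dualP (.lit 0) (.var Arr.root))
    (.mul (.get Arr.disc (.lit 0) (.var Arr.root))
      (.get Arr.val (.lit 0) (.sub (.row Arr.top (.lit 0)) (.lit 1)))))

/-- The shortest edge out of the tree leads to a matched ad: its slot joins the tree. -/
def searchGrow : Com :=
  .letN Arr.cur (.row Arr.hPl (.var Arr.tBest)) ;;
  .letR Arr.dist (.get Arr.key (.lit 0) (.var Arr.cur)) ;;
  heapPop

def searchStep : Com :=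
  relaxAll ;;
  .branch (.lt (.lit 0) (.var Arr.hPn))
    (heapScan ;;
     .branch (.le (.get Arr.key (.lit 0) (.row Arr.hPl (.var Arr.tBest))) (.var Arr.bu))
       searchGrow (.letN Arr.done (.lit 1)))
    (.letN Arr.done (.lit 1))

/-- Let the tree grow until the shortest edge out of it leads to an unmatched ad. -/
def searchLoop : Com := .loop (.eq (.var Arr.done) (.lit 0)) searchStep

theorem searchInit_run (hp : Plan disc v H r tab top) (hk : 0 < k) {σ : Mem}
    (hE : Env disc v H r tab top σ) (hF : (heapOf σ).Fresh) :
    SearchMem disc v H r tab top ⟨H.u, H.p, fun _ => none, {r}⟩ r (SeenSlots tab {r} r k 0)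
      (SeenTypes {r} r 0) (searchInit.run σ) ∧ (heapOf (searchInit.run σ)).pot n 8 = 0 ∧
      (searchInit.run σ).nat Arr.done 0 0 = 0 := by
  have hwn : searchInit.natWrites = [41, 58, 59, 60] := rfl
  have hwr : searchInit.realWrites = [10, 12, 13] := rfl
  have fn : ∀ a, a ≠ 41 ∧ a ≠ 58 ∧ a ≠ 59 ∧ a ≠ 60 → (searchInit.run σ).nat a = σ.nat a := fun a ha =>
    run_nat rfl σ (by rw [hwn]; simpa using ha)
  have fr : ∀ a, a ≠ 10 ∧ a ≠ 12 ∧ a ≠ 13 → (searchInit.run σ).real a = σ.real a := fun a ha =>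
    run_real rfl σ (by rw [hwr]; simpa using ha)
  have hF' : (heapOf (searchInit.run σ)).Fresh := by
    refine ⟨?_, ?_, ?_, ?_⟩
    · rw [heapOf_st, fn _ (by decide)]; exact hF.st
    · rw [heapOf_bk, fn _ (by decide)]; exact hF.bk
    · rw [heapOf_pn, fn _ (by decide)]; exact hF.pn
    · rw [heapOf_cnt, fn _ (by decide)]; exact hF.cnt
  have hrun : searchInit.run σ = ((((((σ.setR Arr.key 0 r 0).setN Arr.cur 0 0 r).setR Arr.dist 0 0 0).setN
      Arr.done 0 0 0).setN Arr.buT 0 0 0).setN Arr.buJ 0 0 r).setR Arr.bu 0 0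
      (H.slack (weight disc v) (⟨0, hk⟩, top ⟨0, hk⟩) r) := by
    have e1 := hE.disc ⟨0, hk⟩ r
    have e2 := hE.val (⟨0, hk⟩, top ⟨0, hk⟩)
    have e3 := hE.top ⟨0, hk⟩
    simp only at e1 e2 e3
    simp [searchInit, Com.run, RExp.eval, NExp.eval, Mem.setN_nat, Mem.setR_real, hE.root, HState.slack,
      weight, hp.good.free _ (hp.free _), e1, e2, e3, hE.p]
  refine ⟨⟨hE.congr (fun a ha => fn a (by omega)) (fun a ha => fr a (by omega)), hF'.inv, hF'.bk, hF'.balanced,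
    by simp [hrun, Mem.setN_nat], ⟨0, hk⟩, r, by simp [hrun, Mem.setN_nat], by simp [hrun, Mem.setN_nat], ?_⟩,
    hF'.pot, by simp [hrun, Mem.setN_nat]⟩
  have e1 : (searchInit.run σ).real Arr.dist 0 0 = 0 := by simp [hrun, Mem.setR_real]
  have e2 : (searchInit.run σ).real Arr.bu 0 0 = H.slack (weight disc v) (⟨0, hk⟩, top ⟨0, hk⟩) r := by
    simp [hrun, Mem.setR_real]
  have e3 : (searchInit.run σ).real Arr.key 0 r = 0 := by simp [hrun, Mem.setR_real]
  rw [e1, e2]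
  refine (Frontier.init hp.good hF'.st e3 (hp.free _) rfl).mono ?_ ?_
  · rintro j m ⟨hj, θ, -, h | h⟩
    · exact h (mem_singleton.1 hj)
    · omega
  · rintro j θ ⟨hj, h | h⟩
    · exact h (mem_singleton.1 hj)
    · omega

/-- The cost of a step of the search. -/
def searchCost (k n : ℕ) : ℕ := k * (relaxCost + 2) + 247 * Heap.maxHeight n + 120

/-- The property `R` lets the caller follow the tree from the start while the loop runs forwards;
`Phase` itself adds its steps at the front. Every iteration but the last puts a new slot into the
tree, so `n - #T.S` bounds the iterations that are left. -/
theorem wp_searchLoop (hp : Plan disc v H r tab top) {R : Tree k n → Prop}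
    (hR : ∀ T a j m, T.NextTight (weight disc v) a j → H.M m = some a → R T →
      R ((T.addEdge (weight disc v) a j).addSlot m)) {T : Tree k n} {cur : Fin n} {σ : Mem} {c d : ℕ}
    (h : SearchMem disc v H r tab top T cur (SeenSlots tab T.S cur k 0) (SeenTypes T.S cur 0) σ)
    (hT : R T) (hdone : σ.nat Arr.done 0 0 = 0)
    (hc : (heapOf σ).pot n 8 + (n - #T.S) * searchCost k n + searchCost k n + d ≤ c) :
    Wp searchLoop (fun c τ => (∃ T cur P Q, SearchMem disc v H r tab top T cur P Q τ ∧ R T ∧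
      ∀ a, (∀ m ∈ T.S, H.M m ≠ some a) → ∀ j ∈ T.S,
        τ.real Arr.bu 0 0 ≤ τ.real Arr.key 0 j + H.slack (weight disc v) a j) ∧ d ≤ c) c σ := by
  refine .loop (fun c τ => (τ.nat Arr.done 0 0 = 0 ∧ ∃ T cur,
      SearchMem disc v H r tab top T cur (SeenSlots tab T.S cur k 0) (SeenTypes T.S cur 0) τ ∧ R T ∧
      (heapOf τ).pot n 8 + (n - #T.S) * searchCost k n + searchCost k n + d ≤ c) ∨
    (τ.nat Arr.done 0 0 = 1 ∧ (∃ T cur P Q, SearchMem disc v H r tab top T cur P Q τ ∧ R T ∧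
      ∀ a, (∀ m ∈ T.S, H.M m ≠ some a) → ∀ j ∈ T.S,
        τ.real Arr.bu 0 0 ≤ τ.real Arr.key 0 j + H.slack (weight disc v) a j) ∧ d + 1 ≤ c))
    (.inl ⟨hdone, T, cur, h, hT, hc⟩) ?_
  clear h hT hdone hc
  rintro c τ (⟨hd, T, cur, h, hT, hc⟩ | ⟨hd, h, hc⟩)
  swap
  · exact ⟨c - 1, by omega, fun hb => by simp [BExp.eval, NExp.eval, hd] at hb, fun _ => ⟨h, by omega⟩⟩
  refine ⟨c - 1, by simp only [searchCost] at hc; omega, fun _ => ?_,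
    fun hb => by simp [BExp.eval, NExp.eval, hd] at hb⟩
  refine .seq ((wp_relaxAll hp h (d := (n - #T.S) * searchCost k n + 247 * Heap.maxHeight n + 116 + d)
    (by simp only [searchCost] at hc ⊢; omega)).framed.mono ?_)
  rintro c1 τ1 ⟨⟨h1, hc1⟩, hn1, -⟩
  -- The search ends when the heap is empty or its least key exceeds the best edge to an unmatched
  -- ad. In both cases that edge is a shortest one out of the tree, as all edges of tree slots have
  -- been taken into account.
  have hquit : ∀ (τ : Mem) c, SearchMem disc v H r tab top T cur (SeenSlots tab T.S cur k k)
      (SeenTypes T.S cur k) τ → d + 3 ≤ c → (∀ m : Fin n, τ.nat Arr.hSt 0 m = 1 →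
        τ.real Arr.bu 0 0 ≤ τ.real Arr.key 0 m) → Wp (.letN Arr.done (.lit 1)) (fun c τ =>
      (τ.nat Arr.done 0 0 = 0 ∧ ∃ T cur,
      SearchMem disc v H r tab top T cur (SeenSlots tab T.S cur k 0) (SeenTypes T.S cur 0) τ ∧ R T ∧
      (heapOf τ).pot n 8 + (n - #T.S) * searchCost k n + searchCost k n + d ≤ c) ∨
    (τ.nat Arr.done 0 0 = 1 ∧ (∃ T cur P Q, SearchMem disc v H r tab top T cur P Q τ ∧ R T ∧
      ∀ a, (∀ m ∈ T.S, H.M m ≠ some a) → ∀ j ∈ T.S,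
        τ.real Arr.bu 0 0 ≤ τ.real Arr.key 0 j + H.slack (weight disc v) a j) ∧ d + 1 ≤ c)) c τ := by
    intro τ c h hc hmin
    refine .straight rfl (d + 1) (by simp only [Com.cost]; omega) (.inr ⟨?_, ⟨T, cur, _, _, h.congr ?_ rfl,
      hT, ?_⟩, le_rfl⟩)
    · simp [Com.run, NExp.eval, Mem.setN_nat]
    · intro a ha
      exact Mem.setN_nat_of_ne _ _ _ _ _ (by simp only [Arr.done]; omega)
    · obtain ⟨θ₀, j₀, -, -, hf⟩ := h.frontier
      exact fun a ha j hj => hf.lower hp.good hp.anti hp.cand (fun j hj θ m hm => ⟨hj, θ, hm, .inr θ.2⟩)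
        (fun j hj θ => ⟨hj, .inr θ.2⟩) le_rfl hmin ha hj
  refine .branch (c1 - 1) (by omega) (fun hb => ?_) (fun hb => ?_)
  swap
  · refine hquit τ1 _ h1 (by omega) fun m hm => ?_
    have hpn : (heapOf τ1).pn = 0 := by simpa [BExp.eval, NExp.eval] using hb
    exact h1.inv.le_key (q := heapOf τ1) h1.bk (fun l hl => by omega) hm
  have hpn : 0 < (heapOf τ1).pn := hb
  refine .seq ((wp_heapScan (e := 0) (d := (n - #T.S) * searchCost k n + 247 * Heap.maxHeight n + 111 + d)
    h1.inv h1.bk hpn (by rw [Nat.zero_add]; omega)).framed.mono ?_)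
  rintro c2 τ2 ⟨⟨hc2, hh2, hf2, hb2, hmin2⟩, hn2, hr2⟩
  have hw : heapScan.natWrites = [33, 32, 33, 12, 32] := rfl
  have h2 : SearchMem disc v H r tab top T cur (SeenSlots tab T.S cur k k) (SeenTypes T.S cur k) τ2 := by
    refine h1.congr (fun a ha => hn2 a ?_) hf2.real
    rw [hw]; simp only [List.mem_cons, List.not_mem_nil, or_false]; omega
  rw [← hh2] at hb2 hmin2
  obtain ⟨x, hx⟩ : ∃ x, x = (heapOf τ2).pl (τ2.nat Arr.tBest 0 0) := ⟨_, rfl⟩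
  rw [← hx] at hmin2
  have hx' : τ2.nat Arr.hPl 0 (τ2.nat Arr.tBest 0 0) = x := hx.symm
  have hst : τ2.nat Arr.hSt 0 x = 1 := by rw [hx]; exact (h2.inv.list _ hb2).1
  refine .branch (c2 - 1) (by omega) (fun hb => ?_) (fun hb => ?_)
  swap
  · refine hquit τ2 _ h2 (by omega) fun m hm => ?_
    have : τ2.real Arr.bu 0 0 < τ2.real Arr.key 0 x := by
      simpa [BExp.eval, RExp.eval, NExp.eval, hx'] using hb
    exact this.le.trans (hmin2 m hm)
  have hbu : τ2.real Arr.key 0 x ≤ τ2.real Arr.bu 0 0 := by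
    simpa [BExp.eval, RExp.eval, NExp.eval, hx'] using hb
  obtain ⟨θ₀, j₀, hθ₀, hj₀, hfr⟩ := h2.frontier
  -- In the remaining case the minimum of the heap is not above the best unmatched edge, so its slot
  -- joins the tree at this distance.
  obtain ⟨m, hmx, hmS, a, j, ha, hnt, hfr'⟩ := hfr.pop hp.good hp.anti hp.cand
    (fun j hj θ m hm => ⟨hj, θ, hm, .inr θ.2⟩) (fun j hj θ => ⟨hj, .inr θ.2⟩) hst hbu
    (fun m hm => hmin2 m hm)
  refine .seq (.straight rfl (c2 - 2) (by simp only [Com.cost]; omega) ?_)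
  refine .seq (.straight rfl (c2 - 3) (by simp only [Com.cost]; omega) ?_)
  set τ3 := (Com.letR Arr.dist (.get Arr.key (.lit 0) (.var Arr.cur))).run
    ((Com.letN Arr.cur (.row Arr.hPl (.var Arr.tBest))).run τ2) with hτ3
  have e3 : τ3 = (τ2.setN Arr.cur 0 0 x).setR Arr.dist 0 0 (τ2.real Arr.key 0 x) := by
    simp [hτ3, Com.run, NExp.eval, RExp.eval, hx', Mem.setN_nat]
  have n3 : ∀ a, a ≠ Arr.cur → τ3.nat a = τ2.nat a := fun a ha => by
    rw [e3]; exact Mem.setN_nat_of_ne _ _ _ _ _ ha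
  have r3 : ∀ a, a ≠ Arr.dist → τ3.real a = τ2.real a := fun a ha => by
    rw [e3]; exact Mem.setR_real_of_ne _ _ _ _ _ ha
  have hh3 : heapOf τ3 = heapOf τ2 :=
    heapOf_congr (fun a ha => n3 a (by simp only [Arr.cur]; omega)) (r3 _ (by decide))
  have t3 : τ3.nat Arr.tBest = τ2.nat Arr.tBest := n3 _ (by decide)
  refine (wp_heapPop (x := x) (d := (n - #T.S) * searchCost k n + 11 + d) (by rw [hh3]; exact h2.inv)
    (by rw [hh3]; exact h2.bk) (by rw [hh3]; exact h2.bal) (by rw [hh3, t3]; exact hb2)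
    (by rw [hh3, t3]; exact hx.symm) (by rw [hh3]; omega)).mono ?_
  rintro c4 τ4 ⟨q4, st4, bk4, bal4, hf4, hc4⟩
  have hcard : #((T.addEdge (weight disc v) a j).addSlot m).S = #T.S + 1 := card_insert_of_notMem hmS
  have hle : #((T.addEdge (weight disc v) a j).addSlot m).S ≤ n := by
    simpa using card_le_univ ((T.addEdge (weight disc v) a j).addSlot m).S
  refine .inl ⟨?_, (T.addEdge (weight disc v) a j).addSlot m, m, ⟨?_, q4, bk4, bal4, ?_, θ₀, j₀, ?_, ?_, ?_⟩,
    hR T a j m hnt ha hT, ?_⟩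
  · rw [hf4.nat _ (by decide), n3 _ (by decide), hf2.nat _ (by decide), hn1 _ (by decide), hd]
  · exact h2.env.congr (fun a ha => (hf4.nat a (by omega)).trans (n3 a (by simp only [Arr.cur]; omega)))
      (fun a ha => by rw [hf4.real]; exact r3 a (by simp only [Arr.dist]; omega))
  · rw [hf4.nat _ (by decide), e3]; simp [Mem.setN_nat, hmx]
  · rw [hf4.nat _ (by decide), n3 _ (by decide), hθ₀]
  · rw [hf4.nat _ (by decide), n3 _ (by decide), hj₀]
  · have st5 : τ4.nat Arr.hSt 0 = upd (τ2.nat Arr.hSt 0) x 2 := by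
      have := st4; rw [hh3] at this; exact this
    have d5 : τ4.real Arr.dist 0 0 = τ2.real Arr.key 0 x := by
      rw [hf4.real, e3]; simp [Mem.setR_real]
    rw [st5, d5, hf4.real, r3 _ (by decide), r3 _ (by decide), hf4.nat _ (by decide), n3 _ (by decide)]
    have hS : ∀ i, i ∈ ((T.addEdge (weight disc v) a j).addSlot m).S → i ≠ m → i ∈ T.S := fun i hi hne =>
      (mem_insert.1 hi).resolve_left hne
    -- All other slots of the tree are finished, and for the new current slot no type has been
    -- treated yet.
    refine hfr'.mono ?_ ?_
    · rintro i l ⟨hi, θ, hl, hcase⟩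
      exact ⟨hS i hi (hcase.resolve_right (by omega)), θ, hl, .inr θ.2⟩
    · rintro i θ ⟨hi, hcase⟩
      exact ⟨hS i hi (hcase.resolve_right (by omega)), .inr θ.2⟩
  · have : n - #T.S = (n - #((T.addEdge (weight disc v) a j).addSlot m).S) + 1 := by omega
    rw [this, Nat.succ_mul] at hc4
    omega

end


/-! ## A phase as a program -/

/-- Lower the price of the slot `vS`. -/
def movePrice : Com :=
  .setR Arr.dualP (.lit 0) (.var Arr.vS) (.sub (.get Arr.dualP (.lit 0) (.var Arr.vS))
    (.sub (.var Arr.bu) (.get Arr.key (.lit 0) (.var Arr.vS))))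

/-- Raise the dual variable of the ad in the slot `vS`. -/
def moveAd : Com :=
  .setR Arr.dualU (.row Arr.matchT (.var Arr.vS)) (.row Arr.matchI (.var Arr.vS))
    (.add (.get Arr.dualU (.row Arr.matchT (.var Arr.vS)) (.row Arr.matchI (.var Arr.vS)))
      (.sub (.var Arr.bu) (.get Arr.key (.lit 0) (.var Arr.vS))))

def moveSlot : Com :=
  .branch (.eq (.var Arr.vS) (.var Arr.root)) movePrice
    (.branch (.eq (.row Arr.hSt (.var Arr.vS)) (.lit 2)) (movePrice ;; moveAd) .skip)

/-- The change of the dual solution at the end of a phase. -/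
def moveDual : Com := .forLt Arr.vS (.var Arr.num) moveSlot

def augmentInit : Com :=
  .letN Arr.pT (.var Arr.buT) ;;
  .letN Arr.pI (.sub (.row Arr.top (.var Arr.buT)) (.lit 1)) ;;
  .letN Arr.pJ (.var Arr.buJ) ;;
  .setN Arr.used (.var Arr.pT) (.var Arr.pI) (.lit 1)

def augmentStep : Com :=
  .letN Arr.oT (.row Arr.matchT (.var Arr.pJ)) ;;
  .letN Arr.oI (.row Arr.matchI (.var Arr.pJ)) ;;
  .setRow Arr.matchT (.var Arr.pJ) (.var Arr.pT) ;;
  .setRow Arr.matchI (.var Arr.pJ) (.var Arr.pI) ;;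
  .letN Arr.pT (.var Arr.oT) ;;
  .letN Arr.pI (.var Arr.oI) ;;
  .letN Arr.pJ (.row Arr.src (.var Arr.pJ))

def augmentLast : Com :=
  .setRow Arr.matchT (.var Arr.pJ) (.var Arr.pT) ;;
  .setRow Arr.matchI (.var Arr.pJ) (.var Arr.pI)

/-- The augmentation along the path from the best unmatched ad to the root. -/
def augment : Com :=
  augmentInit ;; .loop (.not (.eq (.var Arr.pJ) (.var Arr.root))) augmentStep ;; augmentLast

section

variable {k n : ℕ} {disc : Fin k → Fin n → ℝ} {v : Ad k n → ℝ} {H : HState k n} {r : Fin n}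
  {tab : ℕ → ℕ → ℕ → ℕ} {top : Fin k → Fin n} {T : Tree k n}

/-- Slots in the tree are recognised by the status `2`, except for the root, which never enters the
heap and holds no ad. Each ad is in at most one slot, so its dual variable is moved at most once. -/
theorem wp_moveDual {w : Ad k n → Fin n → ℝ} {N : Tree k n} {key : ℕ → ℝ} {b : ℝ} {σ : Mem} {c d : ℕ}
    (hnum : σ.nat Arr.num 0 0 = n) (hroot : σ.nat Arr.root 0 0 = r)
    (hu : ∀ a : Ad k n, σ.real Arr.dualU a.1 a.2 = H.u a) (hp : ∀ j : Fin n, σ.real Arr.dualP 0 j = H.p j)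
    (hM : ∀ (j : Fin n) a, H.M j = some a → σ.nat Arr.matchT 0 j = a.1 ∧ σ.nat Arr.matchI 0 j = a.2)
    (hb : σ.real Arr.bu 0 0 = b) (hkey : σ.real Arr.key 0 = key)
    (hS : ∀ m : Fin n, m ∈ T.S ↔ m = r ∨ σ.nat Arr.hSt 0 m = 2) (hH : H.Good w r)
    (hmat : ∀ m ∈ T.S, m ≠ r → H.M m ≠ none)
    (hN : (∀ m ∈ T.S, ∀ c, H.M m = some c → N.u c = H.u c + (b - key m)) ∧
      (∀ c, (∀ m ∈ T.S, H.M m ≠ some c) → N.u c = H.u c) ∧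
      (∀ i ∈ T.S, N.p i = H.p i - (b - key i)) ∧ (∀ i, i ∉ T.S → N.p i = H.p i))
    (hc : n * 8 + 2 + d ≤ c) :
    Wp moveDual (fun c τ => (∀ a : Ad k n, τ.real Arr.dualU a.1 a.2 = N.u a) ∧
      (∀ j : Fin n, τ.real Arr.dualP 0 j = N.p j) ∧
      (∀ a, a ≠ 12 ∧ a ≠ 66 → τ.nat a = σ.nat a) ∧ (∀ a, a ≠ 8 ∧ a ≠ 9 → τ.real a = σ.real a) ∧
      d ≤ c) c σ := by
  have hr : H.M r = none := (hH.dom r).2 le_rfl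
  refine .mono (Wp.framed (.forLt n 6 (fun i c τ =>
    (∀ a, a ≠ 12 ∧ a ≠ 66 → τ.nat a = σ.nat a) ∧ (∀ a, a ≠ 8 ∧ a ≠ 9 → τ.real a = σ.real a) ∧
    (∀ m ∈ T.S, (m : ℕ) < i → ∀ c, H.M m = some c → τ.real Arr.dualU c.1 c.2 = H.u c + (b - key m)) ∧
    (∀ c, (∀ m ∈ T.S, (m : ℕ) < i → H.M m ≠ some c) → τ.real Arr.dualU c.1 c.2 = H.u c) ∧
    (∀ j ∈ T.S, (j : ℕ) < i → τ.real Arr.dualP 0 j = H.p j - (b - key j)) ∧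
    (∀ j : Fin n, (j ∈ T.S → i ≤ j) → τ.real Arr.dualP 0 j = H.p j) ∧ d ≤ c)
    (Q := fun c τ => (∀ m ∈ T.S, ∀ c, H.M m = some c → τ.real Arr.dualU c.1 c.2 = H.u c + (b - key m)) ∧
    (∀ c, (∀ m ∈ T.S, H.M m ≠ some c) → τ.real Arr.dualU c.1 c.2 = H.u c) ∧
    (∀ j ∈ T.S, τ.real Arr.dualP 0 j = H.p j - (b - key j)) ∧
    (∀ j : Fin n, j ∉ T.S → τ.real Arr.dualP 0 j = H.p j) ∧ d ≤ c) d (by omega) ?_ ?_ ?_ ?_)) ?_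
  · refine ⟨fun a ha => Mem.setN_nat_of_ne _ _ _ _ _ ha.2, fun _ _ => rfl, fun m _ h => by omega,
      fun c _ => hu c, fun m _ h => by omega, fun j _ => hp j, le_rfl⟩
  · rintro i c τ ⟨h, -⟩
    simp only [NExp.eval, h Arr.num (by decide), hnum]
  · rintro i hi c τ ⟨fn, fr, h1, h2, h3, h4, hd⟩ hvS
    obtain ⟨j, rfl⟩ : ∃ j : Fin n, (j : ℕ) = i := ⟨⟨i, hi⟩, rfl⟩
    have hsplit : ∀ m : Fin n, (m : ℕ) < j + 1 → m = j ∨ (m : ℕ) < j := fun m hm => by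
      rcases Nat.lt_succ_iff_lt_or_eq.1 hm with h | h
      · exact .inr h
      · exact .inl (Fin.ext h)
    have hroot' : τ.nat Arr.root 0 0 = r := by rw [fn _ (by decide), hroot]
    have hst' : τ.nat Arr.hSt 0 j = σ.nat Arr.hSt 0 j := by rw [fn _ (by decide)]
    have hP : movePrice.run τ = τ.setR Arr.dualP 0 j (H.p j - (b - key j)) := by
      have e1 : τ.real Arr.dualP 0 j = H.p j := h4 j fun _ => le_rfl
      simp only [movePrice, Com.run, NExp.eval, RExp.eval, hvS, e1, fr Arr.bu (by decide),
        fr Arr.key (by decide), hb, hkey]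
    have hframe : ∀ a, a ≠ 12 ∧ a ≠ 66 → ((moveSlot.run τ).setN Arr.vS 0 0 (j + 1)).nat a = σ.nat a := by
      intro a ha
      have hw : moveSlot.natWrites = [12] := rfl
      rw [Mem.setN_nat_of_ne _ _ _ _ _ ha.2, run_nat rfl τ (by rw [hw]; simpa using ha.1), fn a ha]
    have hframe' : ∀ a, a ≠ 8 ∧ a ≠ 9 → ((moveSlot.run τ).setN Arr.vS 0 0 (j + 1)).real a = σ.real a := by
      intro a ha
      have hw : moveSlot.realWrites = [9, 9, 8] := rfl
      rw [Mem.setN_real, run_real rfl τ (by rw [hw]; simp; omega), fr a ha]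
    have hloop : (moveSlot.run τ).nat Arr.vS 0 0 = j := by
      rw [run_nat rfl τ (by decide), hvS]
    have hcost : moveSlot.cost = 6 := rfl
    refine .straight rfl c (by omega) ⟨hloop, hframe, hframe', ?_⟩
    simp only [Mem.setN_real]
    have hnewP : ∀ ρ : ℕ → ℕ → ℕ → ℝ, (∀ j' : Fin n, ρ Arr.dualP 0 j' =
          if j' = j then H.p j - (b - key j) else τ.real Arr.dualP 0 j') → j ∈ T.S →
        (∀ j' ∈ T.S, (j' : ℕ) < j + 1 → ρ Arr.dualP 0 j' = H.p j' - (b - key j')) ∧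
        (∀ j' : Fin n, (j' ∈ T.S → (j : ℕ) + 1 ≤ j') → ρ Arr.dualP 0 j' = H.p j') := by
      intro ρ hρ hjS
      refine ⟨fun j' hj' hlt => ?_, fun j' hj' => ?_⟩
      · rw [hρ]; split_ifs with h
        · rw [h]
        · exact h3 j' hj' ((hsplit j' hlt).resolve_left h)
      · have hne : j' ≠ j := by rintro rfl; exact absurd (hj' hjS) (by omega)
        rw [hρ, if_neg hne]
        exact h4 j' fun h => (Nat.le_succ _).trans (hj' h)
    by_cases hjr : j = r
    · have hrun : moveSlot.run τ = τ.setR Arr.dualP 0 j (H.p j - (b - key j)) := by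
        rw [moveSlot, Com.run_branch_true (by simp only [BExp.eval, NExp.eval, hvS, hroot', hjr]), hP]
      rw [hrun]
      have hjS : j ∈ T.S := (hS j).2 (.inl hjr)
      obtain ⟨g1, g2⟩ := hnewP (τ.setR Arr.dualP 0 j (H.p j - (b - key j))).real (fun j' => by
        simp [Mem.setR_real, Fin.ext_iff]) hjS
      refine ⟨fun m hm hlt c hc => ?_, fun c hc => ?_, g1, g2, hd⟩
      · rcases hsplit m hlt with rfl | h
        · rw [hjr, hr] at hc; simp at hc
        · exact h1 m hm h c hc
      · exact h2 c fun m hm h => hc m hm (by omega)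
    · by_cases hj2 : σ.nat Arr.hSt 0 j = 2
      · have hjS : j ∈ T.S := (hS j).2 (.inr hj2)
        obtain ⟨a, ha⟩ := Option.ne_none_iff_exists'.1 (hmat j hjS hjr)
        have e2 : τ.real Arr.dualU a.1 a.2 = H.u a := h2 a fun m hm hlt hma => by
          have := hH.inj _ _ _ hma ha
          subst this; exact lt_irrefl _ hlt
        have hmT : τ.nat Arr.matchT 0 j = a.1 := by rw [fn _ (by decide), (hM j a ha).1]
        have hmI : τ.nat Arr.matchI 0 j = a.2 := by rw [fn _ (by decide), (hM j a ha).2]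
        have hrun : moveSlot.run τ = (τ.setR Arr.dualP 0 j (H.p j - (b - key j))).setR Arr.dualU a.1 a.2
            (H.u a + (b - key j)) := by
          rw [moveSlot, Com.run_branch_false (by
              simp only [BExp.eval, NExp.eval, hvS, hroot']; exact fun h => hjr (Fin.ext h)),
            Com.run_branch_true (by simp only [BExp.eval, NExp.eval, hvS, hst', hj2]), Com.run, hP]
          simp only [moveAd, Com.run, NExp.eval, RExp.eval, Mem.setR_nat, hvS, hmT, hmI,
            Mem.setR_real_of_ne _ Arr.dualP _ _ _ (by decide : Arr.dualU ≠ Arr.dualP),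
            Mem.setR_real_of_ne _ Arr.dualP _ _ _ (by decide : Arr.bu ≠ Arr.dualP),
            Mem.setR_real_of_ne _ Arr.dualP _ _ _ (by decide : Arr.key ≠ Arr.dualP), e2,
            fr Arr.bu (by decide), fr Arr.key (by decide), hb, hkey]
        rw [hrun]
        obtain ⟨g1, g2⟩ := hnewP ((τ.setR Arr.dualP 0 j (H.p j - (b - key j))).setR Arr.dualU a.1 a.2
            (H.u a + (b - key j))).real (fun j' => by simp [Mem.setR_real, Fin.ext_iff]) hjS
        have hU : ∀ c : Ad k n, ((τ.setR Arr.dualP 0 j (H.p j - (b - key j))).setR Arr.dualU a.1 a.2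
            (H.u a + (b - key j))).real Arr.dualU c.1 c.2 = if c = a then H.u a + (b - key j) else
              τ.real Arr.dualU c.1 c.2 := fun c => by
          simp [Mem.setR_real, Prod.ext_iff, Fin.ext_iff]
        refine ⟨fun m hm hlt c hc => ?_, fun c hc => ?_, g1, g2, hd⟩
        · rw [hU]
          rcases hsplit m hlt with rfl | h
          · obtain rfl : a = c := by simpa [ha] using hc
            rw [if_pos rfl]
          · rw [if_neg, h1 m hm h c hc]
            rintro rfl
            have := hH.inj _ _ _ hc ha
            subst this; exact lt_irrefl _ h
        · rw [hU, if_neg]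
          · exact h2 c fun m hm h => hc m hm (by omega)
          · rintro rfl; exact hc j hjS (by omega) ha
      · have hjS : j ∉ T.S := fun h => ((hS j).1 h).elim hjr hj2
        have hrun : moveSlot.run τ = τ := by
          rw [moveSlot, Com.run_branch_false (by
              simp only [BExp.eval, NExp.eval, hvS, hroot']; exact fun h => hjr (Fin.ext h)),
            Com.run_branch_false (by simp only [BExp.eval, NExp.eval, hvS, hst', hj2, not_false_iff]),
            Com.run_skip]
        rw [hrun]
        refine ⟨fun m hm hlt => ?_, fun c hc => ?_, fun m hm hlt => ?_, fun m hm => ?_, hd⟩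
        · exact h1 m hm ((hsplit m hlt).resolve_left (by rintro rfl; exact hjS hm))
        · exact h2 c fun m hm h => hc m hm (by omega)
        · exact h3 m hm ((hsplit m hlt).resolve_left (by rintro rfl; exact hjS hm))
        · exact h4 m fun h => (Nat.le_succ _).trans (hm h)
  · rintro c τ ⟨-, -, h1, h2, h3, h4, hd⟩ -
    exact ⟨fun m hm => h1 m hm m.2, fun c hc => h2 c fun m hm _ => hc m hm, fun j hj => h3 j hj j.2,
      fun j hj => h4 j fun h => absurd h hj, hd⟩
  · rintro c τ ⟨⟨h1, h2, h3, h4, hd⟩, fn, fr⟩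
    have hw : moveDual.natWrites = [66, 12, 66] := rfl
    have hw' : moveDual.realWrites = [9, 9, 8] := rfl
    refine ⟨fun a => ?_, fun j => ?_, fun a ha => fn a (by rw [hw]; simp; omega),
      fun a ha => fr a (by rw [hw']; simp; omega), hd⟩
    · by_cases ha : ∃ m ∈ T.S, H.M m = some a
      · obtain ⟨m, hm, ha⟩ := ha
        rw [h1 m hm a ha, hN.1 m hm a ha]
      · push Not at ha
        rw [h2 a ha, hN.2.1 a ha]
    · by_cases hj : j ∈ T.S
      · rw [h3 j hj, hN.2.2.1 j hj]
      · rw [h4 j hj, hN.2.2.2 j hj]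

/-- The path is followed through `src` from the best unmatched ad, with the rank of the current slot
as a measure. Slots of at most this rank still hold their old ads, which is why the matching can be
overwritten along the way. -/
theorem wp_augment {w : Ad k n → Fin n → ℝ} {key : Fin n → ℝ} {D : ℝ} {a₀ : Ad k n} {j₀ : Fin n}
    {σ : Mem} {c d : ℕ} (hH : H.Good w r) (hroot : σ.nat Arr.root 0 0 = r)
    (hM : ∀ (j : Fin n) a, H.M j = some a → σ.nat Arr.matchT 0 j = a.1 ∧ σ.nat Arr.matchI 0 j = a.2)
    (hs : Search w H r T key (slotMap (σ.nat Arr.src 0)) D) (ha₀ : ∀ m, H.M m ≠ some a₀) (hj₀ : j₀ ∈ T.S)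
    (hbT : σ.nat Arr.buT 0 0 = a₀.1) (hbI : σ.nat Arr.top 0 a₀.1 = a₀.2 + 1)
    (hbJ : σ.nat Arr.buJ 0 0 = j₀) (hc : n * 8 + 8 + d ≤ c) :
    Wp augment (fun c τ => (∃ M', Augment (T.addEdge w a₀ j₀).par r H.M a₀ M' ∧
        ∀ (j : Fin n) a, M' j = some a → τ.nat Arr.matchT 0 j = a.1 ∧ τ.nat Arr.matchI 0 j = a.2) ∧
      (∀ x y, τ.nat Arr.used x y = if x = a₀.1 ∧ y = a₀.2 then 1 else σ.nat Arr.used x y) ∧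
      (∀ a, a ≠ 3 ∧ a ≠ 4 ∧ a ≠ 47 ∧ (a < 61 ∨ 65 < a) → τ.nat a = σ.nat a) ∧ τ.real = σ.real ∧ d ≤ c)
      c σ := by
  have hr : H.M r = none := (hH.dom r).2 le_rfl
  obtain ⟨ord, ho1, ho2⟩ := hs.order
  have hcardS : #T.S ≤ n := by simpa using card_le_univ T.S
  set par := (T.addEdge w a₀ j₀).par with hpar
  have hp0 : par a₀ = some j₀ := by simp [hpar, Tree.addEdge]
  have hpb : ∀ m ∈ T.S, ∀ b, H.M m = some b → par b = some (slotMap (σ.nat Arr.src 0) m) := by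
    intro m hm b hb
    have : b ≠ a₀ := by rintro rfl; exact ha₀ m hb
    rw [hpar]
    simp only [Tree.addEdge, Function.update_of_ne this]
    exact hs.par_in m hm b hb
  have hfinal : ∀ M' : Assignment k n, ∀ τ : Mem, ∀ a : Ad k n, ∀ j : Fin n,
      (∀ (i : Fin n) b, M' i = some b → τ.nat Arr.matchT 0 i = b.1 ∧ τ.nat Arr.matchI 0 i = b.2) →
      ∀ (i : Fin n) b, Function.update M' j (some a) i = some b →
        ((τ.setN Arr.matchT 0 j a.1).setN Arr.matchI 0 j a.2).nat Arr.matchT 0 i = b.1 ∧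
        ((τ.setN Arr.matchT 0 j a.1).setN Arr.matchI 0 j a.2).nat Arr.matchI 0 i = b.2 := by
    intro M' τ a j h i b hb
    by_cases hij : i = j
    · subst hij
      obtain rfl : a = b := by simpa using hb
      simp [Mem.setN_nat]
    · rw [Function.update_of_ne hij] at hb
      have : (i : ℕ) ≠ j := fun h => hij (Fin.ext h)
      simpa [Mem.setN_nat, this] using h i b hb
  refine .seq (.straight rfl (c - 4) (by simp only [augmentInit, Com.cost]; omega) ?_)
  refine .seq (.loop (fun c τ => ∃ (M' : Assignment k n) (a : Ad k n) (j : Fin n), j ∈ T.S ∧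
      τ.nat Arr.pT 0 0 = a.1 ∧ τ.nat Arr.pI 0 0 = a.2 ∧ τ.nat Arr.pJ 0 0 = j ∧ par a = some j ∧
      (∀ M'', Augment par r M' a M'' → Augment par r H.M a₀ M'') ∧ (∀ i, ord i ≤ ord j → M' i = H.M i) ∧
      (∀ (i : Fin n) b, M' i = some b → τ.nat Arr.matchT 0 i = b.1 ∧ τ.nat Arr.matchI 0 i = b.2) ∧
      (∀ x y, τ.nat Arr.used x y = if x = a₀.1 ∧ y = a₀.2 then 1 else σ.nat Arr.used x y) ∧
      (∀ a, a ≠ 3 ∧ a ≠ 4 ∧ a ≠ 47 ∧ (a < 61 ∨ 65 < a) → τ.nat a = σ.nat a) ∧ τ.real = σ.real ∧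
      ord j * 8 + 3 + d ≤ c) ⟨H.M, a₀, j₀, hj₀, ?_⟩ ?_)
  · have hord := ho1 j₀ hj₀
    have hrun : augmentInit.run σ = (((σ.setN Arr.pT 0 0 a₀.1).setN Arr.pI 0 0 a₀.2).setN Arr.pJ 0 0 j₀).setN
        Arr.used a₀.1 a₀.2 1 := by
      simp [augmentInit, Com.run, NExp.eval, Mem.setN_nat, hbT, hbI, hbJ]
    refine ⟨by simp [hrun, Mem.setN_nat], by simp [hrun, Mem.setN_nat], by simp [hrun, Mem.setN_nat], hp0,
      fun _ h => h, fun _ _ => rfl, fun i b hb => ?_, fun x y => ?_, fun a ha => ?_, by rw [hrun]; rfl, by omega⟩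
    · simpa [hrun, Mem.setN_nat] using hM i b hb
    · simp [hrun, Mem.setN_nat]
    · exact run_nat rfl σ (by
        rw [show augmentInit.natWrites = [61, 62, 63, 47] from rfl]; simp; omega)
  · rintro c τ ⟨M', a, j, hj, hT, hI, hJ, hpa, hA, hMM, hmem, hused, fn, fr, hc⟩
    have hroot' : τ.nat Arr.root 0 0 = r := by rw [fn _ (by decide), hroot]
    refine ⟨c - 1, by omega, fun hb => ?_, fun hb => ?_⟩
    · have hjr : j ≠ r := by
        rintro rfl; exact hb (by simp only [BExp.eval, NExp.eval, hJ, hroot'])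
      obtain ⟨b, hb'⟩ := Option.ne_none_iff_exists'.1 (hs.matched j hj hjr)
      have hMj : M' j = some b := by rw [hMM j le_rfl, hb']
      have hlt := ho2 j hj hjr
      set j' := slotMap (σ.nat Arr.src 0) j with hj'
      -- The default value of `slotMap` would make the slot its own source, which contradicts the
      -- decreasing ranks; so the stored number is a genuine slot.
      have hsrc : τ.nat Arr.src 0 j = j' := by
        rw [fn _ (by decide), hj', slotMap]
        split_ifs with h
        · rfl
        · exfalso
          have : j' = j := by rw [hj', slotMap, dif_neg h]
          rw [this] at hlt; exact lt_irrefl _ hlt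
      have hmj := hmem j b hMj
      have hrun : augmentStep.run τ = ((((((τ.setN Arr.oT 0 0 b.1).setN Arr.oI 0 0 b.2).setN Arr.matchT 0 j
          a.1).setN Arr.matchI 0 j a.2).setN Arr.pT 0 0 b.1).setN Arr.pI 0 0 b.2).setN Arr.pJ 0 0 j' := by
        simp [augmentStep, Com.run, NExp.eval, Mem.setN_nat, hJ, hmj.1, hmj.2, hT, hI, hsrc]
      refine .straight rfl (ord j' * 8 + 3 + d) (by simp only [augmentStep, Com.cost]; omega)
        ⟨Function.update M' j (some a), b, j', (hs.src_in j hj b hb').1, by simp [hrun, Mem.setN_nat],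
          by simp [hrun, Mem.setN_nat], by simp [hrun, Mem.setN_nat], hpb j hj b hb',
          fun M'' hM'' => hA M'' (.move hpa hjr hMj hM''), fun i hi => ?_, fun i c hc' => ?_, fun x y => ?_,
          fun c hc' => ?_, by rw [hrun]; exact fr, le_rfl⟩
      · rw [Function.update_of_ne (by rintro rfl; omega)]
        exact hMM i (by omega)
      · have := hfinal M' ((τ.setN Arr.oT 0 0 b.1).setN Arr.oI 0 0 b.2) a j (fun i c hc => by
          simpa [Mem.setN_nat] using hmem i c hc) i c hc'
        rw [hrun]
        simpa [Mem.setN_nat] using this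
      · rw [← hused, hrun]; simp [Mem.setN_nat]
      · rw [run_nat rfl τ (by
          rw [show augmentStep.natWrites = [64, 65, 3, 4, 61, 62, 63] from rfl]; simp; omega), fn c hc']
    · have hjr : j = r := by
        by_contra hjr
        exact hb (by simp only [BExp.eval, NExp.eval, hJ, hroot']; exact fun h => hjr (Fin.ext h))
      have hrun : augmentLast.run τ = (τ.setN Arr.matchT 0 j a.1).setN Arr.matchI 0 j a.2 := by
        simp [augmentLast, Com.run, NExp.eval, Mem.setN_nat, hJ, hT, hI]
      refine .straight rfl d (by simp only [augmentLast, Com.cost]; omega)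
        ⟨⟨Function.update M' r (some a), hA _ (.last (hjr ▸ hpa)), ?_⟩, fun x y => ?_, fun c hc' => ?_,
          by rw [hrun]; exact fr, le_rfl⟩
      · rw [hrun, ← hjr]
        exact hfinal M' τ a j hmem
      · rw [← hused, hrun]; simp [Mem.setN_nat]
      · rw [run_nat rfl τ (by
          rw [show augmentLast.natWrites = [3, 4] from rfl]; simp; omega), fn c hc']

end

/-! ### The best unmatched ads -/

/-- The best unmatched ad of the type `vT`. -/
def findTop : Com :=
  .setRow Arr.top (.var Arr.vT) (.lit 0) ;;
  .forLt Arr.vI (.var Arr.num)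
    (.branch (.and (.eq (.get Arr.used (.var Arr.vT) (.var Arr.vI)) (.lit 0))
        (.not (.and (.lt (.lit 0) (.row Arr.top (.var Arr.vT)))
          (.le (.get Arr.val (.var Arr.vT) (.var Arr.vI))
            (.get Arr.val (.var Arr.vT) (.sub (.row Arr.top (.var Arr.vT)) (.lit 1)))))))
      (.setRow Arr.top (.var Arr.vT) (.add (.var Arr.vI) (.lit 1))) .skip)

def findTops : Com := .forLt Arr.vT (.var Arr.types) findTop

/-- `top` is the best of the first `i` ads of type `θ`, among those that are not in use. -/
def IsTop (σ : Mem) (θ i x : ℕ) : Prop :=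
  Pick (fun h => h < i ∧ σ.nat Arr.used θ h = 0)
    (fun h => ∀ m < i, σ.nat Arr.used θ m = 0 → σ.real Arr.val θ m ≤ σ.real Arr.val θ h) x

theorem wp_findTop {σ : Mem} {n θ c d : ℕ} (hn : σ.nat Arr.num 0 0 = n) (hθ : σ.nat Arr.vT 0 0 = θ)
    (hc : n * 6 + 3 + d ≤ c) :
    Wp findTop (fun c τ => IsTop σ θ n (τ.nat Arr.top 0 θ) ∧ (∀ y, y ≠ θ → τ.nat Arr.top 0 y = σ.nat Arr.top 0 y) ∧
      (∀ a, a ≠ 12 ∧ a ≠ 48 ∧ a ≠ 57 → τ.nat a = σ.nat a) ∧ τ.real = σ.real ∧ d ≤ c) c σ := by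
  refine .seq (.straight rfl (c - 1) (by simp only [Com.cost]; omega) ?_)
  have hrun : (Com.setRow Arr.top (.var Arr.vT) (.lit 0)).run σ = σ.setN Arr.top 0 θ 0 := by
    simp [Com.run, NExp.eval, hθ]
  rw [hrun]
  refine .forLt n 4 (fun i c τ => IsTop σ θ i (τ.nat Arr.top 0 θ) ∧
    (∀ y, y ≠ θ → τ.nat Arr.top 0 y = σ.nat Arr.top 0 y) ∧
    (∀ a, a ≠ 12 ∧ a ≠ 48 ∧ a ≠ 57 → τ.nat a = σ.nat a) ∧ τ.real = σ.real ∧ d ≤ c) d (by omega)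
    ⟨?_, ?_, ?_, rfl, le_rfl⟩ ?_ ?_ ?_
  · exact .inl ⟨by simp [Mem.setN_nat], by simp⟩
  · intro y hy; simp [Mem.setN_nat, hy]
  · intro a ha
    rw [Mem.setN_nat_of_ne _ _ _ _ _ ha.2.2, Mem.setN_nat_of_ne _ _ _ _ _ ha.2.1]
  · rintro i c τ ⟨-, -, h, -⟩
    simp only [NExp.eval, h Arr.num (by decide), hn]
  · rintro i hi c τ ⟨h1, h2, h3, h4, hd⟩ hvI
    have hvT : τ.nat Arr.vT 0 0 = θ := by rw [h3 _ (by decide), hθ]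
    have hus : τ.nat Arr.used = σ.nat Arr.used := h3 _ (by decide)
    have hcond : BExp.eval τ (.and (.eq (.get Arr.used (.var Arr.vT) (.var Arr.vI)) (.lit 0))
        (.not (.and (.lt (.lit 0) (.row Arr.top (.var Arr.vT)))
          (.le (.get Arr.val (.var Arr.vT) (.var Arr.vI))
            (.get Arr.val (.var Arr.vT) (.sub (.row Arr.top (.var Arr.vT)) (.lit 1))))))) ↔
        (σ.nat Arr.used θ i = 0 ∧ ¬ (0 < τ.nat Arr.top 0 θ ∧
          σ.real Arr.val θ i ≤ σ.real Arr.val θ (τ.nat Arr.top 0 θ - 1))) := by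
      simp only [BExp.eval, NExp.eval, RExp.eval, hvT, hvI, hus, h4]
    have hcost : Com.cost (.branch (.and (.eq (.get Arr.used (.var Arr.vT) (.var Arr.vI)) (.lit 0))
        (.not (.and (.lt (.lit 0) (.row Arr.top (.var Arr.vT)))
          (.le (.get Arr.val (.var Arr.vT) (.var Arr.vI))
            (.get Arr.val (.var Arr.vT) (.sub (.row Arr.top (.var Arr.vT)) (.lit 1)))))))
      (.setRow Arr.top (.var Arr.vT) (.add (.var Arr.vI) (.lit 1))) .skip) = 3 := rfl
    refine .straight rfl c (by omega) ?_
    by_cases hb : (σ.nat Arr.used θ i = 0 ∧ ¬ (0 < τ.nat Arr.top 0 θ ∧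
          σ.real Arr.val θ i ≤ σ.real Arr.val θ (τ.nat Arr.top 0 θ - 1)))
    · rw [Com.run_branch_true (hcond.2 hb)]
      simp only [Com.run, NExp.eval, hvT, hvI]
      refine ⟨by simp [Mem.setN_nat, hvI], ?_, ?_, ?_, h4, hd⟩
      · rw [Mem.setN_nat_of_ne _ _ _ _ _ (by decide)]
        refine .inr ⟨i, by simp [Mem.setN_nat], ⟨by omega, hb.1⟩, fun m hm hu => ?_⟩
        rcases Nat.lt_succ_iff_lt_or_eq.1 hm with hm | rfl
        · rcases h1 with ⟨h, h1⟩ | ⟨x, hx, h1, h1'⟩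
          · exact absurd ⟨hm, hu⟩ (h1 m)
          · have := hb.2
            rw [hx] at this
            simp only [Nat.succ_pos, true_and, not_le, Nat.add_sub_cancel] at this
            exact (h1' m hm hu).trans this.le
        · exact le_rfl
      · intro y hy
        simp [Mem.setN_nat, hy, h2 y hy]
      · intro a ha
        rw [Mem.setN_nat_of_ne _ _ _ _ _ ha.2.2, Mem.setN_nat_of_ne _ _ _ _ _ ha.2.1, h3 a ha]
    · rw [Com.run_branch_false (fun h => hb (hcond.1 h)), Com.run_skip]
      refine ⟨hvI, ?_, ?_, ?_, h4, hd⟩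
      · rw [Mem.setN_nat_of_ne _ _ _ _ _ (by decide)]
        rcases h1 with ⟨h, h1⟩ | ⟨x, hx, h1, h1'⟩
        · refine .inl ⟨h, fun m hm => ?_⟩
          rcases Nat.lt_succ_iff_lt_or_eq.1 hm.1 with hm' | rfl
          · exact h1 m ⟨hm', hm.2⟩
          · exact hb ⟨hm.2, fun h' => absurd h'.1 (by omega)⟩
        · refine .inr ⟨x, hx, ⟨by omega, h1.2⟩, fun m hm hu => ?_⟩
          rcases Nat.lt_succ_iff_lt_or_eq.1 hm with hm' | rfl
          · exact h1' m hm' hu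
          · by_contra hlt
            refine hb ⟨hu, fun h => hlt ?_⟩
            simpa [hx] using h.2
      · intro y hy
        rw [Mem.setN_nat_of_ne _ _ _ _ _ (by decide)]; exact h2 y hy
      · intro a ha
        rw [Mem.setN_nat_of_ne _ _ _ _ _ ha.2.2, h3 a ha]
  · rintro c τ ⟨h1, h2, h3, h4, hd⟩ -
    exact ⟨h1, h2, h3, h4, hd⟩

theorem wp_findTops {σ : Mem} {n k c d : ℕ} (hn : σ.nat Arr.num 0 0 = n) (hk : σ.nat Arr.types 0 0 = k)
    (hc : k * (n * 6 + 5) + 2 + d ≤ c) :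
    Wp findTops (fun c τ => (∀ θ < k, IsTop σ θ n (τ.nat Arr.top 0 θ)) ∧
      (∀ a, a ≠ 12 ∧ a ≠ 48 ∧ a ≠ 56 ∧ a ≠ 57 → τ.nat a = σ.nat a) ∧ τ.real = σ.real ∧ d ≤ c) c σ := by
  refine .forLt k (n * 6 + 3) (fun i c τ => (∀ θ < i, IsTop σ θ n (τ.nat Arr.top 0 θ)) ∧
      (∀ a, a ≠ 12 ∧ a ≠ 48 ∧ a ≠ 56 ∧ a ≠ 57 → τ.nat a = σ.nat a) ∧ τ.real = σ.real ∧ d ≤ c) d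
    (by ring_nf at hc ⊢; omega) ⟨by simp, ?_, rfl, le_rfl⟩ ?_ ?_ ?_
  · intro a ha
    rw [Mem.setN_nat_of_ne _ _ _ _ _ ha.2.2.1]
  · rintro i c τ ⟨-, h, -⟩
    simp only [NExp.eval, h Arr.types (by decide), hk]
  · rintro θ hθ c τ ⟨h1, h2, h3, hd⟩ hvT
    refine (wp_findTop (d := c) (by rw [h2 _ (by decide), hn]) hvT (by omega)).mono ?_
    rintro c' υ ⟨g1, g2, g3, g4, hd'⟩
    refine ⟨by rw [g3 _ (by decide), hvT], fun y hy => ?_, fun a ha => ?_, g4.trans h3, hd.trans hd'⟩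
    · rw [Mem.setN_nat_of_ne _ _ _ _ _ (by decide)]
      rcases Nat.lt_succ_iff_lt_or_eq.1 hy with hy | rfl
      · rw [g2 y hy.ne]; exact h1 y hy
      · simpa only [IsTop, h2 _ (by decide : Arr.used ≠ 12 ∧ _), h3] using g1
    · rw [Mem.setN_nat_of_ne _ _ _ _ _ ha.2.2.1, g3 a ⟨ha.1, ha.2.1, ha.2.2.2⟩, h2 a ha]
  · rintro c τ ⟨h1, h2, h3, hd⟩ -
    exact ⟨h1, h2, h3, hd⟩


/-! ## The Hungarian algorithm as a program -/

/-- The phase that starts in the slot `root`. -/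
def phase : Com :=
  candidates ;; findTops ;; searchInit ;; searchLoop ;; moveDual ;; augment ;; heapReset

/-- The cost of a phase. -/
def phaseCost (k n : ℕ) : ℕ :=
  k * (n * 46 + 19) + n * searchCost k n + 19 * n + 3 * Heap.maxHeight n + 50

section

variable {k n : ℕ} {disc : Fin k → Fin n → ℝ} {v : Ad k n → ℝ} {H : HState k n}

/-- The memory before the phase that starts in the slot `r`. -/
structure Rep (disc : Fin k → Fin n → ℝ) (v : Ad k n → ℝ) (H : HState k n) (r : ℕ) (τ : Mem) : Prop where
  good : H.Good (weight disc v) r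
  num : τ.nat Arr.num 0 0 = n
  types : τ.nat Arr.types 0 0 = k
  disc : ∀ (θ : Fin k) (j : Fin n), τ.real Arr.disc θ j = disc θ j
  val : ∀ a : Ad k n, τ.real Arr.val a.1 a.2 = v a
  u : ∀ a : Ad k n, τ.real Arr.dualU a.1 a.2 = H.u a
  p : ∀ j : Fin n, τ.real Arr.dualP 0 j = H.p j
  M : ∀ (j : Fin n) a, H.M j = some a → τ.nat Arr.matchT 0 j = a.1 ∧ τ.nat Arr.matchI 0 j = a.2
  used : ∀ a : Ad k n, τ.nat Arr.used a.1 a.2 = 0 ↔ ∀ j, H.M j ≠ some a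
  fresh : (heapOf τ).Fresh

/-- Before this phase exactly the slots below `r` are matched, so the stored type is meaningful
there, and `Holds` excludes all other cells. -/
theorem Rep.holds_iff {r : Fin n} {τ : Mem} (h : Rep disc v H r τ) {θ : Fin k} {x : ℕ} :
    Holds τ r θ x ↔ ∃ m : Fin n, (m : ℕ) = x ∧ ∃ i, H.M m = some (θ, i) := by
  constructor
  · rintro ⟨hx, hθ⟩
    let m : Fin n := ⟨x, hx.trans r.2⟩
    obtain ⟨a, ha⟩ := Option.ne_none_iff_exists'.1 (mt (h.good.dom m).1 (not_le.2 hx))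
    have h1 := (h.M m a ha).1
    rw [show ((m : Fin n) : ℕ) = x from rfl, hθ] at h1
    refine ⟨m, rfl, a.2, ?_⟩
    rw [ha]; exact congrArg some (Prod.ext (Fin.ext h1.symm) rfl)
  · rintro ⟨m, rfl, i, hi⟩
    refine ⟨?_, (h.M m _ hi).1⟩
    by_contra hlt
    rw [(h.good.dom m).2 (not_lt.1 hlt)] at hi
    cases hi

/-- Monotone discounts decide the side: a smaller discount lies to the right and a larger one to the
left, so one table serves each. For equal discounts, the side of `m` selects the table. -/
theorem Rep.candidates {r : Fin n} {σ τ : Mem} (h : Rep disc v H r σ) (hanti : ∀ θ, Antitone (disc θ))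
    {θ : Fin k} {j : Fin n} (ht : CandTable σ r θ j τ) :
    Candidates disc v H.M θ j (candSet τ.nat θ j) := by
  have hv : ∀ (m : Fin n) i, H.M m = some (θ, i) →
      σ.real Arr.val θ (σ.nat Arr.matchI 0 m) = v (θ, i) := fun m i hm => by
    rw [(h.M m _ hm).2]; exact h.val (θ, i)
  refine ⟨fun m i hm hd hne => ?_, fun m i hm hd => ?_, fun m i hm hd => ?_⟩
  · have hm' := h.holds_iff.2 ⟨m, rfl, i, hm⟩
    rcases lt_or_gt_of_ne hne with hlt | hlt
    · rcases ht.sameL with ⟨-, h0⟩ | ⟨x, hx, ⟨⟨hx1, hx2⟩, hx3⟩, hx4⟩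
      · exact absurd ⟨⟨hm', hlt⟩, by simp only [h.disc, hd]⟩ (h0 m)
      · obtain ⟨b, rfl, i', hb⟩ := h.holds_iff.1 hx1
        simp only [h.disc, neg_inj] at hx3
        have := hx4 m ⟨hm', hlt⟩ (by simp only [h.disc, hd])
        exact ⟨b, ⟨45, by norm_num, by norm_num, hx⟩, i', hb, hx3,
          .inr ⟨Fin.le_def.2 (Nat.cast_le (α := ℝ).1 this), hx2⟩⟩
    · rcases ht.sameR with ⟨-, h0⟩ | ⟨x, hx, ⟨⟨hx1, hx2⟩, hx3⟩, hx4⟩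
      · exact absurd ⟨⟨hm', hlt⟩, by simp only [h.disc, hd]⟩ (h0 m)
      · obtain ⟨b, rfl, i', hb⟩ := h.holds_iff.1 hx1
        simp only [h.disc] at hx3
        have := hx4 m ⟨hm', hlt⟩ (by simp only [h.disc, hd])
        exact ⟨b, ⟨43, by norm_num, by norm_num, hx⟩, i', hb, hx3,
          .inl ⟨hx2, Fin.le_def.2 (by exact_mod_cast neg_le_neg_iff.1 this)⟩⟩
  · have hm' := h.holds_iff.2 ⟨m, rfl, i, hm⟩
    have hlt : (j : ℕ) < m := by
      by_contra hlt
      exact hd.not_ge (hanti θ (Fin.le_def.2 (not_lt.1 hlt)))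
    rcases ht.nextR with ⟨-, h0⟩ | ⟨x, hx, ⟨⟨hx1, hx2⟩, hx3⟩, hx4⟩
    · exact absurd ⟨⟨hm', hlt⟩, by simp only [h.disc, hd]⟩ (h0 m)
    · obtain ⟨b, rfl, i', hb⟩ := h.holds_iff.1 hx1
      obtain ⟨h1, h2⟩ := hx4 m ⟨hm', hlt⟩ (by simp only [h.disc, hd])
      simp only [h.disc, hv m i hm, hv b i' hb] at hx3 h1 h2
      exact ⟨b, ⟨44, by norm_num, by norm_num, hx⟩, i', hb, h1, hx3, fun e => h2 e.symm⟩
  · have hm' := h.holds_iff.2 ⟨m, rfl, i, hm⟩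
    have hlt : (m : ℕ) < j := by
      by_contra hlt
      exact hd.not_ge (hanti θ (Fin.le_def.2 (not_lt.1 hlt)))
    rcases ht.nextL with ⟨-, h0⟩ | ⟨x, hx, ⟨⟨hx1, hx2⟩, hx3⟩, hx4⟩
    · exact absurd ⟨⟨hm', hlt⟩, by simp only [h.disc, neg_lt_neg_iff, hd]⟩ (h0 m)
    · obtain ⟨b, rfl, i', hb⟩ := h.holds_iff.1 hx1
      obtain ⟨h1, h2⟩ := hx4 m ⟨hm', hlt⟩ (by simp only [h.disc, neg_lt_neg_iff, hd])
      simp only [h.disc, hv m i hm, hv b i' hb, neg_lt_neg_iff, neg_le_neg_iff, neg_inj] at hx3 h1 h2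
      exact ⟨b, ⟨46, by norm_num, by norm_num, hx⟩, i', hb, h1, hx3, fun e => h2 e.symm⟩

theorem Rep.held {r : Fin n} {σ τ : Mem} (h : Rep disc v H r σ) {θ : Fin k} {j : Fin n}
    (ht : CandTable σ r θ j τ) {a x : ℕ} (h1 : 43 ≤ a) (h2 : a ≤ 46) (hx : τ.nat a θ j = x + 1) :
    ∃ m : Fin n, (m : ℕ) = x ∧ ∃ i, H.M m = some (θ, i) := by
  refine h.holds_iff.1 ?_
  have key : ∀ {P R : ℕ → Prop} {y : ℕ}, Pick P R y → y = x + 1 → P x := by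
    rintro P R y (⟨h, -⟩ | ⟨z, hz, hp, -⟩) hy
    · omega
    · obtain rfl : z = x := by omega
      exact hp
  obtain rfl | rfl | rfl | rfl : a = 43 ∨ a = 44 ∨ a = 45 ∨ a = 46 := by omega
  · exact (key ht.sameR hx).1.1
  · exact (key ht.nextR hx).1.1
  · exact (key ht.sameL hx).1.1
  · exact (key ht.nextL hx).1.1

/-- The tables that are computed at the beginning of a phase. -/
theorem Rep.exists_plan {r : Fin n} {σ τ : Mem} (h : Rep disc v H r σ) (hdisc : ∀ θ j, 0 ≤ disc θ j)
    (hanti : ∀ θ, Antitone (disc θ)) (hc : ∀ θ < k, ∀ j ≤ (r : ℕ), CandTable σ r θ j τ)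
    (ht : ∀ θ < k, IsTop σ θ n (τ.nat Arr.top 0 θ)) :
    ∃ top, Plan disc v H r τ.nat top ∧ ∀ θ : Fin k, τ.nat Arr.top 0 θ = top θ + 1 := by
  have key : ∀ θ : Fin k, ∃ i : Fin n, τ.nat Arr.top 0 θ = i + 1 ∧ (∀ m, H.M m ≠ some (θ, i)) ∧
      ∀ i', (∀ m, H.M m ≠ some (θ, i')) → v (θ, i') ≤ v (θ, i) := by
    intro θ
    rcases ht θ θ.2 with ⟨-, h0⟩ | ⟨x, hx, ⟨hxn, hxu⟩, hbest⟩
    -- The search for the best unmatched ad cannot fail: with n ads of each type and a free slot,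
    -- every type has one.
    · obtain ⟨i, hi⟩ := h.good.exists_unmatched r.2 θ
      exact absurd ⟨i.2, (h.used (θ, i)).2 hi⟩ (h0 i)
    · refine ⟨⟨x, hxn⟩, hx, (h.used (θ, ⟨x, hxn⟩)).1 hxu, fun i' hi' => ?_⟩
      have := hbest i' i'.2 ((h.used (θ, i')).2 hi')
      have e1 := h.val (θ, i')
      have e2 := h.val (θ, ⟨x, hxn⟩)
      simp only at e1 e2
      rwa [e1, e2] at this
  choose top h1 h2 h3 using key
  exact ⟨top, ⟨hdisc, hanti, h.good, fun θ j hj => h.candidates hanti (hc θ θ.2 j hj),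
    fun a θ j x hj ha ha' hx => h.held (hc θ θ.2 j hj) ha ha' hx, h2, h3⟩, h1⟩

/-- The distance search is carried over to the dual form of `Phase` here: the tree of the search is
the tree of the phase, and the final edge is a next tight edge to an unmatched ad. Afterwards the
heap is empty again and the flags in `used` describe the new matching. -/
theorem wp_phase (hdisc : ∀ θ j, 0 ≤ disc θ j) (hanti : ∀ θ, Antitone (disc θ)) (hk : 0 < k) {r : Fin n}
    {σ : Mem} {c d : ℕ} (h : Rep disc v H r σ) (hroot : σ.nat Arr.root 0 0 = r)
    (hc : phaseCost k n + d ≤ c) :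
    Wp phase (fun c τ => τ.nat Arr.root 0 0 = r ∧ (∃ H', Phase (weight disc v) H.M r
      ⟨H.u, H.p, fun _ => none, {r}⟩ H' ∧ Rep disc v H' (r + 1) τ) ∧ d ≤ c) c σ := by
  set w := weight disc v with hw
  -- Both tables have at most n rows per type, since `r + 1 ≤ n`; the coefficients add up to 40 + 6
  -- and 14 + 5.
  have hcost : k * ((r + 1) * 40 + 14) + k * (n * 6 + 5) ≤ k * (n * 46 + 19) := by
    rw [← Nat.mul_add]
    exact Nat.mul_le_mul_left k (by omega)
  rw [phaseCost] at hc
  refine .seq ((wp_candidates (d := k * (n * 6 + 5) + n * searchCost k n + 19 * n + 3 * Heap.maxHeight n + 48 + d)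
    hroot h.types ?_ (by omega)).mono ?_)
  · intro θ hθ i j hij hj
    have e1 := h.disc ⟨θ, hθ⟩ ⟨i, by omega⟩
    have e2 := h.disc ⟨θ, hθ⟩ ⟨j, by omega⟩
    simp only at e1 e2
    rw [e1, e2]
    exact hanti _ (Fin.le_def.2 hij)
  clear hc hcost
  rintro c τ₁ ⟨hn1, hr1, hcand, hc1⟩
  refine .seq ((wp_findTops (d := n * searchCost k n + 19 * n + 3 * Heap.maxHeight n + 46 + d) (n := n) (k := k)
    (by rw [hn1 _ (by decide)]; exact h.num) (by rw [hn1 _ (by decide)]; exact h.types) (by omega)).mono ?_)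
  rintro c τ ⟨htop, hn2, hr2, hc2⟩
  have hn : ∀ a, a < 43 ∧ a ≠ 12 ∨ a = 47 ∨ a = 49 → τ.nat a = σ.nat a := fun a ha => by
    rw [hn2 a (by omega), hn1 a (by simp; omega)]
  have hr : τ.real = σ.real := hr2.trans hr1
  obtain ⟨top, hp, htop⟩ := h.exists_plan (τ := τ) hdisc hanti
    (fun θ hθ j hj => by
      obtain ⟨q1, q2, q3, q4⟩ := hcand θ hθ j hj
      refine ⟨?_, ?_, ?_, ?_⟩ <;> rw [hn2 _ (by decide)] <;> assumption)
    (fun θ hθ => by simpa only [IsTop, hn1 Arr.used (by decide), hr1] using htop θ hθ)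
  have hE : Env disc v H r τ.nat top τ := by
    refine ⟨?_, ?_, ?_, ?_, ?_, ?_, ?_, ?_, fun _ _ _ => rfl, htop⟩
    · rw [hn _ (by decide)]; exact h.num
    · rw [hn _ (by decide)]; exact h.types
    · rw [hn _ (by decide)]; exact hroot
    · rw [hr]; exact h.disc
    · rw [hr]; exact h.val
    · rw [hr]; exact h.u
    · rw [hr]; exact h.p
    · rw [hn _ (by decide), hn _ (by decide)]; exact h.M
  have hF : (heapOf τ).Fresh := by
    obtain ⟨f1, f2, f3, f4⟩ := h.fresh
    refine ⟨?_, ?_, ?_, ?_⟩ <;> simp only [heapOf] at f1 f2 f3 f4 ⊢ <;> rw [hn _ (by decide)] <;> assumption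
  have hused : τ.nat Arr.used = σ.nat Arr.used := hn _ (by decide)
  clear hn hn1 hn2 hr hr1 hr2 hcand htop hc1
  obtain ⟨hS, hpot, hdone⟩ := searchInit_run hp hk hE hF
  refine .seq (.straight rfl (c - 7) (by rw [show searchInit.cost = 7 from rfl]; omega) ?_)
  have hused : (searchInit.run τ).nat Arr.used = σ.nat Arr.used := by
    rw [← hused]; exact run_nat rfl _ (by decide)
  generalize searchInit.run τ = ρ at hS hpot hdone hused ⊢
  set T₀ : Tree k n := ⟨H.u, H.p, fun _ => none, {r}⟩ with hT₀
  have hn0 : 0 < n := r.pos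
  -- The root is in the tree from the beginning, so n iterations suffice, including the last one.
  have hcost : (n - #T₀.S) * searchCost k n + searchCost k n = n * searchCost k n := by
    rw [← Nat.succ_mul]; congr 1; simp [hT₀]; omega
  refine .seq (((wp_searchLoop (d := 19 * n + 3 * Heap.maxHeight n + 39 + d) hp
    (R := fun T => ∀ H', Phase w H.M r T H' → Phase w H.M r T₀ H')
    (fun T a j m h1 h2 h3 H' hH' => h3 H' (.grow h1 h2 hH')) hS (fun _ => id) hdone
    (by rw [hpot]; omega)).framed).mono ?_)
  clear hS hpot hdone hcost hc2 hE hF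
  rintro c τ₂ ⟨⟨⟨T, cur, P, Q, hS, hR, hmin⟩, hc3⟩, hfr, -⟩
  have hused : τ₂.nat Arr.used = σ.nat Arr.used := by
    rw [← hused]; exact hfr _ (by decide)
  clear hfr
  obtain ⟨hE, hinv, hbk, hbal, -, θ₀, j₀, hbT, hbJ, hfro⟩ := hS
  have hfree : ∀ m, H.M m ≠ some (θ₀, top θ₀) := hp.free _
  have hmin' : ∀ a', (∀ m ∈ T.S, H.M m ≠ some a') → ∀ j' ∈ T.S,
      τ₂.real Arr.key 0 j₀ + H.slack w (θ₀, top θ₀) j₀ ≤ τ₂.real Arr.key 0 j' + H.slack w a' j' := by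
    intro a' ha' j' hj'
    rw [← hfro.best]; exact hmin a' ha' j' hj'
  -- Only slots ever get a nonzero status, so clearing the first n entries empties the heap.
  have hst : ∀ x, n ≤ x → τ₂.nat Arr.hSt 0 x = 0 := by
    intro x hx
    by_contra h0
    obtain ⟨m, hm, -⟩ := hfro.held x h0
    exact absurd m.2 (by omega)
  refine .seq ((wp_moveDual (d := 11 * n + 3 * Heap.maxHeight n + 37 + d) hE.num hE.root hE.u hE.p hE.M rfl rfl
    hfro.tree hp.good hfro.search.matched (hfro.search.moved hfree hfro.best_mem hfro.best) (by omega)).mono ?_)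
  rintro c τ₃ ⟨hu, hp3, hn3, hr3, hc4⟩
  refine .seq ((wp_augment (d := 3 * n + 3 * Heap.maxHeight n + 29 + d) (a₀ := (θ₀, top θ₀)) (j₀ := j₀)
    (T := T) (key := fun m => τ₂.real Arr.key 0 m) (σ := τ₃) hp.good
    (by rw [hn3 _ (by decide)]; exact hE.root) (by rw [hn3 _ (by decide), hn3 _ (by decide)]; exact hE.M)
    (by rw [hn3 Arr.src (by decide)]; exact hfro.search) hfree hfro.best_mem
    (by rw [hn3 _ (by decide)]; exact hbT) (by rw [hn3 _ (by decide)]; exact hE.top θ₀)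
    (by rw [hn3 _ (by decide)]; exact hbJ) (by omega)).mono ?_)
  rintro c τ₄ ⟨⟨M', hM', hMm⟩, hus, hn4, hr4, hc5⟩
  have hh : heapOf τ₄ = heapOf τ₂ := by
    refine heapOf_congr (fun a ha => ?_) (by rw [hr4, hr3 _ (by decide)])
    rw [hn4 a (by omega), hn3 a (by omega)]
  have hnum : τ₄.nat Arr.num 0 0 = n := by
    rw [hn4 _ (by decide), hn3 _ (by decide)]; exact hE.num
  refine ((wp_heapReset (n := n) (d := d) (by rwa [hh]) (by rwa [hh]) (by rwa [hh]) hnum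
    (fun x hx => by rw [hn4 _ (by decide), hn3 _ (by decide)]; exact hst x hx) (by omega)).framed).mono ?_
  rintro c τ₅ ⟨⟨hfresh, hd⟩, hn5, hr5⟩
  have hn5 : ∀ a, a < 10 ∨ a = 47 ∨ a = 49 → τ₅.nat a = τ₄.nat a := fun a ha =>
    hn5 a (by rw [show heapReset.natWrites = [26, 29, 27, 29, 32, 20, 32] from rfl]; simp; omega)
  have hr5 : τ₅.real = τ₄.real := funext fun a => hr5 a (by rw [show heapReset.realWrites = [] from rfl]; simp)
  have hgood := hfro.search.finish hp.good hfree hfro.best_mem hmin' hM'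
  refine ⟨?_, ⟨_, hR _ (.finish (hfro.search.nextTight (fun m _ => hfree m) hfro.best_mem hmin') hfree hM'),
    hgood, ?_, ?_, ?_, ?_, ?_, ?_, ?_, ?_, hfresh⟩, hd⟩
  · rw [hn5 _ (by decide), hn4 _ (by decide), hn3 _ (by decide)]; exact hE.root
  · rw [hn5 _ (by decide)]; exact hnum
  · rw [hn5 _ (by decide), hn4 _ (by decide), hn3 _ (by decide)]; exact hE.types
  · rw [hr5, hr4, hr3 _ (by decide)]; exact hE.disc
  · rw [hr5, hr4, hr3 _ (by decide)]; exact hE.val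
  · rw [hr5, hr4]; exact hu
  · rw [hr5, hr4]; exact hp3
  · rw [hn5 _ (by decide), hn5 _ (by decide)]; exact hMm
  · intro a
    have hrn : H.M r = none := (hp.good.dom r).2 le_rfl
    have hex := (hM'.good (P := fun _ _ => True) (fun _ _ _ _ => trivial) (fun _ _ _ => trivial)
      hp.good.inj hfree hrn).2.2.2 a
    have h1 := h.used a
    rw [hn5 _ (by decide), hus, hn3 _ (by decide), hused]
    by_cases ha : a = (θ₀, top θ₀)
    · subst ha
      simp only [true_or, iff_true] at hex
      simpa using hex
    · rw [if_neg (fun h' => ha (Prod.ext (Fin.ext h'.1) (Fin.ext h'.2))), h1]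
      simp only [ha, false_or] at hex
      simpa using not_congr hex.symm

end


/-! ### The initial dual solution, and all phases -/

/-- The largest weight. -/
def maxWeight : Com :=
  .letR Arr.bu (.lit 0) ;;
  .forLt Arr.vT (.var Arr.types) (.forLt Arr.vI (.var Arr.num)
    (.branch (.le (.var Arr.bu) (.mul (.get Arr.disc (.var Arr.vT) (.lit 0)) (.get Arr.val (.var Arr.vT) (.var Arr.vI))))
      (.letR Arr.bu (.mul (.get Arr.disc (.var Arr.vT) (.lit 0)) (.get Arr.val (.var Arr.vT) (.var Arr.vI)))) .skip))

/-- The initial prices. -/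
def initPrices : Com :=
  .forLt Arr.vS (.var Arr.num) (.setR Arr.dualP (.lit 0) (.var Arr.vS) (.var Arr.bu))

/-- The Hungarian algorithm. -/
def hungarian : Com := maxWeight ;; initPrices ;; .forLt Arr.root (.var Arr.num) phase

/-- `b` is the largest weight of the ads before `(θ, i)`. -/
def MaxBefore (σ : Mem) (n θ i : ℕ) (b : ℝ) : Prop :=
  (∀ x y, (x < θ ∧ y < n ∨ x = θ ∧ y < i) → σ.real Arr.disc x 0 * σ.real Arr.val x y ≤ b) ∧
  (b = 0 ∨ ∃ x y, (x < θ ∧ y < n ∨ x = θ ∧ y < i) ∧ b = σ.real Arr.disc x 0 * σ.real Arr.val x y)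

theorem MaxBefore.congr {σ : Mem} {n θ i θ' i' : ℕ} {b : ℝ} (h : MaxBefore σ n θ i b)
    (he : ∀ x y, (x < θ ∧ y < n ∨ x = θ ∧ y < i) ↔ (x < θ' ∧ y < n ∨ x = θ' ∧ y < i')) :
    MaxBefore σ n θ' i' b := by
  simpa only [MaxBefore, he] using h

theorem wp_maxWeight {σ : Mem} {k n c d : ℕ} (hn : σ.nat Arr.num 0 0 = n) (hk : σ.nat Arr.types 0 0 = k)
    (hc : k * (n * 5 + 4) + 3 + d ≤ c) :
    Wp maxWeight (fun c τ => MaxBefore σ n k 0 (τ.real Arr.bu 0 0) ∧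
      (∀ a, a ≠ 12 ∧ a ≠ 56 ∧ a ≠ 57 → τ.nat a = σ.nat a) ∧ (∀ a, a ≠ 13 → τ.real a = σ.real a) ∧ d ≤ c) c σ := by
  refine .seq (.straight rfl (c - 1) (by simp only [Com.cost]; omega) ?_)
  have hrun : (Com.letR Arr.bu (.lit 0)).run σ = σ.setR Arr.bu 0 0 0 := by
    simp [Com.run, NExp.eval, RExp.eval]
  rw [hrun]
  refine .forLt k (n * 5 + 2) (fun i c τ => MaxBefore σ n i 0 (τ.real Arr.bu 0 0) ∧
      (∀ a, a ≠ 12 ∧ a ≠ 56 ∧ a ≠ 57 → τ.nat a = σ.nat a) ∧ (∀ a, a ≠ 13 → τ.real a = σ.real a) ∧ d ≤ c) d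
    (by ring_nf at hc ⊢; omega) ⟨?_, ?_, ?_, le_rfl⟩ ?_ ?_ ?_
  · exact ⟨by simp, .inl (by simp [Mem.setR_real])⟩
  · intro a ha; rw [Mem.setN_nat_of_ne _ _ _ _ _ ha.2.1]; rfl
  · intro a ha; exact Mem.setR_real_of_ne _ _ _ _ _ ha
  · rintro i c τ ⟨-, h, -⟩
    simp only [NExp.eval, h Arr.types (by decide), hk]
  · rintro θ hθ c τ ⟨h1, h2, h3, hd⟩ hvT
    refine .forLt n 3 (fun i c τ => MaxBefore σ n θ i (τ.real Arr.bu 0 0) ∧ τ.nat Arr.vT 0 0 = θ ∧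
      (∀ a, a ≠ 12 ∧ a ≠ 56 ∧ a ≠ 57 → τ.nat a = σ.nat a) ∧ (∀ a, a ≠ 13 → τ.real a = σ.real a) ∧ d ≤ c) c
      (by omega) ⟨h1, ?_, ?_, h3, hd⟩ ?_ ?_ ?_
    · rw [Mem.setN_nat_of_ne _ _ _ _ _ (by decide), hvT]
    · intro a ha; rw [Mem.setN_nat_of_ne _ _ _ _ _ ha.2.2, h2 a ha]
    · rintro i c τ ⟨-, -, h, -⟩
      simp only [NExp.eval, h Arr.num (by decide), hn]
    · clear h1 h2 h3 hd hvT τ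
      rintro i hi c τ ⟨⟨h1, h1'⟩, hvT, h2, h3, hd⟩ hvI
      refine .straight rfl c (by simp only [Com.cost, Com.skip]; omega) ?_
      have e1 : τ.real Arr.disc = σ.real Arr.disc := h3 _ (by decide)
      have e2 : τ.real Arr.val = σ.real Arr.val := h3 _ (by decide)
      have hsplit : ∀ x y, (x < θ ∧ y < n ∨ x = θ ∧ y < i + 1) →
          (x < θ ∧ y < n ∨ x = θ ∧ y < i) ∨ x = θ ∧ y = i := by omega
      by_cases hb : τ.real Arr.bu 0 0 ≤ σ.real Arr.disc θ 0 * σ.real Arr.val θ i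
      · rw [Com.run_branch_true (by simpa [BExp.eval, NExp.eval, RExp.eval, hvT, hvI, e1, e2] using hb)]
        simp only [Com.run, NExp.eval, RExp.eval, hvT, hvI, e1, e2]
        refine ⟨hvI, ⟨fun x y hxy => ?_, .inr ⟨θ, i, by omega, by simp [Mem.setR_real]⟩⟩, ?_, ?_, ?_, hd⟩
        · have hs : (τ.setR Arr.bu 0 0 (σ.real Arr.disc θ 0 * σ.real Arr.val θ i)).real Arr.bu 0 0 =
            σ.real Arr.disc θ 0 * σ.real Arr.val θ i := by simp [Mem.setR_real]
          refine le_trans ?_ (le_of_eq hs.symm)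
          rcases hsplit x y hxy with h | ⟨rfl, rfl⟩
          · exact (h1 x y h).trans hb
          · exact le_rfl
        · rw [Mem.setN_nat_of_ne _ _ _ _ _ (by decide)]; exact hvT
        · intro a ha; rw [Mem.setN_nat_of_ne _ _ _ _ _ ha.2.2]; exact h2 a ha
        · intro a ha
          exact (Mem.setR_real_of_ne _ _ _ _ _ ha).trans (h3 a ha)
      · rw [Com.run_branch_false (by simpa [BExp.eval, NExp.eval, RExp.eval, hvT, hvI, e1, e2] using hb),
          Com.run_skip]
        refine ⟨hvI, ⟨fun x y hxy => ?_, h1'.imp_right ?_⟩, ?_, ?_, h3, hd⟩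
        · rcases hsplit x y hxy with h | ⟨rfl, rfl⟩
          · exact h1 x y h
          · exact (not_le.1 hb).le
        · rintro ⟨x, y, h, h'⟩
          exact ⟨x, y, by omega, h'⟩
        · rw [Mem.setN_nat_of_ne _ _ _ _ _ (by decide)]; exact hvT
        · intro a ha; rw [Mem.setN_nat_of_ne _ _ _ _ _ ha.2.2]; exact h2 a ha
    · rintro c τ ⟨h1, hvT, h2, h3, hd⟩ -
      refine ⟨hvT, h1.congr (by omega), ?_, h3, hd⟩
      intro a ha; rw [Mem.setN_nat_of_ne _ _ _ _ _ ha.2.1]; exact h2 a ha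
  · rintro c τ ⟨h1, h2, h3, hd⟩ -
    exact ⟨h1, h2, h3, hd⟩

theorem wp_initPrices {σ : Mem} {n c d : ℕ} (hn : σ.nat Arr.num 0 0 = n) (hc : n * 3 + 2 + d ≤ c) :
    Wp initPrices (fun c τ => (∀ j < n, τ.real Arr.dualP 0 j = σ.real Arr.bu 0 0) ∧
      (∀ a, a ≠ 66 → τ.nat a = σ.nat a) ∧ (∀ a, a ≠ 9 → τ.real a = σ.real a) ∧ d ≤ c) c σ := by
  refine .forLt n 1 (fun i c τ => (∀ j < i, τ.real Arr.dualP 0 j = σ.real Arr.bu 0 0) ∧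
      (∀ a, a ≠ 66 → τ.nat a = σ.nat a) ∧ (∀ a, a ≠ 9 → τ.real a = σ.real a) ∧ d ≤ c) d
    (by omega) ⟨by simp, ?_, fun _ _ => rfl, le_rfl⟩ ?_ ?_ ?_
  · intro a ha; rw [Mem.setN_nat_of_ne _ _ _ _ _ ha]
  · rintro i c τ ⟨-, h, -⟩
    simp only [NExp.eval, h Arr.num (by decide), hn]
  · rintro i hi c τ ⟨h1, h2, h3, hd⟩ hv
    refine .straight rfl c (by simp only [Com.cost]; omega) ?_
    have hrun : (Com.setR Arr.dualP (.lit 0) (.var Arr.vS) (.var Arr.bu)).run τ =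
        τ.setR Arr.dualP 0 i (σ.real Arr.bu 0 0) := by
      simp [Com.run, NExp.eval, RExp.eval, hv, h3]
    rw [hrun]
    refine ⟨hv, fun j hj => ?_, ?_, ?_, hd⟩
    · by_cases hji : j = i
      · simp [Mem.setR_real, hji]
      · have := h1 j (by omega)
        simp [Mem.setR_real, hji, this]
    · intro a ha; rw [Mem.setN_nat_of_ne _ _ _ _ _ ha]; exact h2 a ha
    · intro a ha; exact (Mem.setR_real_of_ne _ _ _ _ _ ha).trans (h3 a ha)
  · rintro c τ ⟨h1, h2, h3, hd⟩ -
    exact ⟨h1, h2, h3, hd⟩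

section

variable {k n : ℕ} {disc : Fin k → Fin n → ℝ} {v : Ad k n → ℝ} {H : HState k n}

theorem table_apply (f : Ad k n → ℝ) (a : Ad k n) : table f a.1 a.2 = f a := by
  simp [table]

/-- Discounts decrease and values are nonnegative, so the first slot alone determines the maximum.
The starting value 0 of the program is harmless because no weight is negative. -/
theorem iSup_weight {σ : Mem} {b : ℝ} (hk : 0 < k) (hn : 0 < n)
    (hdisc : ∀ (θ : Fin k) (j : Fin n), σ.real Arr.disc θ j = disc θ j)
    (hval : ∀ a : Ad k n, σ.real Arr.val a.1 a.2 = v a) (h0 : ∀ θ j, 0 ≤ disc θ j)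
    (hanti : ∀ θ, Antitone (disc θ)) (hv : ∀ a, 0 ≤ v a) (h : MaxBefore σ n k 0 b) :
    ⨆ e : Ad k n × Fin n, weight disc v e.1 e.2 = b := by
  have hw : ∀ (a : Ad k n), σ.real Arr.disc a.1 0 * σ.real Arr.val a.1 a.2 = weight disc v a ⟨0, hn⟩ := by
    intro a
    rw [hval, weight, ← hdisc]
  have : Nonempty (Ad k n × Fin n) := ⟨((⟨0, hk⟩, ⟨0, hn⟩), ⟨0, hn⟩)⟩
  refine le_antisymm (ciSup_le fun e => ?_) ?_
  · have := h.1 e.1.1 e.1.2 (.inl ⟨e.1.1.2, e.1.2.2⟩)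
    rw [hw] at this
    exact (mul_le_mul_of_nonneg_right (hanti _ (Fin.le_def.2 (Nat.zero_le _))) (hv _)).trans this
  · rcases h.2 with rfl | ⟨x, y, hxy, rfl⟩
    · exact Real.iSup_nonneg fun e => mul_nonneg (h0 _ _) (hv _)
    · have hx : x < k ∧ y < n := by omega
      have := hw (⟨x, hx.1⟩, ⟨y, hx.2⟩)
      simp only at this
      rw [this]
      exact le_ciSup (f := fun e : Ad k n × Fin n => weight disc v e.1 e.2) (Set.finite_range _).bddAbove
        ((⟨x, hx.1⟩, ⟨y, hx.2⟩), ⟨0, hn⟩)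

theorem Rep.congr {r : ℕ} {σ τ : Mem} (h : Rep disc v H r σ) (hn : ∀ a, a ≠ 49 → τ.nat a = σ.nat a)
    (hr : τ.real = σ.real) : Rep disc v H r τ := by
  obtain ⟨h0, h1, h2, h3, h4, h5, h6, h7, h8, ⟨g1, g2, g3, g4⟩⟩ := h
  refine ⟨h0, ?_, ?_, ?_, ?_, ?_, ?_, ?_, ?_, ?_, ?_, ?_, ?_⟩ <;>
    simp only [heapOf] at g1 g2 g3 g4 ⊢ <;> first
    | rw [hr]; assumption
    | rw [hn _ (by decide)]; assumption
    | rw [hn _ (by decide), hn _ (by decide)]; assumption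

theorem wp_hungarian (hk : 0 < k) (hn : 0 < n) (hdisc : ∀ θ j, 0 ≤ disc θ j)
    (hanti : ∀ θ, Antitone (disc θ)) (hv : ∀ a, 0 ≤ v a) :
    Wp hungarian (fun _ τ => HungarianResult disc v (readHState k n τ))
      (k * (n * 5 + 4) + 3 + (n * 3 + 2) + (n * (phaseCost k n + 2) + 2))
      (allocMem k n (table fun a => disc a.1 a.2) (table v)) := by
  set σ := allocMem k n (table fun a => disc a.1 a.2) (table v) with hσ
  have hd : ∀ (θ : Fin k) (j : Fin n), σ.real Arr.disc θ j = disc θ j := fun θ j => by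
    simp [hσ, allocMem, table]
  have hva : ∀ a : Ad k n, σ.real Arr.val a.1 a.2 = v a := fun a => by
    simp [hσ, allocMem, table]
  have hz : ∀ a x y, 2 ≤ a → σ.nat a x y = 0 := fun a x y ha => by
    have h1 : a ≠ 0 := by omega
    have h2 : a ≠ 1 := by omega
    simp [hσ, allocMem, h1, h2]
  have hzr : ∀ a x y, 2 ≤ a → σ.real a x y = 0 := fun a x y ha => by
    have h1 : a ≠ 0 := by omega
    have h2 : a ≠ 1 := by omega
    simp [hσ, allocMem, h1, h2]
  have hnum : σ.nat Arr.num 0 0 = n := by simp [hσ, allocMem]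
  have htypes : σ.nat Arr.types 0 0 = k := by simp [hσ, allocMem]
  have : Nonempty (Ad k n × Fin n) := ⟨((⟨0, hk⟩, ⟨0, hn⟩), ⟨0, hn⟩)⟩
  clear_value σ
  refine .seq ((wp_maxWeight (d := (n * 3 + 2) + (n * (phaseCost k n + 2) + 2)) hnum htypes
    (by omega)).mono ?_)
  rintro c τ₁ ⟨hmax, hn1, hr1, hc1⟩
  refine .seq ((wp_initPrices (n := n) (d := n * (phaseCost k n + 2) + 2)
    (by rw [hn1 _ (by decide), hnum]) (by omega)).mono ?_)
  rintro c τ₂ ⟨hp, hn2, hr2, hc2⟩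
  have hsup := iSup_weight hk hn hd hva hdisc hanti hv hmax
  have hnn : ∀ a, a < 12 ∨ 20 ≤ a ∧ a ≤ 49 → τ₂.nat a = σ.nat a := fun a ha => by
    rw [hn2 _ (by omega), hn1 _ (by omega)]
  have hrr : ∀ a, a < 9 → τ₂.real a = σ.real a := fun a ha => by
    rw [hr2 _ (by omega), hr1 _ (by omega)]
  have h0 : Rep disc v (HState.init (weight disc v)) 0 τ₂ := by
    refine ⟨HState.good_init, ?_, ?_, ?_, ?_, ?_, ?_, ?_, ?_, ⟨?_, ?_, ?_, ?_⟩⟩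
    · rw [hnn _ (by decide), hnum]
    · rw [hnn _ (by decide), htypes]
    · rw [hrr _ (by decide)]; exact hd
    · rw [hrr _ (by decide)]; exact hva
    · intro a; rw [hrr _ (by decide), hzr _ _ _ (by decide)]; rfl
    · intro j; rw [hp j j.2, ← hsup]; rfl
    · intro j a h; simp [HState.init] at h
    · intro a; rw [hnn _ (by decide), hz _ _ _ (by decide)]; simp [HState.init]
    · intro x; rw [heapOf_st, hnn _ (by decide), hz _ _ _ (by decide)]
    · intro x; rw [heapOf_bk, hnn _ (by decide), hz _ _ _ (by decide)]
    · rw [heapOf_pn, hnn _ (by decide), hz _ _ _ (by decide)]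
    · intro x; rw [heapOf_cnt, hnn _ (by decide), hz _ _ _ (by decide)]
  -- The invariant says that any completion by the remaining phases is a run of the whole algorithm;
  -- this turns the list recursion of `Phases` into a forward loop. No budget has to be carried
  -- over, since each phase starts with an empty heap.
  refine .forLt n (phaseCost k n) (fun i _ τ => ∃ H, Rep disc v H i τ ∧
      ∀ H', Phases (weight disc v) ((List.finRange n).drop i) H H' → HungarianResult disc v H') 0
    (by omega) ⟨_, h0.congr (fun a ha => Mem.setN_nat_of_ne _ _ _ _ _ ha) rfl, fun _ => id⟩ ?_ ?_ ?_
  · rintro i c τ ⟨H, h, -⟩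
    exact h.num
  · rintro i hi c τ ⟨H, h, hP⟩ hroot
    refine (wp_phase (d := 0) (r := ⟨i, hi⟩) hdisc hanti hk h hroot (by omega)).mono ?_
    rintro c τ' ⟨hroot', ⟨H', hph, h'⟩, -⟩
    refine ⟨hroot', H', h'.congr (fun a ha => Mem.setN_nat_of_ne _ _ _ _ _ ha) rfl, fun H'' hH => hP H'' ?_⟩
    rw [List.drop_eq_getElem_cons (by simpa using hi)]
    refine .cons ?_ hH
    simpa using hph
  · rintro c τ ⟨H, h, hP⟩ -
    have hres := hP H (by rw [List.drop_of_length_le (by simp)]; exact .nil)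
    convert hres
    simp only [readHState]
    obtain ⟨u, p, M⟩ := H
    congr 1
    · exact funext h.u
    · exact funext h.p
    · funext j
      -- After n phases every slot is matched, so every cell that is read was written by an
      -- augmentation.
      obtain ⟨a, ha⟩ := Option.ne_none_iff_exists'.1 (mt (h.good.dom j).1 (not_le.2 j.2))
      obtain ⟨e1, e2⟩ := h.M j a ha
      rw [e1, e2]
      exact (by simp [readAd] : readAd k n a.1 a.2 = some a).trans ha.symm

end


/-! ## Lowering the value of an ad that gets no slot -/

section

variable {k n : ℕ} {w w' : Ad k n → Fin n → ℝ}

/-- An augmentation moves ads but releases none. Therefore an ad without a slot at the end of a run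
never had one. -/
theorem Augment.exists_slot {par : Ad k n → Option (Fin n)} {r : Fin n} {M M' : Assignment k n} {a : Ad k n}
    (h : Augment par r M a M') (hr : M r = none) {b : Ad k n} (hb : b = a ∨ ∃ j, M j = some b) :
    ∃ j, M' j = some b := by
  induction h with
  | @last M a h =>
    rcases hb with rfl | ⟨j, hj⟩
    · exact ⟨r, by simp⟩
    · exact ⟨j, by rw [Function.update_of_ne (by rintro rfl; simp [hr] at hj), hj]⟩
  | @move M M' a c j h hj hc hM ih =>
    refine ih (by rw [Function.update_of_ne hj.symm, hr]) ?_
    rcases hb with rfl | ⟨i, hi⟩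
    · exact .inr ⟨j, by simp⟩
    · by_cases hij : i = j
      · subst hij; exact .inl (by simpa [hc] using hi.symm)
      · exact .inr ⟨i, by rw [Function.update_of_ne hij, hi]⟩

theorem Augment.free {par : Ad k n → Option (Fin n)} {r : Fin n} {M M' : Assignment k n} {a : Ad k n}
    (h : Augment par r M a M') {i : Fin n} (hi : i ≠ r) (hM : M i = none) : M' i = none := by
  induction h with
  | last h => rw [Function.update_of_ne hi, hM]
  | @move M M' a c j h hj hc hM' ih =>
    refine ih ?_
    rw [Function.update_of_ne (by rintro rfl; simp [hc] at hM), hM]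

theorem Phase.exists_slot {M : Assignment k n} {r : Fin n} {T : Tree k n} {H : HState k n}
    (h : Phase w M r T H) (hr : M r = none) {b : Ad k n} (hb : ∃ j, M j = some b) :
    ∃ j, H.M j = some b := by
  induction h with
  | grow _ _ _ ih => exact ih
  | finish _ _ hM => exact hM.exists_slot hr (.inr hb)

theorem Phase.free {M : Assignment k n} {r : Fin n} {T : Tree k n} {H : HState k n}
    (h : Phase w M r T H) {i : Fin n} (hi : i ≠ r) (hM : M i = none) : H.M i = none := by
  induction h with
  | grow _ _ _ ih => exact ih
  | finish _ _ h => exact h.free hi hM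

/-- Lowering the weights of `a` only increases the slacks of `a`, so a minimal edge to another ad
remains minimal. -/
theorem Tree.NextTight.lower {T : Tree k n} {a b : Ad k n} {j : Fin n} (h : T.NextTight w b j)
    (hw : ∀ c, c ≠ a → w' c = w c) (hle : ∀ j, w' a j ≤ w a j) (hb : b ≠ a) : T.NextTight w' b j := by
  refine ⟨h.1, h.2.1, fun c i hc hi => ?_⟩
  have h1 := h.2.2 c i hc hi
  have h2 : w' c i ≤ w c i := by
    by_cases hca : c = a
    · subst hca; exact hle i
    · rw [hw c hca]
  simp only [Tree.slack, hw b hb] at h1 ⊢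
  linarith

theorem Tree.addEdge_congr {T : Tree k n} {b : Ad k n} {j : Fin n} (h : w' b = w b) :
    T.addEdge w' b j = T.addEdge w b j := by
  simp only [Tree.addEdge, Tree.slack, h]

/-- Every ad that the phase puts into the tree has a slot when the phase ends. So `a` is never
chosen, and the same choices are still valid for the new weights. -/
theorem Phase.lower {M : Assignment k n} {r : Fin n} {T : Tree k n} {H : HState k n} {a : Ad k n}
    (h : Phase w M r T H) (hr : M r = none) (ha : ∀ j, H.M j ≠ some a)
    (hw : ∀ c, c ≠ a → w' c = w c) (hle : ∀ j, w' a j ≤ w a j) : Phase w' M r T H := by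
  induction h with
  | @grow T H b j m h1 h2 h3 ih =>
    have hb : b ≠ a := by
      rintro rfl
      obtain ⟨i, hi⟩ := h3.exists_slot hr ⟨m, h2⟩
      exact ha i hi
    refine .grow (h1.lower hw hle hb) h2 ?_
    rw [Tree.addEdge_congr (hw b hb)]
    exact ih ha
  | @finish T M' b j h1 h2 h3 =>
    have hb : b ≠ a := by
      rintro rfl
      obtain ⟨i, hi⟩ := h3.exists_slot hr (.inl rfl)
      exact ha i hi
    have he : T.addEdge w' b j = T.addEdge w b j := Tree.addEdge_congr (hw b hb)
    have := Phase.finish (w := w') (h1.lower hw hle hb) h2 (he.symm ▸ h3)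
    rwa [he] at this

theorem Phases.exists_slot {l : List (Fin n)} {H H' : HState k n} (h : Phases w l H H') (hl : l.Nodup)
    (hf : ∀ i ∈ l, H.M i = none) {b : Ad k n} (hb : ∃ j, H.M j = some b) : ∃ j, H'.M j = some b := by
  induction h with
  | nil => exact hb
  | @cons H H' H'' j l h hl' ih =>
    rw [List.nodup_cons] at hl
    exact ih hl.2 (fun i hi => h.free (fun he => hl.1 (he ▸ hi)) (hf i (List.mem_cons_of_mem _ hi)))
      (h.exists_slot (hf j List.mem_cons_self) hb)

theorem Phases.lower {l : List (Fin n)} {H H' : HState k n} {a : Ad k n} (h : Phases w l H H') (hl : l.Nodup)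
    (hf : ∀ i ∈ l, H.M i = none) (ha : ∀ j, H'.M j ≠ some a)
    (hw : ∀ c, c ≠ a → w' c = w c) (hle : ∀ j, w' a j ≤ w a j) : Phases w' l H H' := by
  induction h with
  | nil => exact .nil
  | @cons H H' H'' j l h hl' ih =>
    rw [List.nodup_cons] at hl
    have hf' : ∀ i ∈ l, H'.M i = none := fun i hi =>
      h.free (fun he => hl.1 (he ▸ hi)) (hf i (List.mem_cons_of_mem _ hi))
    refine .cons (h.lower (hf j List.mem_cons_self) (fun i hi => ?_) hw hle) (ih hl.2 hf' ha)
    obtain ⟨i', hi'⟩ := hl'.exists_slot hl.2 hf' ⟨i, hi⟩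
    exact ha i' hi'

/-- The value of an ad that gets no slot can be lowered. -/
theorem HungarianResult.lower {disc : Fin k → Fin n → ℝ} {v : Ad k n → ℝ} {H : HState k n} {a : Ad k n}
    {x : ℝ} (h : HungarianResult disc v H) (hn : 0 < n) (hdisc : ∀ θ j, 0 ≤ disc θ j)
    (hanti : ∀ θ, Antitone (disc θ)) (hv : ∀ a, 0 ≤ v a) (hx : x ≤ v a) (ha : ∀ j, H.M j ≠ some a) :
    HungarianResult disc (Function.update v a x) H := by
  set w := weight disc v with hw
  set w' := weight disc (Function.update v a x) with hw'
  have hne : ∀ c, c ≠ a → w' c = w c := fun c hc => by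
    funext j; simp [hw, hw', weight, hc]
  have hle : ∀ j, w' a j ≤ w a j := fun j => by
    simpa [hw, hw', weight] using mul_le_mul_of_nonneg_left hx (hdisc a.1 j)
  have hnd : (List.finRange n).Nodup := List.nodup_finRange n
  have hlow := Phases.lower h hnd (fun _ _ => rfl) ha hne hle
  suffices hinit : HState.init w' = HState.init w by
    rw [HungarianResult, hinit]; exact hlow
  obtain ⟨m, rfl⟩ : ∃ m, n = m + 1 := ⟨n - 1, by omega⟩
  rw [HungarianResult, List.finRange_succ] at h
  rw [List.finRange_succ] at hnd
  -- All prices are equal at the start, so the first phase matches the ad of largest weight in the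
  -- first slot at once. That ad stays matched and is not `a`, hence the largest weight, and with it
  -- the initial price, survives the change.
  have key : ∃ b, b ≠ a ∧ ∀ c, w c 0 ≤ w b 0 := by
    cases h with
    | cons h hl =>
      rw [List.nodup_cons] at hnd
      have hmem : ∀ b, (∃ j, (_ : HState k (m + 1)).M j = some b) → b ≠ a := fun b hb hba => by
        obtain ⟨i, hi⟩ := hl.exists_slot hnd.2
          (fun i hi => h.free (fun he => hnd.1 (he ▸ hi)) rfl) hb
        exact ha i (hba ▸ hi)
      cases h with
      | grow _ h2 _ => simp [HState.init] at h2
      | @finish _ M' b j h1 h2 h3 =>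
        refine ⟨b, hmem b (h3.exists_slot rfl (.inl rfl)), fun c => ?_⟩
        have hj := h1.2.1
        have := h1.2.2 c 0 rfl (by simp)
        rw [mem_singleton] at hj
        subst hj
        simp only [Tree.slack, HState.init] at this
        linarith
  obtain ⟨b, hba, hb⟩ := key
  have hsup : ∀ f : Ad k (m + 1) → Fin (m + 1) → ℝ, (∀ c j, f c j ≤ f b 0) →
      ⨆ e : Ad k (m + 1) × Fin (m + 1), f e.1 e.2 = f b 0 := fun f hf =>
    have : Nonempty (Ad k (m + 1) × Fin (m + 1)) := ⟨(b, 0)⟩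
    le_antisymm (ciSup_le fun e => hf _ _)
      (le_ciSup (f := fun e : Ad k (m + 1) × Fin (m + 1) => f e.1 e.2) (Set.finite_range _).bddAbove (b, 0))
  have hwb : ∀ c j, w c j ≤ w b 0 := fun c j =>
    (mul_le_mul_of_nonneg_right (hanti _ (Fin.zero_le _)) (hv _)).trans (hb c)
  have hwb' : ∀ c j, w' c j ≤ w' b 0 := fun c j => by
    rw [hne b hba]
    by_cases hc : c = a
    · subst hc; exact (hle j).trans (hwb c j)
    · rw [hne c hc]; exact hwb c j
  simp only [HState.init, hsup w hwb, hsup w' hwb', hne b hba]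

end

/-! ## Running times -/

/-- A bound for the running time of the Hungarian algorithm. -/
def hungarianCost (k n : ℕ) : ℕ :=
  k * (n * 5 + 4) + 3 + (n * 3 + 2) + (n * (phaseCost k n + 2) + 2)

/-- The leading terms come from n phases with n iterations each: `relaxCost` per type, and 247 · 3
per unit of the logarithm. The additive constants are absorbed by `k ≥ 1`, which also covers `n =
1`. -/
theorem hungarianCost_le {k n : ℕ} (hk : 0 < k) (hn : 0 < n) :
    hungarianCost k n ≤ 5000 * (n * n * (k + Nat.log 2 n)) := by
  have h1 : k ≤ k * (n * n) := Nat.le_mul_of_pos_right _ (by positivity)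
  have h2 : n ≤ n * n := Nat.le_mul_of_pos_right _ hn
  have h3 : n * n ≤ k * (n * n) := Nat.le_mul_of_pos_left _ hk
  have h4 : k * n ≤ k * (n * n) := Nat.mul_le_mul_left _ h2
  have h5 : n * Nat.log 2 n ≤ n * n * Nat.log 2 n := Nat.mul_le_mul_right _ h2
  have h6 : 1 ≤ n := hn
  simp only [hungarianCost, phaseCost, searchCost, relaxCost, Heap.maxHeight]
  nlinarith

/-- The factor 2 comes from ln 2 > 1/2. -/
theorem natLog_le (n : ℕ) (hn : 0 < n) : (Nat.log 2 n : ℝ) ≤ 2 * Real.log n := by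
  have h1 : ((2 : ℕ) ^ Nat.log 2 n : ℕ) ≤ n := Nat.pow_log_le_self 2 hn.ne'
  have h2 : Real.log ((2 : ℝ) ^ Nat.log 2 n) ≤ Real.log n :=
    Real.log_le_log (by positivity) (by exact_mod_cast h1)
  rw [Real.log_pow] at h2
  have h3 := Real.log_two_gt_d9
  have h4 : (0 : ℝ) ≤ Nat.log 2 n := Nat.cast_nonneg _
  nlinarith


/-! ## Loops with calls -/

section

variable {φ : Mem → ℕ → Mem → Prop} {s : Com} {σ : Mem}

theorem Exec.cast {t t' q q' : ℕ} {τ : Mem} (h : Exec φ s σ t q τ) (ht : t = t') (hq : q = q') :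
    Exec φ s σ t' q' τ := by subst ht hq; exact h

/-- The rule for counting loops; the invariant speaks of the time and of the number of calls. -/
theorem exec_forLt {a : ℕ} {e : NExp} (N : ℕ) (I : ℕ → ℕ → ℕ → Mem → Prop) (h0 : I 0 0 0 (σ.setN a 0 0 0))
    (he : ∀ i t q τ, I i t q τ → e.eval τ = N)
    (hs : ∀ i < N, ∀ t q τ, I i t q τ → τ.nat a 0 0 = i → ∃ t' q' τ', Exec φ s τ t' q' τ' ∧
      τ'.nat a 0 0 = i ∧ I (i + 1) (t + t') (q + q') (τ'.setN a 0 0 (i + 1))) :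
    ∃ t q τ, Exec φ (.forLt a e s) σ (t + 2 * N + 2) q τ ∧ I N t q τ := by
  have key : ∀ m i, i + m = N → ∀ t q τ, I i t q τ → τ.nat a 0 0 = i →
      ∃ t' q' τ', Exec φ (.loop (.lt (.var a) e) (.seq s (.setN a (.lit 0) (.lit 0) (.add (.var a) (.lit 1)))))
        τ (t' + 2 * m + 1) q' τ' ∧ I N (t + t') (q + q') τ' := by
    intro m
    induction m with
    | zero =>
      rintro i rfl t q τ hI ha
      refine ⟨0, 0, τ, .loopFalse ?_, hI⟩
      simp only [BExp.eval, NExp.eval, he _ _ _ _ hI, ha]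
      omega
    | succ m ih =>
      rintro i hi t q τ hI ha
      obtain ⟨t', q', τ', hex, ha', hI'⟩ := hs i (by omega) t q τ hI ha
      obtain ⟨t'', q'', τ'', hex', hI''⟩ := ih (i + 1) (by omega) _ _ _ hI' (by simp [Mem.setN_nat])
      have hb : BExp.eval τ (.lt (.var a) e) := by
        simp only [BExp.eval, NExp.eval, he _ _ _ _ hI, ha]; omega
      have h1 : Exec φ (.setN a (.lit 0) (.lit 0) (.add (.var a) (.lit 1))) τ' 1 0 (τ'.setN a 0 0 (i + 1)) := by
        have := @Exec.setN φ a (.lit 0) (.lit 0) (.add (.var a) (.lit 1)) τ'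
        simp only [NExp.eval, ha'] at this
        exact this
      exact ⟨t' + t'', q' + q'', τ'', (Exec.loopTrue hb (.seq hex h1) hex').cast (by omega) (by omega),
        by rwa [← add_assoc, ← add_assoc]⟩
  obtain ⟨t, q, τ, hex, hI⟩ := key N 0 (by omega) 0 0 _ h0 (by simp [Mem.setN_nat])
  rw [zero_add, zero_add] at hI
  have h1 := @Exec.setN φ a (.lit 0) (.lit 0) (.lit 0) σ
  exact ⟨t, q, τ, (Exec.seq h1 hex).cast (by omega) (by omega), hI⟩

theorem exec_forSlots {n : ℕ} (I : ℕ → Mem → Prop) (h0 : I 0 (σ.setN Arr.cJ 0 0 0))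
    (hn : ∀ i τ, I i τ → τ.nat Arr.num 0 0 = n) (hst : s.isStraight = true)
    (hs : ∀ i < n, ∀ τ, I i τ → τ.nat Arr.cJ 0 0 = i →
      (s.run τ).nat Arr.cJ 0 0 = i ∧ I (i + 1) ((s.run τ).setN Arr.cJ 0 0 (i + 1))) :
    ∃ t τ, Exec φ (forSlots s) σ t 0 τ ∧ t ≤ n * (s.cost + 2) + 2 ∧ I n τ := by
  obtain ⟨t, q, τ, hex, ⟨ht, rfl⟩, hI⟩ := exec_forLt (φ := φ) (s := s) (σ := σ) (a := Arr.cJ)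
    (e := .var Arr.num) n (fun i t q τ => (t ≤ i * s.cost ∧ q = 0) ∧ I i τ) ⟨by simp, h0⟩
    (fun i t q τ h => hn i τ h.2) (fun i hi t q τ ⟨⟨ht, hq⟩, hI⟩ ha => by
      obtain ⟨t', ht', hex⟩ := exec_run φ s hst τ
      obtain ⟨h1, h2⟩ := hs i hi τ hI ha
      refine ⟨t', 0, _, hex, h1, ⟨?_, by omega⟩, h2⟩
      rw [Nat.succ_mul]; omega)
  refine ⟨_, τ, hex, ?_, hI⟩
  rw [Nat.mul_add]; omega

/-- The rule for loops over all ads; the invariant speaks of the set of the ads that have been visited. -/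
theorem exec_forAds {k n : ℕ} (I : Finset (Ad k n) → ℕ → ℕ → Mem → Prop) (h0 : I ∅ 0 0 σ)
    (hset : ∀ S t q τ a x, a = Arr.cT ∨ a = Arr.cI → I S t q τ → I S t q (τ.setN a 0 0 x))
    (hnum : ∀ S t q τ, I S t q τ → τ.nat Arr.types 0 0 = k ∧ τ.nat Arr.num 0 0 = n)
    (hs : ∀ S a t q τ, a ∉ S → I S t q τ → τ.nat Arr.cT 0 0 = a.1 → τ.nat Arr.cI 0 0 = a.2 →
      ∃ t' q' τ', Exec φ s τ t' q' τ' ∧ τ'.nat Arr.cT 0 0 = a.1 ∧ τ'.nat Arr.cI 0 0 = a.2 ∧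
        I (insert a S) (t + t') (q + q') τ') :
    ∃ t q τ, Exec φ (forAds s) σ (t + k * (2 * n + 4) + 2) q τ ∧ I univ t q τ := by
  -- The set of visited ads is an initial segment of the lexicographic order; `hset` is needed
  -- because the loops change the two counters between the visits.
  have inner : ∀ θ < k, ∀ t₀ q τ, I (univ.filter fun a => (a.1 : ℕ) < θ) t₀ q τ → τ.nat Arr.cT 0 0 = θ →
      ∃ t' q' τ', Exec φ (.forLt Arr.cI (.var Arr.num) s) τ (t' + 2 * n + 2) q' τ' ∧
        τ'.nat Arr.cT 0 0 = θ ∧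
        I (univ.filter fun a => (a.1 : ℕ) < θ ∨ (a.1 : ℕ) = θ ∧ (a.2 : ℕ) < n) (t₀ + t') (q + q') τ' := by
    intro θ hθ t₀ q τ hI hT
    refine exec_forLt n (fun i t' q' τ => τ.nat Arr.cT 0 0 = θ ∧
      I (univ.filter fun a => (a.1 : ℕ) < θ ∨ (a.1 : ℕ) = θ ∧ (a.2 : ℕ) < i) (t₀ + t') (q + q') τ)
      ⟨by rw [Mem.setN_nat_of_ne _ _ _ _ _ (by decide)]; exact hT,
        by simpa using hset _ _ _ _ Arr.cI 0 (.inr rfl) hI⟩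
      (fun i t q τ ⟨_, h⟩ => (hnum _ _ _ _ h).2) ?_
    rintro i hi t' q' τ ⟨hT, hI⟩ hi'
    obtain ⟨t'', q'', τ'', hex, h1, h2, h3⟩ := hs _ (⟨θ, hθ⟩, ⟨i, hi⟩) _ _ _ (by simp) hI hT hi'
    refine ⟨t'', q'', τ'', hex, h2, ?_, ?_⟩
    · rw [Mem.setN_nat_of_ne _ _ _ _ _ (by decide)]; exact h1
    · have : (univ.filter fun a : Ad k n => (a.1 : ℕ) < θ ∨ (a.1 : ℕ) = θ ∧ (a.2 : ℕ) < i + 1) =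
          insert (⟨θ, hθ⟩, ⟨i, hi⟩) (univ.filter fun a => (a.1 : ℕ) < θ ∨ (a.1 : ℕ) = θ ∧ (a.2 : ℕ) < i) := by
        ext a
        simp only [mem_filter, mem_univ, true_and, mem_insert, Prod.ext_iff, Fin.ext_iff]
        omega
      rw [this, ← add_assoc, ← add_assoc]
      exact hset _ _ _ _ Arr.cI _ (.inr rfl) h3
  obtain ⟨t, q, τ, hex, t₀, rfl, hI⟩ : ∃ t q τ, Exec φ (forAds s) σ (t + 2 * k + 2) q τ ∧
      ∃ t₀, t = t₀ + k * (2 * n + 2) ∧ I (univ.filter fun a => (a.1 : ℕ) < k) t₀ q τ := by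
    refine exec_forLt k
      (fun θ t q τ => ∃ t₀, t = t₀ + θ * (2 * n + 2) ∧ I (univ.filter fun a => (a.1 : ℕ) < θ) t₀ q τ)
      ⟨0, by simp, by simpa using hset _ _ _ _ Arr.cT 0 (.inl rfl) h0⟩
      (fun θ t q τ ⟨_, _, h⟩ => (hnum _ _ _ _ h).1) ?_
    rintro θ hθ t q τ ⟨t₀, rfl, hI⟩ hT
    obtain ⟨t', q', τ', hex, hT', hI'⟩ := inner θ hθ t₀ q τ hI hT
    refine ⟨_, q', τ', hex, hT', t₀ + t', by ring, ?_⟩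
    have : (univ.filter fun a : Ad k n => (a.1 : ℕ) < θ + 1) =
        univ.filter fun a => (a.1 : ℕ) < θ ∨ (a.1 : ℕ) = θ ∧ (a.2 : ℕ) < n := by
      ext a
      have := a.2.2
      simp only [mem_filter, mem_univ, true_and]
      omega
    rw [this]
    exact hset _ _ _ _ Arr.cT _ (.inl rfl) hI'
  have hu : (univ.filter fun a : Ad k n => (a.1 : ℕ) < k) = univ := by simp
  rw [hu] at hI
  exact ⟨t₀, q, τ, hex.cast (by ring) rfl, hI⟩

end

/-! ## Outcomes in the memory -/

theorem readAd_eq_some {k n r c : ℕ} {a : Ad k n} : readAd k n r c = some a ↔ r = a.1 ∧ c = a.2 := by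
  constructor
  · intro h
    rw [readAd] at h
    split_ifs at h with hrc
    obtain rfl := Option.some.inj h
    exact ⟨rfl, rfl⟩
  · rintro ⟨rfl, rfl⟩
    simp [readAd]

namespace Auction

variable {k n : ℕ} (A : Auction k n)

open Classical in
/-- The outcome with the ads `(T j, I j)`; only accepted bidders keep their slots. -/
noncomputable def outcomeOf (T I : ℕ → ℕ) : Assignment k n := fun j =>
  if ∃ a ∈ A.accepted, readAd k n (T j) (I j) = some a then readAd k n (T j) (I j) else none

theorem outcomeOf_eq_some {T I : ℕ → ℕ} {j : Fin n} {a : Ad k n} :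
    A.outcomeOf T I j = some a ↔ readAd k n (T j) (I j) = some a ∧ a ∈ A.accepted := by
  simp only [outcomeOf]
  split_ifs with h
  · obtain ⟨b, hb, h⟩ := h
    rw [h]
    constructor
    · intro hba; exact ⟨hba, Option.some.inj hba ▸ hb⟩
    · exact fun h => h.1
  · exact iff_of_false (by simp) fun h' => h ⟨a, h'.2, h'.1⟩

theorem isOutcome_outcomeOf {v : Ad k n → ℝ} {H : HState k n} {T I : ℕ → ℕ}
    (h : HungarianResult A.disc v H) (hM : ∀ j : Fin n, H.M j = readAd k n (T j) (I j)) :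
    A.IsOutcome v (A.outcomeOf T I) :=
  ⟨H, h, fun j a => by rw [outcomeOf_eq_some, hM]⟩

/-- The memory holds the auction and the values `v`. -/
structure Loaded (v : Ad k n → ℝ) (τ : Mem) : Prop where
  num : τ.nat Arr.num 0 0 = n
  types : τ.nat Arr.types 0 0 = k
  acc : ∀ r c, τ.nat Arr.acc r c = 1 ↔ ∃ a ∈ A.accepted, readAd k n r c = some a
  disc : τ.real Arr.disc = table fun a => A.disc a.1 a.2
  bid : τ.real Arr.bid = table A.bid
  reserve : τ.real Arr.reserve = table A.reserve
  val : τ.real Arr.val = table v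

variable {A} {v : Ad k n → ℝ} {σ τ : Mem}

theorem Loaded.congr (h : A.Loaded v σ) (hn : ∀ a, a = 0 ∨ a = 1 ∨ a = 5 → τ.nat a = σ.nat a)
    (hr : ∀ a < 4, τ.real a = σ.real a) : A.Loaded v τ := by
  obtain ⟨h1, h2, h3, h4, h5, h6, h7⟩ := h
  refine ⟨?_, ?_, ?_, ?_, ?_, ?_, ?_⟩ <;> first
    | rw [hr _ (by decide)]; assumption
    | rw [hn _ (by decide)]; assumption

/-- The callee starts in a memory built from the arrays of the caller. `Loaded` fixes these arrays
in all cells, not only in the relevant ones, so that this memory is literally the one for which the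
procedure was analysed. -/
theorem Loaded.call (h : A.Loaded v σ) (hk : 0 < k) (hn : 0 < n) (hv : ∀ a, 0 ≤ v a) :
    ∃ t τ, Exec (callProc hungarian) .call σ t 1 τ ∧ t ≤ hungarianCost k n + 2 * (k * n) + 2 * n + 2 ∧
      A.IsOutcome v (A.outcomeOf (τ.nat Arr.matchT 0) (τ.nat Arr.matchI 0)) ∧
      (∃ H, HungarianResult A.disc v H ∧ ∀ j : Fin n, H.M j = readAd k n (τ.nat Arr.matchT 0 j) (τ.nat Arr.matchI 0 j)) ∧
      (∀ a, a ≠ 3 ∧ a ≠ 4 → τ.nat a = σ.nat a) ∧ τ.real = σ.real := by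
  obtain ⟨t, τ, c, hex, ht, hres⟩ := wp_hungarian hk hn A.disc_nonneg A.disc_anti hv
  obtain ⟨τ', hτ'⟩ : ∃ τ' : Mem, τ' = { σ with
      nat := fun a r c =>
        if (a = Arr.matchT ∨ a = Arr.matchI) ∧ r = 0 ∧ c < σ.nat Arr.num 0 0 then τ.nat a r c
        else σ.nat a r c } := ⟨_, rfl⟩
  have hM : ∀ j : Fin n, (readHState k n τ).M j = readAd k n (τ'.nat Arr.matchT 0 j) (τ'.nat Arr.matchI 0 j) := by
    intro j
    simp [hτ', h.num, readHState]
  refine ⟨t + 2 * (k * n) + 2 * n + 2, τ', .call ⟨t, τ, ?_, ?_, hτ'⟩, ?_, A.isOutcome_outcomeOf hres hM,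
    ⟨_, hres, hM⟩, fun a ha => ?_, by rw [hτ']⟩
  · rw [h.num, h.types, h.disc, h.val]; exact hex
  · rw [h.num, h.types]
  · rw [hungarianCost]; omega
  · rw [hτ']
    funext r c
    exact if_neg fun h => h.1.elim ha.1 ha.2

/-! ### Sums over the slots -/

/-- The welfare of the others, slot by slot. -/
theorem welfareOthers_eq {ω : Assignment k n} (hω : ∀ j a, ω j = some a → a ∈ A.accepted) (a : Ad k n) :
    A.welfareOthers ω a =
      ∑ j, (ω j).elim 0 fun b => open Classical in if b = a then 0 else A.bid b * A.disc b.1 j := by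
  classical
  simp only [welfareOthers, quantity, mul_sum]
  rw [sum_comm]
  refine sum_congr rfl fun j _ => ?_
  cases hj : ω j with
  | none => simp
  | some b =>
    simp only [Option.some.injEq, mul_ite, mul_zero, Option.elim_some]
    rw [sum_ite_eq]
    by_cases hb : b = a <;> simp [hb, hω j b hj]

theorem quantity_eq (ω : Assignment k n) (a : Ad k n) :
    A.quantity ω a = ∑ j, (ω j).elim 0 fun b => open Classical in if b = a then A.disc a.1 j else 0 := by
  simp only [quantity]
  refine sum_congr rfl fun j _ => ?_
  cases hj : ω j <;> simp

end Auction


/-! ## The pricing programs -/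

theorem sum_lt_succ {n i : ℕ} (hi : i < n) (f : Fin n → ℝ) :
    ∑ j ∈ univ.filter (fun j : Fin n => (j : ℕ) < i + 1), f j =
      ∑ j ∈ univ.filter (fun j : Fin n => (j : ℕ) < i), f j + f ⟨i, hi⟩ := by
  have : (univ.filter fun j : Fin n => (j : ℕ) < i + 1) =
      insert ⟨i, hi⟩ (univ.filter fun j : Fin n => (j : ℕ) < i) := by
    ext j
    simp only [mem_filter, mem_univ, true_and, mem_insert, Fin.ext_iff]
    omega
  rw [this, sum_insert (by simp), add_comm]

theorem table_update {k n : ℕ} (v : Ad k n → ℝ) (a : Ad k n) (x : ℝ) :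
    table (Function.update v a x) =
    fun r c : ℕ => if r = a.1 ∧ c = a.2 then x else table v r c := by
  funext r c
  by_cases h : r = a.1 ∧ c = a.2
  · rw [if_pos h, h.1, h.2, table_apply, Function.update_self]
  · rw [if_neg h]
    simp only [table]
    split_ifs with hrc
    · rw [Function.update_of_ne]
      rintro rfl
      exact h ⟨rfl, rfl⟩
    · rfl

namespace Auction

variable {k n : ℕ} {A : Auction k n} {φ : Mem → ℕ → Mem → Prop} {v : Ad k n → ℝ} {σ τ : Mem}

/-- A call receives the whole array of values, so it is also recorded that the cells of ads not yet
visited, and those outside of the table, contain 0. -/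
theorem exec_findAccepted (A : Auction k n) : ∃ t τ, Exec φ findAccepted A.mem t 0 τ ∧
    t ≤ k * (10 * n + 4) + 2 ∧ A.Loaded A.acceptedBids τ ∧ (∀ r c, τ.real Arr.price r c = 0) ∧
    ∀ r c, τ.nat Arr.won r c = 0 := by
  classical
  obtain ⟨t, q, τ, hex, ⟨ht, rfl⟩, hn, hr, hp, hacc, hv, hv0⟩ := exec_forAds (φ := φ) (k := k) (n := n)
    (σ := A.mem)
    (s := .seq (setCurR Arr.price (.lit 0))
      (.branch (.and (.eq (curN Arr.isBidder) (.lit 1)) (.le (curR Arr.reserve) (curR Arr.bid)))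
        (.seq (setCurN Arr.acc (.lit 1)) (setCurR Arr.val (curR Arr.bid)))
        (.seq (setCurN Arr.acc (.lit 0)) (setCurR Arr.val (.lit 0)))))
    (fun S t q τ => (t ≤ #S * 6 ∧ q = 0) ∧ (∀ a, a ≠ 5 ∧ a ≠ 10 ∧ a ≠ 11 → τ.nat a = A.mem.nat a) ∧
      (∀ a, a ≠ 1 ∧ a ≠ 4 → τ.real a = A.mem.real a) ∧ (∀ r c, τ.real Arr.price r c = 0) ∧
      (∀ r c, τ.nat Arr.acc r c = 1 ↔ ∃ a ∈ S, a ∈ A.accepted ∧ readAd k n r c = some a) ∧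
      (∀ a ∈ S, τ.real Arr.val a.1 a.2 = A.acceptedBids a) ∧
      (∀ r c, (∀ a ∈ S, readAd k n r c ≠ some a) → τ.real Arr.val r c = 0))
    ⟨by simp, fun _ _ => rfl, fun _ _ => rfl, by simp [Auction.mem], by simp [Auction.mem], by simp,
      by simp [Auction.mem]⟩
    (by
      rintro S t q τ a x ha ⟨h1, h2, h3, h4, h5, h6⟩
      refine ⟨h1, fun b hb => ?_, h3, h4, ?_, h6⟩
      · rw [Mem.setN_nat_of_ne _ _ _ _ _ (by rcases ha with rfl | rfl; exacts [hb.2.1, hb.2.2])]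
        exact h2 b hb
      · rw [Mem.setN_nat_of_ne _ _ _ _ _ (by rcases ha with rfl | rfl <;> decide)]
        exact h5)
    (by
      rintro S t q τ ⟨-, h, -⟩
      rw [h _ (by decide), h _ (by decide)]
      simp [Auction.mem])
    (by
      rintro S a t q τ haS ⟨⟨ht, hq⟩, h2, h3, h4, h5, h6, h7⟩ hT hI
      have hb : (A.mem.nat Arr.isBidder a.1 a.2 = 1 ∧ A.mem.real Arr.reserve a.1 a.2 ≤ A.mem.real Arr.bid a.1 a.2) ↔
          a ∈ A.accepted := by
        simp [Auction.mem, table, accepted, readAd]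
      have hbid : A.mem.real Arr.bid a.1 a.2 = A.bid a := by
        simp [Auction.mem, table]
      have e1 : τ.nat Arr.isBidder = A.mem.nat Arr.isBidder := h2 _ (by decide)
      have e2 : τ.real Arr.reserve = A.mem.real Arr.reserve := h3 _ (by decide)
      have e3 : τ.real Arr.bid = A.mem.real Arr.bid := h3 _ (by decide)
      obtain ⟨t', ht', hex⟩ := exec_run φ (.seq (setCurR Arr.price (.lit 0))
        (.branch (.and (.eq (curN Arr.isBidder) (.lit 1)) (.le (curR Arr.reserve) (curR Arr.bid)))
          (.seq (setCurN Arr.acc (.lit 1)) (setCurR Arr.val (curR Arr.bid)))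
          (.seq (setCurN Arr.acc (.lit 0)) (setCurR Arr.val (.lit 0))))) rfl τ
      have hrun : Com.run (.seq (setCurR Arr.price (.lit 0))
        (.branch (.and (.eq (curN Arr.isBidder) (.lit 1)) (.le (curR Arr.reserve) (curR Arr.bid)))
          (.seq (setCurN Arr.acc (.lit 1)) (setCurR Arr.val (curR Arr.bid)))
          (.seq (setCurN Arr.acc (.lit 0)) (setCurR Arr.val (.lit 0))))) τ =
          ((τ.setR Arr.price a.1 a.2 0).setN Arr.acc a.1 a.2 (if a ∈ A.accepted then 1 else 0)).setR Arr.val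
            a.1 a.2 (A.acceptedBids a) := by
        rw [Com.run]
        by_cases ha : a ∈ A.accepted
        · rw [Com.run_branch_true (by
            simpa [Com.run, BExp.eval, NExp.eval, RExp.eval, hT, hI, e1, e2, e3, Mem.setR_real] using hb.2 ha)]
          simp [Com.run, NExp.eval, RExp.eval, hT, hI, e3, Mem.setR_real, Mem.setN_nat, acceptedBids, ha, hbid]
        · rw [Com.run_branch_false (by
            have := mt hb.1 ha
            simpa [Com.run, BExp.eval, NExp.eval, RExp.eval, hT, hI, e1, e2, e3, Mem.setR_real] using this)]
          simp [Com.run, NExp.eval, RExp.eval, hT, hI, Mem.setN_nat, acceptedBids, ha]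
      rw [hrun] at hex
      refine ⟨t', 0, _, hex, ?_, ?_, ⟨?_, by omega⟩, ?_, ?_, ?_, ?_, ?_, ?_⟩
      · simp [Mem.setN_nat, hT]
      · simp [Mem.setN_nat, hI]
      · rw [card_insert_of_notMem haS]
        simp only [Com.cost] at ht'
        omega
      · intro b hb
        refine Eq.trans ?_ (h2 b hb)
        exact Mem.setN_nat_of_ne _ _ _ _ _ hb.1
      · intro b hb
        rw [← h3 b hb]
        exact (Mem.setR_real_of_ne _ _ _ _ _ hb.1).trans (Mem.setR_real_of_ne _ _ _ _ _ hb.2)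
      · intro r c
        simp [Mem.setR_real, h4]
      · intro r c
        have hcell : ((((τ.setR Arr.price a.1 a.2 0).setN Arr.acc a.1 a.2 (if a ∈ A.accepted then 1 else 0)).setR
            Arr.val a.1 a.2 (A.acceptedBids a)).nat Arr.acc r c) =
            if r = a.1 ∧ c = a.2 then (if a ∈ A.accepted then 1 else 0) else τ.nat Arr.acc r c := by
          simp [Mem.setN_nat]
        rw [hcell]
        split_ifs with hrc ha
        · exact iff_of_true rfl ⟨a, mem_insert_self _ _, ha, readAd_eq_some.2 hrc⟩
        · refine iff_of_false (by simp) ?_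
          rintro ⟨b, -, hb, hrd⟩
          rw [readAd_eq_some.2 hrc] at hrd
          exact ha (Option.some.inj hrd ▸ hb)
        · rw [h5]
          constructor
          · rintro ⟨b, hb, h⟩
            exact ⟨b, mem_insert_of_mem hb, h⟩
          · rintro ⟨b, hb, h⟩
            rcases mem_insert.1 hb with rfl | hb
            · exact absurd (readAd_eq_some.1 h.2) hrc
            · exact ⟨b, hb, h⟩
      · intro b hb
        by_cases hba : b = a
        · subst hba; simp [Mem.setR_real]
        · have hne : ¬ ((b.1 : ℕ) = a.1 ∧ (b.2 : ℕ) = a.2) := fun h =>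
            hba (Prod.ext (Fin.ext h.1) (Fin.ext h.2))
          have := h6 b ((mem_insert.1 hb).resolve_left hba)
          simp only [Mem.setR_real, true_and, if_neg hne]
          exact this
      · intro r c hrc
        have hne : ¬ (r = a.1 ∧ c = a.2) := fun h => hrc a (mem_insert_self _ _) (readAd_eq_some.2 h)
        have := h7 r c fun b hb => hrc b (mem_insert_of_mem hb)
        simp only [Mem.setR_real, true_and, if_neg hne]
        exact this)
  refine ⟨_, τ, hex, ?_, ⟨?_, ?_, fun r c => ?_, ?_, ?_, ?_, ?_⟩, hp, fun r c => ?_⟩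
  · have : #(univ : Finset (Ad k n)) = k * n := by simp
    rw [this] at ht
    have : k * (10 * n + 4) = k * n * 6 + k * (2 * n + 4) + 2 * (k * n) := by ring
    omega
  · rw [hn _ (by decide)]; simp [Auction.mem]
  · rw [hn _ (by decide)]; simp [Auction.mem]
  · simpa using hacc r c
  · rw [hr _ (by decide)]; rfl
  · rw [hr _ (by decide)]; rfl
  · rw [hr _ (by decide)]; rfl
  · funext r c
    by_cases h : r < k ∧ c < n
    · simpa [table, h] using hv (⟨r, h.1⟩, ⟨c, h.2⟩) (mem_univ _)
    · rw [hv0 r c (by simp [readAd, h])]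
      simp [table, h]
  · rw [hn _ (by decide)]; simp [Auction.mem]

/-- The memory holds the outcome `ω`. -/
structure Owned (A : Auction k n) (ω : Assignment k n) (τ : Mem) : Prop where
  some : ∀ j b, ω j = some b → b ∈ A.accepted ∧ τ.nat Arr.own 0 j = 1 ∧ τ.nat Arr.ownT 0 j = b.1 ∧
    τ.nat Arr.ownI 0 j = b.2
  none : ∀ j, ω j = none → τ.nat Arr.own 0 j ≠ 1

theorem Owned.congr {ω : Assignment k n} (h : A.Owned ω σ) (hn : ∀ a, 6 ≤ a ∧ a ≤ 8 → τ.nat a = σ.nat a) :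
    A.Owned ω τ := by
  obtain ⟨h1, h2⟩ := h
  exact ⟨by rw [hn _ (by decide), hn _ (by decide), hn _ (by decide)]; exact h1,
    by rw [hn _ (by decide)]; exact h2⟩

theorem Owned.readOwners {ω : Assignment k n} (h : A.Owned ω τ) : readOwners k n τ = ω := by
  funext j
  rw [AdTypes.readOwners]
  cases hj : ω j with
  | none => rw [if_neg (h.none j hj)]
  | some b =>
    obtain ⟨-, h1, h2, h3⟩ := h.some j b hj
    rw [if_pos h1, h2, h3, readAd_eq_some.2 ⟨rfl, rfl⟩]

end Auction


/-! ### Reading the outcome, and sums of welfare -/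

theorem exec_setR {φ : Mem → ℕ → Mem → Prop} {a x y : ℕ} {r c : NExp} {e : RExp} {z : ℝ} {σ : Mem}
    (hr : r.eval σ = x) (hc : c.eval σ = y) (he : e.eval σ = z) :
    Exec φ (.setR a r c e) σ 1 0 (σ.setR a x y z) := by
  subst hr hc he
  exact .setR ..

namespace Auction

variable {k n : ℕ} {A : Auction k n} {φ : Mem → ℕ → Mem → Prop} {v : Ad k n → ℝ} {σ τ : Mem}

theorem Loaded.acc_of_some (h : A.Loaded v τ) {T I : ℕ → ℕ} {j : Fin n} {b : Ad k n}
    (hb : A.outcomeOf T I j = some b) : τ.nat Arr.acc (T j) (I j) = 1 ∧ T j = b.1 ∧ I j = b.2 := by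
  obtain ⟨h1, h2⟩ := A.outcomeOf_eq_some.1 hb
  exact ⟨(h.acc _ _).2 ⟨b, h2, h1⟩, readAd_eq_some.1 h1⟩

theorem Loaded.acc_of_none (h : A.Loaded v τ) {T I : ℕ → ℕ} {j : Fin n}
    (hb : A.outcomeOf T I j = none) : τ.nat Arr.acc (T j) (I j) ≠ 1 := by
  intro h1
  obtain ⟨a, ha, hr⟩ := (h.acc _ _).1 h1
  rw [A.outcomeOf_eq_some.2 ⟨hr, ha⟩] at hb
  cases hb

/-- The outcome is copied because every later call overwrites the matching. The flags in `won` are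
only ever set, so they have to be clear at the start. -/
theorem Loaded.exec_readOutcome (h : A.Loaded v σ) (hwon : ∀ r c, σ.nat Arr.won r c = 0)
    {ω : Assignment k n} (hω : ω = A.outcomeOf (σ.nat Arr.matchT 0) (σ.nat Arr.matchI 0)) :
    ∃ t τ, Exec φ readOutcome σ t 0 τ ∧ t ≤ n * 8 + 2 ∧
      (∀ a, (a < 6 ∨ 9 < a) ∧ a ≠ 12 → τ.nat a = σ.nat a) ∧ τ.real = σ.real ∧ A.Owned ω τ ∧
      ∀ r c, τ.nat Arr.won r c = 1 ↔ ∃ j b, ω j = some b ∧ (b.1 : ℕ) = r ∧ (b.2 : ℕ) = c := by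
  obtain ⟨t, τ, hex, ht, hn, hr, h1, h2, h3⟩ := exec_forSlots (φ := φ) (n := n) (σ := σ)
    (s := .branch
      (.eq (.get Arr.acc (.row Arr.matchT (.var Arr.cJ)) (.row Arr.matchI (.var Arr.cJ))) (.lit 1))
      (.seq (.setN Arr.own (.lit 0) (.var Arr.cJ) (.lit 1))
        (.seq (.setN Arr.ownT (.lit 0) (.var Arr.cJ) (.row Arr.matchT (.var Arr.cJ)))
          (.seq (.setN Arr.ownI (.lit 0) (.var Arr.cJ) (.row Arr.matchI (.var Arr.cJ)))
            (.setN Arr.won (.row Arr.matchT (.var Arr.cJ)) (.row Arr.matchI (.var Arr.cJ))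
              (.lit 1)))))
      (.setN Arr.own (.lit 0) (.var Arr.cJ) (.lit 0)))
    (fun i τ => (∀ a, (a < 6 ∨ 9 < a) ∧ a ≠ 12 → τ.nat a = σ.nat a) ∧ τ.real = σ.real ∧
      (∀ (j : Fin n) b, (j : ℕ) < i → ω j = some b → τ.nat Arr.own 0 j = 1 ∧ τ.nat Arr.ownT 0 j = b.1 ∧
        τ.nat Arr.ownI 0 j = b.2) ∧
      (∀ j : Fin n, (j : ℕ) < i → ω j = none → τ.nat Arr.own 0 j ≠ 1) ∧
      ∀ r c, τ.nat Arr.won r c = 1 ↔ ∃ (j : Fin n) (b : Ad k n), (j : ℕ) < i ∧ ω j = some b ∧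
        (b.1 : ℕ) = r ∧ (b.2 : ℕ) = c)
    ⟨fun a ha => Mem.setN_nat_of_ne _ _ _ _ _ ha.2, rfl, by simp, by simp, by simp [Mem.setN_nat, hwon]⟩
    (fun i τ h' => by rw [h'.1 _ (by decide)]; exact h.num) rfl
    (by
      rintro i hi τ ⟨hn, hr, h1, h2, h3⟩ hJ
      have eT : τ.nat Arr.matchT = σ.nat Arr.matchT := hn _ (by decide)
      have eI : τ.nat Arr.matchI = σ.nat Arr.matchI := hn _ (by decide)
      have eA : τ.nat Arr.acc = σ.nat Arr.acc := hn _ (by decide)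
      cases hj : ω ⟨i, hi⟩ with
      | some b =>
        obtain ⟨g1, g2, g3⟩ := h.acc_of_some (hω ▸ hj)
        rw [Com.run_branch_true (by simpa [BExp.eval, NExp.eval, hJ, eT, eI, eA] using g1)]
        have hrun : (Com.seq (.setN Arr.own (.lit 0) (.var Arr.cJ) (.lit 1))
          (.seq (.setN Arr.ownT (.lit 0) (.var Arr.cJ) (.row Arr.matchT (.var Arr.cJ)))
            (.seq (.setN Arr.ownI (.lit 0) (.var Arr.cJ) (.row Arr.matchI (.var Arr.cJ)))
              (.setN Arr.won (.row Arr.matchT (.var Arr.cJ)) (.row Arr.matchI (.var Arr.cJ))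
                (.lit 1))))).run τ =
            (((τ.setN Arr.own 0 i 1).setN Arr.ownT 0 i b.1).setN Arr.ownI 0 i b.2).setN Arr.won b.1 b.2 1 := by
          simp only at g2 g3
          simp [Com.run, NExp.eval, Mem.setN_nat, hJ, eT, eI, g2, g3]
        rw [hrun]
        refine ⟨by simp [Mem.setN_nat, hJ], fun a ha => ?_, hr, fun j b' hji hb' => ?_, fun j hji hb' => ?_,
          fun r c => ?_⟩
        · rw [Mem.setN_nat_of_ne _ _ _ _ _ ha.2, Mem.setN_nat_of_ne _ _ _ _ _ (show a ≠ 9 by omega),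
            Mem.setN_nat_of_ne _ _ _ _ _ (show a ≠ 8 by omega), Mem.setN_nat_of_ne _ _ _ _ _ (show a ≠ 7 by omega),
            Mem.setN_nat_of_ne _ _ _ _ _ (show a ≠ 6 by omega)]
          exact hn a ha
        · by_cases hji' : (j : ℕ) = i
          · obtain rfl : j = ⟨i, hi⟩ := Fin.ext hji'
            obtain rfl : b = b' := by simpa [hj] using hb'
            simp [Mem.setN_nat]
          · simpa [Mem.setN_nat, hji'] using h1 j b' (by omega) hb'
        · by_cases hji' : (j : ℕ) = i
          · obtain rfl : j = ⟨i, hi⟩ := Fin.ext hji'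
            simp [hj] at hb'
          · simpa [Mem.setN_nat, hji'] using h2 j (by omega) hb'
        · have hcell : (((((τ.setN Arr.own 0 i 1).setN Arr.ownT 0 i b.1).setN Arr.ownI 0 i b.2).setN Arr.won
              b.1 b.2 1).setN Arr.cJ 0 0 (i + 1)).nat Arr.won r c =
              if r = b.1 ∧ c = b.2 then 1 else τ.nat Arr.won r c := by
            simp [Mem.setN_nat]
          rw [hcell]
          split_ifs with hrc
          · exact iff_of_true rfl ⟨⟨i, hi⟩, b, Nat.lt_succ_self i, hj, hrc.1.symm, hrc.2.symm⟩
          · rw [h3]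
            constructor
            · rintro ⟨j, b', hji, h⟩
              exact ⟨j, b', by omega, h⟩
            · rintro ⟨j, b', hji, hb', h⟩
              refine ⟨j, b', ?_, hb', h⟩
              by_contra hji'
              obtain rfl : j = ⟨i, hi⟩ := Fin.ext (show (j : ℕ) = i by omega)
              obtain rfl : b = b' := by simpa [hj] using hb'
              exact hrc ⟨h.1.symm, h.2.symm⟩
      | none =>
        have g1 := h.acc_of_none (hω ▸ hj)
        rw [Com.run_branch_false (by simpa [BExp.eval, NExp.eval, hJ, eT, eI, eA] using g1)]
        have hrun : (Com.setN Arr.own (.lit 0) (.var Arr.cJ) (.lit 0)).run τ = τ.setN Arr.own 0 i 0 := by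
          simp [Com.run, NExp.eval, hJ]
        rw [hrun]
        refine ⟨by simp [Mem.setN_nat, hJ], fun a ha => ?_, hr, fun j b' hji hb' => ?_, fun j hji hb' => ?_,
          fun r c => ?_⟩
        · rw [Mem.setN_nat_of_ne _ _ _ _ _ ha.2, Mem.setN_nat_of_ne _ _ _ _ _ (show a ≠ 6 by omega)]
          exact hn a ha
        · by_cases hji' : (j : ℕ) = i
          · obtain rfl : j = ⟨i, hi⟩ := Fin.ext hji'
            simp [hj] at hb'
          · simpa [Mem.setN_nat, hji'] using h1 j b' (by omega) hb'
        · by_cases hji' : (j : ℕ) = i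
          · simp [Mem.setN_nat, hji']
          · simpa [Mem.setN_nat, hji'] using h2 j (by omega) hb'
        · have hcell : ((τ.setN Arr.own 0 i 0).setN Arr.cJ 0 0 (i + 1)).nat Arr.won r c = τ.nat Arr.won r c := by
            simp [Mem.setN_nat]
          rw [hcell, h3]
          constructor
          · rintro ⟨j, b', hji, h⟩
            exact ⟨j, b', by omega, h⟩
          · rintro ⟨j, b', hji, hb', h⟩
            refine ⟨j, b', ?_, hb', h⟩
            by_contra hji'
            obtain rfl : j = ⟨i, hi⟩ := Fin.ext (show (j : ℕ) = i by omega)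
            simp [hj] at hb')
  refine ⟨t, τ, hex, ht.trans (by simp only [Com.cost]; omega), hn, hr, ⟨fun j b hb => ?_, fun j hj => h2 j j.2 hj⟩, fun r c => ?_⟩
  · exact ⟨(A.outcomeOf_eq_some.1 (hω ▸ hb)).2, h1 j b j.2 hb⟩
  · rw [h3]; simp

theorem Owned.exec_sumOutcome {ω : Assignment k n} (h : A.Owned ω σ) (hl : A.Loaded v σ) {a : Ad k n}
    (hT : σ.nat Arr.cT 0 0 = a.1) (hI : σ.nat Arr.cI 0 0 = a.2) :
    ∃ t τ, Exec φ sumOutcome σ t 0 τ ∧ t ≤ n * 5 + 3 ∧ (∀ a, a ≠ 12 → τ.nat a = σ.nat a) ∧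
      (∀ a, a ≠ 5 → τ.real a = σ.real a) ∧ τ.real Arr.sw 0 0 = A.welfareOthers ω a := by
  classical
  obtain ⟨f, hf⟩ : ∃ f : Fin n → ℝ, f = fun j => (ω j).elim 0 fun b =>
    open Classical in if b = a then 0 else A.bid b * A.disc b.1 j := ⟨_, rfl⟩
  obtain ⟨t, τ, hex, ht, hn, hr, hs⟩ := exec_forSlots (φ := φ) (n := n) (σ := σ.setR Arr.sw 0 0 0)
    (s := .branch
      (.and (.eq (.row Arr.own (.var Arr.cJ)) (.lit 1)) (.not (isCur Arr.ownT Arr.ownI)))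
      (.letR Arr.sw (.add (.var Arr.sw) (slotValue Arr.ownT Arr.ownI))) .skip)
    (fun i τ => (∀ a, a ≠ 12 → τ.nat a = σ.nat a) ∧ (∀ a, a ≠ 5 → τ.real a = σ.real a) ∧
      τ.real Arr.sw 0 0 = ∑ j ∈ univ.filter (fun j : Fin n => (j : ℕ) < i), f j)
    ⟨fun a ha => Mem.setN_nat_of_ne _ _ _ _ _ ha, fun a ha => Mem.setR_real_of_ne _ _ _ _ _ ha,
      by simp [Mem.setR_real]⟩
    (fun i τ h' => by rw [h'.1 _ (by decide)]; exact hl.num) rfl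
    (by
      rintro i hi τ ⟨hn, hr, hs⟩ hJ
      have eO : τ.nat Arr.own = σ.nat Arr.own := hn _ (by decide)
      have eT : τ.nat Arr.ownT = σ.nat Arr.ownT := hn _ (by decide)
      have eI : τ.nat Arr.ownI = σ.nat Arr.ownI := hn _ (by decide)
      have eB : τ.real Arr.bid = table A.bid := (hr _ (by decide)).trans hl.bid
      have eD : τ.real Arr.disc = table fun a => A.disc a.1 a.2 := (hr _ (by decide)).trans hl.disc
      have eT' : τ.nat Arr.cT 0 0 = a.1 := by rw [hn _ (by decide)]; exact hT
      have eI' : τ.nat Arr.cI 0 0 = a.2 := by rw [hn _ (by decide)]; exact hI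
      have hfi : f ⟨i, hi⟩ = (ω ⟨i, hi⟩).elim 0 fun b => if b = a then 0 else A.bid b * A.disc b.1 ⟨i, hi⟩ := by
        rw [hf]
      by_cases hb : σ.nat Arr.own 0 i = 1 ∧ ¬ (σ.nat Arr.ownT 0 i = a.1 ∧ σ.nat Arr.ownI 0 i = a.2)
      · have hval : f ⟨i, hi⟩ = table A.bid (σ.nat Arr.ownT 0 i) (σ.nat Arr.ownI 0 i) *
            table (fun a => A.disc a.1 a.2) (σ.nat Arr.ownT 0 i) i := by
          cases hj : ω ⟨i, hi⟩ with
          | none => exact absurd hb.1 (h.none _ hj)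
          | some b =>
            obtain ⟨-, -, g2, g3⟩ := h.some _ b hj
            simp only at g2 g3
            have hne : b ≠ a := by
              rintro rfl
              exact hb.2 ⟨g2, g3⟩
            rw [hfi, hj, g2, g3, table_apply]
            simp [hne, table, hi]
        rw [Com.run_branch_true (by
          simpa [BExp.eval, NExp.eval, isCur, hJ, eO, eT, eI, eT', eI'] using hb)]
        have hrun : (Com.letR Arr.sw (.add (.var Arr.sw) (slotValue Arr.ownT Arr.ownI))).run τ =
            τ.setR Arr.sw 0 0 (τ.real Arr.sw 0 0 + f ⟨i, hi⟩) := by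
          simp [Com.run, NExp.eval, RExp.eval, slotValue, hJ, eT, eI, eB, eD, hval]
        rw [hrun]
        refine ⟨hJ, fun b hb => ?_, fun b hb => ?_, ?_⟩
        · rw [Mem.setN_nat_of_ne _ _ _ _ _ hb]; exact hn b hb
        · exact (Mem.setR_real_of_ne _ _ _ _ _ hb).trans (hr b hb)
        · rw [sum_lt_succ hi, ← hs]; simp [Mem.setR_real]
      · have hval : f ⟨i, hi⟩ = 0 := by
          cases hj : ω ⟨i, hi⟩ with
          | none => rw [hfi, hj]; rfl
          | some b =>
            obtain ⟨-, g1, g2, g3⟩ := h.some _ b hj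
            simp only at g1 g2 g3
            have hba : b = a := by
              by_contra hne
              exact hb ⟨g1, fun h' => hne (Prod.ext (Fin.ext (g2.symm.trans h'.1)) (Fin.ext (g3.symm.trans h'.2)))⟩
            rw [hfi, hj]
            simp [hba]
        rw [Com.run_branch_false (by
          simpa [BExp.eval, NExp.eval, isCur, hJ, eO, eT, eI, eT', eI'] using hb), Com.run_skip]
        refine ⟨hJ, fun b hb => ?_, hr, ?_⟩
        · rw [Mem.setN_nat_of_ne _ _ _ _ _ hb]; exact hn b hb
        · rw [sum_lt_succ hi, hval, add_zero]; exact hs)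
  have h0 : Exec φ (.letR Arr.sw (.lit 0)) σ 1 0 (σ.setR Arr.sw 0 0 0) :=
    exec_setR rfl rfl (by simp [RExp.eval])
  refine ⟨_, τ, .seq h0 hex, ?_, hn, hr, ?_⟩
  · simp only [Com.cost, Com.skip] at ht; omega
  · rw [hs, welfareOthers_eq (fun j b hb => (h.some j b hb).1), hf]
    simp

theorem Loaded.exec_sumAlternative (h : A.Loaded v σ) {a : Ad k n} {ω : Assignment k n}
    (hω : ω = A.outcomeOf (σ.nat Arr.matchT 0) (σ.nat Arr.matchI 0))
    (hT : σ.nat Arr.cT 0 0 = a.1) (hI : σ.nat Arr.cI 0 0 = a.2) :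
    ∃ t τ, Exec φ sumAlternative σ t 0 τ ∧ t ≤ n * 7 + 4 ∧ (∀ a, a ≠ 12 → τ.nat a = σ.nat a) ∧
      (∀ a, a ≠ 6 ∧ a ≠ 7 → τ.real a = σ.real a) ∧ τ.real Arr.sw' 0 0 = A.welfareOthers ω a ∧
      τ.real Arr.x' 0 0 = A.quantity ω a := by
  classical
  obtain ⟨f, hf⟩ : ∃ f : Fin n → ℝ, f = fun j => (ω j).elim 0 fun b =>
    open Classical in if b = a then 0 else A.bid b * A.disc b.1 j := ⟨_, rfl⟩
  obtain ⟨g, hg⟩ : ∃ g : Fin n → ℝ, g = fun j => (ω j).elim 0 fun b =>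
    open Classical in if b = a then A.disc a.1 j else 0 := ⟨_, rfl⟩
  obtain ⟨t, τ, hex, ht, hn, hr, hs, hx⟩ := exec_forSlots (φ := φ) (n := n)
    (σ := (σ.setR Arr.sw' 0 0 0).setR Arr.x' 0 0 0)
    (s := .branch
      (.eq (.get Arr.acc (.row Arr.matchT (.var Arr.cJ)) (.row Arr.matchI (.var Arr.cJ))) (.lit 1))
      (.branch (isCur Arr.matchT Arr.matchI)
        (.letR Arr.x' (.add (.var Arr.x') (.get Arr.disc (.var Arr.cT) (.var Arr.cJ))))
        (.letR Arr.sw' (.add (.var Arr.sw') (slotValue Arr.matchT Arr.matchI)))) .skip)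
    (fun i τ => (∀ a, a ≠ 12 → τ.nat a = σ.nat a) ∧ (∀ a, a ≠ 6 ∧ a ≠ 7 → τ.real a = σ.real a) ∧
      τ.real Arr.sw' 0 0 = ∑ j ∈ univ.filter (fun j : Fin n => (j : ℕ) < i), f j ∧
      τ.real Arr.x' 0 0 = ∑ j ∈ univ.filter (fun j : Fin n => (j : ℕ) < i), g j)
    ⟨fun a ha => Mem.setN_nat_of_ne _ _ _ _ _ ha, fun a ha => (Mem.setR_real_of_ne _ _ _ _ _ ha.2).trans
      (Mem.setR_real_of_ne _ _ _ _ _ ha.1), by simp [Mem.setR_real], by simp [Mem.setR_real]⟩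
    (fun i τ h' => by rw [h'.1 _ (by decide)]; exact h.num) rfl
    (by
      rintro i hi τ ⟨hn, hr, hs, hx⟩ hJ
      have eA : τ.nat Arr.acc = σ.nat Arr.acc := hn _ (by decide)
      have eT : τ.nat Arr.matchT = σ.nat Arr.matchT := hn _ (by decide)
      have eI : τ.nat Arr.matchI = σ.nat Arr.matchI := hn _ (by decide)
      have eB : τ.real Arr.bid = table A.bid := (hr _ (by decide)).trans h.bid
      have eD : τ.real Arr.disc = table fun a => A.disc a.1 a.2 := (hr _ (by decide)).trans h.disc
      have eT' : τ.nat Arr.cT 0 0 = a.1 := by rw [hn _ (by decide)]; exact hT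
      have eI' : τ.nat Arr.cI 0 0 = a.2 := by rw [hn _ (by decide)]; exact hI
      have hfi : f ⟨i, hi⟩ = (ω ⟨i, hi⟩).elim 0 fun b => if b = a then 0 else A.bid b * A.disc b.1 ⟨i, hi⟩ := by
        rw [hf]
      have hgi : g ⟨i, hi⟩ = (ω ⟨i, hi⟩).elim 0 fun b => if b = a then A.disc a.1 ⟨i, hi⟩ else 0 := by
        rw [hg]
      cases hj : ω ⟨i, hi⟩ with
      | some b =>
        obtain ⟨g1, g2, g3⟩ := h.acc_of_some (hω ▸ hj)
        simp only at g1 g2 g3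
        rw [hj, Option.elim_some] at hfi hgi
        rw [Com.run_branch_true (by simpa [BExp.eval, NExp.eval, hJ, eT, eI, eA] using g1)]
        by_cases hba : b = a
        · rw [if_pos hba] at hfi hgi
          subst hba
          rw [Com.run_branch_true (by simp [BExp.eval, NExp.eval, isCur, hJ, eT, eI, eT', eI', g2, g3])]
          have hrun : (Com.letR Arr.x' (.add (.var Arr.x') (.get Arr.disc (.var Arr.cT) (.var Arr.cJ)))).run τ =
              τ.setR Arr.x' 0 0 (τ.real Arr.x' 0 0 + g ⟨i, hi⟩) := by
            simp [Com.run, NExp.eval, RExp.eval, hJ, eT', eD, hgi, table, hi]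
          rw [hrun]
          refine ⟨hJ, fun b hb => ?_, fun b hb => ?_, ?_, ?_⟩
          · rw [Mem.setN_nat_of_ne _ _ _ _ _ hb]; exact hn b hb
          · exact (Mem.setR_real_of_ne _ _ _ _ _ hb.2).trans (hr b hb)
          · rw [sum_lt_succ hi, ← hs, hfi]; simp [Mem.setR_real]
          · rw [sum_lt_succ hi, ← hx]; simp [Mem.setR_real]
        · rw [if_neg hba] at hfi hgi
          rw [Com.run_branch_false (by
            simp only [BExp.eval, NExp.eval, isCur, hJ, eT, eI, eT', eI', g2, g3]
            exact fun h' => hba (Prod.ext (Fin.ext h'.1) (Fin.ext h'.2)))]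
          have hrun : (Com.letR Arr.sw' (.add (.var Arr.sw') (slotValue Arr.matchT Arr.matchI))).run τ =
              τ.setR Arr.sw' 0 0 (τ.real Arr.sw' 0 0 + f ⟨i, hi⟩) := by
            simp [Com.run, NExp.eval, RExp.eval, slotValue, hJ, eT, eI, eB, eD, g2, g3, table_apply, hfi]
            simp [table, hi]
          rw [hrun]
          refine ⟨hJ, fun b hb => ?_, fun b hb => ?_, ?_, ?_⟩
          · rw [Mem.setN_nat_of_ne _ _ _ _ _ hb]; exact hn b hb
          · exact (Mem.setR_real_of_ne _ _ _ _ _ hb.1).trans (hr b hb)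
          · rw [sum_lt_succ hi, ← hs]; simp [Mem.setR_real]
          · rw [sum_lt_succ hi, ← hx, hgi]; simp [Mem.setR_real]
      | none =>
        have g1 := h.acc_of_none (hω ▸ hj)
        rw [hj, Option.elim_none] at hfi hgi
        rw [Com.run_branch_false (by simpa [BExp.eval, NExp.eval, hJ, eT, eI, eA] using g1), Com.run_skip]
        refine ⟨hJ, fun b hb => ?_, hr, ?_, ?_⟩
        · rw [Mem.setN_nat_of_ne _ _ _ _ _ hb]; exact hn b hb
        · rw [sum_lt_succ hi, hfi, add_zero]; exact hs
        · rw [sum_lt_succ hi, hgi, add_zero]; exact hx)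
  have h0 : Exec φ (.letR Arr.sw' (.lit 0)) σ 1 0 (σ.setR Arr.sw' 0 0 0) :=
    exec_setR rfl rfl (by simp [RExp.eval])
  have h0' : Exec φ (.letR Arr.x' (.lit 0)) (σ.setR Arr.sw' 0 0 0) 1 0
      ((σ.setR Arr.sw' 0 0 0).setR Arr.x' 0 0 0) :=
    exec_setR rfl rfl (by simp [RExp.eval])
  refine ⟨_, τ, .seq h0 (.seq h0' hex), ?_, hn, hr, ?_, ?_⟩
  · simp only [Com.cost, Com.skip] at ht; omega
  · rw [hs, welfareOthers_eq (fun j b hb => (A.outcomeOf_eq_some.1 (hω ▸ hb)).2), hf]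
    simp
  · rw [hx, quantity_eq, hg]
    simp

end Auction


/-! ### The price of a bidder, and the program as a whole -/

/-- The cost of the computation of a price. -/
def priceCost (k n : ℕ) : ℕ := hungarianCost k n + 2 * (k * n) + 14 * n + 20

namespace Auction

variable {k n : ℕ} {A : Auction k n} {v : Ad k n → ℝ} {σ τ : Mem}

theorem acceptedBids_nonneg (a : Ad k n) : 0 ≤ A.acceptedBids a := by
  rw [acceptedBids]; split_ifs
  · exact A.bid_nonneg a
  · exact le_rfl

/-- The values can be changed for one ad. -/
theorem Loaded.setVal (h : A.Loaded v σ) (a : Ad k n) (x : ℝ) :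
    A.Loaded (Function.update v a x) (σ.setR Arr.val a.1 a.2 x) := by
  obtain ⟨h1, h2, h3, h4, h5, h6, h7⟩ := h
  refine ⟨h1, h2, h3, ?_, ?_, ?_, ?_⟩
  · rw [Mem.setR_real_of_ne _ _ _ _ _ (by decide)]; exact h4
  · rw [Mem.setR_real_of_ne _ _ _ _ _ (by decide)]; exact h5
  · rw [Mem.setR_real_of_ne _ _ _ _ _ (by decide)]; exact h6
  · rw [table_update, ← h7]
    funext r c
    simp [Mem.setR_real]

/-- `x` is a price of `a`, if the outcome is `ω`. -/
def IsPrice (A : Auction k n) (ω : Assignment k n) (a : Ad k n) (x : ℝ) : Prop :=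
  ∃ ω', A.IsOutcome (Function.update A.acceptedBids a (A.reserve a)) ω' ∧
    x = A.welfareOthers ω' a - A.welfareOthers ω a + A.quantity ω' a * A.reserve a

/-- The bid is restored at the end, so the next bidder is priced from the same values. The
alternative outcome is evaluated directly from the matching, while the original one is read from its
copy. -/
theorem Loaded.exec_priceCurrent (hl : A.Loaded A.acceptedBids σ) (hk : 0 < k) (hn : 0 < n)
    {ω : Assignment k n} (ho : A.Owned ω σ) {a : Ad k n} (ha : a ∈ A.accepted)
    (hT : σ.nat Arr.cT 0 0 = a.1) (hI : σ.nat Arr.cI 0 0 = a.2) :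
    ∃ t τ, Exec (callProc hungarian) priceCurrent σ t 1 τ ∧ t ≤ priceCost k n ∧
      (∀ b, b ≠ 3 ∧ b ≠ 4 ∧ b ≠ 12 → τ.nat b = σ.nat b) ∧ (∀ b < 4, τ.real b = σ.real b) ∧
      (∀ r c : ℕ, ¬ (r = a.1 ∧ c = a.2) → τ.real Arr.price r c = σ.real Arr.price r c) ∧
      A.IsPrice ω a (τ.real Arr.price a.1 a.2) := by
  obtain ⟨t₁, σ₁, hex₁, ht₁, hn₁, hr₁, hsw⟩ := ho.exec_sumOutcome (φ := callProc hungarian) hl hT hI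
  have hl₁ : A.Loaded A.acceptedBids σ₁ := hl.congr (fun b hb => hn₁ b (by omega)) (fun b hb => hr₁ b (by omega))
  have hT₁ : σ₁.nat Arr.cT 0 0 = a.1 := by rw [hn₁ _ (by decide)]; exact hT
  have hI₁ : σ₁.nat Arr.cI 0 0 = a.2 := by rw [hn₁ _ (by decide)]; exact hI
  have hres : ∀ τ : Mem, τ.real Arr.reserve = table A.reserve → τ.real Arr.reserve a.1 a.2 = A.reserve a :=
    fun τ h => by rw [h, table_apply]
  have hex₂ : Exec (callProc hungarian) (setCurR Arr.val (curR Arr.reserve)) σ₁ 1 0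
      (σ₁.setR Arr.val a.1 a.2 (A.reserve a)) :=
    exec_setR hT₁ hI₁ (by simp only [RExp.eval, NExp.eval, hT₁, hI₁, hres _ hl₁.reserve])
  have hl₂ := hl₁.setVal a (A.reserve a)
  have hnat₂ : (σ₁.setR Arr.val a.1 a.2 (A.reserve a)).nat = σ₁.nat := rfl
  have hreal₂ : ∀ b, b ≠ 1 → (σ₁.setR Arr.val a.1 a.2 (A.reserve a)).real b = σ₁.real b := fun b hb =>
    Mem.setR_real_of_ne _ _ _ _ _ hb
  generalize σ₁.setR Arr.val a.1 a.2 (A.reserve a) = σ₂ at hex₂ hl₂ hnat₂ hreal₂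
  obtain ⟨t₃, σ₃, hex₃, ht₃, hout, -, hn₃, hr₃⟩ := hl₂.call hk hn (fun b => by
    by_cases hb : b = a
    · rw [hb, Function.update_self]; exact A.reserve_nonneg a
    · rw [Function.update_of_ne hb]; exact acceptedBids_nonneg b)
  have hl₃ := hl₂.congr (τ := σ₃) (fun b hb => hn₃ b (by omega)) (fun b _ => by rw [hr₃])
  have hT₃ : σ₃.nat Arr.cT 0 0 = a.1 := by rw [hn₃ _ (by decide), hnat₂]; exact hT₁
  have hI₃ : σ₃.nat Arr.cI 0 0 = a.2 := by rw [hn₃ _ (by decide), hnat₂]; exact hI₁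
  obtain ⟨t₄, σ₄, hex₄, ht₄, hn₄, hr₄, hsw', hx'⟩ :=
    hl₃.exec_sumAlternative (φ := callProc hungarian) rfl hT₃ hI₃
  have hl₄ := hl₃.congr (τ := σ₄) (fun b hb => hn₄ b (by omega)) (fun b hb => hr₄ b (by omega))
  have hT₄ : σ₄.nat Arr.cT 0 0 = a.1 := by rw [hn₄ _ (by decide)]; exact hT₃
  have hI₄ : σ₄.nat Arr.cI 0 0 = a.2 := by rw [hn₄ _ (by decide)]; exact hI₃
  have hsw₄ : σ₄.real Arr.sw 0 0 = A.welfareOthers ω a := by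
    rw [hr₄ _ (by decide), hr₃, hreal₂ _ (by decide), hsw]
  obtain ⟨x, hx⟩ : ∃ x, x = σ₄.real Arr.sw' 0 0 - σ₄.real Arr.sw 0 0 + σ₄.real Arr.x' 0 0 * A.reserve a := ⟨_, rfl⟩
  have hex₅ : Exec (callProc hungarian) (setCurR Arr.price (.add (.sub (.var Arr.sw') (.var Arr.sw))
      (.mul (.var Arr.x') (curR Arr.reserve)))) σ₄ 1 0 (σ₄.setR Arr.price a.1 a.2 x) :=
    exec_setR hT₄ hI₄ (by simp only [RExp.eval, NExp.eval, hT₄, hI₄, hres _ hl₄.reserve, hx])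
  have hbid : (σ₄.setR Arr.price a.1 a.2 x).real Arr.bid a.1 a.2 = A.bid a := by
    rw [Mem.setR_real_of_ne _ _ _ _ _ (by decide), hl₄.bid, table_apply]
  have hex₆ : Exec (callProc hungarian) (setCurR Arr.val (curR Arr.bid)) (σ₄.setR Arr.price a.1 a.2 x) 1 0
      ((σ₄.setR Arr.price a.1 a.2 x).setR Arr.val a.1 a.2 (A.bid a)) :=
    exec_setR hT₄ hI₄ (by
      change (σ₄.setR Arr.price a.1 a.2 x).real Arr.bid (σ₄.nat Arr.cT 0 0) (σ₄.nat Arr.cI 0 0) = _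
      rw [hT₄, hI₄, hbid])
  have hl₆ := (hl₄.congr (τ := σ₄.setR Arr.price a.1 a.2 x) (fun _ _ => rfl)
    (fun b hb => Mem.setR_real_of_ne _ _ _ _ _ (show b ≠ 4 by omega))).setVal a (A.bid a)
  refine ⟨_, _, .seq hex₁ (.seq hex₂ (.seq hex₃ (.seq hex₄ (.seq hex₅ hex₆)))), ?_, ?_, ?_, ?_, _, hout, ?_⟩
  · rw [priceCost]; omega
  · intro b hb
    change σ₄.nat b = _
    rw [hn₄ b hb.2.2, hn₃ b ⟨hb.1, hb.2.1⟩, hnat₂, hn₁ b hb.2.2]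
  · intro b hb
    by_cases hb1 : b = 1
    · subst hb1
      -- For an accepted bidder the value of the first call is the bid, so the two updates cancel.
      refine hl₆.val.trans (Eq.trans ?_ hl.val.symm)
      rw [Function.update_idem]
      congr 1
      exact Function.update_eq_self_iff.2 (by rw [acceptedBids, if_pos ha])
    · rw [Mem.setR_real_of_ne _ _ _ _ _ hb1, Mem.setR_real_of_ne _ _ _ _ _ (show b ≠ 4 by omega),
        hr₄ b (by omega), hr₃, hreal₂ b hb1, hr₁ b (by omega)]
  · intro r c hrc
    rw [Mem.setR_real_of_ne _ _ _ _ _ (by decide)]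
    simp only [Mem.setR_real, true_and, if_neg hrc]
    rw [hr₄ _ (by decide), hr₃, hreal₂ _ (by decide), hr₁ _ (by decide)]
  · rw [Mem.setR_real_of_ne _ _ _ _ _ (by decide)]
    simp only [Mem.setR_real, and_self, if_true]
    rw [hx, hsw', hx', hsw₄]

/-- A bidder who gets no slot can be given the price `0`. -/
theorem IsOutcome.isPrice_zero {ω : Assignment k n} (h : A.IsOutcome A.acceptedBids ω) (hn : 0 < n) {a : Ad k n}
    (ha : a ∈ A.accepted) (hω : ∀ j, ω j ≠ some a) : A.IsPrice ω a 0 := by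
  obtain ⟨H, hH, hHω⟩ := h
  have hle : A.reserve a ≤ A.acceptedBids a := by
    rw [acceptedBids, if_pos ha]
    classical
    exact (mem_filter.1 ha).2
  have hq : A.quantity ω a = 0 := by
    simp [quantity, hω]
  -- The original run serves as the run for the lowered bid; the two welfare terms cancel and the
  -- quantity is 0.
  refine ⟨ω, ⟨H, hH.lower hn A.disc_nonneg A.disc_anti acceptedBids_nonneg hle fun j hj => ?_, hHω⟩, ?_⟩
  · exact hω j ((hHω j a).2 ⟨hj, ha⟩)
  · rw [hq]; ring

/-- Both programs are instances with different predicates `priced`, and the number of calls is one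
more than the number of priced bidders. A skipped accepted bidder must have no slot; then 0 is a
correct price without a call. -/
theorem exec_pricingWith (A : Auction k n) (hk : 0 < k) (hn : 0 < n) {b : BExp}
    {priced : Assignment k n → Ad k n → Prop} [∀ ω, DecidablePred (priced ω)]
    (hb : ∀ ω τ a, A.Loaded A.acceptedBids τ → (∀ r c, τ.nat Arr.won r c = 1 ↔
      ∃ j b, ω j = some b ∧ (b.1 : ℕ) = r ∧ (b.2 : ℕ) = c) → τ.nat Arr.cT 0 0 = (a.1 : ℕ) →
      τ.nat Arr.cI 0 0 = (a.2 : ℕ) → (b.eval τ ↔ priced ω a))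
    (hacc : ∀ ω a, priced ω a → a ∈ A.accepted)
    (hskip : ∀ ω a, A.IsOutcome A.acceptedBids ω → a ∈ A.accepted → ¬ priced ω a → ∀ j, ω j ≠ some a) :
    ∃ (ω : Assignment k n) (t q : ℕ) (τ : Mem), Exec (callProc hungarian) (pricingWith b) A.mem t q τ ∧
      A.IsPricing (readOwners k n τ) (readPrices k n τ) ∧ q = #{a | priced ω a} + 1 ∧
      t ≤ (#{a | priced ω a} + 1) * (priceCost k n + 1) + 16 * (k * n) + 8 * k + 8 * n + 10 := by
  obtain ⟨t₁, σ₁, hex₁, ht₁, hl₁, hp₁, hw₁⟩ := exec_findAccepted (φ := callProc hungarian) A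
  obtain ⟨t₂, σ₂, hex₂, ht₂, hout, -, hn₂, hr₂⟩ := hl₁.call hk hn acceptedBids_nonneg
  have hl₂ := hl₁.congr (τ := σ₂) (fun b hb => hn₂ b (by omega)) (fun b _ => by rw [hr₂])
  obtain ⟨ω, hω⟩ : ∃ ω, ω = A.outcomeOf (σ₂.nat Arr.matchT 0) (σ₂.nat Arr.matchI 0) := ⟨_, rfl⟩
  rw [← hω] at hout
  obtain ⟨t₃, σ₃, hex₃, ht₃, hn₃, hr₃, ho₃, hw₃⟩ := hl₂.exec_readOutcome (φ := callProc hungarian)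
    (fun r c => by rw [hn₂ _ (by decide)]; exact hw₁ r c) hω
  have hl₃ := hl₂.congr (τ := σ₃) (fun b hb => hn₃ b (by omega)) (fun b _ => by rw [hr₃])
  have hp₃ : ∀ r c, σ₃.real Arr.price r c = 0 := by rw [hr₃, hr₂]; exact hp₁
  obtain ⟨t₄, q, τ, hex₄, ⟨ht₄, hq⟩, hnτ, hrτ, hpS, hp0⟩ := exec_forAds (φ := callProc hungarian) (k := k) (n := n)
    (σ := σ₃) (s := .branch b priceCurrent .skip)
    (fun S t q τ => (t ≤ #S * 2 + q * (priceCost k n + 1) ∧ q = #(S.filter (priced ω))) ∧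
      (∀ a, a ≠ 3 ∧ a ≠ 4 ∧ (a < 10 ∨ 12 < a) → τ.nat a = σ₃.nat a) ∧ (∀ a < 4, τ.real a = σ₃.real a) ∧
      (∀ a ∈ S, priced ω a → A.IsPrice ω a (τ.real Arr.price a.1 a.2)) ∧
      (∀ a, a ∉ S ∨ ¬ priced ω a → τ.real Arr.price a.1 a.2 = 0))
    ⟨by simp, fun _ _ => rfl, fun _ _ => rfl, by simp, fun a _ => hp₃ a.1 a.2⟩
    (by
      rintro S t q τ a x ha ⟨h1, h2, h3⟩
      refine ⟨h1, fun b hb => ?_, h3⟩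
      rw [Mem.setN_nat_of_ne _ _ _ _ _ (by rcases ha with rfl | rfl; exacts [show b ≠ 10 by omega, show b ≠ 11 by omega])]
      exact h2 b hb)
    (by
      rintro S t q τ ⟨-, h, -⟩
      rw [h _ (by decide), h _ (by decide)]
      exact ⟨hl₃.types, hl₃.num⟩)
    (by
      rintro S a t q τ haS ⟨⟨ht, hq⟩, h2, h3, h4, h5⟩ hT hI
      have hl := hl₃.congr (τ := τ) (fun b hb => h2 b (by omega)) h3
      have ho := ho₃.congr (τ := τ) (fun b hb => h2 b (by omega))
      have hcard : #(insert a S) = #S + 1 := card_insert_of_notMem haS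
      have hb' := hb ω τ a hl (by rw [h2 _ (by decide)]; exact hw₃) hT hI
      by_cases hpr : priced ω a
      · obtain ⟨t', τ', hex, ht', g1, g2, g3, g4⟩ := hl.exec_priceCurrent hk hn ho (hacc ω a hpr) hT hI
        have hqq : #((insert a S).filter (priced ω)) = #(S.filter (priced ω)) + 1 := by
          rw [filter_insert, if_pos hpr, card_insert_of_notMem (by simp [haS])]
        have hne : ∀ c : Ad k n, c ≠ a → ¬ ((c.1 : ℕ) = a.1 ∧ (c.2 : ℕ) = a.2) := fun c hc h =>
          hc (Prod.ext (Fin.ext h.1) (Fin.ext h.2))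
        refine ⟨t' + 1, 1, τ', .branchTrue (hb'.2 hpr) hex, by rw [g1 _ (by decide)]; exact hT,
          by rw [g1 _ (by decide)]; exact hI, ⟨?_, by rw [hqq, hq]⟩, fun b hb => ?_, fun b hb => ?_,
          fun c hc hpc => ?_, fun c hc => ?_⟩
        · have : (q + 1) * (priceCost k n + 1) = q * (priceCost k n + 1) + (priceCost k n + 1) := by ring
          rw [hcard, this]; omega
        · rw [g1 b (by omega)]; exact h2 b hb
        · rw [g2 b hb]; exact h3 b hb
        · by_cases hca : c = a
          · subst hca; exact g4
          · rw [g3 _ _ (hne c hca)]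
            exact h4 c ((mem_insert.1 hc).resolve_left hca) hpc
        · have hca : c ≠ a := by
            rintro rfl
            rcases hc with hc | hc
            · exact hc (mem_insert_self _ _)
            · exact hc hpr
          rw [g3 _ _ (hne c hca)]
          exact h5 c (hc.imp_left fun h h' => h (mem_insert_of_mem h'))
      · obtain ⟨t', ht', hex⟩ := exec_run (callProc hungarian) .skip rfl τ
        rw [Com.run_skip] at hex
        have hqq : #((insert a S).filter (priced ω)) = #(S.filter (priced ω)) := by
          rw [filter_insert, if_neg hpr]
        refine ⟨t' + 1, 0, τ, .branchFalse (mt hb'.1 hpr) hex, hT, hI, ⟨?_, by rw [hqq, hq]; rfl⟩, h2, h3,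
          fun c hc hpc => ?_, fun c hc => ?_⟩
        · simp only [Com.cost, Com.skip] at ht'
          rw [hcard]; simp only [add_zero]; omega
        · refine h4 c ((mem_insert.1 hc).resolve_left ?_) hpc
          rintro rfl
          exact hpr hpc
        · by_cases hca : c = a
          · exact h5 c (.inr (hca ▸ hpr))
          · exact h5 c (hc.imp_left fun h h' => h (mem_insert_of_mem h')))
  replace hq : q = #{a | priced ω a} := hq
  have hown := (ho₃.congr (τ := τ) (fun b hb => hnτ b (by omega))).readOwners
  refine ⟨ω, _, _, τ, .seq hex₁ (.seq hex₂ (.seq hex₃ hex₄)), ?_, ?_, ?_⟩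
  · rw [hown]
    refine ⟨hout, fun a ha => hp0 a (.inr fun h => ha (hacc ω a h)), fun a ha => ?_⟩
    by_cases hpr : priced ω a
    · exact hpS a (mem_univ _) hpr
    · have : readPrices k n τ a = 0 := hp0 a (.inr hpr)
      rw [this]
      exact hout.isPrice_zero hn ha (hskip ω a hout ha hpr)
  · rw [hq]; omega
  · rw [← hq]
    have hu : #(univ : Finset (Ad k n)) = k * n := by simp
    rw [hu] at ht₄
    have e1 : k * (10 * n + 4) = 10 * (k * n) + 4 * k := by ring
    have e2 : k * (2 * n + 4) = 2 * (k * n) + 4 * k := by ring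
    have e3 : (q + 1) * (priceCost k n + 1) = q * (priceCost k n + 1) + (priceCost k n + 1) := by ring
    rw [e3]
    have e4 : hungarianCost k n + 2 * (k * n) + 2 * n + 2 ≤ priceCost k n := by rw [priceCost]; omega
    omega

end Auction


/-! ### Time bounds for the two pricing programs -/

theorem implementsHungarian : ImplementsHungarian hungarian := by
  intro k n hk hn disc v hdisc hanti hv
  obtain ⟨t, τ, c, hex, -, h⟩ := wp_hungarian hk hn hdisc hanti hv
  exact ⟨t, τ, hex, h⟩

theorem priceCost_le {k n : ℕ} (hk : 0 < k) (hn : 0 < n) :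
    priceCost k n ≤ 5036 * (n * n * (k + Nat.log 2 n)) := by
  have h1 := hungarianCost_le hk hn
  have h2 : n ≤ n * n := Nat.le_mul_of_pos_right _ hn
  have h3 : n * n ≤ k * (n * n) := Nat.le_mul_of_pos_left _ hk
  have h4 : k * n ≤ k * (n * n) := Nat.mul_le_mul_left _ h2
  have h5 : 0 ≤ n * n * Nat.log 2 n := Nat.zero_le _
  rw [priceCost]
  nlinarith

/-- The running time of the pricing programs with `m` prices that are computed by a call. -/
theorem time_le {k n m t : ℕ} (hk : 0 < k) (hn : 0 < n)
    (ht : t ≤ (m + 1) * (priceCost k n + 1) + 16 * (k * n) + 8 * k + 8 * n + 10) :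
    (t : ℝ) ≤ 15000 * ((m + 1) * (n : ℝ) ^ 2 * (k + Real.log n)) := by
  set g := n * n * (k + Nat.log 2 n) with hg
  have h2 : n ≤ n * n := Nat.le_mul_of_pos_right _ hn
  have h3 : n * n ≤ k * (n * n) := Nat.le_mul_of_pos_left _ hk
  have h4 : k * n ≤ k * (n * n) := Nat.mul_le_mul_left _ h2
  have h5 : k * (n * n) ≤ g := by
    rw [hg, mul_comm]; exact Nat.mul_le_mul_left _ (Nat.le_add_right _ _)
  have h6 : k ≤ k * n := Nat.le_mul_of_pos_right _ hn
  have h7 : priceCost k n + 1 ≤ 5037 * g := by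
    have := priceCost_le hk hn
    omega
  -- The lower terms amount to at most 16 + 8 + 8 + 10 = 42 copies of `g`.
  have h8 : t ≤ (m + 1) * (5080 * g) := by
    have e1 : (m + 1) * (priceCost k n + 1) ≤ (m + 1) * (5037 * g) := Nat.mul_le_mul_left _ h7
    have e2 : 43 * g ≤ (m + 1) * (43 * g) := Nat.le_mul_of_pos_left _ (Nat.succ_pos m)
    have e3 : (m + 1) * (5080 * g) = (m + 1) * (5037 * g) + (m + 1) * (43 * g) := by ring
    omega
  have h9 : (g : ℝ) ≤ (n : ℝ) ^ 2 * (2 * (k + Real.log n)) := by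
    have e1 := natLog_le n hn
    have e2 : (0 : ℝ) ≤ k := Nat.cast_nonneg k
    rw [hg]
    push_cast
    rw [← sq]
    exact mul_le_mul_of_nonneg_left (by linarith) (by positivity)
  have hlog := Real.log_natCast_nonneg n
  calc (t : ℝ) ≤ (m + 1) * (5080 * g) := by exact_mod_cast h8
    _ ≤ (m + 1) * (5080 * ((n : ℝ) ^ 2 * (2 * (k + Real.log n)))) := by gcongr
    _ = 10160 * ((m + 1) * (n : ℝ) ^ 2 * (k + Real.log n)) := by ring
    _ ≤ 15000 * ((m + 1) * (n : ℝ) ^ 2 * (k + Real.log n)) := by gcongr; norm_num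

/-- Since n ≥ 1, the number of calls is at most 2n, which doubles the constant. -/
theorem time_le_of_le {k n m t : ℕ} (hk : 0 < k) (hn : 0 < n) (hm : m ≤ n)
    (ht : t ≤ (m + 1) * (priceCost k n + 1) + 16 * (k * n) + 8 * k + 8 * n + 10) :
    (t : ℝ) ≤ 30000 * ((n : ℝ) ^ 3 * (k + Real.log n)) := by
  have hlog := Real.log_natCast_nonneg n
  have h1 : (m : ℝ) + 1 ≤ 2 * n := by
    have : m + 1 ≤ 2 * n := by omega
    exact_mod_cast this
  calc (t : ℝ) ≤ 15000 * ((m + 1) * (n : ℝ) ^ 2 * (k + Real.log n)) := time_le hk hn ht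
    _ ≤ 15000 * (2 * n * (n : ℝ) ^ 2 * (k + Real.log n)) := by gcongr
    _ = 30000 * ((n : ℝ) ^ 3 * (k + Real.log n)) := by ring

namespace Auction

variable {k n : ℕ} (A : Auction k n)

theorem Loaded.acc_iff {A : Auction k n} {v : Ad k n → ℝ} {τ : Mem} (h : A.Loaded v τ) {a : Ad k n} :
    τ.nat Arr.acc a.1 a.2 = 1 ↔ a ∈ A.accepted := by
  rw [h.acc, readAd_eq_some.2 ⟨rfl, rfl⟩]
  simp

theorem exec_pricing (hk : 0 < k) (hn : 0 < n) :
    ∃ (t q : ℕ) (τ : Mem), Exec (callProc hungarian) pricing A.mem t q τ ∧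
      A.IsPricing (readOwners k n τ) (readPrices k n τ) ∧ q = #A.accepted + 1 ∧
      t ≤ (#A.accepted + 1) * (priceCost k n + 1) + 16 * (k * n) + 8 * k + 8 * n + 10 := by
  classical
  obtain ⟨ω, t, q, τ, hex, hp, hq, ht⟩ := A.exec_pricingWith hk hn (b := .eq (curN Arr.acc) (.lit 1))
    (priced := fun _ a => a ∈ A.accepted)
    (fun ω τ a hl _ hT hI => by
      simp only [BExp.eval, NExp.eval, hT, hI, hl.acc_iff])
    (fun _ _ => id) (fun _ _ _ ha ha' => absurd ha ha')
  have hcard : #{a | a ∈ A.accepted} = #A.accepted := by simp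
  rw [hcard] at ht hq
  exact ⟨t, q, τ, hex, hp, hq, ht⟩

theorem exec_pricingWinners (hk : 0 < k) (hn : 0 < n) :
    ∃ (t q : ℕ) (τ : Mem) (m : ℕ), Exec (callProc hungarian) pricingWinners A.mem t q τ ∧
      A.IsPricing (readOwners k n τ) (readPrices k n τ) ∧ q = m + 1 ∧ m ≤ #A.accepted ∧ m ≤ n ∧
      t ≤ (m + 1) * (priceCost k n + 1) + 16 * (k * n) + 8 * k + 8 * n + 10 := by
  classical
  obtain ⟨ω, t, q, τ, hex, hp, hq, ht⟩ := A.exec_pricingWith hk hn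
    (b := .and (.eq (curN Arr.acc) (.lit 1)) (.eq (curN Arr.won) (.lit 1)))
    (priced := fun ω a => a ∈ A.accepted ∧ ∃ j, ω j = some a)
    (fun ω τ a hl hw hT hI => by
      simp only [BExp.eval, NExp.eval, hT, hI, hl.acc_iff, hw]
      refine and_congr_right fun _ => exists_congr fun j => ⟨?_, fun h => ⟨a, h, rfl, rfl⟩⟩
      rintro ⟨b, h, h1, h2⟩
      rw [h, Prod.ext (Fin.ext h1) (Fin.ext h2)])
    (fun _ _ h => h.1) (fun _ _ _ ha h j hj => h ⟨ha, j, hj⟩)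
  refine ⟨t, q, τ, _, hex, hp, hq, card_le_card fun a ha => (mem_filter.1 ha).2.1, ?_, ht⟩
  -- The winners are values of the outcome, which is a function on n slots; an ad is counted once
  -- even though it is reached through a slot.
  rw [← card_image_of_injective _ (Option.some_injective (Ad k n))]
  calc _ ≤ #(univ.image ω) := card_le_card fun x hx => by
        obtain ⟨a, ha, rfl⟩ := mem_image.1 hx
        obtain ⟨j, hj⟩ := (mem_filter.1 ha).2.2
        exact mem_image.2 ⟨j, mem_univ j, hj⟩
    _ ≤ n := card_image_le.trans (by simp)

end Auction

end AdTypes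

theorem corollary2 :
    ∃ X : AdTypes.Com, AdTypes.ImplementsHungarian X ∧
      ∃ C : ℝ, ∀ (k n : ℕ), 0 < k → 0 < n → ∀ A : AdTypes.Auction k n,
        (∃ (t q : ℕ) (τ : AdTypes.Mem),
          AdTypes.Exec (AdTypes.callProc X) AdTypes.pricing A.mem t q τ ∧
          A.IsPricing (AdTypes.readOwners k n τ) (AdTypes.readPrices k n τ) ∧
          q = A.accepted.card + 1 ∧
          (t : ℝ) ≤ C * ((A.accepted.card + 1) * (n : ℝ) ^ 2 * (k + Real.log n)) ∧
          (A.bidders.card ≤ n → (t : ℝ) ≤ C * ((n : ℝ) ^ 3 * (k + Real.log n)))) ∧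
        (∃ (t q : ℕ) (τ : AdTypes.Mem),
          AdTypes.Exec (AdTypes.callProc X) AdTypes.pricingWinners A.mem t q τ ∧
          A.IsPricing (AdTypes.readOwners k n τ) (AdTypes.readPrices k n τ) ∧
          q ≤ min A.accepted.card n + 1 ∧
          (t : ℝ) ≤ C * ((n : ℝ) ^ 3 * (k + Real.log n))) := by
  refine ⟨AdTypes.hungarian, AdTypes.implementsHungarian, 30000, fun k n hk hn A => ⟨?_, ?_⟩⟩
  · obtain ⟨t, q, τ, hex, hp, hq, ht⟩ := A.exec_pricing hk hn
    have hb := AdTypes.time_le hk hn ht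
    refine ⟨t, q, τ, hex, hp, hq, ?_, fun hcard => AdTypes.time_le_of_le hk hn ?_ ht⟩
    · have h0 : (0 : ℝ) ≤ (A.accepted.card + 1) * (n : ℝ) ^ 2 * (k + Real.log n) := by
        have := Real.log_natCast_nonneg n
        positivity
      linarith
    · exact (Finset.card_le_card (Finset.filter_subset _ _)).trans hcard
  · obtain ⟨t, q, τ, m, hex, hp, hq, hm, hm', ht⟩ := A.exec_pricingWinners hk hn
    exact ⟨t, q, τ, hex, hp, by rw [hq]; exact Nat.succ_le_succ (le_min hm hm'),
      AdTypes.time_le_of_le hk hn hm' ht⟩
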